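/- Let $G$ be a directed graph. A vertex $w$ strongly resolves vertices $u,v$ from $u$ to $v$ if $G$ has a shortest directed path from $w$ to $v$ containing $u$ or a shortest directed path from $u$ to $w$ containing $v$. A set $R\subseteq V(G)$ is a strong resolving set if for all distinct $u,v\in V(G)$ some vertex of $R$ strongly resolves them from $u$ to $v$ and some (possibly different) vertex of $R$ strongly resolves them from $v$ to $u$. A strong metric basis of $G$ is a strong resolving set of minimum size; its size is the directed strong metric dimension of $G$. Directed co-graphs are the directed graphs obtained from single vertices by repeatedly applying, to two vertex-disjoint directed co-graphs $G_1,G_2$, one of the operations union (no new arcs), directed join (all arcs from $V(G_1)$ to $V(G_2)$ are added) and join (all arcs between $V(G_1)$ and $V(G_2)$, in both directions, are added). **Theorem.** A strong metric basis of a strongly connected directed co-graph is computable in linear time. That is, there are a constant $c$ and a program for a random access machine (unit cost per operation; the operations are copying, indirect reading and writing, addition, truncated subtraction and comparison) such that for every strongly connected directed co-graph $G$ with vertex set $\{0,\dots,n-1\}$ and $m$ arcs, given by $n$, $m$ and a list of its arcs in arbitrary order, the program halts after at most $c\,(n+m)$ steps, uses only numbers of size at most $c\,(n+m)$, and outputs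 a strong metric basis of $G$ together with its size, the directed strong metric dimension of $G$. -/

import Mathlib

/-! ### Directed co-graphs -/

/-- Binary co-trees with leaves labelled by vertices. -/
inductive DiCotree (V : Type*) where
  | leaf (v : V) : DiCotree V
  | union (l r : DiCotree V) : DiCotree V
  | dirJoin (l r : DiCotree V) : DiCotree V
  | join (l r : DiCotree V) : DiCotree V

namespace DiCotree

variable {V : Type*}

/-- The vertices at the leaves, from left to right. -/
def leaves : DiCotree V → List V
  | leaf v => [v]
  | union l r => l.leaves ++ r.leaves
  | dirJoin l r => l.leaves ++ r.leaves
  | join l r => l.leaves ++ r.leaves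

/-- The arcs of the directed graph built by the co-tree: a union node adds no arcs, a directed join
node adds all arcs from the left part to the right part, and a join node adds all arcs between the
two parts in both directions. -/
def Arc : DiCotree V → V → V → Prop
  | leaf _, _, _ => False
  | union l r, u, v => l.Arc u v ∨ r.Arc u v
  | dirJoin l r, u, v => l.Arc u v ∨ r.Arc u v ∨ (u ∈ l.leaves ∧ v ∈ r.leaves)
  | join l r, u, v =>
      l.Arc u v ∨ r.Arc u v ∨ (u ∈ l.leaves ∧ v ∈ r.leaves) ∨ (u ∈ r.leaves ∧ v ∈ l.leaves)

end DiCotree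

namespace Digraph

variable {V : Type*}

/-- `T` is a co-tree of `G`: every vertex is associated with exactly one leaf (so that at each inner
node two vertex-disjoint graphs are composed), and the arcs are those that `T` builds. -/
def IsCotree (G : Digraph V) (T : DiCotree V) : Prop :=
  T.leaves.Nodup ∧ (∀ v, v ∈ T.leaves) ∧ ∀ u v, G.Adj u v ↔ T.Arc u v

/-- A directed co-graph: built from single vertices by unions, directed joins and joins. -/
def IsDirectedCograph (G : Digraph V) : Prop :=
  ∃ T : DiCotree V, G.IsCotree T

/-- Every vertex is reachable from every vertex. -/
def IsStronglyConnected (G : Digraph V) : Prop :=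
  ∀ u v, Relation.ReflTransGen G.Adj u v

/-! ### Strong resolving sets -/

/-- `p` is the vertex sequence of a directed path from `x` to `z`. -/
def IsPath (G : Digraph V) (x z : V) (p : List V) : Prop :=
  p.head? = some x ∧ p.getLast? = some z ∧ p.IsChain G.Adj ∧ p.Nodup

/-- `p` is a directed path from `x` to `z` with the least possible number of arcs (equivalently, of
vertices). -/
def IsShortestPath (G : Digraph V) (x z : V) (p : List V) : Prop :=
  G.IsPath x z p ∧ ∀ q, G.IsPath x z q → p.length ≤ q.length

/-- There is a shortest directed path from `x` to `z` that contains `y`. -/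
def HasShortestPathThrough (G : Digraph V) (x y z : V) : Prop :=
  ∃ p, G.IsShortestPath x z p ∧ y ∈ p

/-- `w` strongly resolves `u` and `v` from `u` to `v`. -/
def StronglyResolves (G : Digraph V) (w u v : V) : Prop :=
  G.HasShortestPathThrough w u v ∨ G.HasShortestPathThrough u v w

/-- Any two distinct vertices are strongly resolved, in each of the two directions, by some vertex
of `R`. -/
def IsStrongResolvingSet (G : Digraph V) (R : Finset V) : Prop :=
  ∀ u v, u ≠ v → (∃ w ∈ R, G.StronglyResolves w u v) ∧ (∃ w ∈ R, G.StronglyResolves w v u)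

/-- A strong metric basis: a strong resolving set of least size. -/
def IsStrongMetricBasis (G : Digraph V) (R : Finset V) : Prop :=
  G.IsStrongResolvingSet R ∧ ∀ R', G.IsStrongResolvingSet R' → R.card ≤ R'.card

/-- The directed strong metric dimension. -/
noncomputable def strongMetricDim (G : Digraph V) : ℕ :=
  sInf {k | ∃ R, G.IsStrongResolvingSet R ∧ R.card = k}

/-- `arcs` lists the arcs of `G`, each exactly once, in some order. -/
def IsArcList (G : Digraph V) (arcs : List (V × V)) : Prop :=
  arcs.Nodup ∧ ∀ u v, G.Adj u v ↔ (u, v) ∈ arcs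

end Digraph

/-! ### Random access machines

Structured programs for a random access machine with registers and finitely many arrays per program
(a program is a finite object, and the name of an array is a constant in it), with unit cost for
each operation, and with words of bounded size. -/

namespace RAM

/-- Contents of the registers and of the arrays; `mem a i` is cell `i` of array `a`. -/
structure State where
  reg : ℕ → ℕ
  mem : ℕ → ℕ → ℕ

/-- Expressions; `lt` and `eq` have the value `1` or `0`, and `sub` is truncated at `0`. -/
inductive Term where
  | const (k : ℕ)
  | reg (r : ℕ)
  | read (a : ℕ) (i : Term)
  | add (x y : Term)
  | sub (x y : Term)
  | lt (x y : Term)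
  | eq (x y : Term)

/-- The value of an expression. -/
def Term.val (s : State) : Term → ℕ
  | const k => k
  | reg r => s.reg r
  | read a i => s.mem a (i.val s)
  | add x y => x.val s + y.val s
  | sub x y => x.val s - y.val s
  | lt x y => if x.val s < y.val s then 1 else 0
  | eq x y => if x.val s = y.val s then 1 else 0

/-- The number of operations needed to evaluate an expression. -/
def Term.cost : Term → ℕ
  | const _ => 1
  | reg _ => 1
  | read _ i => i.cost + 1
  | add x y => x.cost + y.cost + 1
  | sub x y => x.cost + y.cost + 1
  | lt x y => x.cost + y.cost + 1
  | eq x y => x.cost + y.cost + 1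

/-- No number above `B` occurs in the evaluation of an expression, neither as an intermediate result
nor as an address. -/
def Term.Fits (B : ℕ) (s : State) : Term → Prop
  | const k => k ≤ B
  | reg r => s.reg r ≤ B
  | read a i => i.Fits B s ∧ s.mem a (i.val s) ≤ B
  | add x y => x.Fits B s ∧ y.Fits B s ∧ x.val s + y.val s ≤ B
  | sub x y => x.Fits B s ∧ y.Fits B s
  | lt x y => x.Fits B s ∧ y.Fits B s ∧ 1 ≤ B
  | eq x y => x.Fits B s ∧ y.Fits B s ∧ 1 ≤ B

/-- Programs. `setReg r e` stores the value of `e` in register `r`, `write a i e` stores it in cell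
`i` of array `a`; `loop b p`
runs `p` as long as the test `b` succeeds; a test succeeds if its value is not `0`. -/
inductive Prog where
  | skip
  | setReg (r : ℕ) (e : Term)
  | write (a : ℕ) (i e : Term)
  | seq (p q : Prog)
  | ite (b : Term) (p q : Prog)
  | loop (b : Term) (p : Prog)

/-- The state after storing `x` in register `r`. -/
def State.setReg (s : State) (r x : ℕ) : State :=
  { s with reg := Function.update s.reg r x }

/-- The state after storing `x` in cell `i` of array `a`. -/
def State.write (s : State) (a i x : ℕ) : State :=
  { s with mem := Function.update s.mem a (Function.update (s.mem a) i x) }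

/-- `Runs B p s s' t`: on a machine whose words hold the numbers `0, …, B`, program `p` started in
state `s` halts in state `s'` after exactly `t` steps, without overflow. -/
inductive Runs (B : ℕ) : Prog → State → State → ℕ → Prop where
  | skip {s : State} : Runs B .skip s s 1
  | setReg {s : State} {r : ℕ} {e : Term} (he : e.Fits B s) :
      Runs B (.setReg r e) s (s.setReg r (e.val s)) (e.cost + 1)
  | write {s : State} {a : ℕ} {i e : Term} (hi : i.Fits B s) (he : e.Fits B s) :
      Runs B (.write a i e) s (s.write a (i.val s) (e.val s)) (i.cost + e.cost + 1)
  | seq {s s' s'' : State} {p q : Prog} {t t' : ℕ} (hp : Runs B p s s' t)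
      (hq : Runs B q s' s'' t') : Runs B (.seq p q) s s'' (t + t')
  | iteTrue {s s' : State} {b : Term} {p q : Prog} {t : ℕ} (hb : b.Fits B s) (h : b.val s ≠ 0)
      (hp : Runs B p s s' t) : Runs B (.ite b p q) s s' (b.cost + 1 + t)
  | iteFalse {s s' : State} {b : Term} {p q : Prog} {t : ℕ} (hb : b.Fits B s) (h : b.val s = 0)
      (hq : Runs B q s s' t) : Runs B (.ite b p q) s s' (b.cost + 1 + t)
  | loopTrue {s s' s'' : State} {b : Term} {p : Prog} {t t' : ℕ} (hb : b.Fits B s)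
      (h : b.val s ≠ 0) (hp : Runs B p s s' t) (hw : Runs B (.loop b p) s' s'' t') :
      Runs B (.loop b p) s s'' (b.cost + 1 + t + t')
  | loopFalse {s : State} {b : Term} {p : Prog} (hb : b.Fits B s) (h : b.val s = 0) :
      Runs B (.loop b p) s s (b.cost + 1)

/-- The initial state for a directed graph with vertices `0, …, n - 1`: the number of vertices in
register `0`, the number of arcs in register `1`, the tails of the arcs in array `0`, their heads in
array `1`, and `0` everywhere else. -/
def inputState {n : ℕ} (arcs : List (Fin n × Fin n)) : State where
  reg := fun r => if r = 0 then n else if r = 1 then arcs.length else 0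
  mem := fun a e =>
    if a = 0 then (arcs.map fun p => (p.1 : ℕ)).getD e 0
    else if a = 1 then (arcs.map fun p => (p.2 : ℕ)).getD e 0
    else 0

/-- The set `R` is the output in state `s`: its size is in register `0`, and that many cells at the
beginning of array `0` hold its elements. -/
def Outputs (s : State) {n : ℕ} (R : Finset (Fin n)) : Prop :=
  s.reg 0 = R.card ∧
    (Finset.range R.card).image (s.mem 0) = R.map Fin.valEmbedding

end RAM

/-!
# A strong metric basis of a strongly connected directed co-graph in linear time

*Strong resolving sets and cliques.* A strongly connected directed co-graph has diameter at most two
(`Digraph.IsDirectedCograph.diamLeTwo`): the root of its co-tree is a join, unless there is just one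
vertex. In diameter at most two, a set is strongly resolving if and only if any two vertices outside
it are `Compatible`, that is, joined in both directions, and told apart by a third vertex for each
of the two directions (`Digraph.DiamLeTwo.isStrongResolvingSet_iff`). So the complement of a maximum
clique of compatible vertices is a strong metric basis, and it remains to find such a clique in
linear time.

*The tree.* The number of arcs between two vertices, the type of one with respect to the other, is
the label of their lowest common ancestor in the co-tree. All that is needed of a directed co-graph
are the local properties collected in `IsCoRel`, which concern these numbers (`IsSymbolic`) and the
transitivity of single arcs. They determine a tree (`IsTree`) in which no inner node has the label
of its parent, and this tree is built by inserting one vertex `x` after the other, with an effort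
linear in the number of arcs between `x` and the vertices inserted before. From the vertices of
nonzero type with respect to `x`, a search finds all nodes whose leaves have the same nonzero type
(`RAM.tri_spread`). The nodes that have such a child, but are not such nodes, are live, and a node
with different types below it is live or the parent of a live node. So a live node that is neither
the parent nor the grandparent of a live node has children of uniform type only
(`IsTree.Live.not_mixed_kid`), and two types at most occur among them: the label, and the type that
decides where `x` belongs (`Stored.exists_place`). The children that move to a new node are always
chosen among those that the search has found. Lists of children are not stored: with each node goes
the sum of the names of its children modulo a number `M` (`SumsTo`), which yields the name of a
child when it is the only one that is left.

*Cliques.* Compatible vertices below a common node are told apart by vertices below that node. Hence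
only two bits of a vertex matter at a node above it: whether some other vertex below the node has no
arc to it (`Alpha`), and whether some other vertex below the node receives no arc from it (`Beta`).
The cliques below a node are classified by the bits of their vertices (`Cls`). At a join, cliques of
the children are united, all of them in the same class or, in class `4`, of class `1` with at most
one exception, which is a leaf; a union or a directed join contributes the best clique of one child,
in a class that depends only on whether the child has a predecessor and a successor (`kidClass`).
The maximum sizes therefore satisfy recurrences (`CoTree.card_le`), and the choices made in them,
followed from the root to the leaves, give a maximum clique (`CoTree.good_of_classes`,
`CoTree.isMaxClique`). The tree does not say which child of a directed join is the first or the
last, but these are the children whose vertices have the least and the greatest in-degree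
(`CoTree.flags`). The order in which the search finds the nodes, if all vertices are given the same
type, has children before parents (`SpreadInv.topo_seg`), so that loops along this order, forwards
and backwards, evaluate the recurrences (`RAM.tri_cliqueProg`).

*Size of numbers.* The main program only increments numbers by one, so a number cannot exceed the
initial ones by more than the running time (`RAM.Ev.runs`). Additions modulo `M` are carried out as
comparisons and subtractions, whence this applies to them as well.
-/

/-! ### Running programs without a word size -/

namespace RAM

/-- Execution of a program in which the size of the numbers is not restricted. -/
inductive Ev : Prog → State → State → ℕ → Prop where
  | skip {s : State} : Ev .skip s s 1
  | setReg {s : State} {r : ℕ} {e : Term} :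
      Ev (.setReg r e) s (s.setReg r (e.val s)) (e.cost + 1)
  | write {s : State} {a : ℕ} {i e : Term} :
      Ev (.write a i e) s (s.write a (i.val s) (e.val s)) (i.cost + e.cost + 1)
  | seq {s s' s'' : State} {p q : Prog} {t t' : ℕ} (hp : Ev p s s' t)
      (hq : Ev q s' s'' t') : Ev (.seq p q) s s'' (t + t')
  | iteTrue {s s' : State} {b : Term} {p q : Prog} {t : ℕ} (h : b.val s ≠ 0)
      (hp : Ev p s s' t) : Ev (.ite b p q) s s' (b.cost + 1 + t)
  | iteFalse {s s' : State} {b : Term} {p q : Prog} {t : ℕ} (h : b.val s = 0)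
      (hq : Ev q s s' t) : Ev (.ite b p q) s s' (b.cost + 1 + t)
  | loopTrue {s s' s'' : State} {b : Term} {p : Prog} {t t' : ℕ}
      (h : b.val s ≠ 0) (hp : Ev p s s' t) (hw : Ev (.loop b p) s' s'' t') :
      Ev (.loop b p) s s'' (b.cost + 1 + t + t')
  | loopFalse {s : State} {b : Term} {p : Prog} (h : b.val s = 0) :
      Ev (.loop b p) s s (b.cost + 1)

/-- Whether an expression is the constant `1`. -/
def Term.isOne : Term → Bool
  | const 1 => true
  | _ => false

/-- An expression all of whose constants are at most `k` and whose only additions are increments by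
one. -/
def Term.mild (k : ℕ) : Term → Bool
  | const c => decide (c ≤ k)
  | reg _ => true
  | read _ i => i.mild k
  | add x y => x.mild k && y.isOne
  | sub x y => x.mild k && y.mild k
  | lt x y => x.mild k && y.mild k
  | eq x y => x.mild k && y.mild k

/-- A program with mild expressions only. -/
def Prog.mild (k : ℕ) : Prog → Bool
  | skip => true
  | setReg _ e => e.mild k
  | write _ i e => i.mild k && e.mild k
  | seq p q => p.mild k && q.mild k
  | ite b p q => b.mild k && p.mild k && q.mild k
  | loop b p => b.mild k && p.mild k

/-- All registers and all cells hold numbers up to `b`. -/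
def State.Bdd (b : ℕ) (s : State) : Prop :=
  (∀ r, s.reg r ≤ b) ∧ ∀ a i, s.mem a i ≤ b

theorem State.Bdd.mono {b b' : ℕ} {s : State} (h : s.Bdd b) (hb : b ≤ b') : s.Bdd b' :=
  ⟨fun r => (h.1 r).trans hb, fun a i => (h.2 a i).trans hb⟩

theorem Term.isOne_iff {y : Term} (h : y.isOne = true) : y = .const 1 := by
  unfold Term.isOne at h
  split at h
  · rfl
  · simp at h

@[simp] theorem State.setReg_reg (s : State) (r x r' : ℕ) :
    (s.setReg r x).reg r' = if r' = r then x else s.reg r' := by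
  simp [State.setReg, Function.update_apply]

@[simp] theorem State.setReg_mem (s : State) (r x : ℕ) : (s.setReg r x).mem = s.mem := rfl

@[simp] theorem State.write_reg (s : State) (a i x : ℕ) : (s.write a i x).reg = s.reg := rfl

@[simp] theorem State.write_mem (s : State) (a i x a' : ℕ) :
    (s.write a i x).mem a' = if a' = a then Function.update (s.mem a) i x else s.mem a' := by
  simp [State.write, Function.update_apply]

theorem Term.val_le_and_fits {k b : ℕ} {s : State} (hk : k ≤ b) (hs : s.Bdd b)
    (e : Term) (h : e.mild k = true) :
    e.val s ≤ b + e.cost ∧ ∀ B, b + e.cost ≤ B → e.Fits B s := by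
  induction e with
  | const c =>
    simp only [Term.mild, decide_eq_true_eq] at h
    simp only [Term.val, Term.cost, Term.Fits]
    exact ⟨by omega, fun B hB => by omega⟩
  | reg r =>
    have := hs.1 r
    simp only [Term.val, Term.cost, Term.Fits]
    exact ⟨by omega, fun B hB => by omega⟩
  | read a i ih =>
    have := hs.2 a (i.val s)
    obtain ⟨_, h2⟩ := ih h
    simp only [Term.val, Term.cost, Term.Fits]
    exact ⟨by omega, fun B hB => ⟨h2 B (by omega), by omega⟩⟩
  | add x y ihx _ =>
    simp only [Term.mild, Bool.and_eq_true] at h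
    obtain ⟨h3, h4⟩ := ihx h.1
    obtain rfl := Term.isOne_iff h.2
    simp only [Term.val, Term.cost, Term.Fits]
    exact ⟨by omega, fun B hB => ⟨h4 B (by omega), by omega, by omega⟩⟩
  | sub x y ihx ihy =>
    simp only [Term.mild, Bool.and_eq_true] at h
    obtain ⟨h3, h4⟩ := ihx h.1
    obtain ⟨h5, h6⟩ := ihy h.2
    simp only [Term.val, Term.cost, Term.Fits]
    exact ⟨by omega, fun B hB => ⟨h4 B (by omega), h6 B (by omega)⟩⟩
  | lt x y ihx ihy =>
    simp only [Term.mild, Bool.and_eq_true] at h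
    obtain ⟨h3, h4⟩ := ihx h.1
    obtain ⟨h5, h6⟩ := ihy h.2
    simp only [Term.val, Term.cost, Term.Fits]
    exact ⟨by split <;> omega, fun B hB => ⟨h4 B (by omega), h6 B (by omega), by omega⟩⟩
  | eq x y ihx ihy =>
    simp only [Term.mild, Bool.and_eq_true] at h
    obtain ⟨h3, h4⟩ := ihx h.1
    obtain ⟨h5, h6⟩ := ihy h.2
    simp only [Term.val, Term.cost, Term.Fits]
    exact ⟨by split <;> omega, fun B hB => ⟨h4 B (by omega), h6 B (by omega), by omega⟩⟩

/-- A mild program cannot produce a number that exceeds the numbers it starts with by more than its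
running time, so that a bound on its running time also bounds the word size that it needs. -/
theorem Ev.runs {p : Prog} {s s' : State} {t : ℕ} (h : Ev p s s' t) {k : ℕ}
    (hm : p.mild k = true) {b : ℕ} (hk : k ≤ b) (h1 : 1 ≤ b) (hs : s.Bdd b) :
    s'.Bdd (b + t) ∧ ∀ B, b + t ≤ B → Runs B p s s' t := by
  induction h generalizing b with
  | skip => exact ⟨hs.mono (by omega), fun B _ => .skip⟩
  | @setReg s r e =>
    obtain ⟨h3, h4⟩ := Term.val_le_and_fits hk hs e hm
    refine ⟨⟨fun r' => ?_, fun a i => (hs.2 a i).trans (by omega)⟩,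
      fun B hB => .setReg (h4 B (by omega))⟩
    have := hs.1 r'
    simp only [State.setReg_reg]
    split <;> omega
  | @write s a i e =>
    simp only [Prog.mild, Bool.and_eq_true] at hm
    obtain ⟨h3, h4⟩ := Term.val_le_and_fits hk hs i hm.1
    obtain ⟨h5, h6⟩ := Term.val_le_and_fits hk hs e hm.2
    refine ⟨⟨fun r' => (hs.1 r').trans (by omega), fun a' j => ?_⟩,
      fun B hB => .write (h4 B (by omega)) (h6 B (by omega))⟩
    have := hs.2 a' j
    have := hs.2 a j
    simp only [State.write_mem]
    split
    · rw [Function.update_apply]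
      split <;> omega
    · omega
  | seq _ _ ihp ihq =>
    simp only [Prog.mild, Bool.and_eq_true] at hm
    obtain ⟨h3, h4⟩ := ihp hm.1 hk h1 hs
    obtain ⟨h5, h6⟩ := ihq hm.2 (by omega) (by omega) h3
    exact ⟨h5.mono (by omega), fun B hB => .seq (h4 B (by omega)) (h6 B (by omega))⟩
  | @iteTrue s s' e p q t h _ ihp =>
    simp only [Prog.mild, Bool.and_eq_true] at hm
    obtain ⟨_, h2⟩ := Term.val_le_and_fits hk hs e hm.1.1
    obtain ⟨h3, h4⟩ := ihp hm.1.2 hk h1 hs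
    exact ⟨h3.mono (by omega), fun B hB => .iteTrue (h2 B (by omega)) h (h4 B (by omega))⟩
  | @iteFalse s s' e p q t h _ ihp =>
    simp only [Prog.mild, Bool.and_eq_true] at hm
    obtain ⟨_, h2⟩ := Term.val_le_and_fits hk hs e hm.1.1
    obtain ⟨h3, h4⟩ := ihp hm.2 hk h1 hs
    exact ⟨h3.mono (by omega), fun B hB => .iteFalse (h2 B (by omega)) h (h4 B (by omega))⟩
  | @loopTrue s s' s'' e p t t' h _ _ ihp ihw =>
    have hm' := hm
    simp only [Prog.mild, Bool.and_eq_true] at hm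
    obtain ⟨_, h2⟩ := Term.val_le_and_fits hk hs e hm.1
    obtain ⟨h3, h4⟩ := ihp hm.2 hk h1 hs
    obtain ⟨h5, h6⟩ := ihw hm' (by omega) (by omega) h3
    exact ⟨h5.mono (by omega),
      fun B hB => .loopTrue (h2 B (by omega)) h (h4 B (by omega)) (h6 B (by omega))⟩
  | @loopFalse s e p h =>
    simp only [Prog.mild, Bool.and_eq_true] at hm
    obtain ⟨_, h2⟩ := Term.val_le_and_fits hk hs e hm.1
    exact ⟨hs.mono (by omega), fun B hB => .loopFalse (h2 B (by omega)) h⟩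

/-- Whether a program may write register `r`. -/
def Prog.writesReg (r : ℕ) : Prog → Bool
  | skip => false
  | setReg r' _ => decide (r = r')
  | write _ _ _ => false
  | seq p q => p.writesReg r || q.writesReg r
  | ite _ p q => p.writesReg r || q.writesReg r
  | loop _ p => p.writesReg r

/-- Whether a program may write array `a`. -/
def Prog.writesMem (a : ℕ) : Prog → Bool
  | skip => false
  | setReg _ _ => false
  | write a' _ _ => decide (a = a')
  | seq p q => p.writesMem a || q.writesMem a
  | ite _ p q => p.writesMem a || q.writesMem a
  | loop _ p => p.writesMem a

theorem Ev.reg_eq {p : Prog} {s s' : State} {t : ℕ} (h : Ev p s s' t) {r : ℕ}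
    (hr : p.writesReg r = false) : s'.reg r = s.reg r := by
  induction h with
  | skip => rfl
  | setReg => simp_all [Prog.writesReg]
  | write => rfl
  | seq _ _ ihp ihq =>
    simp only [Prog.writesReg, Bool.or_eq_false_iff] at hr
    rw [ihq hr.2, ihp hr.1]
  | iteTrue _ _ ih =>
    simp only [Prog.writesReg, Bool.or_eq_false_iff] at hr
    exact ih hr.1
  | iteFalse _ _ ih =>
    simp only [Prog.writesReg, Bool.or_eq_false_iff] at hr
    exact ih hr.2
  | loopTrue _ _ _ ihp ihq => rw [ihq hr, ihp hr]
  | loopFalse => rfl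

theorem Ev.mem_eq {p : Prog} {s s' : State} {t : ℕ} (h : Ev p s s' t) {a : ℕ}
    (ha : p.writesMem a = false) : s'.mem a = s.mem a := by
  induction h with
  | skip => rfl
  | setReg => rfl
  | write => simp_all [Prog.writesMem]
  | seq _ _ ihp ihq =>
    simp only [Prog.writesMem, Bool.or_eq_false_iff] at ha
    rw [ihq ha.2, ihp ha.1]
  | iteTrue _ _ ih =>
    simp only [Prog.writesMem, Bool.or_eq_false_iff] at ha
    exact ih ha.1
  | iteFalse _ _ ih =>
    simp only [Prog.writesMem, Bool.or_eq_false_iff] at ha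
    exact ih ha.2
  | loopTrue _ _ _ ihp ihq => rw [ihq ha, ihp ha]
  | loopFalse => rfl

/-- A program without loops. -/
def Prog.straight : Prog → Bool
  | skip => true
  | setReg _ _ => true
  | write _ _ _ => true
  | seq p q => p.straight && q.straight
  | ite _ p q => p.straight && q.straight
  | loop _ _ => false

/-- The effect of a program without loops (a loop counts as doing nothing). -/
def Prog.run : Prog → State → State
  | skip, s => s
  | setReg r e, s => s.setReg r (e.val s)
  | write a i e, s => s.write a (i.val s) (e.val s)
  | seq p q, s => q.run (p.run s)
  | ite b p q, s => if b.val s ≠ 0 then p.run s else q.run s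
  | loop _ _, s => s

/-- A bound on the running time of a program without loops. -/
def Prog.maxTime : Prog → ℕ
  | skip => 1
  | setReg _ e => e.cost + 1
  | write _ i e => i.cost + e.cost + 1
  | seq p q => p.maxTime + q.maxTime
  | ite b p q => b.cost + 1 + (p.maxTime + q.maxTime)
  | loop _ _ => 0

theorem Prog.ev_of_straight (p : Prog) (h : p.straight = true) (s : State) :
    ∃ t ≤ p.maxTime, Ev p s (p.run s) t := by
  induction p generalizing s with
  | skip => exact ⟨1, le_rfl, .skip⟩
  | setReg r e => exact ⟨_, le_rfl, .setReg⟩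
  | write a i e => exact ⟨_, le_rfl, .write⟩
  | seq p q ihp ihq =>
    simp only [Prog.straight, Bool.and_eq_true] at h
    obtain ⟨t, ht, hp⟩ := ihp h.1 s
    obtain ⟨t', ht', hq⟩ := ihq h.2 (p.run s)
    exact ⟨t + t', by simp only [Prog.maxTime]; omega, .seq hp hq⟩
  | ite b p q ihp ihq =>
    simp only [Prog.straight, Bool.and_eq_true] at h
    by_cases hb : b.val s = 0
    · obtain ⟨t, ht, hq⟩ := ihq h.2 s
      refine ⟨b.cost + 1 + t, by simp only [Prog.maxTime]; omega, ?_⟩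
      simpa [Prog.run, hb] using Ev.iteFalse hb hq
    · obtain ⟨t, ht, hp⟩ := ihp h.1 s
      refine ⟨b.cost + 1 + t, by simp only [Prog.maxTime]; omega, ?_⟩
      simpa [Prog.run, hb] using Ev.iteTrue hb hp
  | loop b p _ => simp [Prog.straight] at h

/-! ### Total correctness with a time bound -/

/-- Started in `s`, the program `p` halts within `T` steps in a state that satisfies `Q`. -/
def Tri (p : Prog) (s : State) (T : ℕ) (Q : State → Prop) : Prop :=
  ∃ s' t, Ev p s s' t ∧ t ≤ T ∧ Q s'

theorem Tri.conseq {p : Prog} {s : State} {T T' : ℕ} {Q Q' : State → Prop} (h : Tri p s T Q)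
    (hT : T ≤ T') (hQ : ∀ s', Q s' → Q' s') : Tri p s T' Q' := by
  obtain ⟨s', t, h1, h2, h3⟩ := h
  exact ⟨s', t, h1, h2.trans hT, hQ s' h3⟩

theorem Tri.seq {p q : Prog} {s : State} {T T' U : ℕ} {Q R : State → Prop} (hp : Tri p s T Q)
    (hq : ∀ s', Q s' → Tri q s' T' R) (hU : T + T' ≤ U) : Tri (.seq p q) s U R := by
  obtain ⟨s', t, h1, h2, h3⟩ := hp
  obtain ⟨s'', t', h4, h5, h6⟩ := hq s' h3
  exact ⟨s'', t + t', .seq h1 h4, by omega, h6⟩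

theorem Tri.straight {p : Prog} {s : State} {T : ℕ} {Q : State → Prop} (hp : p.straight = true)
    (hT : p.maxTime ≤ T) (hQ : Q (p.run s)) : Tri p s T Q := by
  obtain ⟨t, ht, h⟩ := p.ev_of_straight hp s
  exact ⟨_, t, h, ht.trans hT, hQ⟩

theorem Tri.setReg_seq {r : ℕ} {e : Term} {q : Prog} {s : State} {C T U : ℕ} {Q : State → Prop}
    (hC : e.cost + 1 ≤ C) (hq : ∀ s', s'.mem = s.mem → s'.reg r = e.val s →
      (∀ r', r' ≠ r → s'.reg r' = s.reg r') → Tri q s' T Q) (hU : C + T ≤ U) :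
    Tri (.seq (.setReg r e) q) s U Q :=
  Tri.seq (Q := fun s' => s' = s.setReg r (e.val s)) (Tri.straight rfl hC rfl)
    (fun _ h => h ▸ hq _ rfl (by simp) fun r' hr => by simp [hr]) hU

theorem Tri.ite {b : Term} {p q : Prog} {s : State} {T T' : ℕ} {Q : State → Prop}
    (hp : b.val s ≠ 0 → Tri p s T Q) (hq : b.val s = 0 → Tri q s T Q)
    (hT : b.cost + 1 + T ≤ T') : Tri (.ite b p q) s T' Q := by
  by_cases hb : b.val s = 0
  · obtain ⟨s', t, h1, h2, h3⟩ := hq hb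
    exact ⟨s', _, .iteFalse hb h1, by omega, h3⟩
  · obtain ⟨s', t, h1, h2, h3⟩ := hp hb
    exact ⟨s', _, .iteTrue hb h1, by omega, h3⟩

/-- Nothing that the program does not mention as a target of an assignment is changed. -/
theorem Tri.frame {p : Prog} {s : State} {T : ℕ} {Q : State → Prop} (h : Tri p s T Q) :
    Tri p s T fun s' => Q s' ∧ (∀ r, p.writesReg r = false → s'.reg r = s.reg r) ∧
      ∀ a, p.writesMem a = false → s'.mem a = s.mem a := by
  obtain ⟨s', t, h1, h2, h3⟩ := h
  exact ⟨s', t, h1, h2, h3, fun _ hr => h1.reg_eq hr, fun _ ha => h1.mem_eq ha⟩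

/-- The rule for loops: the invariant `I k` contains the number `k` of steps that may still be
spent. -/
theorem Tri.loop {b : Term} {p : Prog} (I : ℕ → State → Prop) {Q : State → Prop}
    (step : ∀ k s, I k s → b.val s ≠ 0 → ∃ T k', Tri p s T (I k') ∧ b.cost + 1 + T + k' ≤ k)
    (exit : ∀ k s, I k s → b.val s = 0 → b.cost + 1 ≤ k ∧ Q s) {k : ℕ} {s : State}
    (h : I k s) : Tri (.loop b p) s k Q := by
  induction k using Nat.strong_induction_on generalizing s with
  | _ k ih =>
    by_cases hb : b.val s = 0
    · obtain ⟨h1, h2⟩ := exit k s h hb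
      exact ⟨s, _, .loopFalse hb, h1, h2⟩
    · obtain ⟨T, k', ⟨s', t, h1, h2, h3⟩, h4⟩ := step k s h hb
      obtain ⟨s'', t', h5, h6, h7⟩ := ih k' (by omega) h3
      exact ⟨s'', _, .loopTrue hb h1 h5, by omega, h7⟩

/-- `for r := r to (value of register rb) - 1 do body` -/
def forUp (r rb : ℕ) (body : Prog) : Prog :=
  .loop (.lt (.reg r) (.reg rb)) (.seq body (.setReg r (.add (.reg r) (.const 1))))

/-- The rule for loops that count upwards: step `i` may cost `C i`, and the invariant `J i` holds
before it. -/
theorem Tri.forUp' {r rb : ℕ} {body : Prog} {N : ℕ} (C : ℕ → ℕ) (J : ℕ → State → Prop)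
    (h : ∀ i s, i < N → J i s → s.reg r = i → s.reg rb = N →
      Tri body s (C i) fun s' => J (i + 1) (s'.setReg r (i + 1)))
    (hr : body.writesReg r = false) (hrb : body.writesReg rb = false) (hne : rb ≠ r)
    {s : State} {T : ℕ} (h0 : s.reg r = 0) (hN : s.reg rb = N) (hJ : J 0 s)
    (hT : ∑ i ∈ Finset.range N, (C i + 8) + 4 ≤ T) :
    Tri (forUp r rb body) s T fun s' => J N s' ∧ s'.reg r = N := by
  have key : Tri (RAM.forUp r rb body) s (∑ i ∈ Finset.Ico 0 N, (C i + 8) + 4)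
      fun s' => J N s' ∧ s'.reg r = N := by
    refine Tri.loop (fun k s => s.reg rb = N ∧ ∃ i ≤ N, s.reg r = i ∧ J i s ∧
      k = ∑ j ∈ Finset.Ico i N, (C j + 8) + 4) ?_ ?_ ⟨hN, 0, by omega, h0, hJ, rfl⟩
    · rintro k s ⟨hb, i, hi, hri, hJi, rfl⟩ hlt
      have hiN : i < N := by
        simp only [Term.val, hb, hri] at hlt
        by_contra hc
        simp [hc] at hlt
      refine ⟨C i + 4, ∑ j ∈ Finset.Ico (i + 1) N, (C j + 8) + 4, ?_, ?_⟩
      · refine Tri.seq (T' := 4) ((h i s hiN hJi hri hb).frame) (fun s' hs' => ?_) le_rfl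
        obtain ⟨h1, h2, _⟩ := hs'
        refine Tri.straight rfl (by simp [Prog.maxTime, Term.cost]) ?_
        have h3 := h2 r hr
        simp only [Prog.run, Term.val, h3, hri]
        refine ⟨?_, i + 1, by omega, by simp, h1, rfl⟩
        simp [hne, h2 rb hrb, hb]
      · rw [Finset.sum_eq_sum_Ico_succ_bot hiN]
        simp only [Term.cost]
        omega
    · rintro k s ⟨hb, i, hi, hri, hJi, rfl⟩ hlt
      have hiN : i = N := by
        simp only [Term.val, hb, hri] at hlt
        by_contra hc
        have : i < N := by omega
        simp [this] at hlt
      subst hiN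
      exact ⟨by simp [Term.cost], hJi, hri⟩
  rw [Nat.Ico_zero_eq_range] at key
  exact key.conseq hT fun _ h => h

theorem Tri.forUp {r rb : ℕ} {body : Prog} {N C : ℕ} (J : ℕ → State → Prop)
    (h : ∀ i s, i < N → J i s → s.reg r = i → s.reg rb = N →
      Tri body s C fun s' => J (i + 1) (s'.setReg r (i + 1)))
    (hr : body.writesReg r = false) (hrb : body.writesReg rb = false) (hne : rb ≠ r)
    {s : State} {T : ℕ} (h0 : s.reg r = 0) (hN : s.reg rb = N) (hJ : J 0 s)
    (hT : N * (C + 8) + 4 ≤ T) :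
    Tri (forUp r rb body) s T fun s' => J N s' ∧ s'.reg r = N :=
  Tri.forUp' (fun _ => C) J h hr hrb hne h0 hN hJ (by simpa using hT)

/-- The list of the first `k` cells of an array. -/
def seg (f : ℕ → ℕ) (k : ℕ) : List ℕ :=
  (List.range k).map f

@[simp] theorem length_seg (f : ℕ → ℕ) (k : ℕ) : (seg f k).length = k := by
  simp [seg]

@[simp] theorem seg_zero (f : ℕ → ℕ) : seg f 0 = [] := rfl

theorem seg_succ (f : ℕ → ℕ) (k : ℕ) : seg f (k + 1) = seg f k ++ [f k] := by
  simp [seg, List.range_succ]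

theorem seg_congr {f g : ℕ → ℕ} {k : ℕ} (h : ∀ i < k, f i = g i) : seg f k = seg g k :=
  List.map_congr_left fun i hi => h i (List.mem_range.1 hi)

theorem mem_seg {f : ℕ → ℕ} {k x : ℕ} : x ∈ seg f k ↔ ∃ i < k, f i = x := by
  simp [seg]

theorem seg_push (f : ℕ → ℕ) (k x : ℕ) : seg (Function.update f k x) (k + 1) = seg f k ++ [x] := by
  rw [seg_succ, Function.update_self]
  congr 1
  exact seg_congr fun i hi => by rw [Function.update_of_ne (by omega)]

theorem seg_eq_append {f : ℕ → ℕ} {k t : ℕ} {l l' : List ℕ} (h : seg f k = l ++ t :: l') :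
    l.length < k ∧ f l.length = t := by
  have h1 := congrArg List.length h
  simp only [length_seg, List.length_append, List.length_cons] at h1
  refine ⟨by omega, ?_⟩
  have h2 := congrArg (fun m => m[l.length]?) h
  simpa [seg, List.getElem?_range (show l.length < k by omega)] using h2

theorem seg_nodup_iff {f : ℕ → ℕ} {k : ℕ} :
    (seg f k).Nodup ↔ ∀ i < k, ∀ j < k, f i = f j → i = j := by
  rw [seg, List.nodup_map_iff_inj_on List.nodup_range]
  simp [List.mem_range]

end RAM

/-! ### Strong resolving sets as complements of cliques -/

namespace Digraph

variable {V : Type*} (G : Digraph V)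

/-- Any two distinct vertices are at distance at most two. -/
def DiamLeTwo : Prop :=
  ∀ u v, u ≠ v → G.Adj u v ∨ ∃ w, G.Adj u w ∧ G.Adj w v

/-- A third vertex sees that `u` and `v` differ: it is an in-neighbour of `u` but not of `v`, or an
out-neighbour of `v` but not of `u`. -/
def Distinguished (u v : V) : Prop :=
  ∃ w, w ≠ u ∧ w ≠ v ∧ ((G.Adj w u ∧ ¬ G.Adj w v) ∨ (G.Adj v w ∧ ¬ G.Adj u w))

/-- The relation on the vertices whose cliques are the complements of the strong resolving sets in
graphs of diameter at most two. -/
def Compatible (u v : V) : Prop :=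
  G.Adj u v ∧ G.Adj v u ∧ G.Distinguished u v ∧ G.Distinguished v u

variable {G}

theorem IsPath.two_le {x z : V} {p : List V} (h : G.IsPath x z p) (hxz : x ≠ z) :
    2 ≤ p.length := by
  obtain ⟨h1, h2, _, _⟩ := h
  match p, h1, h2 with
  | [a], h1, h2 =>
    simp only [List.head?_cons, Option.some.injEq, List.getLast?_singleton] at h1 h2
    exact absurd (h1.symm.trans h2) hxz
  | a :: b :: l, _, _ => simp

theorem IsPath.adj_of_length {x z : V} {p : List V} (h : G.IsPath x z p) (hp : p.length = 2) :
    G.Adj x z := by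
  obtain ⟨h1, h2, h3, _⟩ := h
  match p, hp, h1, h2, h3 with
  | [a, b], _, h1, h2, h3 => simp_all

theorem isPath_pair {x z : V} (h : G.Adj x z) (hxz : x ≠ z) : G.IsPath x z [x, z] := by
  simp [IsPath, h, hxz]

theorem isPath_triple {x y z : V} (h : G.Adj x y) (h' : G.Adj y z) (hxy : x ≠ y) (hyz : y ≠ z)
    (hxz : x ≠ z) : G.IsPath x z [x, y, z] := by
  simp [IsPath, h, h', hxy, hyz, hxz]

theorem isShortestPath_pair {x z : V} (h : G.Adj x z) (hxz : x ≠ z) :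
    G.IsShortestPath x z [x, z] :=
  ⟨isPath_pair h hxz, fun _ hq => hq.two_le hxz⟩

theorem isShortestPath_triple {x y z : V} (h : G.Adj x y) (h' : G.Adj y z) (hxy : x ≠ y)
    (hyz : y ≠ z) (hxz : x ≠ z) (hn : ¬ G.Adj x z) : G.IsShortestPath x z [x, y, z] := by
  refine ⟨isPath_triple h h' hxy hyz hxz, fun q hq => ?_⟩
  have h2 := hq.two_le hxz
  by_contra hc
  have h3 : q.length < 3 := by simpa using hc
  exact hn (hq.adj_of_length (by omega))

theorem IsPath.mem_triple {x y z : V} {p : List V} (h : G.IsPath x z p) (hp : p.length ≤ 3)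
    (hy : y ∈ p) (hyx : y ≠ x) (hyz : y ≠ z) : p.length = 3 ∧ G.Adj x y ∧ G.Adj y z := by
  obtain ⟨h1, h2, h3, _⟩ := h
  match p, hp, h1, h2, h3, hy with
  | [a], _, h1, h2, h3, hy => simp_all
  | [a, b], _, h1, h2, h3, hy => simp_all
  | [a, b, c], _, h1, h2, h3, hy =>
    simp at h1 h2 h3 hy
    subst h1 h2
    rcases hy with rfl | rfl | rfl
    · exact absurd rfl hyx
    · exact ⟨rfl, h3⟩
    · exact absurd rfl hyz

theorem DiamLeTwo.exists_isShortestPath (hd : G.DiamLeTwo) (hirr : ∀ u, ¬ G.Adj u u) {x z : V}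
    (hxz : x ≠ z) : ∃ p, G.IsShortestPath x z p ∧ x ∈ p ∧ z ∈ p ∧ p.length ≤ 3 ∧
      (G.Adj x z → p.length = 2) := by
  by_cases h : G.Adj x z
  · exact ⟨_, isShortestPath_pair h hxz, by simp, by simp, by simp, by simp⟩
  · obtain h' | ⟨w, h1, h2⟩ := hd x z hxz
    · exact absurd h' h
    · refine ⟨_, isShortestPath_triple h1 h2 ?_ ?_ hxz h, by simp, by simp, by simp,
        fun h' => absurd h' h⟩
      · rintro rfl
        exact hirr _ h1
      · rintro rfl
        exact hirr _ h2

theorem DiamLeTwo.hasShortestPathThrough_iff (hd : G.DiamLeTwo) (hirr : ∀ u, ¬ G.Adj u u)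
    {x y z : V} (hyx : y ≠ x) (hyz : y ≠ z) :
    G.HasShortestPathThrough x y z ↔ x ≠ z ∧ ¬ G.Adj x z ∧ G.Adj x y ∧ G.Adj y z := by
  constructor
  · rintro ⟨p, hp, hy⟩
    by_cases hxz : x = z
    · subst hxz
      have := hp.2 [x] (by simp [IsPath])
      have h1 := hp.1
      simp only [List.length_cons, List.length_nil] at this
      have h3 := h1.mem_triple (by omega) hy hyx hyz
      omega
    · obtain ⟨q, hq, _, _, hq3, hq2⟩ := hd.exists_isShortestPath hirr hxz
      have h1 := hp.2 q hq.1
      have h3 := hp.1.mem_triple (by omega) hy hyx hyz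
      exact ⟨hxz, fun h => by have := hq2 h; omega, h3.2⟩
  · rintro ⟨hxz, h1, h2, h3⟩
    exact ⟨_, isShortestPath_triple h2 h3 hyx.symm hyz hxz h1, by simp⟩

theorem DiamLeTwo.stronglyResolves_iff (hd : G.DiamLeTwo) (hirr : ∀ u, ¬ G.Adj u u) {w u v : V}
    (huv : u ≠ v) : G.StronglyResolves w u v ↔ w = u ∨ w = v ∨
      (G.Adj u v ∧ ((G.Adj w u ∧ ¬ G.Adj w v) ∨ (G.Adj v w ∧ ¬ G.Adj u w))) := by
  unfold StronglyResolves
  obtain ⟨p, hp, hup, hvp, _⟩ := hd.exists_isShortestPath hirr huv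
  by_cases h1 : w = u
  · subst h1
    exact ⟨fun _ => .inl rfl, fun _ => .inl ⟨p, hp, hup⟩⟩
  by_cases h2 : w = v
  · subst h2
    exact ⟨fun _ => .inr (.inl rfl), fun _ => .inr ⟨p, hp, hvp⟩⟩
  rw [hd.hasShortestPathThrough_iff hirr (Ne.symm h1) huv,
    hd.hasShortestPathThrough_iff hirr huv.symm (Ne.symm h2)]
  have : u ≠ w := Ne.symm h1
  tauto

/-- In diameter two only the pairs that no third vertex distinguishes, and the pairs at distance
two, have to be met: the former force the rest, because a vertex that distinguishes two vertices is
at distance two from one of them. -/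
theorem DiamLeTwo.isStrongResolvingSet_iff (hd : G.DiamLeTwo) (hirr : ∀ u, ¬ G.Adj u u)
    {R : Finset V} : G.IsStrongResolvingSet R ↔
      ∀ u v, u ∉ R → v ∉ R → u ≠ v → G.Compatible u v := by
  constructor
  · intro h u v hu hv huv
    have key : ∀ u v, u ∉ R → v ∉ R → u ≠ v → G.Adj u v ∧ G.Distinguished u v := by
      intro u v hu hv huv
      obtain ⟨w, hw, hr⟩ := (h u v huv).1
      rw [hd.stronglyResolves_iff hirr huv] at hr
      have hwu : w ≠ u := fun h => hu (h ▸ hw)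
      have hwv : w ≠ v := fun h => hv (h ▸ hw)
      obtain hr | hr | ⟨h1, h2⟩ := hr
      · exact absurd hr hwu
      · exact absurd hr hwv
      · exact ⟨h1, w, hwu, hwv, h2⟩
    have h1 := key u v hu hv huv
    have h2 := key v u hv hu huv.symm
    exact ⟨h1.1, h2.1, h1.2, h2.2⟩
  · intro h
    have key : ∀ u v, u ≠ v → ∃ w ∈ R, G.StronglyResolves w u v := by
      intro u v huv
      by_cases hu : u ∈ R
      · exact ⟨u, hu, (hd.stronglyResolves_iff hirr huv).2 (.inl rfl)⟩
      by_cases hv : v ∈ R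
      · exact ⟨v, hv, (hd.stronglyResolves_iff hirr huv).2 (.inr (.inl rfl))⟩
      obtain ⟨h1, _, ⟨w, hwu, hwv, hw⟩, _⟩ := h u v hu hv huv
      refine ⟨w, ?_, (hd.stronglyResolves_iff hirr huv).2 (.inr (.inr ⟨h1, hw⟩))⟩
      by_contra hwR
      rcases hw with hw | hw
      · exact hw.2 (h w v hwR hv hwv).1
      · exact hw.2 (h u w hu hwR hwu.symm).1
    exact fun u v huv => ⟨key u v huv, key v u huv.symm⟩

/-- Complements of maximum cliques of the compatibility relation are strong metric bases. -/
theorem DiamLeTwo.isStrongMetricBasis [Fintype V] [DecidableEq V] (hd : G.DiamLeTwo)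
    (hirr : ∀ u, ¬ G.Adj u u) {Q : Finset V}
    (hQ : ∀ u ∈ Q, ∀ v ∈ Q, u ≠ v → G.Compatible u v)
    (hmax : ∀ Q' : Finset V, (∀ u ∈ Q', ∀ v ∈ Q', u ≠ v → G.Compatible u v) → Q'.card ≤ Q.card) :
    G.IsStrongMetricBasis Qᶜ ∧ G.strongMetricDim = Qᶜ.card := by
  have h1 : G.IsStrongMetricBasis Qᶜ := by
    refine ⟨?_, fun R' hR' => ?_⟩
    · rw [hd.isStrongResolvingSet_iff hirr]
      intro u v hu hv huv
      exact hQ u (by simpa using hu) v (by simpa using hv) huv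
    · rw [hd.isStrongResolvingSet_iff hirr] at hR'
      have := hmax R'ᶜ (fun u hu v hv huv => hR' u v (by simpa using hu) (by simpa using hv) huv)
      have h2 := R'.card_add_card_compl
      have h3 := Q.card_add_card_compl
      omega
  refine ⟨h1, le_antisymm (Nat.sInf_le ⟨_, h1.1, rfl⟩) ?_⟩
  refine le_csInf ⟨_, _, h1.1, rfl⟩ ?_
  rintro k ⟨R', hR', rfl⟩
  exact h1.2 R' hR'

end Digraph

/-! ### Forbidden patterns of directed co-graphs -/

open Classical in
/-- The number of arcs between two vertices. -/
noncomputable def arcCount {V : Type*} (A : V → V → Prop) (u v : V) : ℕ :=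
  (if A u v then 1 else 0) + (if A v u then 1 else 0)

theorem arcCount_comm {V : Type*} (A : V → V → Prop) (u v : V) :
    arcCount A u v = arcCount A v u := by
  unfold arcCount
  omega

theorem arcCount_eq_two {V : Type*} {A : V → V → Prop} {u v : V} :
    arcCount A u v = 2 ↔ A u v ∧ A v u := by
  unfold arcCount
  split_ifs <;> simp_all

theorem arcCount_eq_one {V : Type*} {A : V → V → Prop} {u v : V} :
    arcCount A u v = 1 ↔ (A u v ∧ ¬ A v u) ∨ (A v u ∧ ¬ A u v) := by
  unfold arcCount
  split_ifs <;> simp_all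

theorem arcCount_eq_zero {V : Type*} {A : V → V → Prop} {u v : V} :
    arcCount A u v = 0 ↔ ¬ A u v ∧ ¬ A v u := by
  unfold arcCount
  split_ifs <;> simp_all

theorem arcCount_le_two {V : Type*} (A : V → V → Prop) (u v : V) : arcCount A u v ≤ 2 := by
  unfold arcCount
  split_ifs <;> simp

/-- The local structure of a directed co-graph on the vertex set `S`. The number of arcs between two
vertices takes at most two values on any three vertices, none of its values forms a path on four
vertices whose complement has a constant value too, and single arcs are transitive. -/
structure IsCoRel {V : Type*} (A : V → V → Prop) (S : Set V) : Prop where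
  irrefl : ∀ u ∈ S, ¬ A u u
  rainbow : ∀ u ∈ S, ∀ v ∈ S, ∀ w ∈ S, u ≠ v → u ≠ w → v ≠ w →
    arcCount A u v = arcCount A u w ∨ arcCount A u v = arcCount A v w ∨
      arcCount A u w = arcCount A v w
  path : ∀ a ∈ S, ∀ b ∈ S, ∀ c ∈ S, ∀ d ∈ S, a ≠ b → a ≠ c → a ≠ d → b ≠ c → b ≠ d → c ≠ d →
    ∀ i j, i ≠ j → arcCount A a b = i → arcCount A b c = i → arcCount A c d = i →
      arcCount A a c = j → arcCount A b d = j → arcCount A a d ≠ j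
  trans : ∀ u ∈ S, ∀ v ∈ S, ∀ w ∈ S, A u v → ¬ A v u → A v w → ¬ A w v → A u w ∧ ¬ A w u

theorem IsCoRel.congr {V : Type*} {A A' : V → V → Prop} {S : Set V} (h : IsCoRel A S)
    (hA : ∀ u ∈ S, ∀ v ∈ S, A' u v ↔ A u v) : IsCoRel A' S := by
  have he : ∀ u ∈ S, ∀ v ∈ S, arcCount A' u v = arcCount A u v := by
    intro u hu v hv
    have h1 := hA u hu v hv
    have h2 := hA v hv u hu
    unfold arcCount
    split_ifs <;> tauto
  refine ⟨?_, ?_, ?_, ?_⟩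
  · intro u hu
    rw [hA u hu u hu]
    exact h.irrefl u hu
  · intro u hu v hv w hw
    rw [he u hu v hv, he u hu w hw, he v hv w hw]
    exact h.rainbow u hu v hv w hw
  · intro a ha b hb c hc d hd
    rw [he a ha b hb, he b hb c hc, he c hc d hd, he a ha c hc, he b hb d hd, he a ha d hd]
    exact h.path a ha b hb c hc d hd
  · intro u hu v hv w hw
    rw [hA u hu v hv, hA v hv u hu, hA v hv w hw, hA w hw v hv, hA u hu w hw, hA w hw u hu]
    exact h.trans u hu v hv w hw

/-- The patterns are not created when two parts are composed uniformly. -/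
theorem IsCoRel.compose {V : Type*} {A : V → V → Prop} {S S' : Set V} (h : IsCoRel A S)
    (h' : IsCoRel A S') {p q : Prop} (hp : ∀ u ∈ S, ∀ v ∈ S', A u v ↔ p)
    (hq : ∀ u ∈ S, ∀ v ∈ S', A v u ↔ q) : IsCoRel A (S ∪ S') := by
  obtain ⟨k, hk⟩ : ∃ k, ∀ u ∈ S, ∀ v ∈ S', arcCount A u v = k := by
    classical
    exact ⟨(if p then 1 else 0) + (if q then 1 else 0), fun u hu v hv => by
      simp [arcCount, hp u hu v hv, hq u hu v hv]⟩
  have hk' : ∀ u ∈ S, ∀ v ∈ S', arcCount A v u = k := fun u hu v hv => by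
    rw [arcCount_comm]; exact hk u hu v hv
  refine ⟨?_, ?_, ?_, ?_⟩
  · rintro u (hu | hu)
    · exact h.irrefl u hu
    · exact h'.irrefl u hu
  · rintro u (hu | hu) v (hv | hv) w (hw | hw) h1 h2 h3
    · exact h.rainbow u hu v hv w hw h1 h2 h3
    · have := hk u hu w hw; have := hk v hv w hw; omega
    · have := hk u hu v hv; have := hk' w hw v hv; omega
    · have := hk u hu v hv; have := hk u hu w hw; omega
    · have := hk' v hv u hu; have := hk' w hw u hu; omega
    · have := hk' v hv u hu; have := hk v hv w hw; omega
    · have := hk' w hw u hu; have := hk' w hw v hv; omega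
    · exact h'.rainbow u hu v hv w hw h1 h2 h3
  · rintro a ha b hb c hc d hd hab hac had hbc hbd hcd i j hij e1 e2 e3 e4 e5 e6
    have key : ∀ x ∈ S ∪ S', ∀ y ∈ S ∪ S', arcCount A x y ≠ k → (x ∈ S → y ∈ S) ∧
        (x ∈ S' → y ∈ S') := by
      rintro x hx y hy hxy
      refine ⟨fun hx => hy.resolve_right fun hy => hxy (hk x hx y hy),
        fun hx => hy.resolve_left fun hy => hxy (hk' y hy x hx)⟩
    by_cases hi : i = k
    · have h1 := key a ha c hc (by omega)
      have h2 := key a ha d hd (by omega)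
      have h3 := key d hd b hb (by rw [arcCount_comm]; omega)
      rcases ha with ha | ha
      · exact h.path a ha b (h3.1 (h2.1 ha)) c (h1.1 ha) d (h2.1 ha) hab hac had hbc hbd hcd i j
          hij e1 e2 e3 e4 e5 e6
      · exact h'.path a ha b (h3.2 (h2.2 ha)) c (h1.2 ha) d (h2.2 ha) hab hac had hbc hbd hcd i j
          hij e1 e2 e3 e4 e5 e6
    · have h1 := key a ha b hb (by omega)
      have h2 := key b hb c hc (by omega)
      have h3 := key c hc d hd (by omega)
      rcases ha with ha | ha
      · exact h.path a ha b (h1.1 ha) c (h2.1 (h1.1 ha)) d (h3.1 (h2.1 (h1.1 ha)))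
          hab hac had hbc hbd hcd i j hij e1 e2 e3 e4 e5 e6
      · exact h'.path a ha b (h1.2 ha) c (h2.2 (h1.2 ha)) d (h3.2 (h2.2 (h1.2 ha)))
          hab hac had hbc hbd hcd i j hij e1 e2 e3 e4 e5 e6
  · rintro u (hu | hu) v (hv | hv) w (hw | hw) h1 h2 h3 h4
    · exact h.trans u hu v hv w hw h1 h2 h3 h4
    · have := hp u hu w hw; have := hp v hv w hw; have := hq u hu w hw; have := hq v hv w hw
      tauto
    · have := hp u hu v hv; have := hp w hw v hv; have := hq u hu v hv; have := hq w hw v hv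
      tauto
    · have := hp u hu w hw; have := hp u hu v hv; have := hq u hu w hw; have := hq u hu v hv
      tauto
    · have := hp v hv u hu; have := hp w hw u hu; have := hq v hv u hu; have := hq w hw u hu
      tauto
    · have := hp v hv u hu; have := hp v hv w hw; have := hq v hv u hu; have := hq v hv w hw
      tauto
    · have := hp w hw u hu; have := hp w hw v hv; have := hq w hw u hu; have := hq w hw v hv
      tauto
    · exact h'.trans u hu v hv w hw h1 h2 h3 h4

namespace DiCotree

variable {V : Type*}

theorem Arc.mem {T : DiCotree V} {u v : V} (h : T.Arc u v) : u ∈ T.leaves ∧ v ∈ T.leaves := by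
  induction T with
  | leaf => exact h.elim
  | union l r ihl ihr =>
    simp only [leaves, List.mem_append]
    rcases h with h | h
    · exact ⟨.inl (ihl h).1, .inl (ihl h).2⟩
    · exact ⟨.inr (ihr h).1, .inr (ihr h).2⟩
  | dirJoin l r ihl ihr =>
    simp only [leaves, List.mem_append]
    rcases h with h | h | h
    · exact ⟨.inl (ihl h).1, .inl (ihl h).2⟩
    · exact ⟨.inr (ihr h).1, .inr (ihr h).2⟩
    · exact ⟨.inl h.1, .inr h.2⟩
  | join l r ihl ihr =>
    simp only [leaves, List.mem_append]
    rcases h with h | h | h | h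
    · exact ⟨.inl (ihl h).1, .inl (ihl h).2⟩
    · exact ⟨.inr (ihr h).1, .inr (ihr h).2⟩
    · exact ⟨.inl h.1, .inr h.2⟩
    · exact ⟨.inr h.1, .inl h.2⟩

theorem leaves_ne_nil (T : DiCotree V) : ∃ v, v ∈ T.leaves := by
  induction T with
  | leaf v => exact ⟨v, by simp [leaves]⟩
  | union l r ihl _ => exact ihl.imp fun v hv => by simp [leaves, hv]
  | dirJoin l r ihl _ => exact ihl.imp fun v hv => by simp [leaves, hv]
  | join l r ihl _ => exact ihl.imp fun v hv => by simp [leaves, hv]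

/-- Directed co-graphs contain none of the forbidden patterns, by induction along the co-tree. -/
theorem isCoRel (T : DiCotree V) (hT : T.leaves.Nodup) : IsCoRel T.Arc {v | v ∈ T.leaves} := by
  have main : ∀ (l r T : DiCotree V), IsCoRel l.Arc {v | v ∈ l.leaves} →
      IsCoRel r.Arc {v | v ∈ r.leaves} → List.Disjoint l.leaves r.leaves →
      T.leaves = l.leaves ++ r.leaves →
      (∃ p q : Prop, ∀ u v, T.Arc u v ↔ l.Arc u v ∨ r.Arc u v ∨ (p ∧ u ∈ l.leaves ∧ v ∈ r.leaves) ∨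
        (q ∧ u ∈ r.leaves ∧ v ∈ l.leaves)) → IsCoRel T.Arc {v | v ∈ T.leaves} := by
    rintro l r T hl hr hd hT ⟨p, q, hpq⟩
    have e : {v | v ∈ T.leaves} = {v | v ∈ l.leaves} ∪ {v | v ∈ r.leaves} := by
      ext; simp [hT]
    have hdl : ∀ v, v ∈ l.leaves → v ∉ r.leaves := fun v h h' => hd h h'
    have hml := fun u v => @Arc.mem _ l u v
    have hmr := fun u v => @Arc.mem _ r u v
    rw [e]
    refine (hl.congr ?_).compose (hr.congr ?_) (p := p) (q := q) ?_ ?_ <;>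
    · intro u hu v hv
      simp only [Set.mem_ofPred_eq] at hu hv
      rw [hpq]
      have := hdl u
      have := hdl v
      have := hml u v
      have := hmr u v
      have := hml v u
      have := hmr v u
      tauto
  induction T with
  | leaf a =>
    refine ⟨fun u _ h => h, ?_, ?_, fun u _ v _ w _ h => h.elim⟩
    · intro u hu v hv w hw h
      simp_all [leaves]
    · intro a ha b hb c hc d hd h
      simp_all [leaves]
  | union l r ihl ihr =>
    rw [leaves, List.nodup_append'] at hT
    exact main l r _ (ihl hT.1) (ihr hT.2.1) hT.2.2 rfl ⟨False, False, by simp [Arc]⟩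
  | dirJoin l r ihl ihr =>
    rw [leaves, List.nodup_append'] at hT
    exact main l r _ (ihl hT.1) (ihr hT.2.1) hT.2.2 rfl ⟨True, False, by simp [Arc]⟩
  | join l r ihl ihr =>
    rw [leaves, List.nodup_append'] at hT
    exact main l r _ (ihl hT.1) (ihr hT.2.1) hT.2.2 rfl ⟨True, True, by simp [Arc]⟩

end DiCotree

namespace Digraph

variable {V : Type*} {G : Digraph V}

theorem IsDirectedCograph.isCoRel (h : G.IsDirectedCograph) : IsCoRel G.Adj Set.univ := by
  obtain ⟨T, h1, h2, h3⟩ := h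
  have := (T.isCoRel h1).congr (A' := G.Adj) fun u _ v _ => h3 u v
  convert this
  ext v
  simp [h2 v]

/-- The root of a co-tree of a strongly connected graph with at least two vertices is a join. -/
theorem IsDirectedCograph.diamLeTwo (h : G.IsDirectedCograph) (hs : G.IsStronglyConnected) :
    G.DiamLeTwo := by
  obtain ⟨T, h1, h2, h3⟩ := h
  have main : ∀ l r : DiCotree V, List.Disjoint l.leaves r.leaves →
      (∀ u ∈ l.leaves, ∀ v, G.Adj u v → v ∈ l.leaves) → False := by
    intro l r hd hc
    obtain ⟨a, ha⟩ := l.leaves_ne_nil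
    obtain ⟨b, hb⟩ := r.leaves_ne_nil
    have key : ∀ v, Relation.ReflTransGen G.Adj a v → v ∈ l.leaves := by
      intro v hv
      induction hv with
      | refl => exact ha
      | tail _ h ih => exact hc _ ih _ h
    exact hd (key b (hs a b)) hb
  intro u v huv
  match T, h1, h2, h3 with
  | .leaf a, _, h2, _ =>
    have h4 := h2 u
    have h5 := h2 v
    simp only [DiCotree.leaves, List.mem_singleton] at h4 h5
    exact absurd (h4.trans h5.symm) huv
  | .union l r, h1, _, h3 =>
    rw [DiCotree.leaves, List.nodup_append'] at h1
    refine (main l r h1.2.2 fun a ha b hab => ?_).elim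
    rcases (h3 a b).1 hab with h | h
    · exact h.mem.2
    · exact absurd h.mem.1 (fun h => h1.2.2 ha h)
  | .dirJoin l r, h1, _, h3 =>
    rw [DiCotree.leaves, List.nodup_append'] at h1
    refine (main r l h1.2.2.symm fun a ha b hab => ?_).elim
    rcases (h3 a b).1 hab with h | h | h
    · exact absurd ha (fun h' => h1.2.2 h.mem.1 h')
    · exact h.mem.2
    · exact absurd ha (fun h' => h1.2.2 h.1 h')
  | .join l r, h1, h2, h3 =>
    obtain ⟨a, ha⟩ := l.leaves_ne_nil
    obtain ⟨b, hb⟩ := r.leaves_ne_nil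
    have hu := h2 u
    have hv := h2 v
    simp only [DiCotree.leaves, List.mem_append] at hu hv
    simp only [h3, DiCotree.Arc]
    rcases hu with hu | hu <;> rcases hv with hv | hv
    · exact .inr ⟨b, by tauto, by tauto⟩
    · exact .inl (by tauto)
    · exact .inl (by tauto)
    · exact .inr ⟨a, by tauto, by tauto⟩

end Digraph

/-! ### Co-trees given by parent pointers -/

/-- The relation `e` on the vertex set `S` has the local structure of the labels of lowest common
ancestors in a tree. -/
structure IsSymbolic (e : ℕ → ℕ → ℕ) (S : Set ℕ) : Prop where
  comm : ∀ u v, e u v = e v u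
  le_two : ∀ u v, e u v ≤ 2
  rainbow : ∀ u ∈ S, ∀ v ∈ S, ∀ w ∈ S, u ≠ v → u ≠ w → v ≠ w →
    e u v = e u w ∨ e u v = e v w ∨ e u w = e v w
  path : ∀ a ∈ S, ∀ b ∈ S, ∀ c ∈ S, ∀ d ∈ S, a ≠ b → a ≠ c → a ≠ d → b ≠ c → b ≠ d → c ≠ d →
    ∀ i j, i ≠ j → e a b = i → e b c = i → e c d = i → e a c = j → e b d = j → e a d ≠ j

/-- A rooted tree with leaf set `V` and set of inner nodes `I`. The parent of a node is given by
`par`; the parent of the root is an extra node `z`. The set `D t` consists of the leaves below `t`,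
and `e u v` is the label of the lowest common ancestor of `u` and `v`. -/
structure IsTree (e : ℕ → ℕ → ℕ) (V I : Finset ℕ) (z : ℕ) (par lab : ℕ → ℕ) (D : ℕ → Finset ℕ) :
    Prop where
  disj : ∀ t ∈ V, t ∉ I
  zV : z ∉ V
  zI : z ∉ I
  par_mem : ∀ t, t ∈ V ∨ t ∈ I → par t = z ∨ par t ∈ I
  leaf : ∀ v ∈ V, D v = {v}
  mem_iff : ∀ q, q = z ∨ q ∈ I → ∀ u, u ∈ D q ↔ ∃ c, (c ∈ V ∨ c ∈ I) ∧ par c = q ∧ u ∈ D c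
  sibling : ∀ c c', c ∈ V ∨ c ∈ I → c' ∈ V ∨ c' ∈ I → c ≠ c' → par c = par c' →
    ∀ u ∈ D c, ∀ v ∈ D c', u ≠ v ∧ e u v = lab (par c)
  nonempty : ∀ t, t ∈ V ∨ t ∈ I → (D t).Nonempty
  sub : ∀ t, t ∈ V ∨ t ∈ I → D t ⊆ V
  top : D z = V
  two : ∀ q ∈ I, ∃ c c', c ≠ c' ∧ (c ∈ V ∨ c ∈ I) ∧ (c' ∈ V ∨ c' ∈ I) ∧ par c = q ∧ par c' = q
  one : ∀ c c', c ∈ V ∨ c ∈ I → c' ∈ V ∨ c' ∈ I → par c = z → par c' = z → c = c'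

namespace IsTree

variable {e : ℕ → ℕ → ℕ} {V I : Finset ℕ} {z : ℕ} {par lab : ℕ → ℕ} {D : ℕ → Finset ℕ}

theorem subset_par (h : IsTree e V I z par lab D) {t : ℕ} (ht : t ∈ V ∨ t ∈ I) :
    D t ⊆ D (par t) := fun u hu =>
  (h.mem_iff (par t) (h.par_mem t ht) u).2 ⟨t, ht, rfl, hu⟩

theorem exists_sibling (h : IsTree e V I z par lab D) {t : ℕ} (hp : par t ∈ I) :
    ∃ c, (c ∈ V ∨ c ∈ I) ∧ c ≠ t ∧ par c = par t := by
  obtain ⟨c, c', hne, hc, hc', h1, h2⟩ := h.two _ hp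
  by_cases hct : c = t
  · exact ⟨c', hc', fun h => hne (hct.trans h.symm), h2⟩
  · exact ⟨c, hc, hct, h1⟩

theorem card_lt (h : IsTree e V I z par lab D) {t : ℕ} (ht : t ∈ V ∨ t ∈ I) (hp : par t ∈ I) :
    (D t).card < (D (par t)).card := by
  obtain ⟨c, hc, hne, hpc⟩ := h.exists_sibling hp
  obtain ⟨u, hu⟩ := h.nonempty c hc
  refine Finset.card_lt_card ⟨h.subset_par ht, fun hsub => ?_⟩
  have h1 : u ∈ D t := hsub (hpc ▸ h.subset_par hc hu)
  exact (h.sibling c t hc ht hne hpc u hu u h1).1 rfl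

/-- Induction from the leaves to the root. -/
theorem down (h : IsTree e V I z par lab D) {P : ℕ → Prop} (hV : ∀ v ∈ V, P v)
    (hI : ∀ q ∈ I, (∀ c, c ∈ V ∨ c ∈ I → par c = q → P c) → P q) :
    ∀ t, t ∈ V ∨ t ∈ I → P t := by
  intro t
  induction hn : (D t).card using Nat.strong_induction_on generalizing t with
  | _ n ih =>
    rintro (ht | ht)
    · exact hV t ht
    · refine hI t ht fun c hc hpc => ih _ ?_ c rfl hc
      subst hpc
      rw [← hn]
      exact h.card_lt hc ht

/-- Induction from the root to the leaves. -/
theorem up (h : IsTree e V I z par lab D) {P : ℕ → Prop}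
    (hz : ∀ t, t ∈ V ∨ t ∈ I → par t = z → P t)
    (hI : ∀ t, t ∈ V ∨ t ∈ I → par t ∈ I → P (par t) → P t) :
    ∀ t, t ∈ V ∨ t ∈ I → P t := by
  intro t
  induction hn : V.card - (D t).card using Nat.strong_induction_on generalizing t with
  | _ n ih =>
    intro ht
    rcases h.par_mem t ht with hp | hp
    · exact hz t ht hp
    · refine hI t ht hp (ih _ ?_ _ rfl (.inr hp))
      have := h.card_lt ht hp
      have := Finset.card_le_card (h.sub (par t) (.inr hp))
      omega

/-- The vertices below a node are not told apart from outside. -/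
theorem eq_of_notMem (h : IsTree e V I z par lab D) :
    ∀ t, t ∈ V ∨ t ∈ I → ∀ w ∈ V, w ∉ D t → ∀ u ∈ D t, ∀ v ∈ D t, e w u = e w v := by
  have main : ∀ t, t ∈ V ∨ t ∈ I → ∀ w, w ∈ D (par t) → w ∉ D t → ∀ u ∈ D t, ∀ v ∈ D t,
      e w u = e w v := by
    intro t ht w hw hwt u hu v hv
    obtain ⟨c, hcN, hpc, hwc⟩ := (h.mem_iff _ (h.par_mem t ht) w).1 hw
    have hne : c ≠ t := by rintro rfl; exact hwt hwc
    rw [(h.sibling c t hcN ht hne hpc w hwc u hu).2, (h.sibling c t hcN ht hne hpc w hwc v hv).2]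
  refine h.up ?_ ?_
  · intro t ht hp w hw hwt
    exact main t ht w (by rw [hp, h.top]; exact hw) hwt
  · intro t ht hp ih w hw hwt u hu v hv
    by_cases hwp : w ∈ D (par t)
    · exact main t ht w hwp hwt u hu v hv
    · exact ih w hw hwp u (h.subset_par ht hu) v (h.subset_par ht hv)

/-- The ancestor relation. -/
def Anc (V I : Finset ℕ) (par : ℕ → ℕ) : ℕ → ℕ → Prop :=
  Relation.ReflTransGen fun a b => (a ∈ V ∨ a ∈ I) ∧ par a = b

theorem subset_of_anc (h : IsTree e V I z par lab D) {t q : ℕ} (hA : Anc V I par t q) :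
    D t ⊆ D q := by
  induction hA with
  | refl => exact subset_rfl
  | tail _ hs ih => exact ih.trans (hs.2 ▸ h.subset_par hs.1)

theorem anc_of_mem (h : IsTree e V I z par lab D) : ∀ t, t ∈ V ∨ t ∈ I → ∀ u ∈ D t,
    Anc V I par u t := by
  refine h.down ?_ ?_
  · intro v hv u hu
    rw [h.leaf v hv, Finset.mem_singleton] at hu
    subst hu
    exact .refl
  · intro q hq ih u hu
    obtain ⟨c, hcN, hpc, huc⟩ := (h.mem_iff q (.inr hq) u).1 hu
    exact (ih c hcN hpc u huc).tail ⟨hcN, hpc⟩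

theorem anc_of_mem_top (h : IsTree e V I z par lab D) {u : ℕ} (hu : u ∈ V) :
    Anc V I par u z := by
  rw [← h.top] at hu
  obtain ⟨c, hcN, hpc, huc⟩ := (h.mem_iff z (.inl rfl) u).1 hu
  exact (h.anc_of_mem c hcN u huc).tail ⟨hcN, hpc⟩

/-- A node whose leaves are among those of another node is that node or lies below one of its
children. -/
theorem exists_kid_of_subset (h : IsTree e V I z par lab D) {t q : ℕ} (ht : t ∈ V ∨ t ∈ I)
    (hq : q = z ∨ q ∈ V ∨ q ∈ I) (hsub : D t ⊆ D q) (hne : t ≠ q) :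
    (q = z ∨ q ∈ I) ∧ D (par t) ⊆ D q ∧ (par t = z → q = z) ∧
      ∃ c, (c ∈ V ∨ c ∈ I) ∧ par c = q ∧ D t ⊆ D c := by
  obtain ⟨u, hu⟩ := h.nonempty t ht
  have h1 := h.anc_of_mem t ht u hu
  have h2 : Anc V I par u q := by
    rcases hq with rfl | hq
    · exact h.anc_of_mem_top (h.sub t ht hu)
    · exact h.anc_of_mem q hq u (hsub hu)
  have hz : ∀ b, Anc V I par z b → b = z := by
    intro b hb
    rcases Relation.ReflTransGen.cases_head hb with hb | ⟨c, hc, _⟩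
    · exact hb.symm
    · rcases hc.1 with h3 | h3
      · exact absurd h3 h.zV
      · exact absurd h3 h.zI
  have huniq : Relator.RightUnique fun a b => (a ∈ V ∨ a ∈ I) ∧ par a = b :=
    fun a b c hb hc => hb.2.symm.trans hc.2
  have h3 : Anc V I par t q := by
    rcases Relation.ReflTransGen.total_of_right_unique huniq h1 h2 with h3 | h3
    · exact h3
    · rcases Relation.ReflTransGen.cases_head h3 with h4 | ⟨b, hb, hbt⟩
      · exact absurd h4.symm hne
      · obtain ⟨hqN, rfl⟩ := hb
        rcases h.par_mem q hqN with h5 | h5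
        · rw [h5] at hbt
          have := hz t hbt
          subst this
          rcases ht with ht | ht
          · exact absurd ht h.zV
          · exact absurd ht h.zI
        · have h6 := Finset.card_le_card ((h.subset_of_anc hbt).trans hsub)
          have h7 := h.card_lt hqN h5
          omega
  have h4 : ∃ c, Anc V I par t c ∧ (c ∈ V ∨ c ∈ I) ∧ par c = q := by
    rcases Relation.ReflTransGen.cases_tail h3 with h4 | ⟨c, hc1, hc2⟩
    · exact absurd h4.symm hne
    · exact ⟨c, hc1, hc2⟩
  obtain ⟨c, hc1, hcN, hpc⟩ := h4
  refine ⟨hpc ▸ h.par_mem c hcN, ?_, ?_, c, hcN, hpc, h.subset_of_anc hc1⟩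
  · rcases Relation.ReflTransGen.cases_head h3 with h4 | ⟨b, hb, hbt⟩
    · exact absurd h4 hne
    · exact hb.2 ▸ h.subset_of_anc hbt
  · intro hp
    rcases Relation.ReflTransGen.cases_head h3 with h4 | ⟨b, hb, hbt⟩
    · exact absurd h4 hne
    · rw [← hb.2, hp] at hbt
      exact hz q hbt

/-! ### Where a new vertex belongs -/

/-- The new vertex has two different types with respect to the leaves below `t`. -/
def Mixed (e : ℕ → ℕ → ℕ) (D : ℕ → Finset ℕ) (x t : ℕ) : Prop :=
  ∃ u ∈ D t, ∃ v ∈ D t, e x u ≠ e x v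

/-- The new vertex has type `k` with respect to all leaves below `t`. -/
def Unif (e : ℕ → ℕ → ℕ) (D : ℕ → Finset ℕ) (x t k : ℕ) : Prop :=
  ∀ u ∈ D t, e x u = k

theorem mixed_or_unif (h : IsTree e V I z par lab D) (x : ℕ) {t : ℕ} (ht : t ∈ V ∨ t ∈ I) :
    Mixed e D x t ∨ ∃ u ∈ D t, Unif e D x t (e x u) := by
  obtain ⟨u, hu⟩ := h.nonempty t ht
  by_cases hm : ∃ v ∈ D t, e x v ≠ e x u
  · obtain ⟨v, hv, hne⟩ := hm
    exact .inl ⟨v, hv, u, hu, hne⟩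
  · push Not at hm
    exact .inr ⟨u, hu, hm⟩

theorem Mixed.not_unif {x t k : ℕ} (h : Mixed e D x t) : ¬ Unif e D x t k := by
  obtain ⟨u, hu, v, hv, hne⟩ := h
  exact fun h => hne ((h u hu).trans (h v hv).symm)

theorem Mixed.mem_inner (h : IsTree e V I z par lab D) {x t : ℕ} (ht : t ∈ V ∨ t ∈ I)
    (hm : Mixed e D x t) : t ∈ I := by
  rcases ht with ht | ht
  · obtain ⟨u, hu, v, hv, hne⟩ := hm
    rw [h.leaf t ht, Finset.mem_singleton] at hu hv
    exact absurd (by rw [hu, hv]) hne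
  · exact ht

theorem Mixed.exists_kids (h : IsTree e V I z par lab D) {x t : ℕ} (ht : t ∈ I)
    (hm : Mixed e D x t) : ∃ c c' u v, (c ∈ V ∨ c ∈ I) ∧ (c' ∈ V ∨ c' ∈ I) ∧ c ≠ c' ∧ par c = t ∧
      par c' = t ∧ u ∈ D c ∧ v ∈ D c' ∧ e x u ≠ e x v := by
  obtain ⟨u, hu, v, hv, hne⟩ := hm
  obtain ⟨c, hc, hpc, huc⟩ := (h.mem_iff t (.inr ht) u).1 hu
  obtain ⟨c', hc', hpc', hvc'⟩ := (h.mem_iff t (.inr ht) v).1 hv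
  by_cases hcc : c = c'
  · subst hcc
    obtain ⟨b, hb, hbc, hpb⟩ := h.exists_sibling (hpc ▸ ht)
    obtain ⟨w, hw⟩ := h.nonempty b hb
    by_cases hwu : e x u = e x w
    · exact ⟨c, b, v, w, hc, hb, hbc.symm, hpc, hpb.trans hpc, hvc', hw,
        fun h => hne (hwu.trans h.symm)⟩
    · exact ⟨c, b, u, w, hc, hb, hbc.symm, hpc, hpb.trans hpc, huc, hw, hwu⟩
  · exact ⟨c, c', u, v, hc, hc', hcc, hpc, hpc', huc, hvc', hne⟩

/-- Next to a mixed child, the type of the new vertex is the label. -/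
theorem Mixed.sibling (h : IsTree e V I z par lab D) {S : Set ℕ} (hS : IsSymbolic e S)
    (hVS : ∀ v ∈ V, v ∈ S) {x : ℕ} (hxS : x ∈ S) (hxV : x ∉ V) {t : ℕ} (ht : t ∈ V ∨ t ∈ I)
    (hm : Mixed e D x t) (hlab : lab t ≠ lab (par t)) {c : ℕ} (hc : c ∈ V ∨ c ∈ I) (hct : c ≠ t)
    (hp : par c = par t) : Unif e D x c (lab (par t)) := by
  intro w hw
  obtain ⟨a, b, u, v, ha, hb, hab, hpa, hpb, hu, hv, hne⟩ :=
    hm.exists_kids h (hm.mem_inner h ht)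
  have hut : u ∈ D t := hpa ▸ h.subset_par ha hu
  have hvt : v ∈ D t := hpb ▸ h.subset_par hb hv
  have e1 := h.sibling c t hc ht hct hp w hw u hut
  have e2 := h.sibling c t hc ht hct hp w hw v hvt
  have e3 := h.sibling a b ha hb hab (hpa.trans hpb.symm) u hu v hv
  have m1 := h.sub c hc hw
  have m2 := h.sub t ht hut
  have m3 := h.sub t ht hvt
  have n1 : x ≠ w := by rintro rfl; exact hxV m1
  have n2 : x ≠ u := by rintro rfl; exact hxV m2
  have n3 : x ≠ v := by rintro rfl; exact hxV m3
  have r1 := hS.rainbow x hxS w (hVS w m1) u (hVS u m2) n1 n2 e1.1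
  have r2 := hS.rainbow x hxS w (hVS w m1) v (hVS v m3) n1 n3 e2.1
  have r3 := hS.rainbow x hxS u (hVS u m2) v (hVS v m3) n2 n3 e3.1
  rw [hp] at e1 e2
  rw [hpa] at e3
  by_contra hω
  have r1' : e x u = e x w ∨ e x u = lab (par t) := by omega
  have r2' : e x v = e x w ∨ e x v = lab (par t) := by omega
  clear r1 r2
  rcases r1' with h1 | h1 <;> rcases r2' with h2 | h2
  · exact hne (h1.trans h2.symm)
  · exact hS.path w (hVS w m1) x hxS u (hVS u m2) v (hVS v m3) n1.symm e1.1 e2.1 n2 n3 e3.1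
      (e x w) (lab (par t)) hω (hS.comm w x) h1 (by omega) e1.2 h2 e2.2
  · have c := hS.comm v u
    exact hS.path w (hVS w m1) x hxS v (hVS v m3) u (hVS u m2) n1.symm e2.1 e1.1 n3 n2 e3.1.symm
      (e x w) (lab (par t)) hω (hS.comm w x) h2 (by omega) e2.2 h1 e1.2
  · exact hne (h1.trans h2.symm)

/-- The types at a mixed node without mixed children: the label, and one other type. -/
theorem Mixed.types (h : IsTree e V I z par lab D) {S : Set ℕ} (hS : IsSymbolic e S)
    (hVS : ∀ v ∈ V, v ∈ S) {x : ℕ} (hxS : x ∈ S) (hxV : x ∉ V) {p : ℕ} (hp : p ∈ I)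
    (hm : Mixed e D x p) (hk : ∀ c, c ∈ V ∨ c ∈ I → par c = p → ¬ Mixed e D x c) :
    ∃ σ ≤ 2, σ ≠ lab p ∧ (∀ c, c ∈ V ∨ c ∈ I → par c = p → Unif e D x c (lab p) ∨ Unif e D x c σ) ∧
      (∃ c, (c ∈ V ∨ c ∈ I) ∧ par c = p ∧ Unif e D x c (lab p)) ∧
      ∃ c, (c ∈ V ∨ c ∈ I) ∧ par c = p ∧ Unif e D x c σ := by
  have tri : ∀ a b u v, a ∈ V ∨ a ∈ I → b ∈ V ∨ b ∈ I → a ≠ b → par a = p → par b = p →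
      u ∈ D a → v ∈ D b → e x u = e x v ∨ e x u = lab p ∨ e x v = lab p := by
    intro a b u v ha hb hab hpa hpb hu hv
    have e3 := h.sibling a b ha hb hab (hpa.trans hpb.symm) u hu v hv
    have m2 := h.sub a ha hu
    have m3 := h.sub b hb hv
    have n2 : x ≠ u := by rintro rfl; exact hxV m2
    have n3 : x ≠ v := by rintro rfl; exact hxV m3
    have r3 := hS.rainbow x hxS u (hVS u m2) v (hVS v m3) n2 n3 e3.1
    rw [hpa] at e3
    omega
  have hu : ∀ c, c ∈ V ∨ c ∈ I → par c = p → ∀ u ∈ D c, Unif e D x c (e x u) := by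
    intro c hc hpc u hu v hv
    by_contra hne
    exact hk c hc hpc ⟨v, hv, u, hu, hne⟩
  have main : ∀ a b u v, a ∈ V ∨ a ∈ I → b ∈ V ∨ b ∈ I → a ≠ b → par a = p → par b = p →
      u ∈ D a → v ∈ D b → e x u = lab p → e x v ≠ e x u →
      ∃ σ ≤ 2, σ ≠ lab p ∧
      (∀ c, c ∈ V ∨ c ∈ I → par c = p → Unif e D x c (lab p) ∨ Unif e D x c σ) ∧
      (∃ c, (c ∈ V ∨ c ∈ I) ∧ par c = p ∧ Unif e D x c (lab p)) ∧
      ∃ c, (c ∈ V ∨ c ∈ I) ∧ par c = p ∧ Unif e D x c σ := by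
    intro a b u v ha hb hab hpa hpb hua hvb hul hne
    refine ⟨e x v, hS.le_two _ _, by omega, ?_, ⟨a, ha, hpa, hul ▸ hu a ha hpa u hua⟩,
      ⟨b, hb, hpb, hu b hb hpb v hvb⟩⟩
    intro c hc hpc
    obtain ⟨w, hw⟩ := h.nonempty c hc
    by_cases hcb : c = b
    · subst hcb
      exact .inr (hu c hc hpc v hvb)
    · rcases tri c b w v hc hb hcb hpc hpb hw hvb with h1 | h1 | h1
      · exact .inr (h1 ▸ hu c hc hpc w hw)
      · exact .inl (h1 ▸ hu c hc hpc w hw)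
      · omega
  obtain ⟨a, b, u, v, ha, hb, hab, hpa, hpb, hua, hvb, hne⟩ := hm.exists_kids h hp
  rcases tri a b u v ha hb hab hpa hpb hua hvb with h1 | h1 | h1
  · exact absurd h1 hne
  · exact main a b u v ha hb hab hpa hpb hua hvb h1 hne.symm
  · exact main b a v u hb ha hab.symm hpb hpa hvb hua h1 hne

/-- The nodes that have a child all of whose leaves have the same nonzero type, but are not such
nodes themselves. -/
def Live (e : ℕ → ℕ → ℕ) (V I : Finset ℕ) (z : ℕ) (par : ℕ → ℕ) (D : ℕ → Finset ℕ) (x q : ℕ) :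
    Prop :=
  (q = z ∨ q ∈ I) ∧ (∃ c, (c ∈ V ∨ c ∈ I) ∧ par c = q ∧ ∃ k ≠ 0, Unif e D x c k) ∧
    ¬ (q ∈ I ∧ ∃ k ≠ 0, Unif e D x q k)

theorem Live.mixed (h : IsTree e V I z par lab D) {x q : ℕ} (hq : Live e V I z par D x q)
    (hqI : q ∈ I) : Mixed e D x q := by
  obtain ⟨_, ⟨c, hc, hpc, k, hk, hu⟩, h2⟩ := hq
  rcases h.mixed_or_unif x (.inr hqI : q ∈ V ∨ q ∈ I) with h1 | ⟨u, hu', h1⟩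
  · exact h1
  · refine absurd ⟨hqI, e x u, ?_, h1⟩ h2
    obtain ⟨v, hv⟩ := h.nonempty c hc
    have h3 := h1 v (hpc ▸ h.subset_par hc hv)
    have h4 := hu v hv
    omega

theorem Live.unif_of_top (h : IsTree e V I z par lab D) {x : ℕ} (hz : Live e V I z par D x z) :
    ∃ k ≠ 0, ∀ u ∈ V, e x u = k := by
  obtain ⟨_, ⟨c, hc, hpc, k, hk, hu⟩, _⟩ := hz
  refine ⟨k, hk, fun u huV => ?_⟩
  rw [← h.top] at huV
  obtain ⟨b, hb, hpb, hub⟩ := (h.mem_iff z (.inl rfl) u).1 huV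
  rw [h.one b c hb hc hpb hpc] at hub
  exact hu u hub

theorem Live.eq_top (h : IsTree e V I z par lab D) {x q : ℕ} (hz : Live e V I z par D x z)
    (hq : Live e V I z par D x q) : q = z := by
  by_contra hne
  have hqI := hq.1.resolve_left hne
  obtain ⟨k, _, hk⟩ := hz.unif_of_top h
  exact (hq.mixed h hqI).not_unif fun u hu => hk u (h.sub q (.inr hqI) hu)

/-- If no node is live then the new vertex has type `0` throughout. -/
theorem eq_zero_of_not_live (h : IsTree e V I z par lab D) {x : ℕ}
    (hn : ∀ q, ¬ Live e V I z par D x q) : ∀ u ∈ V, e x u = 0 := by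
  have key : ∀ t, t ∈ V ∨ t ∈ I → ¬ ∃ k ≠ 0, Unif e D x t k := by
    refine h.up ?_ ?_
    · intro t ht hp hk
      exact hn z ⟨.inl rfl, ⟨t, ht, hp, hk⟩, fun h' => h.zI h'.1⟩
    · intro t ht hp ih hk
      exact hn (par t) ⟨.inr hp, ⟨t, ht, rfl, hk⟩, fun h' => ih h'.2⟩
  intro u hu
  by_contra hne
  exact key u (.inl hu) ⟨_, hne, fun v hv => by
    rw [h.leaf u hu, Finset.mem_singleton] at hv; rw [hv]⟩

/-- Some live node is neither the parent nor the grandparent of a live node. -/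
theorem exists_lowest_live (h : IsTree e V I z par lab D) {x q : ℕ}
    (hq : Live e V I z par D x q) (hz : ¬ (par z = z ∨ par z ∈ I))
    (hz' : ¬ (par (par z) = z ∨ par (par z) ∈ I)) :
    ∃ p, Live e V I z par D x p ∧ ∀ q, Live e V I z par D x q → par q ≠ p ∧ par (par q) ≠ p := by
  classical
  by_cases hzl : Live e V I z par D x z
  · refine ⟨z, hzl, fun q hq => ?_⟩
    rw [hzl.eq_top h hq]
    exact ⟨fun h' => hz (.inl h'), fun h' => hz' (.inl h')⟩
  · have hne : {k | ∃ q, Live e V I z par D x q ∧ (D q).card = k}.Nonempty := ⟨_, q, hq, rfl⟩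
    obtain ⟨p, hp, hpk⟩ := Nat.sInf_mem hne
    have hmin : ∀ q, Live e V I z par D x q → (D p).card ≤ (D q).card := fun q hq => by
      rw [hpk]; exact Nat.sInf_le ⟨q, hq, rfl⟩
    have hI : ∀ q, Live e V I z par D x q → q ∈ I := fun q hq =>
      hq.1.resolve_left (by rintro rfl; exact hzl hq)
    refine ⟨p, hp, fun q hq => ?_⟩
    have hqI := hI q hq
    have hpI := hI p hp
    have h1 := hmin q hq
    constructor
    · rintro rfl
      have := h.card_lt (.inr hqI) hpI
      omega
    · intro h2
      rcases h.par_mem q (.inr hqI) with h3 | h3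
      · rw [h3] at h2
        exact hz (.inr (h2 ▸ hpI))
      · have h4 := h.card_lt (.inr hqI) h3
        have h5 := h.card_lt (.inr h3) (h2 ▸ hpI)
        rw [h2] at h5
        omega

/-- Such a live node has no mixed child. -/
theorem Live.not_mixed_kid (h : IsTree e V I z par lab D) {S : Set ℕ} (hS : IsSymbolic e S)
    (hVS : ∀ v ∈ V, v ∈ S) {x : ℕ} (hxS : x ∈ S) (hxV : x ∉ V)
    (hred : ∀ t ∈ I, lab t ≠ lab (par t)) {p : ℕ}
    (hlow : ∀ q, Live e V I z par D x q → par q ≠ p ∧ par (par q) ≠ p) {c : ℕ}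
    (hc : c ∈ V ∨ c ∈ I) (hpc : par c = p) : ¬ Mixed e D x c := by
  intro hm
  have hcI := hm.mem_inner h hc
  -- A mixed node with a child of uniform nonzero type is live.
  have live : ∀ t ∈ I, Mixed e D x t → (∃ b, (b ∈ V ∨ b ∈ I) ∧ par b = t ∧
      ∃ k ≠ 0, Unif e D x b k) → Live e V I z par D x t := fun t ht hmt hb =>
    ⟨.inr ht, hb, fun h' => by obtain ⟨_, k, _, hk⟩ := h'; exact hmt.not_unif hk⟩
  have hcl : ∀ b, b ∈ V ∨ b ∈ I → par b = c → ∀ k ≠ 0, ¬ Unif e D x b k := fun b hb hpb k hk hu =>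
    (hlow c (live c hcI hm ⟨b, hb, hpb, k, hk, hu⟩)).1 hpc
  obtain ⟨u, hu, v, hv, hne⟩ := hm
  have hb : ∃ b, (b ∈ V ∨ b ∈ I) ∧ par b = c ∧ Mixed e D x b := by
    by_contra hcon
    push Not at hcon
    have hzero : ∀ w ∈ D c, e x w = 0 := by
      intro w hw
      obtain ⟨b, hb, hpb, hwb⟩ := (h.mem_iff c (.inr hcI) w).1 hw
      rcases h.mixed_or_unif x hb with h1 | ⟨a, ha, h1⟩
      · exact absurd h1 (hcon b hb hpb)
      · have : e x a = 0 := by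
          by_contra h0
          exact hcl b hb hpb _ h0 h1
        rw [h1 w hwb, this]
    exact hne ((hzero u hu).trans (hzero v hv).symm)
  obtain ⟨b, hb, hpb, hmb⟩ := hb
  have hbI := hmb.mem_inner h hb
  have hlc : lab c = 0 := by
    by_contra h0
    obtain ⟨a, ha, hab, hpa⟩ := h.exists_sibling (hpb ▸ hcI)
    have h1 := hmb.sibling h hS hVS hxS hxV hb (hred b hbI) ha hab hpa
    rw [hpb] at h1 hpa
    exact hcl a ha hpa _ h0 h1
  have hlb : lab b ≠ 0 := by
    have := hred b hbI
    rwa [hpb, hlc] at this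
  have hbl : Live e V I z par D x b := by
    refine live b hbI hmb ?_
    by_cases hcon : ∃ a, (a ∈ V ∨ a ∈ I) ∧ par a = b ∧ Mixed e D x a
    · obtain ⟨a, ha, hpa, hma⟩ := hcon
      obtain ⟨d, hd, hda, hpd⟩ := h.exists_sibling (hpa ▸ hbI)
      have h1 := hma.sibling h hS hVS hxS hxV ha (hred a (hma.mem_inner h ha)) hd hda hpd
      rw [hpa] at h1 hpd
      exact ⟨d, hd, hpd, _, hlb, h1⟩
    · push Not at hcon
      by_contra hcon'
      push Not at hcon'
      obtain ⟨u, hu, v, hv, hne⟩ := hmb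
      have hzero : ∀ w ∈ D b, e x w = 0 := by
        intro w hw
        obtain ⟨a, ha, hpa, hwa⟩ := (h.mem_iff b (.inr hbI) w).1 hw
        rcases h.mixed_or_unif x ha with h1 | ⟨d, hd, h1⟩
        · exact absurd h1 (hcon a ha hpa)
        · have : e x d = 0 := by
            by_contra h0
            exact hcon' a ha hpa _ h0 h1
          rw [h1 w hwa, this]
      exact hne ((hzero u hu).trans (hzero v hv).symm)
  exact (hlow b hbl).2 (by rw [hpb, hpc])

end IsTree

/-! ### Changing the tree -/

namespace IsTree

variable {e : ℕ → ℕ → ℕ} {V I : Finset ℕ} {z : ℕ} {par lab : ℕ → ℕ} {D : ℕ → Finset ℕ}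

theorem disjoint_sibling (h : IsTree e V I z par lab D) {c c' : ℕ} (hc : c ∈ V ∨ c ∈ I)
    (hc' : c' ∈ V ∨ c' ∈ I) (hne : c ≠ c') (hp : par c = par c') {u : ℕ} (hu : u ∈ D c) :
    u ∉ D c' := fun hu' => (h.sibling c c' hc hc' hne hp u hu u hu').1 rfl

theorem par_ne_self (h : IsTree e V I z par lab D) {t : ℕ} (ht : t ∈ V ∨ t ∈ I) : par t ≠ t := by
  intro hp
  rcases h.par_mem t ht with h1 | h1
  · rw [hp] at h1
    subst h1
    exact ht.elim h.zV h.zI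
  · have := h.card_lt ht h1
    rw [hp] at this
    omega

/-- A new leaf `x` is put below the inner node `c₀`. -/
theorem addLeaf (h : IsTree e V I z par lab D) (hcomm : ∀ u v, e u v = e v u) {x c₀ : ℕ}
    (hxV : x ∉ V) (hxI : x ∉ I) (hxz : x ≠ z) (hc₀ : c₀ ∈ I) (hu : Unif e D x c₀ (lab c₀))
    (hanc : ∀ c, c ∈ V ∨ c ∈ I → D c₀ ⊆ D c → ∀ c', c' ∈ V ∨ c' ∈ I → c' ≠ c → par c' = par c →
      Unif e D x c' (lab (par c)))
    {par' : ℕ → ℕ} (hpx : par' x = c₀) (hp : ∀ t, t ∈ V ∨ t ∈ I → par' t = par t) :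
    ∃ D', IsTree e (insert x V) I z par' lab D' := by
  classical
  set D' : ℕ → Finset ℕ := fun t => if t = x then {x} else if D c₀ ⊆ D t then insert x (D t)
    else D t with hD'
  have hx : D' x = {x} := by simp [hD']
  have hmem : ∀ t, t ≠ x → ∀ u, u ∈ D' t ↔ u ∈ D t ∨ (u = x ∧ D c₀ ⊆ D t) := by
    intro t ht u
    simp only [hD', if_neg ht]
    split_ifs with h1 <;> simp [h1, or_comm]
  have hNx : ∀ t, t ∈ V ∨ t ∈ I → t ≠ x := by rintro t ht rfl; exact ht.elim hxV hxI
  have hVn : ∀ t ∈ V, ¬ D c₀ ⊆ D t := by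
    intro t ht hs
    have hne : c₀ ≠ t := by rintro rfl; exact h.disj _ ht hc₀
    rcases (h.exists_kid_of_subset (.inr hc₀) (.inr (.inl ht)) hs hne).1 with h1 | h1
    · exact h.zV (h1 ▸ ht)
    · exact h.disj t ht h1
  have hsubV : ∀ t, t ∈ V ∨ t ∈ I → x ∉ D t := fun t ht hxt => hxV (h.sub t ht hxt)
  have hc₀' : c₀ ≠ x := hNx c₀ (.inr hc₀)
  obtain ⟨w, hw⟩ := h.nonempty c₀ (.inr hc₀)
  have hdis : ∀ c c', c ∈ V ∨ c ∈ I → c' ∈ V ∨ c' ∈ I → c ≠ c' → par c = par c' →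
      D c₀ ⊆ D c → ¬ D c₀ ⊆ D c' := fun c c' hc hc' hne hpp h1 h2 =>
    h.disjoint_sibling hc hc' hne hpp (h1 hw) (h2 hw)
  refine ⟨D', ?_, ?_, h.zI, ?_, ?_, ?_, ?_, ?_, ?_, ?_, ?_, ?_⟩
  · intro t ht
    rcases Finset.mem_insert.1 ht with rfl | ht
    · exact hxI
    · exact h.disj t ht
  · simp [hxz.symm, h.zV]
  · intro t ht
    rw [Finset.mem_insert, or_assoc] at ht
    rcases ht with rfl | ht
    · exact .inr (hpx ▸ hc₀)
    · rw [hp t ht]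
      exact h.par_mem t ht
  · intro v hv
    rcases Finset.mem_insert.1 hv with rfl | hv
    · exact hx
    · ext u
      rw [hmem v (hNx v (.inl hv)), h.leaf v hv]
      have := hVn v hv
      rw [h.leaf v hv] at this
      tauto
  · intro q hq u
    have hqx : q ≠ x := by
      rcases hq with rfl | hq
      · exact hxz.symm
      · exact hNx q (.inr hq)
    rw [hmem q hqx, h.mem_iff q hq]
    constructor
    · rintro (⟨c, hc, hpc, huc⟩ | ⟨rfl, hs⟩)
      · exact ⟨c, by rw [Finset.mem_insert, or_assoc]; exact .inr hc, (hp c hc).trans hpc,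
          (hmem c (hNx c hc) u).2 (.inl huc)⟩
      · by_cases hqc : c₀ = q
        · exact ⟨u, by simp, hpx.trans hqc, by simp [hx]⟩
        · obtain ⟨_, _, _, c, hc, hpc, hsc⟩ := h.exists_kid_of_subset (.inr hc₀)
            (hq.imp_right .inr) hs hqc
          exact ⟨c, by rw [Finset.mem_insert, or_assoc]; exact .inr hc, (hp c hc).trans hpc,
            (hmem c (hNx c hc) u).2 (.inr ⟨rfl, hsc⟩)⟩
    · rintro ⟨c, hc, hpc, huc⟩
      rw [Finset.mem_insert, or_assoc] at hc
      rcases hc with rfl | hc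
      · rw [hx, Finset.mem_singleton] at huc
        exact .inr ⟨huc, by rw [← hpc, hpx]⟩
      · rw [hp c hc] at hpc
        rcases (hmem c (hNx c hc) u).1 huc with huc | ⟨rfl, hs⟩
        · exact .inl ⟨c, hc, hpc, huc⟩
        · exact .inr ⟨rfl, hs.trans (hpc ▸ h.subset_par hc)⟩
  · -- By symmetry the second child may be assumed to be an old node.
    have old : ∀ c c', c ∈ V ∨ c ∈ I → c' ∈ V ∨ c' ∈ I → c ≠ c' → par c = par c' →
        ∀ u ∈ D' c, ∀ v ∈ D' c', u ≠ v ∧ e u v = lab (par c) := by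
      intro c c' hc hc' hne hpp u hu' v hv'
      rcases (hmem c (hNx c hc) u).1 hu' with h1 | ⟨rfl, h1⟩ <;>
        rcases (hmem c' (hNx c' hc') v).1 hv' with h2 | ⟨rfl, h2⟩
      · exact h.sibling c c' hc hc' hne hpp u h1 v h2
      · refine ⟨by rintro rfl; exact hsubV c hc h1, ?_⟩
        rw [hcomm, hanc c' hc' h2 c hc hne hpp u h1, hpp]
      · refine ⟨by rintro rfl; exact hsubV c' hc' h2, ?_⟩
        exact hanc c hc h1 c' hc' hne.symm hpp.symm v h2
      · exact absurd h2 (hdis c c' hc hc' hne hpp h1)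
    have new : ∀ c', c' ∈ V ∨ c' ∈ I → par c' = c₀ → ∀ v ∈ D' c', x ≠ v ∧ e x v = lab c₀ := by
      intro c' hc' hpc v hv
      rcases (hmem c' (hNx c' hc') v).1 hv with h2 | ⟨rfl, h2⟩
      · exact ⟨by rintro rfl; exact hsubV c' hc' h2, hu v (hpc ▸ h.subset_par hc' h2)⟩
      · have h3 := h.card_lt hc' (hpc ▸ hc₀)
        have h4 := Finset.card_le_card h2
        rw [hpc] at h3
        omega
    intro c c' hc hc' hne hpp u hu' v hv'
    rw [Finset.mem_insert, or_assoc] at hc hc'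
    rcases hc with rfl | hc <;> rcases hc' with rfl | hc'
    · exact absurd rfl hne
    · rw [hx, Finset.mem_singleton] at hu'
      subst hu'
      rw [hpx, hp c' hc'] at hpp
      rw [hpx]
      exact new c' hc' hpp.symm v hv'
    · rw [hx, Finset.mem_singleton] at hv'
      subst hv'
      rw [hpx, hp c hc] at hpp
      rw [hp c hc, hpp, hcomm]
      exact (new c hc hpp u hu').imp_left Ne.symm
    · rw [hp c hc, hp c' hc'] at hpp
      rw [hp c hc]
      exact old c c' hc hc' hne hpp u hu' v hv'
  · intro t ht
    rw [Finset.mem_insert, or_assoc] at ht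
    rcases ht with rfl | ht
    · simp [hx]
    · exact (h.nonempty t ht).mono fun u hu => (hmem t (hNx t ht) u).2 (.inl hu)
  · intro t ht u hu'
    rw [Finset.mem_insert, or_assoc] at ht
    rcases ht with rfl | ht
    · rw [hx, Finset.mem_singleton] at hu'
      simp [hu']
    · rcases (hmem t (hNx t ht) u).1 hu' with h1 | ⟨rfl, _⟩
      · exact Finset.mem_insert_of_mem (h.sub t ht h1)
      · simp
  · ext u
    rw [hmem z hxz.symm, h.top, Finset.mem_insert]
    have := h.sub c₀ (.inr hc₀)
    tauto
  · intro q hq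
    obtain ⟨c, c', hne, hc, hc', h1, h2⟩ := h.two q hq
    exact ⟨c, c', hne, by simp only [Finset.mem_insert]; tauto,
      by simp only [Finset.mem_insert]; tauto, (hp c hc).trans h1, (hp c' hc').trans h2⟩
  · intro c c' hc hc' h1 h2
    rw [Finset.mem_insert, or_assoc] at hc hc'
    have hz : c₀ ≠ z := by rintro rfl; exact h.zI hc₀
    rcases hc with rfl | hc
    · exact absurd (hpx.symm.trans h1) hz
    · rcases hc' with rfl | hc'
      · exact absurd (hpx.symm.trans h2) hz
      · exact h.one c c' hc hc' ((hp c hc).symm.trans h1) ((hp c' hc').symm.trans h2)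

/-- A new inner node `r` takes the place of `c₀`, with children `c₀` and a new leaf `x`. -/
theorem addParent (h : IsTree e V I z par lab D) (hcomm : ∀ u v, e u v = e v u) {x r c₀ : ℕ}
    (hxV : x ∉ V) (hxI : x ∉ I) (hxz : x ≠ z) (hrV : r ∉ V) (hrI : r ∉ I) (hrz : r ≠ z)
    (hrx : r ≠ x) (hc₀ : c₀ ∈ V ∨ c₀ ∈ I) {par' lab' : ℕ → ℕ} (hu : Unif e D x c₀ (lab' r))
    (hanc : ∀ c, c ∈ V ∨ c ∈ I → D c₀ ⊆ D c → ∀ c', c' ∈ V ∨ c' ∈ I → c' ≠ c → par c' = par c →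
      Unif e D x c' (lab (par c)))
    (hpx : par' x = r) (hpc₀ : par' c₀ = r) (hpr : par' r = par c₀)
    (hp : ∀ t, t ∈ V ∨ t ∈ I → t ≠ c₀ → par' t = par t)
    (hl : ∀ t, t = z ∨ t ∈ I → lab' t = lab t) :
    ∃ D', IsTree e (insert x V) (insert r I) z par' lab' D' := by
  classical
  -- The node `o c` is the old node in whose place `c` stands.
  set o : ℕ → ℕ := fun t => if t = r then c₀ else t with ho
  set D' : ℕ → Finset ℕ := fun t => if t = x then {x} else if t ≠ c₀ ∧ D c₀ ⊆ D (o t) then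
    insert x (D (o t)) else D (o t) with hD'
  have hx : D' x = {x} := by simp [hD']
  have hmem : ∀ t, t ≠ x → ∀ u, u ∈ D' t ↔ u ∈ D (o t) ∨ (u = x ∧ t ≠ c₀ ∧ D c₀ ⊆ D (o t)) := by
    intro t ht u
    simp only [hD', if_neg ht]
    split_ifs with h1
    · simp [h1, or_comm]
    · simp only [h1, and_false, or_false]
  have hNx : ∀ t, t ∈ V ∨ t ∈ I → t ≠ x := by rintro t ht rfl; exact ht.elim hxV hxI
  have hNr : ∀ t, t ∈ V ∨ t ∈ I → t ≠ r := by rintro t ht rfl; exact ht.elim hrV hrI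
  have hor : o r = c₀ := by simp [ho]
  have hot : ∀ t, t ≠ r → o t = t := fun t ht => by simp [ho, ht]
  have hoN : ∀ t, t ∈ V ∨ t ∈ I → o t = t := fun t ht => hot t (hNr t ht)
  have hVn : ∀ t ∈ V, t ≠ c₀ → ¬ D c₀ ⊆ D t := by
    intro t ht hne hs
    rcases (h.exists_kid_of_subset hc₀ (.inr (.inl ht)) hs hne.symm).1 with h1 | h1
    · exact h.zV (h1 ▸ ht)
    · exact h.disj t ht h1
  have hsubV : ∀ t, t ∈ V ∨ t ∈ I → x ∉ D t := fun t ht hxt => hxV (h.sub t ht hxt)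
  obtain ⟨w, hw⟩ := h.nonempty c₀ hc₀
  have hdis : ∀ c c', c ∈ V ∨ c ∈ I → c' ∈ V ∨ c' ∈ I → c ≠ c' → par c = par c' →
      D c₀ ⊆ D c → ¬ D c₀ ⊆ D c' := fun c c' hc hc' hne hpp h1 h2 =>
    h.disjoint_sibling hc hc' hne hpp (h1 hw) (h2 hw)
  have hcr : c₀ ≠ r := hNr c₀ hc₀
  have hpcr : par c₀ ≠ r := by
    rcases h.par_mem c₀ hc₀ with h1 | h1
    · rw [h1]; exact hrz.symm
    · exact hNr _ (.inr h1)
  have hN' : ∀ t, t ∈ insert x V ∨ t ∈ insert r I ↔ t = x ∨ t = r ∨ t ∈ V ∨ t ∈ I := by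
    intro t
    simp only [Finset.mem_insert]
    tauto
  -- Away from `x` and `c₀` the tree looks as before.
  have hpo : ∀ t, t = r ∨ t ∈ V ∨ t ∈ I → t ≠ c₀ → (o t ∈ V ∨ o t ∈ I) ∧ par' t = par (o t) := by
    rintro t (rfl | ht) hne
    · rw [hor]; exact ⟨hc₀, hpr⟩
    · rw [hoN t ht]; exact ⟨ht, hp t ht hne⟩
  have hoinj : ∀ t t', t = r ∨ t ∈ V ∨ t ∈ I → t' = r ∨ t' ∈ V ∨ t' ∈ I → t ≠ c₀ → t' ≠ c₀ →
      o t = o t' → t = t' := by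
    rintro t t' (rfl | ht) (rfl | ht') h1 h2 h3
    · rfl
    · rw [hor, hoN t' ht'] at h3; exact absurd h3.symm h2
    · rw [hor, hoN t ht] at h3; exact absurd h3 h1
    · rwa [hoN t ht, hoN t' ht'] at h3
  have hpr' : ∀ t, t = r ∨ t ∈ V ∨ t ∈ I → t ≠ c₀ → par' t = z ∨ par' t ∈ I := by
    intro t ht hne
    obtain ⟨h1, h2⟩ := hpo t ht hne
    rw [h2]; exact h.par_mem _ h1
  have hrx' : ∀ t, t = r ∨ t ∈ V ∨ t ∈ I → t ≠ x := by
    rintro t (rfl | ht)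
    · exact hrx
    · exact hNx t ht
  have hr' : ∀ q, q = z ∨ q ∈ I → q ≠ r := by
    rintro q (rfl | hq)
    · exact hrz.symm
    · exact hNr q (.inr hq)
  refine ⟨D', ?_, ?_, ?_, ?_, ?_, ?_, ?_, ?_, ?_, ?_, ?_, ?_⟩
  · intro t ht
    rw [Finset.mem_insert, not_or]
    rcases Finset.mem_insert.1 ht with rfl | ht
    · exact ⟨hrx.symm, hxI⟩
    · exact ⟨hNr t (.inl ht), h.disj t ht⟩
  · simp [hxz.symm, h.zV]
  · simp [hrz.symm, h.zI]
  · intro t ht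
    rw [Finset.mem_insert]
    rcases (hN' t).1 ht with rfl | ht
    · exact .inr (.inl hpx)
    · by_cases hne : t = c₀
      · subst hne; exact .inr (.inl hpc₀)
      · rcases hpr' t ht hne with h1 | h1
        · exact .inl h1
        · exact .inr (.inr h1)
  · intro v hv
    rcases Finset.mem_insert.1 hv with rfl | hv
    · exact hx
    · ext u
      rw [hmem v (hNx v (.inl hv)), hoN v (.inl hv), h.leaf v hv]
      have := hVn v hv
      rw [h.leaf v hv] at this
      tauto
  · intro q hq u
    rw [Finset.mem_insert, or_left_comm] at hq
    rcases hq with rfl | hq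
    · rw [hmem q hrx, hor]
      constructor
      · rintro (h1 | ⟨rfl, _⟩)
        · exact ⟨c₀, (hN' _).2 (.inr (.inr hc₀)), hpc₀,
            (hmem c₀ (hNx c₀ hc₀) u).2 (.inl (by rwa [hoN c₀ hc₀]))⟩
        · exact ⟨u, (hN' _).2 (.inl rfl), hpx, by simp [hx]⟩
      · rintro ⟨c, hc, hpc, huc⟩
        rcases (hN' c).1 hc with rfl | hc
        · rw [hx, Finset.mem_singleton] at huc
          exact .inr ⟨huc, hcr.symm, subset_rfl⟩
        · by_cases hne : c = c₀
          · subst hne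
            rw [hmem c (hrx' c hc), hoN c hc₀] at huc
            exact .inl (huc.resolve_right fun h => h.2.1 rfl)
          · exact absurd hpc (hr' _ (hpr' c hc hne))
    · have hqx : q ≠ x := by
        rcases hq with rfl | hq
        · exact hxz.symm
        · exact hNx q (.inr hq)
      rw [hmem q hqx, hot q (hr' q hq), h.mem_iff q hq]
      -- The node that stands in the place of an old node.
      have rep : ∀ c, c ∈ V ∨ c ∈ I → ∃ t, (t = r ∨ t ∈ V ∨ t ∈ I) ∧ t ≠ c₀ ∧ o t = c := by
        intro c hc
        by_cases hne : c = c₀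
        · exact ⟨r, .inl rfl, hcr.symm, hor.trans hne.symm⟩
        · exact ⟨c, .inr hc, hne, hoN c hc⟩
      constructor
      · rintro (⟨c, hc, hpc, huc⟩ | ⟨rfl, hne, hs⟩)
        · obtain ⟨t, ht, htc, rfl⟩ := rep c hc
          exact ⟨t, (hN' t).2 (.inr ht), (hpo t ht htc).2.trans hpc,
            (hmem t (hrx' t ht) u).2 (.inl huc)⟩
        · obtain ⟨_, _, _, c, hc, hpc, hsc⟩ := h.exists_kid_of_subset hc₀
            (hq.imp_right .inr) hs hne.symm
          obtain ⟨t, ht, htc, rfl⟩ := rep c hc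
          exact ⟨t, (hN' t).2 (.inr ht), (hpo t ht htc).2.trans hpc,
            (hmem t (hrx' t ht) u).2 (.inr ⟨rfl, htc, hsc⟩)⟩
      · rintro ⟨c, hc, hpc, huc⟩
        rcases (hN' c).1 hc with rfl | hc
        · exact absurd (hpx.symm.trans hpc).symm (hr' q hq)
        · by_cases hne : c = c₀
          · subst hne
            exact absurd (hpc₀.symm.trans hpc).symm (hr' q hq)
          · obtain ⟨h1, h2⟩ := hpo c hc hne
            rw [hpc] at h2
            rcases (hmem c (hrx' c hc) u).1 huc with huc | ⟨rfl, _, hs⟩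
            · exact .inl ⟨o c, h1, h2.symm, huc⟩
            · refine .inr ⟨rfl, ?_, hs.trans (h2 ▸ h.subset_par h1)⟩
              rintro rfl
              have h3 : par (o c) ∈ I := by
                rw [← h2]
                exact hq.resolve_left (by rintro rfl; exact hc₀.elim h.zV h.zI)
              have h4 := h.card_lt h1 h3
              rw [← h2] at h4
              have := Finset.card_le_card hs
              omega
  · have old : ∀ c c', c = r ∨ c ∈ V ∨ c ∈ I → c' = r ∨ c' ∈ V ∨ c' ∈ I → c ≠ c₀ → c' ≠ c₀ →
        c ≠ c' → par' c = par' c' →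
        ∀ u ∈ D' c, ∀ v ∈ D' c', u ≠ v ∧ e u v = lab' (par' c) := by
      intro c c' hc hc' hcc hcc' hne hpp u hu' v hv'
      rw [hl _ (hpr' c hc hcc)]
      obtain ⟨h3, h4⟩ := hpo c hc hcc
      obtain ⟨h5, h6⟩ := hpo c' hc' hcc'
      have hne' : o c ≠ o c' := fun hh => hne (hoinj c c' hc hc' hcc hcc' hh)
      rw [h4, h6] at hpp
      rw [h4]
      rcases (hmem c (hrx' c hc) u).1 hu' with h1 | ⟨rfl, _, h1⟩ <;>
        rcases (hmem c' (hrx' c' hc') v).1 hv' with h2 | ⟨rfl, _, h2⟩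
      · exact h.sibling _ _ h3 h5 hne' hpp u h1 v h2
      · refine ⟨by rintro rfl; exact hsubV _ h3 h1, ?_⟩
        rw [hcomm, hanc _ h5 h2 _ h3 hne' hpp u h1, hpp]
      · refine ⟨by rintro rfl; exact hsubV _ h5 h2, ?_⟩
        exact hanc _ h3 h1 _ h5 hne'.symm hpp.symm v h2
      · exact absurd h2 (hdis _ _ h3 h5 hne' hpp h1)
    have hDc : D' c₀ = D c₀ := by
      ext u
      rw [hmem c₀ (hNx c₀ hc₀), hoN c₀ hc₀]
      tauto
    have hpar : ∀ c, c = r ∨ c ∈ V ∨ c ∈ I → par' c = r → c = c₀ := fun c hc hpc => by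
      by_contra hne
      exact hr' _ (hpr' c hc hne) hpc
    intro c c' hc hc' hne hpp u hu' v hv'
    rw [hN'] at hc hc'
    rcases hc with rfl | hc
    · rcases hc' with rfl | hc'
      · exact absurd rfl hne
      · rw [hpx] at hpp
        obtain rfl := hpar c' hc' hpp.symm
        rw [hx, Finset.mem_singleton] at hu'
        subst hu'
        rw [hDc] at hv'
        rw [hpx]
        exact ⟨by rintro rfl; exact hsubV _ hc₀ hv', hu v hv'⟩
    · rcases hc' with rfl | hc'
      · rw [hpx] at hpp
        obtain rfl := hpar c hc hpp
        rw [hx, Finset.mem_singleton] at hv'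
        subst hv'
        rw [hDc] at hu'
        rw [hpp, hcomm]
        exact ⟨by rintro rfl; exact hsubV _ hc₀ hu', hu u hu'⟩
      · by_cases h1 : c = c₀
        · subst h1
          rw [hpc₀] at hpp
          exact absurd (hpar c' hc' hpp.symm).symm hne
        · by_cases h2 : c' = c₀
          · subst h2
            rw [hpc₀] at hpp
            exact absurd (hpar c hc hpp) hne
          · exact old c c' hc hc' h1 h2 hne hpp u hu' v hv'
  · intro t ht
    rcases (hN' t).1 ht with rfl | rfl | ht
    · simp [hx]
    · exact ⟨w, (hmem t hrx w).2 (.inl (by rwa [hor]))⟩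
    · refine (h.nonempty t ht).mono fun u hu => (hmem t (hNx t ht) u).2 (.inl ?_)
      rwa [hoN t ht]
  · intro t ht u hu'
    rcases (hN' t).1 ht with rfl | ht
    · rw [hx, Finset.mem_singleton] at hu'
      simp [hu']
    · rcases (hmem t (hrx' t ht) u).1 hu' with h1 | ⟨rfl, _⟩
      · refine Finset.mem_insert_of_mem ?_
        rcases ht with rfl | ht
        · rw [hor] at h1; exact h.sub _ hc₀ h1
        · rw [hoN t ht] at h1; exact h.sub _ ht h1
      · simp
  · ext u
    rw [hmem z hxz.symm, hot z hrz.symm, h.top, Finset.mem_insert]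
    have h1 := h.sub c₀ hc₀
    have h2 : z ≠ c₀ := by rintro rfl; exact hc₀.elim h.zV h.zI
    tauto
  · intro q hq
    rcases Finset.mem_insert.1 hq with rfl | hq
    · exact ⟨x, c₀, (hNx c₀ hc₀).symm, (hN' _).2 (.inl rfl), (hN' _).2 (.inr (.inr hc₀)), hpx, hpc₀⟩
    · obtain ⟨c, c', hne, hc, hc', h1, h2⟩ := h.two q hq
      by_cases h3 : c = c₀
      · subst h3
        exact ⟨r, c', (hNr c' hc').symm, (hN' _).2 (.inr (.inl rfl)), (hN' _).2 (.inr (.inr hc')),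
          hpr.trans h1, (hp c' hc' hne.symm).trans h2⟩
      · by_cases h4 : c' = c₀
        · subst h4
          exact ⟨c, r, hNr c hc, (hN' _).2 (.inr (.inr hc)), (hN' _).2 (.inr (.inl rfl)),
            (hp c hc h3).trans h1, hpr.trans h2⟩
        · exact ⟨c, c', hne, (hN' _).2 (.inr (.inr hc)), (hN' _).2 (.inr (.inr hc')),
            (hp c hc h3).trans h1, (hp c' hc' h4).trans h2⟩
  · intro c c' hc hc' h1 h2
    rw [hN'] at hc hc'
    have key : ∀ c, c = x ∨ c = r ∨ c ∈ V ∨ c ∈ I → par' c = z →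
        (c = r ∨ c ∈ V ∨ c ∈ I) ∧ c ≠ c₀ := by
      rintro c (rfl | hc) hpc
      · exact absurd (hpx.symm.trans hpc) hrz
      · refine ⟨hc, ?_⟩
        rintro rfl
        exact hrz (hpc₀.symm.trans hpc)
    obtain ⟨h3, h4⟩ := key c hc h1
    obtain ⟨h5, h6⟩ := key c' hc' h2
    obtain ⟨h7, h8⟩ := hpo c h3 h4
    obtain ⟨h9, h10⟩ := hpo c' h5 h6
    exact hoinj c c' h3 h5 h4 h6 (h.one _ _ h7 h9 (h8.symm.trans h1) (h10.symm.trans h2))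

/-- The children of `p` in `F` are put below a new child `r` of `p` with the same label. -/
theorem groupBelow (h : IsTree e V I z par lab D) {p r : ℕ} {F : Finset ℕ} (hp : p ∈ I)
    (hrV : r ∉ V) (hrI : r ∉ I) (hrz : r ≠ z) (hF : ∀ c ∈ F, (c ∈ V ∨ c ∈ I) ∧ par c = p)
    (hF2 : ∃ c ∈ F, ∃ c' ∈ F, c ≠ c') (hF' : ∃ c, (c ∈ V ∨ c ∈ I) ∧ par c = p ∧ c ∉ F)
    {par' lab' : ℕ → ℕ} (hpF : ∀ c ∈ F, par' c = r) (hpr : par' r = p)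
    (hpar : ∀ t, t ∈ V ∨ t ∈ I → t ∉ F → par' t = par t) (hlr : lab' r = lab p)
    (hl : ∀ t, t = z ∨ t ∈ I → lab' t = lab t) :
    IsTree e V (insert r I) z par' lab' (Function.update D r (F.biUnion D)) := by
  classical
  have hNr : ∀ t, t ∈ V ∨ t ∈ I → t ≠ r := by rintro t ht rfl; exact ht.elim hrV hrI
  have hDr : Function.update D r (F.biUnion D) r = F.biUnion D := by simp
  have hD : ∀ t, t ≠ r → Function.update D r (F.biUnion D) t = D t := fun t ht => by
    simp [ht]
  have hDN : ∀ t, t ∈ V ∨ t ∈ I → Function.update D r (F.biUnion D) t = D t := fun t ht =>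
    hD t (hNr t ht)
  have hpz : p ≠ z := by rintro rfl; exact h.zI hp
  have hN' : ∀ t, t ∈ V ∨ t ∈ insert r I ↔ t = r ∨ t ∈ V ∨ t ∈ I := by
    intro t
    simp only [Finset.mem_insert]
    tauto
  have hpm := h.par_mem
  have hFp : F.biUnion D ⊆ D p := by
    intro u hu
    obtain ⟨c, hc, huc⟩ := Finset.mem_biUnion.1 hu
    exact (hF c hc).2 ▸ h.subset_par (hF c hc).1 huc
  have hrF : r ∉ F := fun hr => hNr r (hF r hr).1 rfl
  have hz : z = z ∨ z ∈ I := .inl rfl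
  refine ⟨?_, h.zV, ?_, ?_, ?_, ?_, ?_, ?_, ?_, ?_, ?_, ?_⟩
  · intro t ht
    rw [Finset.mem_insert, not_or]
    exact ⟨hNr t (.inl ht), h.disj t ht⟩
  · simp [hrz.symm, h.zI]
  · intro t ht
    rw [Finset.mem_insert]
    rcases (hN' t).1 ht with rfl | ht
    · exact .inr (.inr (hpr ▸ hp))
    · by_cases htF : t ∈ F
      · exact .inr (.inl (hpF t htF))
      · rw [hpar t ht htF]
        have := hpm t ht
        tauto
  · intro v hv
    rw [hDN v (.inl hv), h.leaf v hv]
  · intro q hq u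
    rw [Finset.mem_insert, or_left_comm] at hq
    rcases hq with rfl | hq
    · rw [hDr, Finset.mem_biUnion]
      constructor
      · rintro ⟨c, hc, hu⟩
        exact ⟨c, (hN' c).2 (.inr (hF c hc).1), hpF c hc, by rwa [hDN c (hF c hc).1]⟩
      · rintro ⟨c, hc, hpc, hu⟩
        rcases (hN' c).1 hc with rfl | hc
        · exact absurd (hpr.symm.trans hpc) (hNr p (.inr hp))
        · by_cases hcF : c ∈ F
          · exact ⟨c, hcF, by rwa [hDN c hc] at hu⟩
          · rw [hpar c hc hcF] at hpc
            rcases hpm c hc with h1 | h1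
            · exact absurd (hpc.symm.trans h1) hrz
            · exact absurd hpc (hNr _ (.inr h1))
    · have hqr : q ≠ r := by
        rcases hq with rfl | hq
        · exact hrz.symm
        · exact hNr q (.inr hq)
      rw [hD q hqr, h.mem_iff q hq]
      constructor
      · rintro ⟨c, hc, hpc, hu⟩
        by_cases hcF : c ∈ F
        · refine ⟨r, (hN' r).2 (.inl rfl), ?_, ?_⟩
          · rw [hpr, ← hpc, (hF c hcF).2]
          · rw [hDr]
            exact Finset.mem_biUnion.2 ⟨c, hcF, hu⟩
        · exact ⟨c, (hN' c).2 (.inr hc), (hpar c hc hcF).trans hpc, by rwa [hDN c hc]⟩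
      · rintro ⟨c, hc, hpc, hu⟩
        rcases (hN' c).1 hc with rfl | hc
        · rw [hDr] at hu
          obtain ⟨f, hf, huf⟩ := Finset.mem_biUnion.1 hu
          exact ⟨f, (hF f hf).1, (hF f hf).2.trans (hpr.symm.trans hpc), huf⟩
        · rw [hDN c hc] at hu
          by_cases hcF : c ∈ F
          · exact absurd ((hpF c hcF).symm.trans hpc).symm hqr
          · exact ⟨c, hc, (hpar c hc hcF).symm.trans hpc, hu⟩
  · have hlp : ∀ t, t ∈ V ∨ t ∈ I → lab' (par t) = lab (par t) := fun t ht => hl _ (hpm t ht)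
    have hrest : ∀ t, t ∈ V ∨ t ∈ I → t ∉ F → par' t ≠ r := by
      intro t ht htF
      rw [hpar t ht htF]
      rcases hpm t ht with h1 | h1
      · rw [h1]; exact hrz.symm
      · exact hNr _ (.inr h1)
    have hfc : ∀ c, c ∈ V ∨ c ∈ I → par' c = p → ∀ f ∈ F, c ≠ f ∧ par c = par f := by
      intro c hc hpc f hf
      have hcF : c ∉ F := fun hcF => hNr p (.inr hp) (hpc.symm.trans (hpF c hcF))
      refine ⟨by rintro rfl; exact hcF hf, ?_⟩
      rw [(hF f hf).2, ← hpc, hpar c hc hcF]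
    intro c c' hc hc' hne hpp u hu v hv
    rw [hN'] at hc hc'
    rcases hc with rfl | hc
    · rcases hc' with rfl | hc'
      · exact absurd rfl hne
      · rw [hDr] at hu
        rw [hDN c' hc'] at hv
        obtain ⟨f, hf, huf⟩ := Finset.mem_biUnion.1 hu
        obtain ⟨h1, h2⟩ := hfc c' hc' (hpp.symm.trans hpr) f hf
        have h3 := h.sibling f c' (hF f hf).1 hc' h1.symm h2.symm u huf v hv
        rwa [(hF f hf).2, ← hl p (.inr hp), ← hpr] at h3
    · rcases hc' with rfl | hc'
      · rw [hDr] at hv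
        rw [hDN c hc] at hu
        obtain ⟨f, hf, hvf⟩ := Finset.mem_biUnion.1 hv
        obtain ⟨h1, h2⟩ := hfc c hc (hpp.trans hpr) f hf
        have h3 := h.sibling c f hc (hF f hf).1 h1 h2 u hu v hvf
        rwa [h2, (hF f hf).2, ← hl p (.inr hp), ← hpr, ← hpp] at h3
      · rw [hDN c hc] at hu
        rw [hDN c' hc'] at hv
        by_cases hcF : c ∈ F
        · by_cases hcF' : c' ∈ F
          · have h3 := h.sibling c c' hc hc' hne ((hF c hcF).2.trans (hF c' hcF').2.symm)
              u hu v hv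
            rwa [(hF c hcF).2, ← hlr, ← hpF c hcF] at h3
          · exact absurd (hpp.symm.trans (hpF c hcF)) (hrest c' hc' hcF')
        · by_cases hcF' : c' ∈ F
          · exact absurd (hpp.trans (hpF c' hcF')) (hrest c hc hcF)
          · have h3 := h.sibling c c' hc hc' hne
              ((hpar c hc hcF).symm.trans (hpp.trans (hpar c' hc' hcF'))) u hu v hv
            rwa [← hlp c hc, ← hpar c hc hcF] at h3
  · intro t ht
    rcases (hN' t).1 ht with rfl | ht
    · obtain ⟨c, hc, _⟩ := hF2
      obtain ⟨u, hu⟩ := h.nonempty c (hF c hc).1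
      rw [hDr]
      exact ⟨u, Finset.mem_biUnion.2 ⟨c, hc, hu⟩⟩
    · rw [hDN t ht]
      exact h.nonempty t ht
  · intro t ht
    rcases (hN' t).1 ht with rfl | ht
    · rw [hDr]
      exact hFp.trans (h.sub p (.inr hp))
    · rw [hDN t ht]
      exact h.sub t ht
  · rw [hD z hrz.symm, h.top]
  · intro q hq
    rcases Finset.mem_insert.1 hq with rfl | hq
    · obtain ⟨c, hc, c', hc', hne⟩ := hF2
      exact ⟨c, c', hne, (hN' c).2 (.inr (hF c hc).1), (hN' c').2 (.inr (hF c' hc').1),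
        hpF c hc, hpF c' hc'⟩
    · by_cases hqp : q = p
      · subst hqp
        obtain ⟨c, hc, hpc, hcF⟩ := hF'
        exact ⟨r, c, (hNr c hc).symm, (hN' r).2 (.inl rfl), (hN' c).2 (.inr hc), hpr,
          (hpar c hc hcF).trans hpc⟩
      · obtain ⟨c, c', hne, hc, hc', h1, h2⟩ := h.two q hq
        have h3 : ∀ c, par c = q → c ∉ F := fun c hpc hcF => hqp (hpc.symm.trans (hF c hcF).2)
        exact ⟨c, c', hne, (hN' c).2 (.inr hc), (hN' c').2 (.inr hc'),
          (hpar c hc (h3 c h1)).trans h1, (hpar c' hc' (h3 c' h2)).trans h2⟩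
  · intro c c' hc hc' h1 h2
    rw [hN'] at hc hc'
    have key : ∀ c, c = r ∨ c ∈ V ∨ c ∈ I → par' c = z → (c ∈ V ∨ c ∈ I) ∧ par c = z := by
      rintro c (rfl | hc) hpc
      · exact absurd (hpr.symm.trans hpc) hpz
      · by_cases hcF : c ∈ F
        · exact absurd ((hpF c hcF).symm.trans hpc) hrz
        · exact ⟨hc, (hpar c hc hcF).symm.trans hpc⟩
    obtain ⟨h3, h4⟩ := key c hc h1
    obtain ⟨h5, h6⟩ := key c' hc' h2
    exact h.one c c' h3 h5 h4 h6

/-- Nodes may be renamed, as long as the leaves and the node above the root keep their names. -/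
theorem rename (h : IsTree e V I z par lab D) {σ : Equiv.Perm ℕ} (hV : ∀ v ∈ V, σ v = v)
    (hz : σ z = z) {I' : Finset ℕ} (hI : ∀ t, t ∈ I' ↔ σ t ∈ I) {par' lab' : ℕ → ℕ}
    (hpar : ∀ t, t ∈ V ∨ t ∈ I' → σ (par' t) = par (σ t))
    (hlab : ∀ q, q = z ∨ q ∈ I' → lab' q = lab (σ q)) :
    IsTree e V I' z par' lab' fun t => D (σ t) := by
  have hV' : ∀ t, t ∈ V ↔ σ t ∈ V := fun t =>
    ⟨fun ht => (hV t ht).symm ▸ ht, fun ht => σ.injective (hV _ ht) ▸ ht⟩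
  have hN : ∀ t, t ∈ V ∨ t ∈ I' ↔ σ t ∈ V ∨ σ t ∈ I := fun t => or_congr (hV' t) (hI t)
  have hz' : ∀ t, t = z ↔ σ t = z := fun t => ⟨fun ht => ht ▸ hz, fun ht =>
    σ.injective (ht.trans hz.symm)⟩
  have hq : ∀ q, q = z ∨ q ∈ I' ↔ σ q = z ∨ σ q ∈ I := fun q => or_congr (hz' q) (hI q)
  have hpm : ∀ t, t ∈ V ∨ t ∈ I' → par' t = z ∨ par' t ∈ I' := fun t ht => by
    rw [hq, hpar t ht]
    exact h.par_mem _ ((hN t).1 ht)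
  have hpe : ∀ t q, t ∈ V ∨ t ∈ I' → (par' t = q ↔ par (σ t) = σ q) := fun t q ht => by
    rw [← hpar t ht, σ.apply_eq_iff_eq]
  have hex : ∀ q (P : ℕ → Prop), (∃ c, (c ∈ V ∨ c ∈ I) ∧ par c = σ q ∧ P c) ↔
      ∃ c, (c ∈ V ∨ c ∈ I') ∧ par' c = q ∧ P (σ c) := by
    intro q P
    constructor
    · rintro ⟨c, hc, hpc, hP⟩
      obtain ⟨c, rfl⟩ := σ.surjective c
      exact ⟨c, (hN c).2 hc, (hpe c q ((hN c).2 hc)).2 hpc, hP⟩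
    · rintro ⟨c, hc, hpc, hP⟩
      exact ⟨σ c, (hN c).1 hc, (hpe c q hc).1 hpc, hP⟩
  refine ⟨fun t ht ht' => h.disj t ht (hV t ht ▸ (hI t).1 ht'), h.zV, fun ht => h.zI
    (hz ▸ (hI z).1 ht), hpm, fun v hv => by rw [hV v hv, h.leaf v hv], fun q hq' u => ?_,
    fun c c' hc hc' hne hpp u hu v hv => ?_, fun t ht => h.nonempty _ ((hN t).1 ht),
    fun t ht => h.sub _ ((hN t).1 ht), by rw [hz, h.top], fun q hq' => ?_,
    fun c c' hc hc' h1 h2 => σ.injective (h.one _ _ ((hN c).1 hc) ((hN c').1 hc')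
      (hz ▸ (hpe c z hc).1 h1) (hz ▸ (hpe c' z hc').1 h2))⟩
  · rw [h.mem_iff _ ((hq q).1 hq'), hex]
  · rw [hlab _ (hpm c hc), hpar c hc]
    exact h.sibling _ _ ((hN c).1 hc) ((hN c').1 hc') (σ.injective.ne hne)
      (by rw [← hpar c hc, ← hpar c' hc', hpp]) u hu v hv
  · obtain ⟨c, c', hne, hc, hc', h1, h2⟩ := h.two _ ((hI q).1 hq')
    obtain ⟨c, rfl⟩ := σ.surjective c
    obtain ⟨c', rfl⟩ := σ.surjective c'
    exact ⟨c, c', fun hh => hne (hh ▸ rfl), (hN c).2 hc, (hN c').2 hc',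
      (hpe c q ((hN c).2 hc)).2 h1, (hpe c' q ((hN c').2 hc')).2 h2⟩

/-- A new node `r` with the label of `p` takes the place of `p`; its children are `p` and the
children of `p` in `F`, which `p` loses. Up to the names of `p` and `r`, the children of `p` outside
`F` are put below a new child of `p`. -/
theorem pullAbove (h : IsTree e V I z par lab D) {p r : ℕ} {F : Finset ℕ} (hp : p ∈ I)
    (hrV : r ∉ V) (hrI : r ∉ I) (hrz : r ≠ z) (hF : ∀ c ∈ F, (c ∈ V ∨ c ∈ I) ∧ par c = p)
    (hF2 : F.Nonempty) (hF' : ∃ c c', c ≠ c' ∧ ((c ∈ V ∨ c ∈ I) ∧ par c = p ∧ c ∉ F) ∧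
      (c' ∈ V ∨ c' ∈ I) ∧ par c' = p ∧ c' ∉ F)
    {par' lab' : ℕ → ℕ} (hpF : ∀ c ∈ F, par' c = r) (hpp : par' p = r) (hpr : par' r = par p)
    (hpar : ∀ t, t ∈ V ∨ t ∈ I → t ∉ F → t ≠ p → par' t = par t) (hlr : lab' r = lab p)
    (hl : ∀ t, t = z ∨ t ∈ I → lab' t = lab t) :
    IsTree e V (insert r I) z par' lab'
      (Function.update (Function.update D r (D p)) p (D p \ F.biUnion D)) := by
  classical
  have hNr : ∀ t, t ∈ V ∨ t ∈ I → t ≠ r := by rintro t ht rfl; exact ht.elim hrV hrI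
  have hrp : p ≠ r := hNr p (.inr hp)
  have hpz : p ≠ z := by rintro rfl; exact h.zI hp
  have hpmr : ∀ t, t = z ∨ t ∈ I → t ≠ r := by
    rintro t (rfl | ht)
    exacts [hrz.symm, hNr t (.inr ht)]
  set σ : Equiv.Perm ℕ := Equiv.swap p r with hσ
  have hσp : σ p = r := Equiv.swap_apply_left p r
  have hσr : σ r = p := Equiv.swap_apply_right p r
  have hσt : ∀ t, t ≠ p → t ≠ r → σ t = t := fun t => Equiv.swap_apply_of_ne_of_ne
  have hσσ : ∀ t, σ (σ t) = t := Equiv.swap_apply_self p r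
  have hkp : ∀ c, c ∈ V ∨ c ∈ I → par c = p → c ≠ p := by
    rintro c hc hpc rfl
    exact h.par_ne_self hc hpc
  set F' := (V ∪ I).filter fun c => par c = p ∧ c ∉ F with hFdef
  have hF'' : ∀ c, c ∈ F' ↔ (c ∈ V ∨ c ∈ I) ∧ par c = p ∧ c ∉ F := fun c => by
    simp [hFdef]
  have hD : F'.biUnion D = D p \ F.biUnion D := by
    ext u
    rw [Finset.mem_sdiff, h.mem_iff p (.inr hp), Finset.mem_biUnion, Finset.mem_biUnion]
    constructor
    · rintro ⟨c, hc, hu⟩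
      obtain ⟨hc, hpc, hcF⟩ := (hF'' c).1 hc
      refine ⟨⟨c, hc, hpc, hu⟩, fun ⟨f, hf, huf⟩ => ?_⟩
      exact h.disjoint_sibling hc (hF f hf).1 (fun hh => hcF (hh ▸ hf))
        (hpc.trans (hF f hf).2.symm) hu huf
    · rintro ⟨⟨c, hc, hpc, hu⟩, hn⟩
      exact ⟨c, (hF'' c).2 ⟨hc, hpc, fun hcF => hn ⟨c, hcF, hu⟩⟩, hu⟩
  have hg := h.groupBelow (F := F') (par' := fun t => σ (par' (σ t))) (lab' := fun t => lab' (σ t))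
    hp hrV hrI hrz (fun c hc => ⟨((hF'' c).1 hc).1, ((hF'' c).1 hc).2.1⟩)
    (by
      obtain ⟨c, c', hne, hc, hc'⟩ := hF'
      exact ⟨c, (hF'' c).2 hc, c', (hF'' c').2 hc', hne⟩)
    (by
      obtain ⟨c, hc⟩ := hF2
      exact ⟨c, (hF c hc).1, (hF c hc).2, fun hh => ((hF'' c).1 hh).2.2 hc⟩)
    (fun c hc => by
      obtain ⟨hc, hpc, hcF⟩ := (hF'' c).1 hc
      have h1 := hkp c hc hpc
      rw [hσt c h1 (hNr c hc), hpar c hc hcF h1, hpc, hσp])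
    (by rw [hσr, hpp, hσr])
    (fun t ht htF => by
      by_cases h1 : t = p
      · subst h1
        rw [hσp, hpr, hσt _ (h.par_ne_self ht) (hpmr _ (h.par_mem t ht))]
      · rw [hσt t h1 (hNr t ht)]
        by_cases h2 : t ∈ F
        · rw [hpF t h2, hσr, (hF t h2).2]
        · rw [hpar t ht h2 h1, hσt _ (fun hh => htF ((hF'' t).2 ⟨ht, hh, h2⟩))
            (hpmr _ (h.par_mem t ht))])
    (by rw [hσr, hl p (.inr hp)])
    (fun t ht => by
      by_cases h1 : t = p
      · rw [h1, hσp, hlr]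
      · rw [hσt t h1 (hpmr t ht), hl t ht])
  have hr := hg.rename (σ := σ) (I' := insert r I) (par' := par') (lab' := lab')
    (fun v hv => hσt v (by rintro rfl; exact h.disj _ hv hp) (hNr v (.inl hv)))
    (hσt z hpz.symm hrz.symm)
    (fun t => by
      by_cases h1 : t = p
      · subst h1; simp [hσp, hp]
      · by_cases h2 : t = r
        · subst h2; simp [hσr, hp]
        · rw [hσt t h1 h2])
    (fun t _ => by rw [hσσ]) (fun t _ => by rw [hσσ])
  convert hr using 1
  funext t
  rw [hD]
  by_cases h1 : t = p
  · subst h1; simp [hσp]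
  · by_cases h2 : t = r
    · subst h2; simp [hσr, hrp, hrp.symm]
    · simp [hσt t h1 h2, h1, h2]

/-- If the new vertex has a constant type below `c₀`, and its type next to `c₀` is the label of the
parent, then along the whole path from `c₀` to the root its types are the labels. -/
theorem types_above (h : IsTree e V I z par lab D) {S : Set ℕ} (hS : IsSymbolic e S)
    (hVS : ∀ v ∈ V, v ∈ S) {x : ℕ} (hxS : x ∈ S) (hxV : x ∉ V) {c₀ : ℕ} (hc₀ : c₀ ∈ V ∨ c₀ ∈ I)
    (hred : ∀ t ∈ I, t ≠ c₀ → lab t ≠ lab (par t))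
    (hsib : ∀ c, c ∈ V ∨ c ∈ I → c ≠ c₀ → par c = par c₀ → Unif e D x c (lab (par c₀)))
    (hm : par c₀ = z ∨ Mixed e D x (par c₀)) :
    ∀ c, c ∈ V ∨ c ∈ I → D c₀ ⊆ D c → ∀ c', c' ∈ V ∨ c' ∈ I → c' ≠ c → par c' = par c →
      Unif e D x c' (lab (par c)) := by
  intro c hc hs c' hc' hne hp
  by_cases hcc : c = c₀
  · subst hcc
    exact hsib c' hc' hne hp
  · obtain ⟨_, h2, h3, _⟩ := h.exists_kid_of_subset hc₀ (.inr hc) hs (Ne.symm hcc)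
    have h4 : Mixed e D x c := by
      rcases hm with hm | ⟨u, hu, v, hv, huv⟩
      · rw [h3 hm] at hc
        exact (hc.elim h.zV h.zI).elim
      · exact ⟨u, h2 hu, v, h2 hv, huv⟩
    exact h4.sibling h hS hVS hxS hxV hc (hred c (h4.mem_inner h hc) hcc) hc' hne hp

end IsTree

/-! ### The program -/

namespace RAM

-- Arrays. Inputs: tails and heads of the arcs.
notation "aTail" => (0 : ℕ)
notation "aHead" => (1 : ℕ)
-- Lists of arcs by their larger endpoint: first arc, next arc, smaller endpoint; and in-degrees.
notation "aFirst" => (2 : ℕ)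
notation "aNext" => (3 : ℕ)
notation "aOther" => (4 : ℕ)
notation "aIndeg" => (5 : ℕ)
-- The tree: parent, label, number of children, sum of the children.
notation "aPar" => (6 : ℕ)
notation "aLab" => (7 : ℕ)
notation "aNum" => (8 : ℕ)
notation "aSum" => (9 : ℕ)
-- Insertion: types of nodes, numbers of children of types one and two, marks, and two work lists.
notation "aType" => (10 : ℕ)
notation "aOne" => (11 : ℕ)
notation "aTwo" => (12 : ℕ)
notation "aMark" => (13 : ℕ)
notation "aW" => (14 : ℕ)
notation "aQ" => (15 : ℕ)
-- Dynamic programming: first and last child, maximum sizes, a leaf child, chosen children, classes.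
notation "aLo" => (16 : ℕ)
notation "aHi" => (17 : ℕ)
notation "aB" => (18 : ℕ)
notation "aX" => (19 : ℕ)
notation "aY" => (20 : ℕ)
notation "aLeaf" => (21 : ℕ)
notation "aArgB" => (22 : ℕ)
notation "aArgX" => (23 : ℕ)
notation "aArgY" => (24 : ℕ)
notation "aClass" => (25 : ℕ)

-- Registers. The number of vertices, the number of arcs, and a bound for the names of nodes.
notation "rN" => (0 : ℕ)
notation "rE" => (1 : ℕ)
notation "rM" => (2 : ℕ)
-- Counters: general, current vertex, next unused node, lengths of the work lists, current arc.
notation "rI" => (3 : ℕ)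
notation "rX" => (4 : ℕ)
notation "rNew" => (5 : ℕ)
notation "rLenW" => (6 : ℕ)
notation "rLenQ" => (7 : ℕ)
notation "rJ" => (8 : ℕ)
-- Insertion: lowest mixed node, moved type, type of the new vertex, point of attachment, size of the
-- part that the new vertex is attached to, sum of the moved nodes, new node, current node, its
-- parent, label of the lowest mixed node, whether the moved part gets the label.
notation "rP" => (9 : ℕ)
notation "rMove" => (10 : ℕ)
notation "rType" => (11 : ℕ)
notation "rC" => (12 : ℕ)
notation "rNum" => (13 : ℕ)
notation "rSum" => (14 : ℕ)
notation "rD" => (15 : ℕ)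
notation "rT" => (16 : ℕ)
notation "rU" => (17 : ℕ)
notation "rLam" => (18 : ℕ)
notation "rUp" => (19 : ℕ)
notation "rA" => (20 : ℕ)

open Term Prog

infixr:60 " ;; " => Prog.seq

/-- `r := (r + e) mod M` for numbers below `M`. -/
def addMod (r : ℕ) (e : Term) : Prog :=
  ite (lt (reg r) (sub (reg rM) e)) (setReg r (sub (reg rM) (sub (sub (reg rM) e) (reg r))))
    (setReg r (sub (reg r) (sub (reg rM) e)))

/-- `r := (r - e) mod M` for numbers below `M`. -/
def subMod (r : ℕ) (e : Term) : Prog :=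
  ite (lt (reg r) e) (setReg r (sub (reg rM) (sub e (reg r)))) (setReg r (sub (reg r) e))

/-- Put the arc in register `rI` into the list of its larger endpoint, and count it as incoming. -/
def arcBody : Prog :=
  setReg rT (read aTail (reg rI)) ;; setReg rU (read aHead (reg rI)) ;;
  write aIndeg (reg rU) (add (read aIndeg (reg rU)) (const 1)) ;;
  ite (lt (reg rT) (reg rU))
    (write aNext (reg rI) (read aFirst (reg rU)) ;;
      write aFirst (reg rU) (add (reg rI) (const 1)) ;; write aOther (reg rI) (reg rT))
    (write aNext (reg rI) (read aFirst (reg rT)) ;;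
      write aFirst (reg rT) (add (reg rI) (const 1)) ;; write aOther (reg rI) (reg rU))

/-- The tree with the single leaf `0`. -/
def initTree : Prog :=
  write aPar (const 0) (reg rN) ;; write aLab (const 0) (const 3) ;;
  write aPar (reg rN) (reg rM) ;; write aPar (reg rM) (reg rM) ;; write aLab (reg rN) (const 3) ;;
  write aNum (reg rN) (const 2) ;; setReg rNew (add (reg rN) (const 1))

/-- Count the arc in register `rJ` for the type of its smaller endpoint, and go to the next arc. -/
def collectBody : Prog :=
  setReg rT (read aOther (sub (reg rJ) (const 1))) ;;
  ite (read aType (reg rT)) skip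
    (write aW (reg rLenW) (reg rT) ;; setReg rLenW (add (reg rLenW) (const 1))) ;;
  write aType (reg rT) (add (read aType (reg rT)) (const 1)) ;;
  setReg rJ (read aNext (sub (reg rJ) (const 1)))

/-- Find the types of the vertices with respect to the new vertex. -/
def collect : Prog :=
  setReg rLenW (const 0) ;; setReg rJ (read aFirst (reg rX)) ;; loop (reg rJ) collectBody

/-- Pass the type `k` of a node to its parent, where children of that type are counted in `a`. -/
def passType (a k : ℕ) : Prog :=
  write a (reg rU) (add (read a (reg rU)) (const 1)) ;;
  ite (eq (read a (reg rU)) (read aNum (reg rU)))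
    (write aType (reg rU) (const k) ;; write aW (reg rLenW) (reg rU) ;;
      setReg rLenW (add (reg rLenW) (const 1))) skip

/-- Process a node of uniform nonzero type. -/
def spreadBody : Prog :=
  setReg rT (read aW (reg rI)) ;; setReg rU (read aPar (reg rT)) ;;
  ite (read aOne (reg rU)) skip (ite (read aTwo (reg rU)) skip
    (write aQ (reg rLenQ) (reg rU) ;; setReg rLenQ (add (reg rLenQ) (const 1)))) ;;
  ite (eq (read aType (reg rT)) (const 1)) (passType aOne 1) (passType aTwo 2) ;;
  setReg rI (add (reg rI) (const 1))

/-- Find all nodes of uniform nonzero type. -/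
def spread : Prog :=
  setReg rI (const 0) ;; setReg rLenQ (const 0) ;; loop (lt (reg rI) (reg rLenW)) spreadBody

/-- Mark the parent and the grandparent of a live node. -/
def markBody : Prog :=
  setReg rT (read aQ (reg rI)) ;;
  ite (read aType (reg rT)) skip
    (write aMark (read aPar (reg rT)) (const 1) ;;
      write aMark (read aPar (read aPar (reg rT))) (const 1))

/-- Select an unmarked live node. -/
def selectBody : Prog :=
  setReg rT (read aQ (reg rI)) ;;
  ite (read aType (reg rT)) skip (ite (read aMark (reg rT)) skip (setReg rP (reg rT)))

/-- Decide which children of the selected node are moved, and what the type of the new vertex is. -/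
def decideMove : Prog :=
  setReg rLam (read aLab (reg rP)) ;;
  ite (eq (reg rLam) (const 1))
    (setReg rMove (const 1) ;; setReg rUp (const 1) ;;
      setReg rNum (sub (read aNum (reg rP)) (read aOne (reg rP))) ;;
      ite (read aTwo (reg rP)) (setReg rType (const 2)) (setReg rType (const 0)))
    (ite (eq (reg rLam) (const 2))
      (setReg rMove (const 2) ;; setReg rUp (const 1) ;;
        setReg rNum (sub (read aNum (reg rP)) (read aTwo (reg rP))) ;;
        ite (read aOne (reg rP)) (setReg rType (const 1)) (setReg rType (const 0)))
      (ite (read aOne (reg rP))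
        (setReg rMove (const 1) ;; setReg rUp (const 0) ;; setReg rNum (read aOne (reg rP)) ;;
          setReg rType (const 1))
        (ite (read aTwo (reg rP))
          (setReg rMove (const 2) ;; setReg rUp (const 0) ;; setReg rNum (read aTwo (reg rP)) ;;
            setReg rType (const 2))
          (setReg rMove (const 0) ;; setReg rUp (const 1) ;; setReg rNum (const 1) ;;
            setReg rType (const 0)))))

/-- Clear the marks and the counters that belong to a node in the second work list. -/
def clearBody : Prog :=
  setReg rT (read aQ (reg rI)) ;;
  write aMark (read aPar (reg rT)) (const 0) ;;
  write aMark (read aPar (read aPar (reg rT))) (const 0) ;;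
  write aOne (reg rT) (const 0) ;; write aTwo (reg rT) (const 0)

/-- Add up the moved children. -/
def sumBody : Prog :=
  setReg rT (read aW (reg rI)) ;;
  ite (eq (read aPar (reg rT)) (reg rP))
    (ite (eq (read aType (reg rT)) (reg rMove)) (addMod rSum (reg rT)) skip) skip

/-- Move a child to the new node. -/
def moveBody : Prog :=
  setReg rT (read aW (reg rI)) ;;
  ite (eq (read aPar (reg rT)) (reg rP))
    (ite (eq (read aType (reg rT)) (reg rMove)) (write aPar (reg rT) (reg rD)) skip) skip

/-- In the children of the node in register `rU`, replace the one in `rT` by the one in `rA`. -/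
def replaceKid : Prog :=
  setReg rSum (read aSum (reg rU)) ;; subMod rSum (reg rT) ;; addMod rSum (reg rA) ;;
  write aSum (reg rU) (reg rSum)

/-- Make the new node the parent of the selected node. -/
def finishAbove : Prog :=
  write aNum (reg rD) (add (sub (read aNum (reg rP)) (reg rNum)) (const 1)) ;;
  setReg rU (read aSum (reg rP)) ;; subMod rU (reg rSum) ;; write aSum (reg rP) (reg rU) ;;
  write aNum (reg rP) (reg rNum) ;;
  addMod rSum (reg rP) ;; write aSum (reg rD) (reg rSum) ;;
  setReg rU (read aPar (reg rP)) ;; setReg rT (reg rP) ;; setReg rA (reg rD) ;; replaceKid ;;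
  write aPar (reg rD) (reg rU) ;; write aPar (reg rP) (reg rD) ;; setReg rC (reg rP)

/-- Make the new node a child of the selected node. -/
def finishBelow : Prog :=
  write aNum (reg rD) (reg rNum) ;; write aSum (reg rD) (reg rSum) ;;
  write aPar (reg rD) (reg rP) ;;
  write aNum (reg rP) (add (sub (read aNum (reg rP)) (reg rNum)) (const 1)) ;;
  setReg rU (reg rP) ;; setReg rT (reg rSum) ;; setReg rA (reg rD) ;; replaceKid ;;
  setReg rC (reg rD)

/-- Find the node to which the new vertex is attached; it has to be created if it consists of
several, but not all, children of the selected node. -/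
def regroup : Prog :=
  setReg rSum (const 0) ;; setReg rI (const 0) ;; forUp rI rLenW sumBody ;;
  ite (eq (reg rNum) (const 1))
    (ite (reg rUp) (setReg rC (read aSum (reg rP)) ;; subMod rC (reg rSum))
      (setReg rC (reg rSum)))
    (setReg rD (reg rNew) ;; setReg rNew (add (reg rNew) (const 1)) ;;
      write aLab (reg rD) (reg rLam) ;; setReg rI (const 0) ;; forUp rI rLenW moveBody ;;
      ite (reg rUp) finishAbove finishBelow)

/-- Attach the new vertex. -/
def attach : Prog :=
  write aLab (reg rX) (const 3) ;;
  ite (eq (read aLab (reg rC)) (reg rType))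
    (write aPar (reg rX) (reg rC) ;; write aNum (reg rC) (add (read aNum (reg rC)) (const 1)) ;;
      setReg rU (read aSum (reg rC)) ;; addMod rU (reg rX) ;; write aSum (reg rC) (reg rU))
    (setReg rA (reg rNew) ;; setReg rNew (add (reg rNew) (const 1)) ;;
      write aLab (reg rA) (reg rType) ;;
      setReg rU (read aPar (reg rC)) ;; setReg rT (reg rC) ;; replaceKid ;;
      write aPar (reg rA) (reg rU) ;; write aPar (reg rC) (reg rA) ;; write aPar (reg rX) (reg rA) ;;
      write aNum (reg rA) (const 2) ;;
      setReg rU (reg rC) ;; addMod rU (reg rX) ;; write aSum (reg rA) (reg rU))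

/-- Forget the type of a node. -/
def forgetBody : Prog :=
  write aType (read aW (reg rI)) (const 0)

/-- Insert the vertex in register `rX` into the tree. -/
def insertVertex : Prog :=
  collect ;; spread ;;
  setReg rI (const 0) ;; forUp rI rLenQ markBody ;;
  setReg rP (reg rN) ;; setReg rI (const 0) ;; forUp rI rLenQ selectBody ;;
  decideMove ;; setReg rI (const 0) ;; forUp rI rLenQ clearBody ;;
  regroup ;; attach ;; setReg rI (const 0) ;; forUp rI rLenW forgetBody

/-- Build the tree. -/
def buildTree : Prog :=
  setReg rI (const 0) ;; forUp rI rE arcBody ;; initTree ;;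
  setReg rX (const 0) ;; forUp rX rN (ite (reg rX) insertVertex skip)

end RAM

namespace RAM

open Term Prog

/-! ### Lists of arcs -/

/-- The list `l` is stored as a linked list that starts at `k`; the entry `i` is represented by
`i + 1`, and the end of a list by `0`. -/
def Linked (nxt : ℕ → ℕ) : ℕ → List ℕ → Prop
  | k, [] => k = 0
  | k, i :: l => k = i + 1 ∧ Linked nxt (nxt i) l

theorem Linked.congr {nxt nxt' : ℕ → ℕ} {k : ℕ} {l : List ℕ} (h : Linked nxt k l)
    (he : ∀ i ∈ l, nxt' i = nxt i) : Linked nxt' k l := by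
  induction l generalizing k with
  | nil => exact h
  | cons i l ih =>
    refine ⟨h.1, ?_⟩
    rw [he i (by simp)]
    exact ih h.2 fun j hj => he j (by simp [hj])

/-- The arcs among the first `k` whose larger endpoint is `y`. -/
def arcsAt (T H : ℕ → ℕ) (k y : ℕ) : List ℕ :=
  ((List.range k).filter fun i => decide (max (T i) (H i) = y)).reverse

theorem arcsAt_succ (T H : ℕ → ℕ) (k y : ℕ) : arcsAt T H (k + 1) y =
    if max (T k) (H k) = y then k :: arcsAt T H k y else arcsAt T H k y := by
  by_cases h : max (T k) (H k) = y <;>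
    simp [arcsAt, List.range_succ, h]

theorem lt_of_mem_arcsAt {T H : ℕ → ℕ} {k y i : ℕ} (h : i ∈ arcsAt T H k y) :
    i < k ∧ max (T i) (H i) = y := by
  simpa [arcsAt] using h

theorem sum_length_arcsAt (T H : ℕ → ℕ) (k n : ℕ) :
    ∑ y ∈ Finset.range n, (arcsAt T H k y).length ≤ k := by
  induction k with
  | zero => simp [arcsAt]
  | succ k ih =>
    have : ∀ y, (arcsAt T H (k + 1) y).length = (arcsAt T H k y).length +
        if max (T k) (H k) = y then 1 else 0 := by
      intro y
      rw [arcsAt_succ]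
      split_ifs <;> simp
    simp only [this, Finset.sum_add_distrib, Finset.sum_ite_eq]
    split_ifs <;> omega

/-- Each arc is filed under its larger endpoint, together with its smaller endpoint, and the
in-degrees are counted. -/
theorem tri_arcs {s : State} {m : ℕ} {T H : ℕ → ℕ} (hT : s.mem aTail = T) (hH : s.mem aHead = H)
    (h0 : ∀ y, s.mem aFirst y = 0) (h1 : ∀ y, s.mem aIndeg y = 0) (hi : s.reg rI = 0)
    (hm : s.reg rE = m) :
    Tri (forUp rI rE arcBody) s (m * 60 + 4) fun s' =>
      (∀ y, Linked (s'.mem aNext) (s'.mem aFirst y) (arcsAt T H m y)) ∧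
      (∀ i < m, s'.mem aOther i = min (T i) (H i)) ∧
      ∀ v, s'.mem aIndeg v = ((Finset.range m).filter fun i => H i = v).card := by
  refine (Tri.forUp (C := 52) (N := m) (fun k s =>
      s.mem aTail = T ∧ s.mem aHead = H ∧
      (∀ y, Linked (s.mem aNext) (s.mem aFirst y) (arcsAt T H k y)) ∧
      (∀ i < k, s.mem aOther i = min (T i) (H i)) ∧
      ∀ v, s.mem aIndeg v = ((Finset.range k).filter fun i => H i = v).card)
    ?_ rfl rfl (by decide) hi hm ?_ (by omega)).conseq le_rfl fun s' h => h.1.2.2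
  · rintro k s _ ⟨hT, hH, hL, hO, hD⟩ hk _
    refine Tri.straight rfl (by decide) ?_
    have hlink : ∀ f : ℕ → ℕ, ∀ y, max (T k) (H k) = y →
        f = Function.update (s.mem aFirst) y (k + 1) → ∀ v,
        Linked (Function.update (s.mem aNext) k (s.mem aFirst y)) (f v)
          (arcsAt T H (k + 1) v) := by
      rintro f y hy rfl v
      have hc : Linked (Function.update (s.mem aNext) k (s.mem aFirst y)) (s.mem aFirst v)
          (arcsAt T H k v) := (hL v).congr fun i hi => by
        rw [Function.update_of_ne]
        have := (lt_of_mem_arcsAt hi).1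
        omega
      rw [arcsAt_succ, hy]
      by_cases hyv : y = v
      · subst hyv
        simpa [Linked] using hc
      · rw [if_neg hyv, Function.update_of_ne (Ne.symm hyv)]
        exact hc
    have hcount : ∀ v, Function.update (s.mem aIndeg) (H k) (s.mem aIndeg (H k) + 1) v =
        ((Finset.range (k + 1)).filter fun i => H i = v).card := by
      intro v
      rw [Finset.range_add_one, Finset.filter_insert]
      by_cases hv : H k = v
      · subst hv
        rw [if_pos rfl, Finset.card_insert_of_notMem (by simp), Function.update_self, hD]
      · rw [if_neg hv, Function.update_of_ne (Ne.symm hv), hD]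
    have hoth : ∀ x, x = min (T k) (H k) → ∀ i ≤ k,
        Function.update (s.mem aOther) k x i = min (T i) (H i) := by
      rintro x rfl i hi
      by_cases hik : i = k
      · subst hik
        simp
      · rw [Function.update_of_ne hik]
        exact hO i (by omega)
    by_cases hlt : T k < H k
    · simp [arcBody, Prog.run, Term.val, hT, hH, hk, hlt]
      exact ⟨hlink _ _ (by omega) rfl, hoth _ (by rw [min_def]; split_ifs <;> omega), hcount⟩
    · simp [arcBody, Prog.run, Term.val, hT, hH, hk, hlt]
      exact ⟨hlink _ _ (by omega) rfl, hoth _ (by rw [min_def]; split_ifs <;> omega), hcount⟩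
  · exact ⟨hT, hH, fun y => by simp [arcsAt, Linked, h0], by simp, by simp [h1]⟩

/-! ### The types of the vertices -/

theorem tri_collect {s : State} {x : ℕ} {l : List ℕ} (hx : s.reg rX = x)
    (hl : Linked (s.mem aNext) (s.mem aFirst x) l) (h0 : ∀ y, s.mem aType y = 0) :
    Tri collect s (l.length * 40 + 20) fun s' =>
      (∀ y, s'.mem aType y = (l.map (s.mem aOther)).count y) ∧
      (seg (s'.mem aW) (s'.reg rLenW)).Nodup ∧
      (∀ y, y ∈ seg (s'.mem aW) (s'.reg rLenW) ↔ s'.mem aType y ≠ 0) ∧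
      s'.reg rLenW ≤ l.length := by
  obtain ⟨nx, hnx⟩ : ∃ nx, nx = s.mem aNext := ⟨_, rfl⟩
  obtain ⟨ot, hot⟩ : ∃ ot, ot = s.mem aOther := ⟨_, rfl⟩
  rw [← hnx] at hl
  rw [← hot]
  refine Tri.seq (T := 2) (Q := fun s' => s'.reg rLenW = 0 ∧ s'.reg rX = x ∧ s'.mem = s.mem)
    (Tri.straight rfl (by decide) (by simp [Prog.run, Term.val, hx]))
    (T' := l.length * 40 + 18) ?_ (by omega)
  rintro s1 ⟨hW, hx1, hm1⟩
  refine Tri.seq (T := 4) (Q := fun s' => s'.reg rLenW = 0 ∧ Linked nx (s'.reg rJ) l ∧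
    s'.mem = s.mem) (Tri.straight rfl (by decide)
      (by simpa [Prog.run, Term.val, hW, hx1, hm1] using hl))
    (T' := l.length * 40 + 10) ?_ (by omega)
  rintro s2 ⟨hW2, hl2, hm2⟩
  refine Tri.loop (fun k s' => ∃ l0 l1, l = l0 ++ l1 ∧ Linked nx (s'.reg rJ) l1 ∧
    s'.mem aNext = nx ∧ s'.mem aOther = ot ∧ (∀ y, s'.mem aType y = (l0.map ot).count y) ∧
    (seg (s'.mem aW) (s'.reg rLenW)).Nodup ∧
    (∀ y, y ∈ seg (s'.mem aW) (s'.reg rLenW) ↔ s'.mem aType y ≠ 0) ∧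
    s'.reg rLenW ≤ l0.length ∧ k = l1.length * 40 + 10) ?_ ?_
    ⟨[], l, rfl, hl2, by rw [hm2, hnx], by rw [hm2, hot], by simp [hm2, h0], by simp [hW2],
      by simp [hW2, hm2, h0], by omega, rfl⟩
  · rintro k s ⟨l0, l1, rfl, hj, hn, ho, ht, hnd, hmem, hlen, rfl⟩ hne
    simp only [Term.val] at hne
    match l1, hj with
    | [], hj => exact absurd hj hne
    | i :: l1, ⟨hj1, hj2⟩ =>
      refine ⟨36, l1.length * 40 + 10, Tri.straight rfl (by decide) ?_, by
        simp only [Term.cost, List.length_cons]; omega⟩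
      have hcount : ∀ y, Function.update (s.mem aType) (ot i) (s.mem aType (ot i) + 1) y =
          ((l0 ++ [i]).map ot).count y := by
        intro y
        rw [List.map_append, List.count_append, ← ht y]
        by_cases hy : y = ot i
        · subst hy
          simp
        · rw [Function.update_of_ne hy]
          simp [Ne.symm hy]
      refine ⟨l0 ++ [i], l1, by simp, ?_⟩
      have hmem' : ot i ∈ seg (s.mem aW) (s.reg rLenW) ↔ s.mem aType (ot i) ≠ 0 := hmem _
      by_cases htz : s.mem aType (ot i) = 0
      · simp [collectBody, Prog.run, Term.val, hn, ho, hj1, htz]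
        simp only [htz, zero_add] at hcount
        refine ⟨hj2, by simpa using hcount, ?_, ?_, by omega⟩
        · rw [seg_push, List.nodup_append]
          refine ⟨hnd, by simp, ?_⟩
          intro a ha b hb
          rw [List.mem_singleton] at hb
          rintro rfl
          rw [hb] at ha
          exact hmem'.1 ha htz
        · intro y
          rw [seg_push, List.mem_append, hmem, List.mem_singleton]
          by_cases hy : y = ot i
          · subst hy
            simp
          · rw [Function.update_of_ne hy]
            simp [hy]
      · simp [collectBody, Prog.run, Term.val, hn, ho, hj1, htz]
        refine ⟨hj2, by simpa using hcount, hnd, ?_, by omega⟩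
        intro y
        rw [hmem]
        by_cases hy : y = ot i
        · subst hy
          simp [htz]
        · rw [Function.update_of_ne hy]
  · rintro k s ⟨l0, l1, rfl, hj, hn, ho, ht, hnd, hmem, hlen, rfl⟩ hz
    simp only [Term.val] at hz
    match l1, hj with
    | [], hj => exact ⟨by simp [Term.cost], by simpa using ht, hnd, hmem, by simpa using hlen⟩
    | i :: l1, ⟨hj1, hj2⟩ => omega

end RAM

/-! ### Nodes with leaves of one type -/

/-- The children of a node. -/
def kids (V I : Finset ℕ) (par : ℕ → ℕ) (q : ℕ) : Finset ℕ :=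
  (V ∪ I).filter fun t => par t = q

theorem mem_kids {V I : Finset ℕ} {par : ℕ → ℕ} {q t : ℕ} :
    t ∈ kids V I par q ↔ (t ∈ V ∨ t ∈ I) ∧ par t = q := by
  simp [kids]

/-- The state of the search for the nodes whose leaves all have the same nonzero type, given by `f`.
Nodes in `done` have been passed to their parents, those in `todo` have not; `ty` contains the types
of the nodes found. -/
structure SpreadInv (V I : Finset ℕ) (par : ℕ → ℕ) (D : ℕ → Finset ℕ) (f : ℕ → ℕ)
    (done todo : List ℕ) (ty : ℕ → ℕ) : Prop where
  nodup : (done ++ todo).Nodup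
  node : ∀ t ∈ done ++ todo, (t ∈ V ∨ t ∈ I) ∧ ty t ≠ 0 ∧ ∀ u ∈ D t, f u = ty t
  zero : ∀ t, t ∉ done ++ todo → ty t = 0
  leaf : ∀ v ∈ V, f v ≠ 0 → v ∈ done ++ todo
  full : ∀ q ∈ I, q ∈ done ++ todo ↔ ∃ k, ∀ c ∈ kids V I par q, c ∈ done ∧ ty c = k
  topo : ∀ l q l', done ++ todo = l ++ q :: l' → q ∈ I → ∀ c ∈ kids V I par q, c ∈ l

/-- The number of processed children of type `k`. -/
def typeCount (par : ℕ → ℕ) (done : List ℕ) (ty : ℕ → ℕ) (k q : ℕ) : ℕ :=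
  (done.toFinset.filter fun t => par t = q ∧ ty t = k).card

namespace SpreadInv

variable {e : ℕ → ℕ → ℕ} {V I : Finset ℕ} {z : ℕ} {par lab : ℕ → ℕ} {D : ℕ → Finset ℕ} {f : ℕ → ℕ}
  {done todo : List ℕ} {ty : ℕ → ℕ}

theorem typeCount_append (h : SpreadInv V I par D f done todo ty) {t : ℕ} {l : List ℕ}
    (hl : todo = t :: l) (k q : ℕ) : typeCount par (done ++ [t]) ty k q =
      typeCount par done ty k q + if par t = q ∧ ty t = k then 1 else 0 := by
  have hnd : t ∉ done := by
    have := h.nodup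
    rw [hl, List.nodup_append] at this
    intro ht
    exact this.2.2 t ht t (by simp) rfl
  unfold typeCount
  rw [List.toFinset_append, Finset.union_comm]
  simp only [List.toFinset_cons, List.toFinset_nil, insert_empty_eq, Finset.singleton_union]
  rw [Finset.filter_insert]
  split_ifs
  · rw [Finset.card_insert_of_notMem (by simp [hnd])]
  · rfl

theorem exists_of_typeCount_ne_zero {k q : ℕ} (h : typeCount par done ty k q ≠ 0) :
    ∃ t ∈ done, par t = q ∧ ty t = k := by
  obtain ⟨t, ht⟩ := Finset.card_ne_zero.1 h
  simp only [Finset.mem_filter, List.mem_toFinset] at ht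
  exact ⟨t, ht⟩

theorem type_le_two (h : SpreadInv V I par D f done todo ty) (hT : IsTree e V I z par lab D)
    (hf : ∀ u ∈ V, f u ≤ 2) {t : ℕ} (ht : t ∈ done ++ todo) : ty t = 1 ∨ ty t = 2 := by
  obtain ⟨h1, h2, h3⟩ := h.node t ht
  obtain ⟨u, hu⟩ := hT.nonempty t h1
  have h4 := h3 u hu
  have h5 := hf u (hT.sub t h1 hu)
  omega

/-- Each inner node found has two children that have been found before, so the nodes found are at
most twice as many as the leaves among them. -/
theorem length_le (h : SpreadInv V I par D f done todo ty) (hT : IsTree e V I z par lab D) {L : ℕ}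
    (hL : (V.filter fun v => f v ≠ 0).card ≤ L) : (done ++ todo).length ≤ 2 * L := by
  classical
  set S := (done ++ todo).toFinset with hS
  have hmem : ∀ t, t ∈ S ↔ t ∈ done ++ todo := fun t => List.mem_toFinset
  have hcard : S.card = (done ++ todo).length := List.toFinset_card_of_nodup h.nodup
  rw [← hcard]
  have h1 : S.card = (S.filter (· ∈ V)).card + (S.filter (· ∉ V)).card :=
    (Finset.card_filter_add_card_filter_not _).symm
  have h2 : (S.filter (· ∈ V)).card ≤ L := by
    refine (Finset.card_le_card fun t ht => ?_).trans hL
    rw [Finset.mem_filter, hmem] at ht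
    obtain ⟨_, h3, h4⟩ := h.node t ht.1
    refine Finset.mem_filter.2 ⟨ht.2, ?_⟩
    rw [h4 t (by rw [hT.leaf t ht.2]; simp)]
    exact h3
  have h3 : (S.filter (· ∉ V)).card * 2 ≤ S.card := by
    refine (?_ : _ ≤ ((S.filter (· ∉ V)).biUnion (kids V I par)).card).trans
      (Finset.card_le_card ?_)
    · rw [Finset.card_biUnion]
      · rw [← smul_eq_mul, ← Finset.sum_const]
        refine Finset.sum_le_sum fun q hq => ?_
        rw [Finset.mem_filter, hmem] at hq
        obtain ⟨c, c', hne, hc, hc', h5, h6⟩ := hT.two q ((h.node q hq.1).1.resolve_left hq.2)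
        rw [← Finset.card_pair hne]
        refine Finset.card_le_card fun t ht => ?_
        rw [Finset.mem_insert, Finset.mem_singleton] at ht
        rcases ht with rfl | rfl
        · exact mem_kids.2 ⟨hc, h5⟩
        · exact mem_kids.2 ⟨hc', h6⟩
      · intro q _ q' _ hne
        rw [Function.onFun, Finset.disjoint_left]
        intro t ht ht'
        exact hne ((mem_kids.1 ht).2.symm.trans (mem_kids.1 ht').2)
    · intro c hc
      obtain ⟨q, hq, hcq⟩ := Finset.mem_biUnion.1 hc
      rw [Finset.mem_filter, hmem] at hq
      obtain ⟨k, hk⟩ := (h.full q ((h.node q hq.1).1.resolve_left hq.2)).1 hq.1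
      rw [hmem]
      exact List.mem_append_left _ (hk c hcq).1
  omega

/-- A node without its last child having been processed has not been found. -/
theorem par_notMem (h : SpreadInv V I par D f done todo ty) {t : ℕ} {l : List ℕ}
    (hl : todo = t :: l) (hq : par t ∈ I) : par t ∉ done ++ todo := by
  intro hmem
  obtain ⟨k, hk⟩ := (h.full _ hq).1 hmem
  have h1 := (hk t (mem_kids.2 ⟨(h.node t (by simp [hl])).1, rfl⟩)).1
  have h2 := h.nodup
  rw [hl, List.nodup_append] at h2
  exact h2.2.2 t h1 t (by simp) rfl

/-- A node is processed whose parent still has a child that has not been processed or has another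
type. -/
theorem skip (h : SpreadInv V I par D f done todo ty) {t : ℕ} {l : List ℕ}
    (hl : todo = t :: l)
    (hn : par t ∈ I → ∃ c ∈ kids V I par (par t), ¬ (c ∈ done ++ [t] ∧ ty c = ty t)) :
    SpreadInv V I par D f (done ++ [t]) l ty := by
  have he : done ++ [t] ++ l = done ++ todo := by simp [hl]
  refine ⟨he ▸ h.nodup, he ▸ h.node, he ▸ h.zero, he ▸ h.leaf, ?_, he ▸ h.topo⟩
  intro q hq
  rw [he, h.full q hq]
  constructor
  · rintro ⟨k, hk⟩
    exact ⟨k, fun c hc => ⟨by simp [(hk c hc).1], (hk c hc).2⟩⟩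
  · rintro ⟨k, hk⟩
    by_cases hqt : q = par t
    · subst hqt
      obtain ⟨c, hc, hc'⟩ := hn hq
      have h1 := hk t (mem_kids.2 ⟨(h.node t (by simp [hl])).1, rfl⟩)
      exact absurd ⟨(hk c hc).1, (hk c hc).2.trans h1.2.symm⟩ hc'
    · refine ⟨k, fun c hc => ⟨?_, (hk c hc).2⟩⟩
      have h1 := (hk c hc).1
      rw [List.mem_append, List.mem_singleton] at h1
      refine h1.resolve_right ?_
      rintro rfl
      exact hqt (mem_kids.1 hc).2.symm

/-- The last child of a node is processed, and all its children have the same type: the node is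
found. -/
theorem push (h : SpreadInv V I par D f done todo ty) (hT : IsTree e V I z par lab D) {t : ℕ}
    {l : List ℕ} (hl : todo = t :: l) (hq : par t ∈ I)
    (hn : ∀ c ∈ kids V I par (par t), c ∈ done ++ [t] ∧ ty c = ty t) :
    SpreadInv V I par D f (done ++ [t]) (l ++ [par t])
      (Function.update ty (par t) (ty t)) := by
  have he : done ++ [t] ++ (l ++ [par t]) = (done ++ todo) ++ [par t] := by simp [hl]
  have hnot := h.par_notMem hl hq
  have htm : t ∈ done ++ todo := by simp [hl]
  have hty : ∀ c ∈ done ++ todo, Function.update ty (par t) (ty t) c = ty c := by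
    intro c hc
    rw [Function.update_of_ne]
    rintro rfl
    exact hnot hc
  have hsub : ∀ c, c ∈ done ++ [t] → c ∈ done ++ todo := by
    intro c hc
    rw [hl]
    simp only [List.mem_append, List.mem_cons] at hc ⊢
    tauto
  refine ⟨?_, ?_, ?_, ?_, ?_, ?_⟩
  · rw [he, List.nodup_append]
    refine ⟨h.nodup, by simp, ?_⟩
    intro a ha b hb
    rw [List.mem_singleton] at hb
    rintro rfl
    exact hnot (hb ▸ ha)
  · intro c hc
    rw [he, List.mem_append, List.mem_singleton] at hc
    rcases hc with hc | rfl
    · rw [hty c hc]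
      exact h.node c hc
    · rw [Function.update_self]
      refine ⟨.inr hq, (h.node t htm).2.1, ?_⟩
      intro u hu
      obtain ⟨c, hc, hpc, huc⟩ := (hT.mem_iff _ (.inr hq) u).1 hu
      obtain ⟨h1, h2⟩ := hn c (mem_kids.2 ⟨hc, hpc⟩)
      rw [← h2]
      exact (h.node c (hsub c h1)).2.2 u huc
  · intro c hc
    rw [he, List.mem_append, List.mem_singleton, not_or] at hc
    rw [Function.update_of_ne hc.2]
    exact h.zero c hc.1
  · intro v hv hf
    rw [he, List.mem_append]
    exact .inl (h.leaf v hv hf)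
  · intro q hqI
    rw [he, List.mem_append, List.mem_singleton]
    by_cases hqt : q = par t
    · subst hqt
      refine ⟨fun _ => ⟨ty t, fun c hc => ?_⟩, fun _ => .inr rfl⟩
      obtain ⟨h1, h2⟩ := hn c hc
      exact ⟨h1, by rw [hty c (hsub c h1), h2]⟩
    · rw [h.full q hqI]
      simp only [hqt, or_false]
      refine exists_congr fun k => forall₂_congr fun c hc => ?_
      have hct : c ≠ t := by
        rintro rfl
        exact hqt (mem_kids.1 hc).2.symm
      rw [List.mem_append, List.mem_singleton, or_iff_left hct]
      refine and_congr_right fun h1 => ?_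
      rw [hty c (by simp [h1])]
  · intro l1 q l2 hl12 hqI c hc
    rw [he] at hl12
    rcases List.eq_nil_or_concat l2 with rfl | ⟨l3, b, rfl⟩
    · have h1 := (List.append_inj' hl12 rfl)
      simp only [List.cons.injEq, and_true] at h1
      rw [← h1.1]
      rw [← h1.2] at hc
      exact hsub c (hn c hc).1
    · have h1 := List.append_inj' (hl12.trans (by simp :
        l1 ++ q :: (l3.concat b) = (l1 ++ q :: l3) ++ [b])) rfl
      exact h.topo l1 q l3 h1.1 hqI c hc

/-- At the end all nodes with leaves of one nonzero type have been found. -/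
theorem mem_iff (h : SpreadInv V I par D f done [] ty) (hT : IsTree e V I z par lab D) (t : ℕ) :
    t ∈ done ↔ (t ∈ V ∨ t ∈ I) ∧ ∃ k ≠ 0, ∀ u ∈ D t, f u = k := by
  constructor
  · intro ht
    obtain ⟨h1, h2, h3⟩ := h.node t (by simpa using ht)
    exact ⟨h1, _, h2, h3⟩
  · rintro ⟨ht, k, hk, hu⟩
    revert hu
    refine hT.down (P := fun t => (∀ u ∈ D t, f u = k) → t ∈ done) ?_ ?_ t ht
    · intro v hv hu
      simpa using h.leaf v hv (by rw [hu v (by rw [hT.leaf v hv]; simp)]; exact hk)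
    · intro q hq ih hu
      have := (h.full q hq).2 ⟨k, fun c hc => ?_⟩
      · simpa using this
      · obtain ⟨hcN, hpc⟩ := mem_kids.1 hc
        have huc : ∀ u ∈ D c, f u = k := fun u huc => hu u (hpc ▸ hT.subset_par hcN huc)
        have h1 := ih c hcN hpc huc
        obtain ⟨u, hu'⟩ := hT.nonempty c hcN
        exact ⟨h1, ((h.node c (by simpa using h1)).2.2 u hu').symm.trans (huc u hu')⟩

end SpreadInv

namespace RAM

open Term Prog

/-- One step of the search, for a node `t` with parent `u`. -/
theorem run_spreadBody {s : State} {t u : ℕ} (ht : s.mem aW (s.reg rI) = t)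
    (hu : s.mem aPar t = u) (hty : s.mem aType t = 1 ∨ s.mem aType t = 2) :
    ∃ s', spreadBody.run s = s' ∧ s'.reg rI = s.reg rI + 1 ∧ s'.mem aPar = s.mem aPar ∧
      s'.mem aNum = s.mem aNum ∧
      s'.mem aOne = (if s.mem aType t = 1 then Function.update (s.mem aOne) u (s.mem aOne u + 1)
        else s.mem aOne) ∧
      s'.mem aTwo = (if s.mem aType t = 1 then s.mem aTwo
        else Function.update (s.mem aTwo) u (s.mem aTwo u + 1)) ∧
      ((s.mem aOne u = 0 ∧ s.mem aTwo u = 0 ∧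
        s'.mem aQ = Function.update (s.mem aQ) (s.reg rLenQ) u ∧ s'.reg rLenQ = s.reg rLenQ + 1) ∨
        (¬ (s.mem aOne u = 0 ∧ s.mem aTwo u = 0) ∧ s'.mem aQ = s.mem aQ ∧
          s'.reg rLenQ = s.reg rLenQ)) ∧
      ((s'.mem aOne u = s.mem aNum u ∧ s.mem aType t = 1 ∨
          s'.mem aTwo u = s.mem aNum u ∧ s.mem aType t = 2) →
        s'.mem aType = Function.update (s.mem aType) u (s.mem aType t) ∧
        s'.mem aW = Function.update (s.mem aW) (s.reg rLenW) u ∧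
        s'.reg rLenW = s.reg rLenW + 1) ∧
      (¬ (s'.mem aOne u = s.mem aNum u ∧ s.mem aType t = 1 ∨
          s'.mem aTwo u = s.mem aNum u ∧ s.mem aType t = 2) →
        s'.mem aType = s.mem aType ∧ s'.mem aW = s.mem aW ∧ s'.reg rLenW = s.reg rLenW) := by
  refine ⟨_, rfl, ?_⟩
  rcases hty with hty | hty <;> by_cases hq : s.mem aOne u = 0 <;>
    by_cases hq2 : s.mem aTwo u = 0 <;> by_cases h1 : s.mem aNum u = 1 <;>
    by_cases hz : s.mem aOne u + 1 = s.mem aNum u <;>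
    by_cases hz2 : s.mem aTwo u + 1 = s.mem aNum u <;>
    simp_all [spreadBody, passType, Prog.run, Term.val, eq_comm (a := 1) (b := s.mem aNum u)]

/-- The time to find the nodes whose leaves all have the same nonzero type is linear in the number
of leaves of nonzero type. A node is found when as many of its children have been found with one
type as it has children. The second work list consists of the parents of the nodes found. -/
theorem tri_spread {e : ℕ → ℕ → ℕ} {V I : Finset ℕ} {z : ℕ} {par lab : ℕ → ℕ} {D : ℕ → Finset ℕ}
    {f : ℕ → ℕ} {s : State} (hT : IsTree e V I z par lab D) (hpar : s.mem aPar = par)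
    (hf : ∀ u ∈ V, f u ≤ 2) (hnum : ∀ q ∈ I, s.mem aNum q = (kids V I par q).card)
    (hnumz : s.mem aNum z = 2) (h1 : ∀ q, s.mem aOne q = 0) (h2 : ∀ q, s.mem aTwo q = 0)
    (hV : ∀ v ∈ V, s.mem aType v = f v) (hV' : ∀ v, v ∉ V → s.mem aType v = 0)
    (hnd : (seg (s.mem aW) (s.reg rLenW)).Nodup)
    (hmem : ∀ y, y ∈ seg (s.mem aW) (s.reg rLenW) ↔ s.mem aType y ≠ 0) :
    Tri spread s (s.reg rLenW * 160 + 20) fun s' => ∃ wl,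
      seg (s'.mem aW) (s'.reg rLenW) = wl ∧ SpreadInv V I par D f wl [] (s'.mem aType) ∧
      (∀ q, s'.mem aOne q = typeCount par wl (s'.mem aType) 1 q) ∧
      (∀ q, s'.mem aTwo q = typeCount par wl (s'.mem aType) 2 q) ∧
      (∀ q, q ∈ seg (s'.mem aQ) (s'.reg rLenQ) ↔ ∃ t ∈ wl, par t = q) ∧
      s'.reg rLenQ ≤ wl.length ∧ wl.length ≤ 2 * s.reg rLenW := by
  obtain ⟨L, hL⟩ : ∃ L, L = s.reg rLenW := ⟨_, rfl⟩
  obtain ⟨num, hn⟩ : ∃ num, num = s.mem aNum := ⟨_, rfl⟩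
  rw [← hL]
  have hmemV : ∀ y, y ∈ seg (s.mem aW) L → y ∈ V ∧ f y ≠ 0 := by
    intro y hy
    rw [hL, hmem] at hy
    have hyV : y ∈ V := by
      by_contra hyV
      exact hy (hV' y hyV)
    exact ⟨hyV, by rwa [← hV y hyV]⟩
  have hLV : (V.filter fun v => f v ≠ 0).card ≤ L := by
    have e1 : (seg (s.mem aW) L).toFinset.card = L := by
      rw [hL, List.toFinset_card_of_nodup hnd, length_seg]
    rw [← e1]
    refine Finset.card_le_card fun v hv => ?_
    rw [Finset.mem_filter] at hv
    rw [List.mem_toFinset, hL, hmem, hV v hv.1]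
    exact hv.2
  have hinit : SpreadInv V I par D f [] (seg (s.mem aW) L) (s.mem aType) := by
    rw [← hL] at hnd hmem
    refine ⟨by simpa using hnd, ?_, ?_, ?_, ?_, ?_⟩
    · intro t ht
      obtain ⟨h3, h4⟩ := hmemV t (by simpa using ht)
      refine ⟨.inl h3, by rwa [hV t h3], ?_⟩
      intro u hu
      rw [hT.leaf t h3, Finset.mem_singleton] at hu
      rw [hu, hV t h3]
    · intro t ht
      rw [List.nil_append, hmem, not_not] at ht
      exact ht
    · intro v hv hfv
      rw [List.nil_append, hmem, hV v hv]
      exact hfv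
    · intro q hq
      constructor
      · intro hqm
        exact absurd hq (hT.disj q (hmemV q (by simpa using hqm)).1)
      · rintro ⟨k, hk⟩
        obtain ⟨c, _, _, hc, _, hpc, _⟩ := hT.two q hq
        exact absurd (hk c (mem_kids.2 ⟨hc, hpc⟩)).1 (by simp)
    · intro l q l' hl hq
      exact absurd hq (hT.disj q (hmemV q (by rw [List.nil_append] at hl; simp [hl])).1)
  refine Tri.seq (T := 2) (Q := fun s' => s'.reg rI = 0 ∧ s'.reg rLenW = L ∧ s'.mem = s.mem)
    (Tri.straight rfl (by decide) (by simp [Prog.run, Term.val, hL])) (T' := L * 160 + 18) ?_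
    (by omega)
  rintro s1 ⟨hI1, hW1, hm1⟩
  refine Tri.seq (T := 2) (Q := fun s' => s'.reg rI = 0 ∧ s'.reg rLenW = L ∧ s'.reg rLenQ = 0 ∧
    s'.mem = s.mem)
    (Tri.straight rfl (by decide) (by simp [Prog.run, Term.val, hI1, hW1, hm1]))
    (T' := 2 * L * 80 + 16) ?_ (by omega)
  rintro s2 ⟨hI2, hW2, hQ2, hm2⟩
  refine Tri.loop (fun k s' => ∃ done todo, seg (s'.mem aW) (s'.reg rLenW) = done ++ todo ∧
    s'.reg rI = done.length ∧ SpreadInv V I par D f done todo (s'.mem aType) ∧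
    s'.mem aPar = par ∧ s'.mem aNum = num ∧
    (∀ q, s'.mem aOne q = typeCount par done (s'.mem aType) 1 q) ∧
    (∀ q, s'.mem aTwo q = typeCount par done (s'.mem aType) 2 q) ∧
    (∀ q, q ∈ seg (s'.mem aQ) (s'.reg rLenQ) ↔ ∃ t ∈ done, par t = q) ∧
    s'.reg rLenQ ≤ done.length ∧ k = (2 * L - done.length) * 80 + 16) ?_ ?_
    ⟨[], seg (s.mem aW) L, by simp [hW2, hm2], by simp [hI2], by rwa [hm2], by rw [hm2, hpar],
      by rw [hm2, hn], by simp [hm2, h1, typeCount], by simp [hm2, h2, typeCount],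
      by simp [hQ2], by simp [hQ2], by simp⟩
  · rintro k s ⟨done, todo, hseg, hI, hinv, hp, hnm, hc1, hc2, hq, hql, rfl⟩ hlt
    have hlen := hinv.length_le hT hLV
    have hlenW : s.reg rLenW = (done ++ todo).length := by rw [← hseg, length_seg]
    have hlt' : done.length < s.reg rLenW := by
      by_contra hcon
      simp [Term.val, hI, hcon] at hlt
    match todo, hseg, hinv, hlen, hlenW with
    | [], hseg, hinv, hlen, hlenW => simp at hlenW; omega
    | t :: todo, hseg, hinv, hlen, hlenW =>
    have htm : t ∈ done ++ t :: todo := by simp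
    have hWt : s.mem aW done.length = t := (seg_eq_append hseg).2
    have htN := (hinv.node t htm).1
    refine ⟨76, (2 * L - (done.length + 1)) * 80 + 16, Tri.straight rfl (by decide) ?_, ?_⟩
    swap
    · simp only [Term.cost, List.length_append, List.length_cons] at hlen ⊢
      omega
    -- The queue of parents after this step.
    have hQ : ∀ Q' lq', ((s.mem aOne (par t) = 0 ∧ s.mem aTwo (par t) = 0 ∧
        Q' = Function.update (s.mem aQ) (s.reg rLenQ) (par t) ∧ lq' = s.reg rLenQ + 1) ∨
        (¬ (s.mem aOne (par t) = 0 ∧ s.mem aTwo (par t) = 0) ∧ Q' = s.mem aQ ∧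
          lq' = s.reg rLenQ)) →
        (∀ q, q ∈ seg Q' lq' ↔ ∃ t' ∈ done ++ [t], par t' = q) ∧
          lq' ≤ (done ++ [t]).length := by
      rintro Q' lq' (⟨_, _, rfl, rfl⟩ | ⟨h3, rfl, rfl⟩)
      · refine ⟨fun q => ?_, by simpa using hql⟩
        rw [seg_push, List.mem_append, hq, List.mem_singleton]
        simp only [List.mem_append, List.mem_singleton, or_and_right, exists_or,
          exists_eq_left, eq_comm (a := q)]
      · refine ⟨fun q => ?_, by simp; omega⟩
        rw [hq]
        simp only [List.mem_append, List.mem_singleton, or_and_right, exists_or,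
          exists_eq_left]
        refine ⟨.inl, ?_⟩
        rintro (h4 | h4)
        · exact h4
        · subst h4
          rw [hc1, hc2] at h3
          by_cases h5 : typeCount par done (s.mem aType) 1 (par t) = 0
          · obtain ⟨t', h6, h7, _⟩ := SpreadInv.exists_of_typeCount_ne_zero
              (fun h => h3 ⟨h5, h⟩)
            exact ⟨t', h6, h7⟩
          · obtain ⟨t', h6, h7, _⟩ := SpreadInv.exists_of_typeCount_ne_zero h5
            exact ⟨t', h6, h7⟩
    have hty := hinv.type_le_two hT hf htm
    have hcount := hinv.typeCount_append rfl
    have hnz : ∀ k, k = s.mem aType t → (typeCount par done (s.mem aType) k (par t) + 1 =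
        num (par t) ↔ par t ∈ I ∧ ∀ c ∈ kids V I par (par t),
          c ∈ done ++ [t] ∧ s.mem aType c = s.mem aType t) := by
      rintro k rfl
      have h3 := hcount (s.mem aType t) (par t)
      rw [if_pos ⟨rfl, rfl⟩] at h3
      rw [← h3]
      have hsub : ((done ++ [t]).toFinset.filter fun t' => par t' = par t ∧
          s.mem aType t' = s.mem aType t) ⊆ kids V I par (par t) := by
        intro c hc
        simp only [Finset.mem_filter, List.mem_toFinset] at hc
        refine mem_kids.2 ⟨(hinv.node c ?_).1, hc.2.1⟩
        have := hc.1
        simp only [List.mem_append, List.mem_cons] at this ⊢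
        tauto
      have hset : ∀ n, n = (kids V I par (par t)).card →
          (typeCount par (done ++ [t]) (s.mem aType) (s.mem aType t) (par t) = n ↔
          ∀ c ∈ kids V I par (par t), c ∈ done ++ [t] ∧ s.mem aType c = s.mem aType t) := by
        rintro n rfl
        constructor
        · intro hc c hck
          rw [← Finset.eq_of_subset_of_card_le hsub hc.ge] at hck
          simp only [Finset.mem_filter, List.mem_toFinset] at hck
          exact ⟨hck.1, hck.2.2⟩
        · intro hc
          refine congrArg Finset.card (Finset.Subset.antisymm hsub fun c hck => ?_)
          have := hc c hck
          have := (mem_kids.1 hck).2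
          simp only [Finset.mem_filter, List.mem_toFinset]
          tauto
      rcases hT.par_mem t htN with h4 | h4
      · have h5 : par t ∉ I := by rw [h4]; exact hT.zI
        refine iff_of_false (fun h6 => ?_) (fun h6 => h5 h6.1)
        have h7 : (kids V I par (par t)).card ≤ 1 := by
          refine Finset.card_le_one.2 fun a ha b hb => ?_
          rw [mem_kids] at ha hb
          exact hT.one a b ha.1 hb.1 (ha.2.trans h4) (hb.2.trans h4)
        -- A single child cannot make up the dummy count of two at the top.
        have h8 : typeCount par (done ++ [t]) (s.mem aType) (s.mem aType t) (par t) ≤ 1 :=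
          (Finset.card_le_card hsub).trans h7
        rw [h6, h4, hn, hnumz] at h8
        omega
      · rw [hset _ (by rw [hn, hnum _ h4])]
        simp [h4]
    have hskip : par t ∈ I → ¬ (par t ∈ I ∧ ∀ c ∈ kids V I par (par t),
        c ∈ done ++ [t] ∧ s.mem aType c = s.mem aType t) →
        ∃ c ∈ kids V I par (par t), ¬ (c ∈ done ++ [t] ∧ s.mem aType c = s.mem aType t) := by
      intro h3 h4
      by_contra hcon
      push Not at hcon
      exact h4 ⟨h3, fun c hc => ⟨(hcon c hc).1, (hcon c hc).2⟩⟩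
    have htc : ∀ k q, par t ∈ I →
        typeCount par (done ++ [t]) (Function.update (s.mem aType) (par t) (s.mem aType t)) k q =
        typeCount par (done ++ [t]) (s.mem aType) k q := by
      intro k q hI'
      unfold typeCount
      refine congrArg Finset.card (Finset.filter_congr fun c hc => ?_)
      rw [Function.update_of_ne]
      rintro rfl
      refine hinv.par_notMem rfl hI' ?_
      simp only [List.mem_toFinset, List.mem_append, List.mem_cons] at hc ⊢
      tauto
    have hone : ∀ q, (if s.mem aType t = 1 then
        Function.update (s.mem aOne) (par t) (s.mem aOne (par t) + 1) else s.mem aOne) q =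
        typeCount par (done ++ [t]) (s.mem aType) 1 q := by
      intro q
      rw [hcount, ← hc1]
      by_cases h3 : s.mem aType t = 1
      · by_cases h4 : par t = q
        · subst h4; simp [h3]
        · simp [h3, h4, Function.update_of_ne (Ne.symm h4)]
      · simp [h3]
    have htwo : ∀ q, (if s.mem aType t = 1 then s.mem aTwo else
        Function.update (s.mem aTwo) (par t) (s.mem aTwo (par t) + 1)) q =
        typeCount par (done ++ [t]) (s.mem aType) 2 q := by
      intro q
      rw [hcount, ← hc2]
      by_cases h3 : s.mem aType t = 1
      · simp [h3]
      · have h3' : s.mem aType t = 2 := by omega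
        by_cases h4 : par t = q
        · subst h4; simp [h3']
        · simp [h3', h4, Function.update_of_ne (Ne.symm h4)]
    have hseg' : seg (s.mem aW) (s.reg rLenW) = done ++ [t] ++ todo := by simp [hseg]
    have hseg2 : seg (Function.update (s.mem aW) (s.reg rLenW) (par t)) (s.reg rLenW + 1) =
        done ++ [t] ++ (todo ++ [par t]) := by rw [seg_push, hseg']; simp
    obtain ⟨s', hs', hI', hp', hn', h1', h2', hq', hyes, hno⟩ :=
      run_spreadBody (by rw [hI]; exact hWt) (congrFun hp t) hty
    rw [hs']
    have hQ' := hQ _ _ hq'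
    have hiff : (s'.mem aOne (par t) = s.mem aNum (par t) ∧ s.mem aType t = 1 ∨
        s'.mem aTwo (par t) = s.mem aNum (par t) ∧ s.mem aType t = 2) ↔
        par t ∈ I ∧ ∀ c ∈ kids V I par (par t),
          c ∈ done ++ [t] ∧ s.mem aType c = s.mem aType t := by
      rw [← hnz _ rfl, hnm, h1', h2']
      rcases hty with hty | hty <;> simp [hty, hc1, hc2]
    by_cases hfull : par t ∈ I ∧ ∀ c ∈ kids V I par (par t),
        c ∈ done ++ [t] ∧ s.mem aType c = s.mem aType t
    · obtain ⟨h3, h4, h5⟩ := hyes (hiff.2 hfull)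
      refine ⟨done ++ [t], todo ++ [par t], by rw [h4, h5, hseg2], by simp [hI', hI],
        by rw [h3]; exact hinv.push hT rfl hfull.1 hfull.2, by rw [hp', hp], by rw [hn', hnm],
        fun q => by rw [h1', h3, htc _ _ hfull.1]; exact hone q,
        fun q => by rw [h2', h3, htc _ _ hfull.1]; exact htwo q, hQ'.1, hQ'.2, by simp⟩
    · obtain ⟨h3, h4, h5⟩ := hno (mt hiff.1 hfull)
      refine ⟨done ++ [t], todo, by rw [h4, h5, hseg'], by simp [hI', hI],
        by rw [h3]; exact hinv.skip rfl fun h3 => hskip h3 hfull, by rw [hp', hp],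
        by rw [hn', hnm], fun q => by rw [h1', h3]; exact hone q,
        fun q => by rw [h2', h3]; exact htwo q, hQ'.1, hQ'.2, by simp⟩
  · rintro k s ⟨done, todo, hseg, hI, hinv, hp, hnm, hc1, hc2, hq, hql, rfl⟩ hz
    have hlen := hinv.length_le hT hLV
    have hlenW : s.reg rLenW = (done ++ todo).length := by rw [← hseg, length_seg]
    have hlt' : ¬ done.length < s.reg rLenW := by
      intro hcon
      simp [Term.val, hI, hcon] at hz
    have : todo = [] := by
      rw [List.length_append] at hlenW
      exact List.length_eq_zero_iff.1 (by omega)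
    subst this
    refine ⟨by simp [Term.cost], done, by simpa using hseg, hinv, hc1, hc2, hq, hql,
      by simpa using hlen⟩

end RAM

/-! ### Sums of children -/

/-- Addition modulo `M` on `0, …, M - 1`, without intermediate results beyond `M`. -/
def addM (M a b : ℕ) : ℕ :=
  if a < M - b then M - (M - b - a) else a - (M - b)

/-- Subtraction modulo `M` on `0, …, M - 1`. -/
def subM (M a b : ℕ) : ℕ :=
  if a < b then M - (b - a) else a - b

/-- The number `s < M` is the sum of the elements of `K` modulo `M`. -/
def SumsTo (M : ℕ) (K : Finset ℕ) (s : ℕ) : Prop :=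
  s < M ∧ (s : ZMod M) = ∑ c ∈ K, (c : ZMod M)

namespace SumsTo

variable {M s : ℕ} {K : Finset ℕ}

theorem addM_lt {a b : ℕ} (ha : a < M) (hb : b < M) :
    addM M a b < M ∧ (addM M a b : ZMod M) = a + b := by
  unfold addM
  split_ifs with h
  · refine ⟨by omega, ?_⟩
    rw [← Nat.cast_add]
    congr 1
    omega
  · refine ⟨by omega, ?_⟩
    have h1 : a + b = (a - (M - b)) + M := by omega
    rw [← Nat.cast_add, h1, Nat.cast_add, ZMod.natCast_self, add_zero]

theorem subM_lt {a b : ℕ} (ha : a < M) (hb : b < M) :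
    subM M a b < M ∧ (subM M a b : ZMod M) = a - b := by
  unfold subM
  split_ifs with h
  · refine ⟨by omega, ?_⟩
    rw [eq_sub_iff_add_eq, ← Nat.cast_add, show M - (b - a) + b = a + M by omega, Nat.cast_add,
      ZMod.natCast_self, add_zero]
  · refine ⟨by omega, ?_⟩
    rw [Nat.cast_sub (by omega)]

theorem empty (hM : 0 < M) : SumsTo M ∅ 0 := ⟨hM, by simp⟩

theorem insert (h : SumsTo M K s) {a : ℕ} (ha : a ∉ K) (haM : a < M) :
    SumsTo M (insert a K) (addM M s a) := by
  obtain ⟨h1, h2⟩ := addM_lt h.1 haM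
  exact ⟨h1, by rw [h2, h.2, Finset.sum_insert ha, add_comm]⟩

theorem singleton {a : ℕ} (ha : a < M) : SumsTo M {a} a := ⟨ha, by simp⟩

theorem sdiff (h : SumsTo M K s) {F : Finset ℕ} {s' : ℕ} (h' : SumsTo M F s') (hF : F ⊆ K) :
    SumsTo M (K \ F) (subM M s s') := by
  obtain ⟨h1, h2⟩ := subM_lt h.1 h'.1
  exact ⟨h1, by rw [h2, h.2, h'.2, ← Finset.sum_sdiff hF, add_sub_cancel_right]⟩

theorem erase (h : SumsTo M K s) {a : ℕ} (ha : a ∈ K) (haM : a < M) :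
    SumsTo M (K.erase a) (subM M s a) := by
  rw [Finset.erase_eq]
  exact h.sdiff (singleton haM) (by simpa using ha)

theorem eq_of_singleton {a : ℕ} (h : SumsTo M {a} s) (ha : a < M) : s = a := by
  have h1 := h.2
  rw [Finset.sum_singleton, ZMod.natCast_eq_natCast_iff', Nat.mod_eq_of_lt h.1,
    Nat.mod_eq_of_lt ha] at h1
  exact h1

end SumsTo

/-! ### The data stored for a tree -/

/-- The stored labels, numbers of children and sums of children agree with the tree. The inner nodes
are named by numbers between `z` and `N`, the label `3` marks leaves and the node `z` above the root;
the number of children of `z` is stored as `2`, so that `z` never seems to be full. -/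
structure Stored (e : ℕ → ℕ → ℕ) (V I : Finset ℕ) (z M N : ℕ) (par lab num sum : ℕ → ℕ)
    (D : ℕ → Finset ℕ) : Prop where
  tree : IsTree e V I z par lab D
  lab_top : lab z = 3
  lab_leaf : ∀ v ∈ V, lab v = 3
  lab_le : ∀ t ∈ I, lab t ≤ 2
  inner : ∀ t ∈ I, z < t ∧ t < N
  vert : ∀ v ∈ V, v < z
  top_lt : z < N
  par_top : par z = M
  par_bound : par M = M
  num_top : num z = 2
  num_eq : ∀ q ∈ I, num q = (kids V I par q).card
  sum_eq : ∀ q, q = z ∨ q ∈ I → SumsTo M (kids V I par q) (sum q)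

theorem IsTree.congr_lab {e : ℕ → ℕ → ℕ} {V I : Finset ℕ} {z : ℕ} {par lab lab' : ℕ → ℕ}
    {D : ℕ → Finset ℕ} (h : IsTree e V I z par lab D) (hl : ∀ t, t = z ∨ t ∈ I → lab' t = lab t) :
    IsTree e V I z par lab' D :=
  { h with
    sibling := fun c c' hc hc' hne hp u hu v hv => by
      rw [hl _ (h.par_mem c hc)]
      exact h.sibling c c' hc hc' hne hp u hu v hv }

namespace Stored

open IsTree (Unif Mixed Live)

variable {e : ℕ → ℕ → ℕ} {V I : Finset ℕ} {z M N : ℕ} {par lab num sum : ℕ → ℕ}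
  {D : ℕ → Finset ℕ}

theorem node_lt (h : Stored e V I z M N par lab num sum D) {t : ℕ} (ht : t ∈ V ∨ t ∈ I) :
    t < N ∧ t ≠ z := by
  have := h.top_lt
  rcases ht with ht | ht
  · have := h.vert t ht
    omega
  · have := h.inner t ht
    omega

theorem par_lt (h : Stored e V I z M N par lab num sum D) {t : ℕ} (ht : t ∈ V ∨ t ∈ I) :
    par t < N ∧ z ≤ par t := by
  have := h.top_lt
  rcases h.tree.par_mem t ht with h1 | h1
  · omega
  · have := h.inner _ h1
    omega

/-- The new leaf `x` is put below the inner node `c`. -/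
theorem attachLeaf (h : Stored e V I z M N par lab num sum D) (hM : N ≤ M)
    (hcomm : ∀ u v, e u v = e v u)
    {x c : ℕ} (hx : x < z) (hxV : x ∉ V) (hc : c ∈ I) (hu : Unif e D x c (lab c))
    (hanc : ∀ c', c' ∈ V ∨ c' ∈ I → D c ⊆ D c' → ∀ c'', c'' ∈ V ∨ c'' ∈ I → c'' ≠ c' →
      par c'' = par c' → Unif e D x c'' (lab (par c')))
    (hred : ∀ t ∈ I, lab t ≠ lab (par t)) {par' lab' num' sum' : ℕ → ℕ}
    (hpar : par' = Function.update par x c) (hlab : lab' = Function.update lab x 3)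
    (hnum : num' = Function.update num c (num c + 1))
    (hsum : sum' = Function.update sum c (addM M (sum c) x)) :
    ∃ D', Stored e (insert x V) I z M N par' lab' num' sum' D' ∧
      ∀ t ∈ I, lab' t ≠ lab' (par' t) := by
  have hxI : x ∉ I := fun hxI => by have := h.inner x hxI; omega
  have hcb := h.inner c hc
  have hne : ∀ t, t ∈ V ∨ t ∈ I → t ≠ x := by
    rintro t (ht | ht) rfl <;> contradiction
  have hp : ∀ t, t ∈ V ∨ t ∈ I → par' t = par t := fun t ht => by
    rw [hpar, Function.update_of_ne (hne t ht)]
  have hpx : par' x = c := by rw [hpar, Function.update_self]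
  have hl : ∀ t, t ≠ x → lab' t = lab t := fun t ht => by rw [hlab, Function.update_of_ne ht]
  have hlz : ∀ t, t = z ∨ t ∈ I → lab' t = lab t := by
    rintro t (ht | ht)
    · exact hl t (by omega)
    · exact hl t (hne t (.inr ht))
  obtain ⟨D', hD'⟩ := h.tree.addLeaf hcomm hxV hxI (by omega) hc hu hanc hpx hp
  have hk : ∀ q, kids (insert x V) I par' q =
      if q = c then insert x (kids V I par c) else kids V I par q := by
    intro q
    ext t
    split_ifs <;> simp only [mem_kids, Finset.mem_insert] <;> grind
  have hxk : x ∉ kids V I par c := by simp [mem_kids, hxV, hxI]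
  refine ⟨D', ⟨hD'.congr_lab hlz, by rw [hlz z (.inl rfl), h.lab_top], ?_, ?_, h.inner, ?_,
    h.top_lt, ?_, ?_, ?_, ?_, ?_⟩, ?_⟩
  · intro v hv
    rcases Finset.mem_insert.1 hv with rfl | hv
    · rw [hlab, Function.update_self]
    · rw [hl v (hne v (.inl hv)), h.lab_leaf v hv]
  · intro t ht
    rw [hlz t (.inr ht)]
    exact h.lab_le t ht
  · intro v hv
    rcases Finset.mem_insert.1 hv with rfl | hv
    · exact hx
    · exact h.vert v hv
  · rw [hpar, Function.update_of_ne (by omega), h.par_top]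
  · rw [hpar, Function.update_of_ne (by omega), h.par_bound]
  · rw [hnum, Function.update_of_ne (by omega), h.num_top]
  · intro q hq
    rw [hk, hnum, Function.update_apply]
    split_ifs with hqc
    · rw [Finset.card_insert_of_notMem hxk, h.num_eq c hc]
    · exact h.num_eq q hq
  · intro q hq
    rw [hk, hsum, Function.update_apply]
    split_ifs with hqc
    · exact (h.sum_eq c (.inr hc)).insert hxk (by omega)
    · exact h.sum_eq q hq
  · intro t ht
    rw [hlz t (.inr ht), hp t (.inr ht), hlz _ (h.tree.par_mem t (.inr ht))]
    exact hred t ht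

/-- A new inner node with label `k` takes the place of `c`; its children are `c` and the new leaf
`x`. -/
theorem attachParent (h : Stored e V I z M N par lab num sum D) (hM : N < M)
    (hcomm : ∀ u v, e u v = e v u)
    {x c k : ℕ} (hx : x < z) (hxV : x ∉ V) (hc : c ∈ V ∨ c ∈ I) (hu : Unif e D x c k) (hk2 : k ≤ 2)
    (hanc : ∀ c', c' ∈ V ∨ c' ∈ I → D c ⊆ D c' → ∀ c'', c'' ∈ V ∨ c'' ∈ I → c'' ≠ c' →
      par c'' = par c' → Unif e D x c'' (lab (par c')))
    (hred : ∀ t ∈ I, t ≠ c → lab t ≠ lab (par t)) (hkc : lab c ≠ k) (hkp : k ≠ lab (par c))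
    {par' lab' num' sum' : ℕ → ℕ}
    (hpar : par' = Function.update (Function.update (Function.update par N (par c)) c N) x N)
    (hlab : lab' = Function.update (Function.update lab x 3) N k)
    (hnum : num' = Function.update num N 2)
    (hsum : sum' = Function.update (Function.update sum (par c)
      (addM M (subM M (sum (par c)) c) N)) N (addM M c x)) :
    ∃ D', Stored e (insert x V) (insert N I) z M (N + 1) par' lab' num' sum' D' ∧
      ∀ t ∈ insert N I, lab' t ≠ lab' (par' t) := by
  have hzN := h.top_lt
  have hxI : x ∉ I := fun hxI => by have := h.inner x hxI; omega
  have hNI : N ∉ I := fun hNI => by have := h.inner N hNI; omega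
  have hNV : N ∉ V := fun hNV => by have := h.vert N hNV; omega
  have hcb := h.node_lt hc
  have hpb := h.par_lt hc
  have hne : ∀ t, t ∈ V ∨ t ∈ I → t ≠ x ∧ t ≠ N := by
    rintro t (ht | ht) <;> constructor <;> rintro rfl <;> contradiction
  have hcx := (hne c hc).1
  have hp : ∀ t, t ≠ x → t ≠ N → t ≠ c → par' t = par t := fun t h1 h2 h3 => by
    simp [hpar, h1, h2, h3]
  have hpx : par' x = N := by rw [hpar, Function.update_self]
  have hpc : par' c = N := by rw [hpar, Function.update_of_ne hcx, Function.update_self]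
  have hpN : par' N = par c := by
    rw [hpar, Function.update_of_ne (by omega), Function.update_of_ne (by omega),
      Function.update_self]
  have hlN : lab' N = k := by rw [hlab, Function.update_self]
  have hl : ∀ t, t ≠ x → t ≠ N → lab' t = lab t := fun t h1 h2 => by
    rw [hlab, Function.update_of_ne h2, Function.update_of_ne h1]
  have hlz : ∀ t, t = z ∨ t ∈ I → lab' t = lab t := by
    rintro t (ht | ht)
    · exact hl t (by omega) (by omega)
    · exact hl t (hne t (.inr ht)).1 (hne t (.inr ht)).2
  obtain ⟨D', hD'⟩ := h.tree.addParent hcomm hxV hxI (by omega) hNV hNI (by omega) (by omega) hc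
    (by rw [hlN]; exact hu) hanc hpx hpc hpN
    (fun t ht htc => hp t (hne t ht).1 (hne t ht).2 htc) hlz
  have hxk : ∀ q, x ∉ kids V I par q := by simp [mem_kids, hxV, hxI]
  have hNk : ∀ q, N ∉ kids V I par q := by simp [mem_kids, hNV, hNI]
  have hck : c ∈ kids V I par (par c) := mem_kids.2 ⟨hc, rfl⟩
  have hkN : kids (insert x V) (insert N I) par' N = {c, x} := by
    ext t
    have := h.par_lt (t := t)
    simp only [mem_kids, Finset.mem_insert, Finset.mem_singleton]
    grind
  have hkpar : kids (insert x V) (insert N I) par' (par c) =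
      insert N ((kids V I par (par c)).erase c) := by
    ext t
    have := h.par_lt (t := t)
    simp only [mem_kids, Finset.mem_insert, Finset.mem_erase]
    grind
  have hko : ∀ q, q ≠ N → q ≠ par c →
      kids (insert x V) (insert N I) par' q = kids V I par q := by
    intro q hqN hqp
    ext t
    have := h.par_lt (t := t)
    simp only [mem_kids, Finset.mem_insert]
    grind
  refine ⟨D', ⟨hD', by rw [hlz z (.inl rfl), h.lab_top], ?_, ?_, ?_, ?_, by omega, ?_, ?_, ?_,
    ?_, ?_⟩, ?_⟩
  · intro v hv
    rcases Finset.mem_insert.1 hv with rfl | hv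
    · rw [hlab, Function.update_of_ne (by omega), Function.update_self]
    · rw [hl v (hne v (.inl hv)).1 (hne v (.inl hv)).2, h.lab_leaf v hv]
  · intro t ht
    rcases Finset.mem_insert.1 ht with rfl | ht
    · omega
    · rw [hlz t (.inr ht)]
      exact h.lab_le t ht
  · intro t ht
    rcases Finset.mem_insert.1 ht with rfl | ht
    · omega
    · have := h.inner t ht
      omega
  · intro v hv
    rcases Finset.mem_insert.1 hv with rfl | hv
    · exact hx
    · exact h.vert v hv
  · rw [hp z (by omega) (by omega) (Ne.symm hcb.2), h.par_top]
  · rw [hp M (by omega) (by omega) (by omega), h.par_bound]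
  · rw [hnum, Function.update_of_ne (by omega), h.num_top]
  · intro q hq
    by_cases hqN : q = N
    · subst hqN
      rw [hkN, hnum, Function.update_self, Finset.card_pair hcx]
    · rw [hnum, Function.update_of_ne hqN, h.num_eq q (Finset.mem_of_mem_insert_of_ne hq hqN)]
      by_cases hqp : q = par c
      · subst hqp
        rw [hkpar, Finset.card_insert_of_notMem (by simp [hNk]), Finset.card_erase_add_one hck]
      · rw [hko q hqN hqp]
  · intro q hq
    by_cases hqN : q = N
    · subst hqN
      rw [hkN, hsum, Function.update_self, Finset.pair_comm]
      exact (SumsTo.singleton (by omega)).insert (by simpa using hcx.symm) (by omega)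
    · have hq' : q = z ∨ q ∈ I := hq.imp_right fun hq => Finset.mem_of_mem_insert_of_ne hq hqN
      rw [hsum, Function.update_of_ne hqN]
      by_cases hqp : q = par c
      · subst hqp
        rw [hkpar, Function.update_self]
        exact ((h.sum_eq _ hq').erase hck (by omega)).insert (by simp [hNk]) hM
      · rw [hko q hqN hqp, Function.update_of_ne hqp]
        exact h.sum_eq q hq'
  · intro t ht
    rcases Finset.mem_insert.1 ht with rfl | ht
    · rw [hpN, hlN, hl (par c) (by omega) (by omega)]
      exact hkp
    · rw [hlz t (.inr ht)]
      by_cases htc : t = c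
      · rw [htc, hpc, hlN]
        exact hkc
      · rw [hp t (hne t (.inr ht)).1 (hne t (.inr ht)).2 htc, hlz _ (h.tree.par_mem t (.inr ht))]
        exact hred t ht htc

end Stored

/-! ### The place of the new leaf -/

namespace Stored

open IsTree (Unif Mixed Live)

variable {e : ℕ → ℕ → ℕ} {V I : Finset ℕ} {z M N : ℕ} {par lab num sum : ℕ → ℕ}
  {D : ℕ → Finset ℕ}

/-- The new leaf `x`, of type `k`, can be put at the node `c`: it has type `k` below `c`, and its
types next to the path from `c` to the root are the labels on that path. -/
structure Ready (e : ℕ → ℕ → ℕ) (V I : Finset ℕ) (par lab : ℕ → ℕ) (D : ℕ → Finset ℕ) (x c k : ℕ) :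
    Prop where
  mem : c ∈ V ∨ c ∈ I
  unif : Unif e D x c k
  le_two : k ≤ 2
  above : ∀ c', c' ∈ V ∨ c' ∈ I → D c ⊆ D c' → ∀ c'', c'' ∈ V ∨ c'' ∈ I → c'' ≠ c' →
      par c'' = par c' → Unif e D x c'' (lab (par c'))
  red : ∀ t ∈ I, t ≠ c → lab t ≠ lab (par t)
  ne_par : k ≠ lab (par c)

/-- The new leaf `x` belongs next to the children of `p` in `S`, where it has the type `k`; for the
other children of `p` its type is the label of `p`. The node `p` may be the node above the root. -/
structure Place (e : ℕ → ℕ → ℕ) (V I : Finset ℕ) (z : ℕ) (par lab : ℕ → ℕ) (D : ℕ → Finset ℕ)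
    (x p : ℕ) (S : Finset ℕ) (k : ℕ) : Prop where
  le_two : k ≤ 2
  ne_lab : k ≠ lab p
  sub : S ⊆ kids V I par p
  nonempty : S.Nonempty
  unif : ∀ c ∈ S, Unif e D x c k
  other : ∀ c ∈ kids V I par p, c ∉ S → Unif e D x c (lab p)
  top : p = z ∨ p ∈ I ∧ (kids V I par p \ S).Nonempty

theorem Place.mixed (hT : IsTree e V I z par lab D) {x p k : ℕ} {S : Finset ℕ}
    (h : Place e V I z par lab D x p S k) : p = z ∨ Mixed e D x p := by
  refine h.top.imp_right fun ⟨_, c, hc⟩ => ?_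
  rw [Finset.mem_sdiff] at hc
  obtain ⟨c', hc'⟩ := h.nonempty
  obtain ⟨hcN, hcp⟩ := mem_kids.1 hc.1
  obtain ⟨hcN', hcp'⟩ := mem_kids.1 (h.sub hc')
  obtain ⟨u, hu⟩ := hT.nonempty c hcN
  obtain ⟨v, hv⟩ := hT.nonempty c' hcN'
  refine ⟨u, hcp ▸ hT.subset_par hcN hu, v, hcp' ▸ hT.subset_par hcN' hv, ?_⟩
  rw [h.other c hc.1 hc.2 u hu, h.unif c' hc' v hv]
  exact h.ne_lab.symm

theorem Place.card_le_one (hT : IsTree e V I z par lab D) {x p k : ℕ} {S : Finset ℕ}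
    (h : Place e V I z par lab D x p S k) (hp : p ∉ I) : S.card ≤ 1 := by
  obtain rfl : p = z := h.top.resolve_right fun h' => hp h'.1
  refine Finset.card_le_one.2 fun a ha b hb => ?_
  have ha := mem_kids.1 (h.sub ha)
  have hb := mem_kids.1 (h.sub hb)
  exact hT.one a b ha.1 hb.1 ha.2 hb.2

theorem Place.ready_single (hT : IsTree e V I z par lab D) {E : Set ℕ} (hE : IsSymbolic e E)
    (hVE : ∀ v ∈ V, v ∈ E) {x : ℕ} (hxE : x ∈ E) (hxV : x ∉ V)
    (hred : ∀ t ∈ I, lab t ≠ lab (par t)) {p c k : ℕ}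
    (h : Place e V I z par lab D x p {c} k) : Ready e V I par lab D x c k := by
  obtain ⟨hc, hcp⟩ := mem_kids.1 (h.sub (Finset.mem_singleton_self c))
  refine ⟨hc, h.unif c (by simp), h.le_two, ?_, fun t ht _ => hred t ht, by rw [hcp]; exact h.ne_lab⟩
  refine hT.types_above hE hVE hxE hxV hc (fun t ht _ => hred t ht) ?_ (by rw [hcp]; exact h.mixed hT)
  intro c' hc' hne hp
  rw [hcp]
  exact h.other c' (mem_kids.2 ⟨hc', hp.trans hcp⟩) (by simpa using hne)

/-- Several children of `p` with a common type are put below a new child of `p`. -/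
theorem group_below (h : Stored e V I z M N par lab num sum D) (hM : N < M) {E : Set ℕ}
    (hE : IsSymbolic e E) (hVE : ∀ v ∈ V, v ∈ E) {x : ℕ} (hxE : x ∈ E) (hxV : x ∉ V)
    (hred : ∀ t ∈ I, lab t ≠ lab (par t)) {p k s : ℕ} {F : Finset ℕ}
    (hp : Place e V I z par lab D x p F k) (hF : F.card ≠ 1) (hs : SumsTo M F s)
    {par' lab' num' sum' : ℕ → ℕ}
    (hpar : par' = Function.update (fun t => if t ∈ F then N else par t) N p)
    (hlab : lab' = Function.update lab N (lab p))
    (hnum : num' = Function.update (Function.update num N F.card) p (num p - F.card + 1))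
    (hsum : sum' = Function.update (Function.update sum N s) p
      (addM M (subM M (sum p) s) N)) :
    ∃ D', Stored e V (insert N I) z M (N + 1) par' lab' num' sum' D' ∧
      Ready e V (insert N I) par' lab' D' x N k := by
  have hzN := h.top_lt
  have hpI : p ∈ I := by
    by_contra hpI
    have := hp.card_le_one h.tree hpI
    have := hp.nonempty.card_pos
    omega
  have hNI : N ∉ I := fun hNI => by have := h.inner N hNI; omega
  have hNV : N ∉ V := fun hNV => by have := h.vert N hNV; omega
  have hpb := h.inner p hpI
  have hne : ∀ t, t ∈ V ∨ t ∈ I → t ≠ N := by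
    rintro t (ht | ht) rfl <;> contradiction
  have hFm : ∀ c ∈ F, (c ∈ V ∨ c ∈ I) ∧ par c = p := fun c hc => mem_kids.1 (hp.sub hc)
  have hNF : N ∉ F := fun hN => hne N (hFm N hN).1 rfl
  have hpF : ∀ c ∈ F, par' c = N := fun c hc => by
    rw [hpar, Function.update_of_ne (hne c (hFm c hc).1), if_pos hc]
  have hpN : par' N = p := by rw [hpar, Function.update_self]
  have hpo : ∀ t, t ≠ N → t ∉ F → par' t = par t := fun t h1 h2 => by
    rw [hpar, Function.update_of_ne h1, if_neg h2]
  have hlN : lab' N = lab p := by rw [hlab, Function.update_self]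
  have hlo : ∀ t, t ≠ N → lab' t = lab t := fun t h1 => by rw [hlab, Function.update_of_ne h1]
  have hlz : ∀ t, t = z ∨ t ∈ I → lab' t = lab t := by
    rintro t (ht | ht)
    · exact hlo t (by omega)
    · exact hlo t (hne t (.inr ht))
  have hzF : z ∉ F := fun hzF => (h.node_lt (hFm z hzF).1).2 rfl
  have hMF : M ∉ F := fun hMF => by have := (h.node_lt (hFm M hMF).1).1; omega
  obtain ⟨hpI', c₁, hc₁⟩ := hp.top.resolve_left (by rintro rfl; omega)
  rw [Finset.mem_sdiff, mem_kids] at hc₁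
  have hF2 : ∃ c ∈ F, ∃ c' ∈ F, c ≠ c' := by
    have : 1 < F.card := by have := hp.nonempty.card_pos; omega
    obtain ⟨a, ha, b, hb, hab⟩ := Finset.one_lt_card.1 this
    exact ⟨a, ha, b, hb, hab⟩
  have hT := h.tree.groupBelow hpI hNV hNI (by omega) hFm hF2 ⟨c₁, hc₁.1.1, hc₁.1.2, hc₁.2⟩
    hpF hpN (fun t ht htF => hpo t (hne t ht) htF) hlN hlz
  have hD : ∀ t, t ≠ N → Function.update D N (F.biUnion D) t = D t := fun t ht =>
    Function.update_of_ne ht _ _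
  have hNk : ∀ q, N ∉ kids V I par q := by simp [mem_kids, hNV, hNI]
  have hkN : kids V (insert N I) par' N = F := by
    ext t
    have := h.par_lt (t := t)
    simp only [mem_kids, Finset.mem_insert]
    grind
  have hkp : kids V (insert N I) par' p = insert N (kids V I par p \ F) := by
    ext t
    simp only [mem_kids, Finset.mem_insert, Finset.mem_sdiff]
    grind
  have hko : ∀ q, q ≠ N → q ≠ p → kids V (insert N I) par' q = kids V I par q := by
    intro q hqN hqp
    ext t
    simp only [mem_kids, Finset.mem_insert]
    grind
  have hredN : ∀ t ∈ I, lab' t ≠ lab' (par' t) := by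
    intro t ht
    have := h.tree.par_mem t (.inr ht)
    grind
  refine ⟨_, ⟨hT, by rw [hlz z (.inl rfl), h.lab_top], ?_, ?_, ?_, h.vert, by omega, ?_, ?_, ?_,
    ?_, ?_⟩, ?_⟩
  · intro v hv
    rw [hlo v (hne v (.inl hv)), h.lab_leaf v hv]
  · intro t ht
    rcases Finset.mem_insert.1 ht with rfl | ht
    · rw [hlN]
      exact h.lab_le p hpI
    · rw [hlz t (.inr ht)]
      exact h.lab_le t ht
  · intro t ht
    rcases Finset.mem_insert.1 ht with rfl | ht
    · omega
    · have := h.inner t ht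
      omega
  · rw [hpo z (by omega) hzF, h.par_top]
  · rw [hpo M (by omega) hMF, h.par_bound]
  · rw [hnum, Function.update_of_ne (by omega), Function.update_of_ne (by omega), h.num_top]
  · intro q hq
    by_cases hqN : q = N
    · subst hqN
      rw [hkN, hnum, Function.update_of_ne (by omega), Function.update_self]
    · by_cases hqp : q = p
      · subst hqp
        rw [hkp, hnum, Function.update_self, Finset.card_insert_of_notMem (by simp [hNk]),
          Finset.card_sdiff_of_subset hp.sub, h.num_eq q hpI]
      · rw [hko q hqN hqp, hnum, Function.update_of_ne hqp, Function.update_of_ne hqN]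
        exact h.num_eq q (Finset.mem_of_mem_insert_of_ne hq hqN)
  · intro q hq
    by_cases hqN : q = N
    · subst hqN
      rw [hkN, hsum, Function.update_of_ne (by omega), Function.update_self]
      exact hs
    · by_cases hqp : q = p
      · subst hqp
        rw [hkp, hsum, Function.update_self]
        exact ((h.sum_eq q (.inr hpI)).sdiff hs hp.sub).insert (by simp [hNk]) hM
      · rw [hko q hqN hqp, hsum, Function.update_of_ne hqp, Function.update_of_ne hqN]
        exact h.sum_eq q (hq.imp_right fun hq => Finset.mem_of_mem_insert_of_ne hq hqN)
  · have hother : ∀ c, c ∈ V ∨ c ∈ insert N I → c ≠ N → par' c = par' N →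
        Unif e (Function.update D N (F.biUnion D)) x c (lab' (par' N)) := by
      intro c hc hcN hcp
      have hc' : c ∈ kids V (insert N I) par' p := mem_kids.2 ⟨hc, hcp.trans hpN⟩
      rw [hkp, Finset.mem_insert, Finset.mem_sdiff] at hc'
      have h1 := hc'.resolve_left hcN
      rw [hpN, hlo p (by omega)]
      unfold Unif
      rw [hD c hcN]
      exact hp.other c h1.1 h1.2
    have hred' : ∀ t ∈ insert N I, t ≠ N → lab' t ≠ lab' (par' t) := fun t ht htN =>
      hredN t (Finset.mem_of_mem_insert_of_ne ht htN)
    refine ⟨by simp, ?_, hp.le_two, ?_, hred', by rw [hpN, hlo p (by omega)]; exact hp.ne_lab⟩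
    · intro u hu
      rw [Function.update_self, Finset.mem_biUnion] at hu
      obtain ⟨c, hc, hu⟩ := hu
      exact hp.unif c hc u hu
    · refine hT.types_above hE hVE hxE hxV (by simp) hred' hother ?_
      rw [hpN]
      refine (hp.mixed h.tree).imp_right fun hm => ?_
      unfold Mixed
      rw [hD p (by omega)]
      exact hm

set_option maxHeartbeats 1000000 in
/-- All but several children of `p` with a common type are moved to a new node that takes the place
of `p`. -/
theorem group_above (h : Stored e V I z M N par lab num sum D) (hM : N < M) {E : Set ℕ}
    (hE : IsSymbolic e E) (hVE : ∀ v ∈ V, v ∈ E) {x : ℕ} (hxE : x ∈ E) (hxV : x ∉ V)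
    (hred : ∀ t ∈ I, lab t ≠ lab (par t)) {p k s : ℕ} {F : Finset ℕ} (hFk : F ⊆ kids V I par p)
    (hp : Place e V I z par lab D x p (kids V I par p \ F) k)
    (hF : (kids V I par p \ F).card ≠ 1) (hs : SumsTo M F s)
    {par' lab' num' sum' : ℕ → ℕ}
    (hpar : par' = Function.update (Function.update (fun t => if t ∈ F then N else par t) N (par p))
      p N)
    (hlab : lab' = Function.update lab N (lab p))
    (hnum : num' = Function.update (Function.update num N (F.card + 1)) p
      (kids V I par p \ F).card)
    (hsum : sum' = Function.update (Function.update (Function.update sum p (subM M (sum p) s)) N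
      (addM M s p)) (par p) (addM M (subM M (sum (par p)) p) N)) :
    ∃ D', Stored e V (insert N I) z M (N + 1) par' lab' num' sum' D' ∧
      Ready e V (insert N I) par' lab' D' x p k := by
  have hzN := h.top_lt
  have hpI : p ∈ I := by
    by_contra hpI
    have := hp.card_le_one h.tree hpI
    have := hp.nonempty.card_pos
    omega
  have hNI : N ∉ I := fun hNI => by have := h.inner N hNI; omega
  have hNV : N ∉ V := fun hNV => by have := h.vert N hNV; omega
  have hpb := h.inner p hpI
  have hub := h.par_lt (.inr hpI)
  have hup := h.tree.par_ne_self (.inr hpI)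
  have hne : ∀ t, t ∈ V ∨ t ∈ I → t ≠ N := by
    rintro t (ht | ht) rfl <;> contradiction
  have hFm : ∀ c ∈ F, (c ∈ V ∨ c ∈ I) ∧ par c = p := fun c hc => mem_kids.1 (hFk hc)
  have hNF : N ∉ F := fun hN => hne N (hFm N hN).1 rfl
  have hpnF : p ∉ F := fun hpF => hup (hFm p hpF).2
  have hpF : ∀ c ∈ F, par' c = N := fun c hc => by
    rw [hpar, Function.update_of_ne (by rintro rfl; contradiction),
      Function.update_of_ne (hne c (hFm c hc).1), if_pos hc]
  have hpp : par' p = N := by rw [hpar, Function.update_self]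
  have hpN : par' N = par p := by
    rw [hpar, Function.update_of_ne (by omega), Function.update_self]
  have hpo : ∀ t, t ≠ N → t ≠ p → t ∉ F → par' t = par t := fun t h1 h2 h3 => by
    rw [hpar, Function.update_of_ne h2, Function.update_of_ne h1, if_neg h3]
  have hlN : lab' N = lab p := by rw [hlab, Function.update_self]
  have hlo : ∀ t, t ≠ N → lab' t = lab t := fun t h1 => by rw [hlab, Function.update_of_ne h1]
  have hlz : ∀ t, t = z ∨ t ∈ I → lab' t = lab t := by
    rintro t (ht | ht)
    · exact hlo t (by omega)
    · exact hlo t (hne t (.inr ht))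
  have hzF : z ∉ F := fun hzF => (h.node_lt (hFm z hzF).1).2 rfl
  have hMF : M ∉ F := fun hMF => by have := (h.node_lt (hFm M hMF).1).1; omega
  have hSF : kids V I par p \ (kids V I par p \ F) = F := Finset.sdiff_sdiff_eq_self hFk
  obtain ⟨-, hFne⟩ := hp.top.resolve_left (by rintro rfl; omega)
  rw [hSF] at hFne
  have hF2 : ∃ c c', c ≠ c' ∧ ((c ∈ V ∨ c ∈ I) ∧ par c = p ∧ c ∉ F) ∧
      (c' ∈ V ∨ c' ∈ I) ∧ par c' = p ∧ c' ∉ F := by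
    have : 1 < (kids V I par p \ F).card := by have := hp.nonempty.card_pos; omega
    obtain ⟨a, ha, b, hb, hab⟩ := Finset.one_lt_card.1 this
    rw [Finset.mem_sdiff, mem_kids] at ha hb
    exact ⟨a, b, hab, ⟨ha.1.1, ha.1.2, ha.2⟩, hb.1.1, hb.1.2, hb.2⟩
  have hT := h.tree.pullAbove hpI hNV hNI (by omega) hFm hFne hF2
    hpF hpp hpN (fun t ht htF htp => hpo t (hne t ht) htp htF) hlN hlz
  obtain ⟨D', hD'⟩ : ∃ D', D' = Function.update (Function.update D N (D p)) p
    (D p \ F.biUnion D) := ⟨_, rfl⟩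
  rw [← hD'] at hT
  have hD : ∀ t, t ≠ N → t ≠ p → D' t = D t := fun t ht htp => by
    rw [hD', Function.update_of_ne htp, Function.update_of_ne ht]
  have hDN : D' N = D p := by rw [hD', Function.update_of_ne (by omega), Function.update_self]
  have hNk : ∀ q, N ∉ kids V I par q := by simp [mem_kids, hNV, hNI]
  have hpk : p ∈ kids V I par (par p) := mem_kids.2 ⟨.inr hpI, rfl⟩
  have hkN : kids V (insert N I) par' N = insert p F := by
    ext t
    have := h.par_lt (t := t)
    simp only [mem_kids, Finset.mem_insert]
    grind
  have hkp : kids V (insert N I) par' p = kids V I par p \ F := by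
    ext t
    simp only [mem_kids, Finset.mem_insert, Finset.mem_sdiff]
    grind
  have hku : kids V (insert N I) par' (par p) = insert N ((kids V I par (par p)).erase p) := by
    ext t
    simp only [mem_kids, Finset.mem_insert, Finset.mem_erase]
    grind
  have hko : ∀ q, q ≠ N → q ≠ p → q ≠ par p →
      kids V (insert N I) par' q = kids V I par q := by
    intro q hqN hqp hqu
    ext t
    simp only [mem_kids, Finset.mem_insert]
    grind
  have hredN : ∀ t ∈ insert N I, t ≠ p → lab' t ≠ lab' (par' t) := by
    intro t ht htp
    rcases Finset.mem_insert.1 ht with rfl | ht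
    · rw [hlN, hpN, hlz _ (h.tree.par_mem p (.inr hpI))]
      exact hred p hpI
    · have := h.tree.par_mem t (.inr ht)
      by_cases htF : t ∈ F <;> grind
  refine ⟨D', ⟨hT, by rw [hlz z (.inl rfl), h.lab_top], ?_, ?_, ?_, h.vert, by omega, ?_, ?_, ?_,
    ?_, ?_⟩, ?_⟩
  · intro v hv
    rw [hlo v (hne v (.inl hv)), h.lab_leaf v hv]
  · intro t ht
    rcases Finset.mem_insert.1 ht with rfl | ht
    · rw [hlN]
      exact h.lab_le p hpI
    · rw [hlz t (.inr ht)]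
      exact h.lab_le t ht
  · intro t ht
    rcases Finset.mem_insert.1 ht with rfl | ht
    · omega
    · have := h.inner t ht
      omega
  · rw [hpo z (by omega) (by omega) hzF, h.par_top]
  · rw [hpo M (by omega) (by omega) hMF, h.par_bound]
  · rw [hnum, Function.update_of_ne (by omega), Function.update_of_ne (by omega), h.num_top]
  · intro q hq
    by_cases hqp : q = p
    · subst hqp
      rw [hkp, hnum, Function.update_self]
    · rw [hnum, Function.update_of_ne hqp]
      by_cases hqN : q = N
      · subst hqN
        rw [hkN, Function.update_self, Finset.card_insert_of_notMem hpnF]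
      · rw [Function.update_of_ne hqN, h.num_eq q (Finset.mem_of_mem_insert_of_ne hq hqN)]
        by_cases hqu : q = par p
        · subst hqu
          rw [hku, Finset.card_insert_of_notMem (by simp [hNk]), Finset.card_erase_add_one hpk]
        · rw [hko q hqN hqp hqu]
  · intro q hq
    by_cases hqu : q = par p
    · subst hqu
      rw [hku, hsum, Function.update_self]
      exact ((h.sum_eq _ (h.tree.par_mem p (.inr hpI))).erase hpk (by omega)).insert
        (by simp [hNk]) hM
    · rw [hsum, Function.update_of_ne hqu]
      by_cases hqN : q = N
      · subst hqN
        rw [hkN, Function.update_self]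
        exact hs.insert hpnF (by omega)
      · rw [Function.update_of_ne hqN]
        by_cases hqp : q = p
        · subst hqp
          rw [hkp, Function.update_self]
          exact (h.sum_eq q (.inr hpI)).sdiff hs hFk
        · rw [hko q hqN hqp hqu, Function.update_of_ne hqp]
          exact h.sum_eq q (hq.imp_right fun hq => Finset.mem_of_mem_insert_of_ne hq hqN)
  · have hother : ∀ c, c ∈ V ∨ c ∈ insert N I → c ≠ p → par' c = par' p →
        Unif e D' x c (lab' (par' p)) := by
      intro c hc hcp hcu
      have hc' : c ∈ kids V (insert N I) par' N := mem_kids.2 ⟨hc, hcu.trans hpp⟩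
      rw [hkN, Finset.mem_insert] at hc'
      have h1 := hc'.resolve_left hcp
      rw [hpp, hlN]
      unfold Unif
      rw [hD c (by rintro rfl; contradiction) hcp]
      exact hp.other c (hFk h1) (by simp [h1])
    refine ⟨.inr (by simp [hpI]), ?_, hp.le_two, ?_, hredN, by rw [hpp, hlN]; exact hp.ne_lab⟩
    · intro u hu
      rw [hD', Function.update_self, Finset.mem_sdiff, Finset.mem_biUnion] at hu
      obtain ⟨c, hc, hcp, huc⟩ := (h.tree.mem_iff p (.inr hpI) u).1 hu.1
      exact hp.unif c (Finset.mem_sdiff.2 ⟨mem_kids.2 ⟨hc, hcp⟩, fun hcF => hu.2 ⟨c, hcF, huc⟩⟩) u huc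
    · refine hT.types_above hE hVE hxE hxV (.inr (by simp [hpI])) hredN hother ?_
      rw [hpp]
      refine (hp.mixed h.tree).imp (fun hpz => by omega) fun hm => ?_
      unfold Mixed
      rw [hDN]
      exact hm

end Stored

/-! ### Finding the place of the new leaf -/

/-- The processed children of `q` of type `k`. -/
def typeSet (par : ℕ → ℕ) (done : List ℕ) (ty : ℕ → ℕ) (k q : ℕ) : Finset ℕ :=
  done.toFinset.filter fun t => par t = q ∧ ty t = k

namespace Stored

open IsTree (Unif Mixed Live)

variable {e : ℕ → ℕ → ℕ} {V I : Finset ℕ} {z : ℕ} {par lab : ℕ → ℕ} {D : ℕ → Finset ℕ}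

theorem mem_typeSet (hT : IsTree e V I z par lab D) {x : ℕ} {wl : List ℕ} {ty : ℕ → ℕ}
    (h : SpreadInv V I par D (e x) wl [] ty) {k q c : ℕ} (hk : k ≠ 0) :
    c ∈ typeSet par wl ty k q ↔ c ∈ kids V I par q ∧ Unif e D x c k := by
  simp only [typeSet, Finset.mem_filter, List.mem_toFinset, mem_kids]
  constructor
  · rintro ⟨h1, h2, rfl⟩
    obtain ⟨h3, _, h5⟩ := h.node c (by simpa using h1)
    exact ⟨⟨h3, h2⟩, h5⟩
  · rintro ⟨⟨h1, h2⟩, h3⟩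
    have h4 := (h.mem_iff hT c).2 ⟨h1, k, hk, h3⟩
    refine ⟨h4, h2, ?_⟩
    obtain ⟨u, hu⟩ := hT.nonempty c h1
    exact ((h.node c (by simpa using h4)).2.2 u hu).symm.trans (h3 u hu)

/-- At a mixed node without mixed children, or at the node above the root if all types agree, the
types of the children are the label and one other number `k`. Whichever of the two is not `0`
determines by the search which children have it, and hence the place of the new leaf. -/
theorem exists_place (hT : IsTree e V I z par lab D) {E : Set ℕ} (hE : IsSymbolic e E)
    (hVE : ∀ v ∈ V, v ∈ E) {x : ℕ} (hxE : x ∈ E) (hxV : x ∉ V) (hlz : lab z = 3)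
    (hne : V.Nonempty) {wl : List ℕ} {ty : ℕ → ℕ}
    (h : SpreadInv V I par D (e x) wl [] ty) {p : ℕ}
    (hp : (p = z ∧ ∃ k, ∀ u ∈ V, e x u = k) ∨ (p ∈ I ∧ Mixed e D x p ∧
      ∀ c, c ∈ V ∨ c ∈ I → par c = p → ¬ Mixed e D x c)) :
    ∃ k ≤ 2, k ≠ lab p ∧ (∀ mv, mv = 1 ∨ mv = 2 →
      (typeCount par wl ty mv p ≠ 0 ↔ mv = lab p ∨ mv = k) ∧
      (mv = lab p → Place e V I z par lab D x p (kids V I par p \ typeSet par wl ty mv p) k) ∧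
      (mv = k → Place e V I z par lab D x p (typeSet par wl ty mv p) k)) ∧
      (lab p ≠ 1 → lab p ≠ 2 → k = 0 → (kids V I par p).card = 1 ∧
        Place e V I z par lab D x p (kids V I par p) k) := by
  classical
  obtain ⟨k, hk2, hkl, hkids, hex, hlam, hone⟩ : ∃ k ≤ 2, k ≠ lab p ∧
      (∀ c ∈ kids V I par p, Unif e D x c (lab p) ∨ Unif e D x c k) ∧
      (∃ c ∈ kids V I par p, Unif e D x c k) ∧
      (p = z ∧ (∀ c ∈ kids V I par p, Unif e D x c k) ∨
        p ∈ I ∧ ∃ c ∈ kids V I par p, Unif e D x c (lab p)) ∧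
      (p = z → (kids V I par p).card = 1) := by
    rcases hp with ⟨rfl, k, hk⟩ | ⟨hpI, hm, hmk⟩
    · obtain ⟨u, hu⟩ := hne
      have hu' := hu
      rw [← hT.top] at hu'
      obtain ⟨c, hc, hcp, huc⟩ := (hT.mem_iff p (.inl rfl) u).1 hu'
      have hall : ∀ c ∈ kids V I par p, Unif e D x c k := fun c hc v hv =>
        hk v (hT.sub c (mem_kids.1 hc).1 hv)
      have hk2 : k ≤ 2 := by rw [← hk u hu]; exact hE.le_two x u
      refine ⟨k, hk2, by omega, fun c hc => .inr (hall c hc), ⟨c, mem_kids.2 ⟨hc, hcp⟩,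
        hall c (mem_kids.2 ⟨hc, hcp⟩)⟩, .inl ⟨rfl, hall⟩, fun _ => ?_⟩
      rw [Finset.card_eq_one]
      refine ⟨c, Finset.eq_singleton_iff_unique_mem.2 ⟨mem_kids.2 ⟨hc, hcp⟩, fun c' hc' => ?_⟩⟩
      obtain ⟨h1, h2⟩ := mem_kids.1 hc'
      exact hT.one c' c h1 hc h2 hcp
    · obtain ⟨k, hk2, hkl, h1, ⟨c, h2, h3, h4⟩, ⟨c', h5, h6, h7⟩⟩ :=
        Mixed.types hT hE hVE hxE hxV hpI hm hmk
      refine ⟨k, hk2, hkl, fun c hc => h1 c (mem_kids.1 hc).1 (mem_kids.1 hc).2,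
        ⟨c', mem_kids.2 ⟨h5, h6⟩, h7⟩, .inr ⟨hpI, c, mem_kids.2 ⟨h2, h3⟩, h4⟩, ?_⟩
      rintro rfl
      exact absurd hpI hT.zI
  have huniq : ∀ c ∈ kids V I par p, ∀ i j, Unif e D x c i → Unif e D x c j → i = j := by
    intro c hc i j hi hj
    obtain ⟨u, hu⟩ := hT.nonempty c (mem_kids.1 hc).1
    exact (hi u hu).symm.trans (hj u hu)
  have hplace : ∀ S, (∀ c, c ∈ S ↔ c ∈ kids V I par p ∧ Unif e D x c k) →
      Place e V I z par lab D x p S k := by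
    intro S hS
    refine ⟨hk2, hkl, fun c hc => ((hS c).1 hc).1, ?_, fun c hc => ((hS c).1 hc).2, ?_, ?_⟩
    · obtain ⟨c, h1, h2⟩ := hex
      exact ⟨c, (hS c).2 ⟨h1, h2⟩⟩
    · intro c hc hcS
      exact (hkids c hc).resolve_right fun hu => hcS ((hS c).2 ⟨hc, hu⟩)
    · refine hlam.imp (fun h => h.1) ?_
      rintro ⟨h1, c, h2, h3⟩
      refine ⟨h1, c, Finset.mem_sdiff.2 ⟨h2, fun hcS => hkl ?_⟩⟩
      exact huniq c h2 _ _ ((hS c).1 hcS).2 h3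
  refine ⟨k, hk2, hkl, fun mv hmv => ⟨?_, ?_, ?_⟩, ?_⟩
  · have hmem : ∀ c, c ∈ typeSet par wl ty mv p ↔ _ := fun c => mem_typeSet hT h (by omega)
    have : typeCount par wl ty mv p ≠ 0 ↔ ∃ c, c ∈ typeSet par wl ty mv p := Finset.card_ne_zero
    rw [this]
    constructor
    · rintro ⟨c, hc⟩
      obtain ⟨h1, h2⟩ := (hmem c).1 hc
      exact (hkids c h1).imp (huniq c h1 _ _ h2) (huniq c h1 _ _ h2)
    · rintro (h1 | rfl)
      · rcases hlam with ⟨rfl, h2⟩ | ⟨_, c, h2, h3⟩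
        · omega
        · exact ⟨c, (hmem c).2 ⟨h2, h1 ▸ h3⟩⟩
      · obtain ⟨c, h2, h3⟩ := hex
        exact ⟨c, (hmem c).2 ⟨h2, h3⟩⟩
  · intro hml
    refine hplace _ fun c => ?_
    rw [Finset.mem_sdiff, mem_typeSet hT h (by omega), hml]
    constructor
    · rintro ⟨h1, h2⟩
      exact ⟨h1, (hkids c h1).resolve_left fun h3 => h2 ⟨h1, h3⟩⟩
    · rintro ⟨h1, h2⟩
      exact ⟨h1, fun h3 => hkl (huniq c h1 _ _ h2 h3.2)⟩
  · intro hmk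
    refine hplace _ fun c => ?_
    rw [mem_typeSet hT h (by omega), hmk]
  · intro h1 h2 h3
    have hpz : p = z := by
      rcases hp with ⟨hpz, _⟩ | ⟨hpI, _⟩
      · exact hpz
      · rcases hlam with ⟨hpz, _⟩ | ⟨_, c, h4, h5⟩
        · exact hpz
        · exfalso
          -- The label is neither `1` nor `2`, and it differs from the type `0`.
          obtain ⟨u, hu⟩ := hT.nonempty c (mem_kids.1 h4).1
          have := hE.le_two x u
          have := h5 u hu
          omega
    refine ⟨hone hpz, hplace _ fun c => ?_⟩
    rcases hlam with ⟨_, h4⟩ | ⟨h4, _⟩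
    · exact ⟨fun hc => ⟨hc, h4 c hc⟩, fun hc => hc.1⟩
    · rw [hpz] at h4
      exact absurd h4 hT.zI

/-- Either no node is live and the new vertex has one type throughout, or an unmarked live node
is a lowest mixed node or the node above the root. -/
theorem selected (hT : IsTree e V I z par lab D) {E : Set ℕ} (hE : IsSymbolic e E)
    (hVE : ∀ v ∈ V, v ∈ E) {x : ℕ} (hxE : x ∈ E) (hxV : x ∉ V)
    (hred : ∀ t ∈ I, lab t ≠ lab (par t)) {p M : ℕ} (hzM : M ≠ z) (hIM : M ∉ I) (hzp : par z = M)
    (hMp : par M = M)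
    (hp : (p = z ∧ ∀ q, Live e V I z par D x q →
        ∃ q', Live e V I z par D x q' ∧ (q = par q' ∨ q = par (par q'))) ∨
      (Live e V I z par D x p ∧ ∀ q, Live e V I z par D x q → par q ≠ p ∧ par (par q) ≠ p)) :
    (p = z ∧ ∃ k, ∀ u ∈ V, e x u = k) ∨ (p ∈ I ∧ Mixed e D x p ∧
      ∀ c, c ∈ V ∨ c ∈ I → par c = p → ¬ Mixed e D x c) := by
  rcases hp with ⟨rfl, hp⟩ | ⟨hp, hlow⟩
  · refine .inl ⟨rfl, 0, IsTree.eq_zero_of_not_live hT fun q hq => ?_⟩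
    obtain ⟨q', hq', hlow⟩ := IsTree.exists_lowest_live hT hq (by rw [hzp]; tauto)
      (by rw [hzp, hMp]; tauto)
    obtain ⟨r, hr, h1 | h1⟩ := hp q' hq'
    · exact (hlow r hr).1 h1.symm
    · exact (hlow r hr).2 h1.symm
  · rcases hp.1 with rfl | hpI
    · obtain ⟨k, _, hk⟩ := Live.unif_of_top hT hp
      exact .inl ⟨rfl, k, hk⟩
    · exact .inr ⟨hpI, Live.mixed hT hp hpI, fun c hc hcp =>
        Live.not_mixed_kid hT hE hVE hxE hxV hred hlow hc hcp⟩

/-- The live nodes are the parents of nodes found that have not been found themselves. -/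
theorem live_iff (hT : IsTree e V I z par lab D) {x : ℕ} {wl : List ℕ} {ty : ℕ → ℕ}
    (h : SpreadInv V I par D (e x) wl [] ty) (q : ℕ) :
    Live e V I z par D x q ↔ (∃ t ∈ wl, par t = q) ∧ ty q = 0 := by
  have hty : ty q = 0 ↔ q ∉ wl := by
    constructor
    · intro h0 hq
      exact (h.node q (by simpa using hq)).2.1 h0
    · intro hq
      exact h.zero q (by simpa using hq)
  have hnode : q ∈ wl ↔ _ := h.mem_iff hT q
  rw [hty, hnode]
  constructor
  · rintro ⟨h1, ⟨c, h2, h3, h4⟩, h5⟩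
    refine ⟨⟨c, (h.mem_iff hT c).2 ⟨h2, h4⟩, h3⟩, ?_⟩
    rintro ⟨h6 | h6, h7⟩
    · rcases h1 with rfl | h1
      · exact hT.zV h6
      · exact hT.disj q h6 h1
    · exact h5 ⟨h6, h7⟩
  · rintro ⟨⟨c, h1, rfl⟩, h2⟩
    obtain ⟨h3, h4⟩ := (h.mem_iff hT c).1 h1
    exact ⟨hT.par_mem c h3, ⟨c, h3, rfl, h4⟩, fun h5 => h2 ⟨.inr h5.1, h5.2⟩⟩

end Stored

/-! ### Marking, moving and clearing -/

namespace RAM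

open Term Prog

@[simp] theorem run_addMod (s : State) (r : ℕ) (e : Term) :
    (addMod r e).run s = s.setReg r (addM (s.reg rM) (s.reg r) (e.val s)) := by
  unfold addMod addM
  by_cases h : s.reg r < s.reg rM - e.val s <;> simp [Prog.run, Term.val, h]

@[simp] theorem run_subMod (s : State) (r : ℕ) (e : Term) :
    (subMod r e).run s = s.setReg r (subM (s.reg rM) (s.reg r) (e.val s)) := by
  unfold subMod subM
  by_cases h : s.reg r < e.val s <;> simp [Prog.run, Term.val, h]

/-- Marks are put on the parents and grandparents of the nodes in the second work list that have no
type. -/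
theorem tri_mark {s : State} {par ty Q : ℕ → ℕ} {K : ℕ} (hp : s.mem aPar = par)
    (hty : s.mem aType = ty) (hQ : s.mem aQ = Q) (hK : s.reg rLenQ = K) (hI : s.reg rI = 0)
    (h0 : ∀ t, s.mem aMark t = 0) :
    Tri (forUp rI rLenQ markBody) s (K * 40 + 4) fun s' => ∀ t, s'.mem aMark t ≠ 0 ↔
      ∃ j < K, ty (Q j) = 0 ∧ (t = par (Q j) ∨ t = par (par (Q j))) := by
  refine (Tri.forUp (C := 30) (N := K) (fun i s' => s'.mem aPar = par ∧ s'.mem aType = ty ∧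
    s'.mem aQ = Q ∧ ∀ t, s'.mem aMark t ≠ 0 ↔
      ∃ j < i, ty (Q j) = 0 ∧ (t = par (Q j) ∨ t = par (par (Q j)))) ?_ rfl rfl (by decide) hI hK
      ⟨hp, hty, hQ, by simp [h0]⟩ (by omega)).conseq le_rfl fun s' hs' => hs'.1.2.2.2
  rintro i s hi ⟨hp, hty, hQ, hm⟩ hri _
  have hsplit : ∀ t, (∃ j < i + 1, ty (Q j) = 0 ∧ (t = par (Q j) ∨ t = par (par (Q j)))) ↔
      (∃ j < i, ty (Q j) = 0 ∧ (t = par (Q j) ∨ t = par (par (Q j)))) ∨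
        (ty (Q i) = 0 ∧ (t = par (Q i) ∨ t = par (par (Q i)))) := by
    intro t
    simp only [Nat.lt_succ_iff_lt_or_eq, or_and_right, exists_or, exists_eq_left]
  refine Tri.straight rfl (by decide) ?_
  by_cases hz : ty (Q i) = 0
  · simp only [markBody, Prog.run, Term.val, State.setReg_reg, State.setReg_mem, hri, hQ, hty, hp,
      hz, if_true, ne_eq, not_true_eq_false, if_false]
    refine ⟨by simp [hp], by simp [hty], by simp [hQ], fun t => ?_⟩
    rw [hsplit, ← hm]
    by_cases h1 : t = par (Q i) <;> by_cases h2 : t = par (par (Q i)) <;>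
      simp [h1, h2, hp, Function.update_apply, hz]
  · simp only [markBody, Prog.run, Term.val, State.setReg_reg, State.setReg_mem, hri, hQ, hty,
      hz, if_true, ne_eq, not_false_eq_true]
    refine ⟨by simp [hp], by simp, by simp, fun t => ?_⟩
    rw [hsplit, ← hm]
    simp [hz]

/-- A node of the second work list that has neither a type nor a mark is selected, and the node `z`
above the root if there is none. -/
theorem tri_select {s : State} {ty mk Q : ℕ → ℕ} {K z : ℕ} (hty : s.mem aType = ty)
    (hmk : s.mem aMark = mk) (hQ : s.mem aQ = Q) (hK : s.reg rLenQ = K) (hI : s.reg rI = 0)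
    (hz : s.reg rP = z) :
    Tri (forUp rI rLenQ selectBody) s (K * 40 + 4) fun s' =>
      (s'.reg rP = z ∧ ∀ j < K, ty (Q j) = 0 → mk (Q j) ≠ 0) ∨
      ∃ j < K, Q j = s'.reg rP ∧ ty (Q j) = 0 ∧ mk (Q j) = 0 := by
  refine (Tri.forUp (C := 30) (N := K) (fun i s' => s'.mem aType = ty ∧ s'.mem aMark = mk ∧
    s'.mem aQ = Q ∧ ((s'.reg rP = z ∧ ∀ j < i, ty (Q j) = 0 → mk (Q j) ≠ 0) ∨
      ∃ j < i, Q j = s'.reg rP ∧ ty (Q j) = 0 ∧ mk (Q j) = 0)) ?_ rfl rfl (by decide) hI hK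
      ⟨hty, hmk, hQ, .inl ⟨hz, by simp⟩⟩ (by omega)).conseq le_rfl fun s' hs' => hs'.1.2.2.2
  rintro i s hi ⟨hty, hmk, hQ, hm⟩ hri _
  refine Tri.straight rfl (by decide) ?_
  by_cases hz : ty (Q i) = 0 ∧ mk (Q i) = 0
  · simp only [selectBody, Prog.run, Term.val, State.setReg_reg, State.setReg_mem, hri, hQ, hty,
      hz, hmk, if_true, ne_eq, not_true_eq_false, if_false]
    exact ⟨by simp, by simp, by simp, .inr ⟨i, by omega, by simp, hz⟩⟩
  · have hrun : (selectBody.run s) = s.setReg rT (Q i) := by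
      by_cases h1 : ty (Q i) = 0
      · have h2 : mk (Q i) ≠ 0 := fun h2 => hz ⟨h1, h2⟩
        simp [selectBody, Prog.run, Term.val, hri, hQ, hty, hmk, h1, h2]
      · simp [selectBody, Prog.run, Term.val, hri, hQ, hty, h1]
    rw [hrun]
    refine ⟨hty, hmk, hQ, hm.imp (fun h => ⟨by simpa using h.1, fun j hj h0 => ?_⟩) ?_⟩
    · rcases Nat.lt_succ_iff_lt_or_eq.1 hj with hj | rfl
      · exact h.2 j hj h0
      · exact fun h1 => hz ⟨h0, h1⟩
    · rintro ⟨j, hj, h1, h2⟩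
      exact ⟨j, by omega, by simpa using h1, h2⟩

/-- Marks and counters can be different from zero only at the nodes in the second work list and at
their parents and grandparents. -/
theorem tri_clear {s : State} {par Q : ℕ → ℕ} {K : ℕ} (hp : s.mem aPar = par)
    (hQ : s.mem aQ = Q) (hK : s.reg rLenQ = K) (hI : s.reg rI = 0)
    (hmk : ∀ t, s.mem aMark t ≠ 0 → ∃ j < K, t = par (Q j) ∨ t = par (par (Q j)))
    (h1 : ∀ t, s.mem aOne t ≠ 0 → ∃ j < K, t = Q j)
    (h2 : ∀ t, s.mem aTwo t ≠ 0 → ∃ j < K, t = Q j) :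
    Tri (forUp rI rLenQ clearBody) s (K * 40 + 4) fun s' =>
      (∀ t, s'.mem aMark t = 0) ∧ (∀ t, s'.mem aOne t = 0) ∧ ∀ t, s'.mem aTwo t = 0 := by
  refine (Tri.forUp (C := 30) (N := K) (fun i s' => s'.mem aPar = par ∧ s'.mem aQ = Q ∧
    (∀ t, s'.mem aMark t ≠ 0 → ∃ j, i ≤ j ∧ j < K ∧ (t = par (Q j) ∨ t = par (par (Q j)))) ∧
    (∀ t, s'.mem aOne t ≠ 0 → ∃ j, i ≤ j ∧ j < K ∧ t = Q j) ∧
    (∀ t, s'.mem aTwo t ≠ 0 → ∃ j, i ≤ j ∧ j < K ∧ t = Q j)) ?_ rfl rfl (by decide) hI hK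
      ⟨hp, hQ, by simpa using hmk, by simpa using h1, by simpa using h2⟩
      (by omega)).conseq le_rfl ?_
  · rintro i s hi ⟨hp, hQ, hm, h1, h2⟩ hri _
    refine Tri.straight rfl (by decide) ?_
    simp only [clearBody, Prog.run, Term.val, State.setReg_reg, State.setReg_mem, State.write_mem,
      State.write_reg, hri, hQ, hp, if_true]
    refine ⟨by simp, by simp, ?_, ?_, ?_⟩
    · intro t ht
      by_cases h3 : t = par (Q i)
      · simp [h3, Function.update_apply] at ht
      by_cases h4 : t = par (par (Q i))
      · simp [h4] at ht
      simp only [Nat.reduceEqDiff, if_false] at ht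
      rw [Function.update_of_ne h4, Function.update_of_ne h3] at ht
      obtain ⟨j, hj, h5, h6⟩ := hm t ht
      refine ⟨j, ?_, h5, h6⟩
      by_contra hcon
      obtain rfl : j = i := by omega
      tauto
    · intro t ht
      by_cases h3 : t = Q i
      · simp [h3] at ht
      simp only [Nat.reduceEqDiff, if_false] at ht
      rw [Function.update_of_ne h3] at ht
      obtain ⟨j, hj, h5, h6⟩ := h1 t ht
      refine ⟨j, ?_, h5, h6⟩
      by_contra hcon
      obtain rfl : j = i := by omega
      tauto
    · intro t ht
      by_cases h3 : t = Q i
      · simp [h3] at ht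
      simp only [Nat.reduceEqDiff, if_false] at ht
      rw [Function.update_of_ne h3] at ht
      obtain ⟨j, hj, h5, h6⟩ := h2 t ht
      refine ⟨j, ?_, h5, h6⟩
      by_contra hcon
      obtain rfl : j = i := by omega
      tauto
  · rintro s' ⟨⟨_, _, h3, h4, h5⟩, _⟩
    refine ⟨fun t => ?_, fun t => ?_, fun t => ?_⟩ <;> by_contra hne
    · obtain ⟨j, h6, h7, _⟩ := h3 t hne
      omega
    · obtain ⟨j, h6, h7, _⟩ := h4 t hne
      omega
    · obtain ⟨j, h6, h7, _⟩ := h5 t hne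
      omega

theorem typeSet_append (par ty : ℕ → ℕ) (l : List ℕ) (t k q : ℕ) :
    typeSet par (l ++ [t]) ty k q =
      if par t = q ∧ ty t = k then insert t (typeSet par l ty k q) else typeSet par l ty k q := by
  unfold typeSet
  rw [List.toFinset_append, Finset.union_comm]
  simp only [List.toFinset_cons, List.toFinset_nil, insert_empty_eq, Finset.singleton_union]
  rw [Finset.filter_insert]

/-- The sum of the children of `p` of type `mv` is computed modulo `M`. -/
theorem tri_sum {s : State} {par ty W : ℕ → ℕ} {L M p mv : ℕ} (hp : s.mem aPar = par)
    (hty : s.mem aType = ty) (hW : s.mem aW = W) (hL : s.reg rLenW = L) (hI : s.reg rI = 0)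
    (hrp : s.reg rP = p) (hmv : s.reg rMove = mv) (hM : s.reg rM = M) (hM0 : 0 < M)
    (hs : s.reg rSum = 0) (hnd : (seg W L).Nodup) (hlt : ∀ t ∈ seg W L, t < M) :
    Tri (forUp rI rLenW sumBody) s (L * 68 + 4) fun s' =>
      SumsTo M (typeSet par (seg W L) ty mv p) (s'.reg rSum) := by
  refine (Tri.forUp (C := 60) (N := L) (fun i s' => s'.mem aPar = par ∧ s'.mem aType = ty ∧
    s'.mem aW = W ∧ s'.reg rP = p ∧ s'.reg rMove = mv ∧ s'.reg rM = M ∧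
    SumsTo M (typeSet par (seg W i) ty mv p) (s'.reg rSum)) ?_ rfl rfl (by decide) hI hL
      ⟨hp, hty, hW, hrp, hmv, hM, by rw [hs]; exact SumsTo.empty hM0⟩ (by omega)).conseq le_rfl
      fun s' hs' => hs'.1.2.2.2.2.2.2
  rintro i s hi ⟨hp, hty, hW, hrp, hmv, hM, hs⟩ hri _
  refine Tri.straight rfl (by decide) ?_
  have hnd' : W i ∉ seg W i := by
    intro hm
    obtain ⟨j, hj, h1⟩ := mem_seg.1 hm
    have := seg_nodup_iff.1 hnd j (by omega) i hi h1
    omega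
  have hnd2 : W i ∉ typeSet par (seg W i) ty mv p := by
    simp [typeSet, hnd']
  have hWM : W i < M := hlt _ (mem_seg.2 ⟨i, hi, rfl⟩)
  rw [seg_succ, typeSet_append]
  by_cases hc : par (W i) = p ∧ ty (W i) = mv
  · have hrun : sumBody.run s = (s.setReg rT (W i)).setReg rSum (addM M (s.reg rSum) (W i)) := by
      simp [sumBody, Prog.run, Term.val, hri, hW, hp, hty, hrp, hmv, hc, hM]
    rw [hrun, if_pos hc]
    simpa [hp, hty, hW, hrp, hmv, hM] using hs.insert hnd2 hWM
  · have hrun : sumBody.run s = s.setReg rT (W i) := by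
      by_cases h1 : par (W i) = p
      · have h2 : ty (W i) ≠ mv := fun h2 => hc ⟨h1, h2⟩
        simp [sumBody, Prog.run, Term.val, hri, hW, hp, hty, hrp, hmv, h1, h2]
      · simp [sumBody, Prog.run, Term.val, hri, hW, hp, hrp, h1]
    rw [hrun, if_neg hc]
    simpa [hp, hty, hW, hrp, hmv, hM] using hs

/-- The children of `p` of type `mv` are made children of the node `N`. -/
theorem tri_move {s : State} {par ty W : ℕ → ℕ} {L p mv N : ℕ} (hp : s.mem aPar = par)
    (hty : s.mem aType = ty) (hW : s.mem aW = W) (hL : s.reg rLenW = L) (hI : s.reg rI = 0)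
    (hrp : s.reg rP = p) (hmv : s.reg rMove = mv) (hN : s.reg rD = N) (hnd : (seg W L).Nodup) :
    Tri (forUp rI rLenW moveBody) s (L * 40 + 4) fun s' =>
      s'.mem aPar = fun t => if t ∈ typeSet par (seg W L) ty mv p then N else par t := by
  refine (Tri.forUp (C := 30) (N := L) (fun i s' =>
    (s'.mem aPar = fun t => if t ∈ typeSet par (seg W i) ty mv p then N else par t) ∧
    s'.mem aType = ty ∧ s'.mem aW = W ∧ s'.reg rP = p ∧ s'.reg rMove = mv ∧ s'.reg rD = N)
    ?_ rfl rfl (by decide) hI hL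
      ⟨by simp [hp, typeSet], hty, hW, hrp, hmv, hN⟩ (by omega)).conseq le_rfl
      fun s' hs' => hs'.1.1
  rintro i s hi ⟨hp, hty, hW, hrp, hmv, hN⟩ hri _
  refine Tri.straight rfl (by decide) ?_
  have hnd' : W i ∉ seg W i := by
    intro hm
    obtain ⟨j, hj, h1⟩ := mem_seg.1 hm
    have := seg_nodup_iff.1 hnd j (by omega) i hi h1
    omega
  have hnd2 : W i ∉ typeSet par (seg W i) ty mv p := by
    simp [typeSet, hnd']
  have hpi : s.mem aPar (W i) = par (W i) := by rw [hp]; simp [hnd2]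
  rw [seg_succ, typeSet_append]
  by_cases hc : par (W i) = p ∧ ty (W i) = mv
  · have hrun : moveBody.run s = (s.setReg rT (W i)).write aPar (W i) N := by
      simp [moveBody, Prog.run, Term.val, hri, hW, hpi, hty, hrp, hmv, hc, hN]
    rw [hrun, if_pos hc]
    refine ⟨?_, by simp [hty], by simp [hW], by simp [hrp], by simp [hmv], by simp [hN]⟩
    funext t
    by_cases h1 : t = W i
    · simp [h1]
    · simp [h1, hp]
  · have hrun : moveBody.run s = s.setReg rT (W i) := by
      by_cases h1 : par (W i) = p
      · have h2 : ty (W i) ≠ mv := fun h2 => hc ⟨h1, h2⟩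
        simp [moveBody, Prog.run, Term.val, hri, hW, hpi, hty, hrp, hmv, h1, h2]
      · simp [moveBody, Prog.run, Term.val, hri, hW, hpi, hrp, h1]
    rw [hrun, if_neg hc]
    exact ⟨by simp [hp], by simp [hty], by simp [hW], by simp [hrp], by simp [hmv], by simp [hN]⟩

/-- The types are reset. -/
theorem tri_forget {s : State} {ty W : ℕ → ℕ} {L : ℕ} (hty : s.mem aType = ty)
    (hW : s.mem aW = W) (hL : s.reg rLenW = L) (hI : s.reg rI = 0)
    (h : ∀ t, ty t ≠ 0 → t ∈ seg W L) :
    Tri (forUp rI rLenW forgetBody) s (L * 20 + 4) fun s' => ∀ t, s'.mem aType t = 0 := by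
  refine (Tri.forUp (C := 10) (N := L) (fun i s' => s'.mem aW = W ∧
    ∀ t, s'.mem aType t ≠ 0 → ∃ j, i ≤ j ∧ j < L ∧ W j = t)
    ?_ rfl rfl (by decide) hI hL
      ⟨hW, fun t ht => ?_⟩ (by omega)).conseq le_rfl ?_
  · rintro i s hi ⟨hW, hs⟩ hri _
    refine Tri.straight rfl (by decide) ?_
    simp only [forgetBody, Prog.run, Term.val, hri, hW]
    refine ⟨by simp [hW], fun t ht => ?_⟩
    by_cases h1 : t = W i
    · simp [h1] at ht
    · simp only [State.setReg_mem, State.write_mem, if_true] at ht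
      rw [Function.update_of_ne h1] at ht
      obtain ⟨j, h2, h3, h4⟩ := hs t ht
      refine ⟨j, ?_, h3, h4⟩
      by_contra hcon
      obtain rfl : j = i := by omega
      exact h1 h4.symm
  · rw [hty] at ht
    obtain ⟨j, h1, h2⟩ := mem_seg.1 (h t ht)
    exact ⟨j, by omega, h1, h2⟩
  · rintro s' ⟨⟨_, hs⟩, _⟩ t
    by_contra hne
    obtain ⟨j, h1, h2, _⟩ := hs t hne
    omega

end RAM

/-! ### Attaching the new leaf -/

namespace RAM

open Term Prog Stored

/-- The new leaf is put at the node `c`: below it if it has the label `k`, and else next to it,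
below a new node. -/
theorem tri_attach {e : ℕ → ℕ → ℕ} {V I : Finset ℕ} {z M N : ℕ} {D : ℕ → Finset ℕ} {x c k : ℕ}
    {s : State} (h : Stored e V I z M N (s.mem aPar) (s.mem aLab) (s.mem aNum) (s.mem aSum) D)
    (hM : N < M) (hcomm : ∀ u v, e u v = e v u) (hx : x < z) (hxV : x ∉ V)
    (hR : Ready e V I (s.mem aPar) (s.mem aLab) D x c k) (hrx : s.reg rX = x) (hrc : s.reg rC = c)
    (hrk : s.reg rType = k) (hrN : s.reg rNew = N) (hrM : s.reg rM = M) :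
    Tri attach s 300 fun s' => ∃ I' D', Stored e (insert x V) I' z M (s'.reg rNew) (s'.mem aPar)
      (s'.mem aLab) (s'.mem aNum) (s'.mem aSum) D' ∧
      (∀ t ∈ I', s'.mem aLab t ≠ s'.mem aLab (s'.mem aPar t)) ∧ s'.reg rNew ≤ N + 1 := by
  refine Tri.straight rfl (by decide) ?_
  have hcx : c ≠ x := by
    rintro rfl
    rcases hR.mem with h1 | h1
    · exact hxV h1
    · have := h.inner _ h1
      omega
  by_cases hl : s.mem aLab c = k
  · have hcI : c ∈ I := by
      refine hR.mem.resolve_left fun hcV => ?_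
      have := h.lab_leaf c hcV
      have := hR.le_two
      omega
    obtain ⟨D', h1, h2⟩ := h.attachLeaf hM.le hcomm hx hxV hcI (by rw [hl]; exact hR.unif) hR.above
      (fun t ht => by
        by_cases htc : t = c
        · rw [htc, hl]
          exact hR.ne_par
        · exact hR.red t ht htc) rfl rfl rfl rfl
    refine ⟨I, D', ?_⟩
    simpa [attach, Prog.run, Term.val, hrx, hrc, hrk, hrN, hrM, hcx, hl] using ⟨h1, h2⟩
  · obtain ⟨D', h1, h2⟩ := h.attachParent hM hcomm hx hxV hR.mem hR.unif hR.le_two hR.above hR.red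
      hl hR.ne_par rfl rfl rfl rfl
    refine ⟨insert N I, D', ?_⟩
    simpa [attach, replaceKid, Prog.run, Term.val, hrx, hrc, hrk, hrN, hrM, hcx, hl]
      using ⟨h1, by simpa using h2⟩

theorem tri_finishBelow {s : State} {p N nu M sF : ℕ} (hrp : s.reg rP = p) (hrD : s.reg rD = N)
    (hru : s.reg rNum = nu) (hrM : s.reg rM = M) (hrs : s.reg rSum = sF) (hpN : p ≠ N) :
    Tri finishBelow s 120 fun s' => s'.mem aPar = Function.update (s.mem aPar) N p ∧
      s'.mem aNum = Function.update (Function.update (s.mem aNum) N nu) p (s.mem aNum p - nu + 1) ∧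
      s'.mem aSum = Function.update (Function.update (s.mem aSum) N sF) p
        (addM M (subM M (s.mem aSum p) sF) N) ∧ s'.reg rC = N := by
  refine Tri.straight rfl (by decide) ?_
  simp [finishBelow, replaceKid, Prog.run, Term.val, hrp, hrD, hru, hrM, hrs, hpN]

theorem tri_finishAbove {s : State} {p N nu M sF u : ℕ} (hrp : s.reg rP = p) (hrD : s.reg rD = N)
    (hru : s.reg rNum = nu) (hrM : s.reg rM = M) (hrs : s.reg rSum = sF)
    (hu : s.mem aPar p = u) (hup : u ≠ p) (huN : u ≠ N) :
    Tri finishAbove s 160 fun s' =>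
      s'.mem aPar = Function.update (Function.update (s.mem aPar) N u) p N ∧
      s'.mem aNum = Function.update (Function.update (s.mem aNum) N (s.mem aNum p - nu + 1)) p nu ∧
      s'.mem aSum = Function.update (Function.update (Function.update (s.mem aSum) p
        (subM M (s.mem aSum p) sF)) N (addM M sF p)) u (addM M (subM M (s.mem aSum u) p) N) ∧
      s'.reg rC = p := by
  refine Tri.straight rfl (by decide) ?_
  simp [finishAbove, replaceKid, Prog.run, Term.val, hrp, hrD, hru, hrM, hrs, hu, hup, huN]

/-- What is known before regrouping: the moved children are those of type `mv`; the new vertex has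
type `k` for exactly these children of `p`, or for exactly the others. -/
structure Decided (e : ℕ → ℕ → ℕ) (V I : Finset ℕ) (z : ℕ) (par lab : ℕ → ℕ) (D : ℕ → Finset ℕ)
    (x p : ℕ) (F : Finset ℕ) (k up nu : ℕ) : Prop where
  sub : F ⊆ kids V I par p
  above : up ≠ 0 → Place e V I z par lab D x p (kids V I par p \ F) k ∧
    nu = (kids V I par p \ F).card
  below : up = 0 → Place e V I z par lab D x p F k ∧ nu = F.card

/-- The children of `p` next to which the new leaf belongs get a node of their own. Only children
that the search has found are moved; if these are the other ones, then the new node is put above `p`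
instead of below. If the new leaf belongs next to a single child, then nothing is moved, and that
child is found as a sum, or as a difference of two sums, of names of children. -/
theorem tri_regroup {e : ℕ → ℕ → ℕ} {V I : Finset ℕ} {z M N : ℕ} {D : ℕ → Finset ℕ}
    {x p k mv up nu L : ℕ} {ty W : ℕ → ℕ}
    {s : State} (h : Stored e V I z M N (s.mem aPar) (s.mem aLab) (s.mem aNum) (s.mem aSum) D)
    (hM : N < M) {E : Set ℕ} (hE : IsSymbolic e E)
    (hVE : ∀ v ∈ V, v ∈ E) (hxE : x ∈ E) (hxV : x ∉ V)
    (hred : ∀ t ∈ I, s.mem aLab t ≠ s.mem aLab (s.mem aPar t))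
    (hd : Decided e V I z (s.mem aPar) (s.mem aLab) D x p
      (typeSet (s.mem aPar) (seg W L) ty mv p) k up nu)
    (hty : s.mem aType = ty) (hW : s.mem aW = W) (hL : s.reg rLenW = L)
    (hrp : s.reg rP = p) (hmv : s.reg rMove = mv) (hup : s.reg rUp = up) (hnu : s.reg rNum = nu)
    (hla : s.reg rLam = s.mem aLab p) (hrN : s.reg rNew = N) (hrM : s.reg rM = M)
    (hnd : (seg W L).Nodup) (hlt : ∀ t ∈ seg W L, t < M) :
    Tri regroup s (L * 108 + 300) fun s' => ∃ I' D', Stored e V I' z M (s'.reg rNew) (s'.mem aPar)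
      (s'.mem aLab) (s'.mem aNum) (s'.mem aSum) D' ∧
      Ready e V I' (s'.mem aPar) (s'.mem aLab) D' x (s'.reg rC) k ∧ s'.reg rNew ≤ N + 1 := by
  obtain ⟨par, hpar⟩ : ∃ par, par = s.mem aPar := ⟨_, rfl⟩
  obtain ⟨lab, hlab⟩ : ∃ lab, lab = s.mem aLab := ⟨_, rfl⟩
  obtain ⟨num, hnum⟩ : ∃ num, num = s.mem aNum := ⟨_, rfl⟩
  obtain ⟨sum, hsum⟩ : ∃ sum, sum = s.mem aSum := ⟨_, rfl⟩
  rw [← hpar, ← hlab, ← hnum, ← hsum] at h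
  rw [← hpar, ← hlab] at hd hred
  rw [← hlab] at hla
  set F := typeSet par (seg W L) ty mv p with hF
  unfold regroup
  refine Tri.setReg_seq (C := 2) (T := L * 108 + 298) (by decide)
    (fun s1 hm1 hs1 hr1 => ?_) (by omega)
  refine Tri.setReg_seq (C := 2) (T := L * 108 + 296) (by decide)
    (fun s2 hm2 hi2 hr2' => ?_) (by omega)
  rw [hm1] at hm2
  have hs2 : s2.reg rSum = 0 := (hr2' _ (by decide)).trans hs1
  have hr2 : ∀ r, r ≠ rSum ∧ r ≠ rI → s2.reg r = s.reg r := fun r h =>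
    (hr2' r h.2).trans (hr1 r h.1)
  have hM0 : 0 < M := by omega
  refine Tri.seq (T := L * 68 + 4) (T' := L * 40 + 292)
    (tri_sum (M := M) (par := par) (ty := ty) (W := W)
    (L := L) (p := p) (mv := mv) (by rw [hm2, hpar]) (by rw [hm2, hty]) (by rw [hm2, hW])
    (by rw [hr2 _ (by decide), hL]) hi2
    (by rw [hr2 _ (by decide), hrp]) (by rw [hr2 _ (by decide), hmv])
    (by rw [hr2 _ (by decide), hrM]) hM0 hs2 hnd hlt).frame ?_ (by omega)
  rintro s3 ⟨hsF, hr3', hm3'⟩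
  rw [← hF] at hsF
  have hr3 : ∀ r, r ≠ rSum ∧ r ≠ rI ∧ sumBody.writesReg r = false → s3.reg r = s.reg r :=
    fun r ⟨h1, h2, h3⟩ => by
      rw [hr3' r (by simp only [forUp, Prog.writesReg, h3]; simp [h2]), hr2 r ⟨h1, h2⟩]
  have hm3 : s3.mem = s.mem := by
    funext a
    rw [hm3' a (by simp [forUp, sumBody, addMod, Prog.writesMem]), hm2]
  obtain ⟨sF, hsF'⟩ : ∃ sF, sF = s3.reg rSum := ⟨_, rfl⟩
  rw [← hsF'] at hsF
  have e1 : s3.reg rNum = nu := by rw [hr3 _ (by decide), hnu]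
  have e2 : s3.reg rUp = up := by rw [hr3 _ (by decide), hup]
  have e3 : s3.reg rP = p := by rw [hr3 _ (by decide), hrp]
  have e4 : s3.reg rNew = N := by rw [hr3 _ (by decide), hrN]
  have e5 : s3.reg rLam = lab p := by rw [hr3 _ (by decide), hla]
  have e6 : s3.reg rLenW = L := by rw [hr3 _ (by decide), hL]
  have e7 : s3.reg rMove = mv := by rw [hr3 _ (by decide), hmv]
  have e8 : s3.reg rM = M := by rw [hr3 _ (by decide), hrM]
  have hp : p = z ∨ p ∈ I := by
    by_cases hu : up = 0
    · exact (hd.below hu).1.top.imp_right And.left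
    · exact (hd.above hu).1.top.imp_right And.left
  have hkM : ∀ c ∈ kids V I par p, c < M := fun c hc =>
    (h.node_lt (mem_kids.1 hc).1).1.trans hM
  refine Tri.ite (T := L * 40 + 286) (fun hb => ?_) (fun hb => ?_)
    (by simp only [Term.cost]; omega)
  · -- A single child.
    have hnu1 : nu = 1 := by
      by_contra hne
      simp [Term.val, e1, hne] at hb
    refine Tri.straight rfl (le_trans (b := 60) (by decide) (by omega)) ?_
    by_cases hu : up = 0
    · obtain ⟨h1, h2⟩ := hd.below hu
      obtain ⟨c, hc⟩ := Finset.card_eq_one.1 (h2.symm.trans hnu1)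
      rw [hc] at h1 hsF
      have hcM := hkM c (h1.sub (by simp))
      have hsc := hsF.eq_of_singleton hcM
      have hR := h1.ready_single h.tree hE hVE hxE hxV hred
      refine ⟨I, D, ?_⟩
      simpa [Prog.run, Term.val, e2, hu, hm3, ← hpar, ← hlab, ← hnum, ← hsum, e4, ← hsF', hsc]
        using ⟨h, hR⟩
    · obtain ⟨h1, h2⟩ := hd.above hu
      have hsS := (h.sum_eq p hp).sdiff hsF hd.sub
      obtain ⟨c, hc⟩ := Finset.card_eq_one.1 (h2.symm.trans hnu1)
      rw [hc] at h1 hsS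
      have hcM := hkM c (h1.sub (by simp))
      have hsc := hsS.eq_of_singleton hcM
      have hR := h1.ready_single h.tree hE hVE hxE hxV hred
      refine ⟨I, D, ?_⟩
      simpa [Prog.run, Term.val, e2, hu, hm3, ← hpar, ← hlab, ← hnum, ← hsum, e4, ← hsF', e3, e8,
        hsc] using ⟨h, hR⟩
  · have hnu1 : nu ≠ 1 := by
      rintro rfl
      simp [Term.val, e1] at hb
    have hpI : p ∈ I := by
      by_contra hpI
      by_cases hu : up = 0
      · obtain ⟨h1, h2⟩ := hd.below hu
        have := h1.card_le_one h.tree hpI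
        have := h1.nonempty.card_pos
        omega
      · obtain ⟨h1, h2⟩ := hd.above hu
        have := h1.card_le_one h.tree hpI
        have := h1.nonempty.card_pos
        omega
    have hpb := h.inner p hpI
    refine Tri.setReg_seq (C := 2) (T := L * 40 + 284) (by decide)
      (fun s4 hm4 hD4 hr4 => ?_) (by omega)
    refine Tri.setReg_seq (C := 4) (T := L * 40 + 280) (by decide)
      (fun s5 hm5 hN5 hr5' => ?_) (by omega)
    rw [hm4, hm3] at hm5
    have hD5 : s5.reg rD = N := (hr5' _ (by decide)).trans (hD4.trans e4)
    have hr5 : ∀ r, r ≠ rD → r ≠ rNew → s5.reg r = s3.reg r := fun r h h' =>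
      (hr5' r h').trans (hr4 r h)
    replace hN5 : s5.reg rNew = N + 1 := by
      rw [hN5, Term.val, Term.val, Term.val, hr4 _ (by decide), e4]
    refine Tri.seq (T := 3) (T' := L * 40 + 277) (Q := fun s' => s'.mem aPar = par ∧
      s'.mem aType = ty ∧ s'.mem aW = W ∧ s'.mem aNum = num ∧ s'.mem aSum = sum ∧
      s'.mem aLab = Function.update lab N (lab p) ∧ s'.reg rD = N ∧
      s'.reg rNew = N + 1 ∧ ∀ r, r ≠ rD → r ≠ rNew → s'.reg r = s3.reg r)
      (Tri.straight rfl (by decide) (by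
        have := hr5 rLam (by decide) (by decide)
        refine ⟨?_, ?_, ?_, ?_, ?_, ?_, hD5, hN5, hr5⟩ <;>
          simp [Prog.run, Term.val, hm5, hD5, this, hpar, hty, hW, hnum, hsum, hlab]
        rw [e5, hlab]))
      ?_ (by omega)
    rintro s6 ⟨hp6, hty6, hW6, hn6, hsu6, hl6, hD6, hN6, hr6⟩
    refine Tri.setReg_seq (C := 2) (T := L * 40 + 275) (by decide)
      (fun s7 hm7 hI7 hr7 => ?_) (by omega)
    have hr67 : ∀ r, r ≠ rI ∧ r ≠ rD ∧ r ≠ rNew → s7.reg r = s3.reg r := fun r ⟨h1, h2, h3⟩ => by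
      rw [hr7 r h1, hr6 r h2 h3]
    refine Tri.seq (T := L * 40 + 4) (T' := 271) (tri_move (par := par) (ty := ty) (W := W)
      (L := L) (p := p) (mv := mv) (N := N) (by rw [hm7, hp6]) (by rw [hm7, hty6])
      (by rw [hm7, hW6]) (by rw [hr67 _ (by decide), e6]) hI7
      (by rw [hr67 _ (by decide), e3])
      (by rw [hr67 _ (by decide), e7])
      (by rw [hr7 _ (by decide), hD6]) hnd).frame ?_ (by omega)
    rintro s8 ⟨hp8, hr8', hm8⟩
    rw [← hF] at hp8
    have hr8 : ∀ r, r ≠ rI ∧ moveBody.writesReg r = false → s8.reg r = s7.reg r :=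
      fun r ⟨h2, h3⟩ => by
        rw [hr8' r (by simp only [forUp, Prog.writesReg, h3]; simp [h2])]
    have g1 : s8.reg rNum = nu := by rw [hr8 _ (by decide), hr67 _ (by decide), e1]
    have g2 : s8.reg rUp = up := by rw [hr8 _ (by decide), hr67 _ (by decide), e2]
    have g3 : s8.reg rP = p := by rw [hr8 _ (by decide), hr67 _ (by decide), e3]
    have g4 : s8.reg rM = M := by rw [hr8 _ (by decide), hr67 _ (by decide), e8]
    have g5 : s8.reg rSum = sF := by rw [hr8 _ (by decide), hr67 _ (by decide), hsF']
    have g6 : s8.reg rD = N := by rw [hr8 _ (by decide), hr7 _ (by decide), hD6]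
    have g7 : s8.reg rNew = N + 1 := by rw [hr8 _ (by decide), hr7 _ (by decide), hN6]
    have g8 : s8.mem aNum = num := by rw [hm8 _ (by decide), hm7, hn6]
    have g9 : s8.mem aSum = sum := by rw [hm8 _ (by decide), hm7, hsu6]
    have g10 : s8.mem aLab = Function.update lab N (lab p) := by
      rw [hm8 _ (by decide), hm7, hl6]
    have hpF : p ∉ F := fun hpF => h.tree.par_ne_self (.inr hpI) (mem_kids.1 (hd.sub hpF)).2
    refine Tri.ite (T := 200) (fun hb => ?_) (fun hb => ?_) (by simp only [Term.cost]; omega)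
    · obtain ⟨h1, h2⟩ := hd.above (by simpa [Term.val, g2] using hb)
      have hub := h.par_lt (.inr hpI)
      refine (tri_finishAbove (u := par p) g3 g6 g1 g4 g5 (by rw [hp8]; simp [hpF])
        (h.tree.par_ne_self (.inr hpI)) (by omega)).frame.conseq (by omega) ?_
      rintro s9 ⟨⟨k1, k2, k3, k4⟩, hr9, hm9⟩
      have hFc : num p - nu = F.card := by
        rw [h.num_eq p hpI, h2, Finset.card_sdiff_of_subset hd.sub]
        have := Finset.card_le_card hd.sub
        omega
      obtain ⟨D', h3, h4⟩ := h.group_above hM hE hVE hxE hxV hred hd.sub h1 (by omega) hsF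
        (par' := s9.mem aPar) (lab' := s9.mem aLab) (num' := s9.mem aNum) (sum' := s9.mem aSum)
        (by rw [k1, hp8]) (by rw [hm9 _ (by decide), g10]) (by rw [k2, g8, hFc, h2])
        (by rw [k3, g9])
      have hN9 : s9.reg rNew = N + 1 := by rw [hr9 _ (by decide), g7]
      exact ⟨insert N I, D', by rw [hN9]; exact h3, by rw [k4]; exact h4, by omega⟩
    · obtain ⟨h1, h2⟩ := hd.below (by simpa [Term.val, g2] using hb)
      refine (tri_finishBelow g3 g6 g1 g4 g5 (by omega)).frame.conseq (by omega) ?_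
      rintro s9 ⟨⟨k1, k2, k3, k4⟩, hr9, hm9⟩
      obtain ⟨D', h3, h4⟩ := h.group_below hM hE hVE hxE hxV hred h1 (by omega) hsF
        (par' := s9.mem aPar) (lab' := s9.mem aLab) (num' := s9.mem aNum) (sum' := s9.mem aSum)
        (by rw [k1, hp8]) (by rw [hm9 _ (by decide), g10]) (by rw [k2, g8, h2])
        (by rw [k3, g9])
      have hN9 : s9.reg rNew = N + 1 := by rw [hr9 _ (by decide), g7]
      exact ⟨insert N I, D', by rw [hN9]; exact h3, by rw [k4]; exact h4, by omega⟩

end RAM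

/-! ### Inserting a vertex -/

namespace RAM

open Term Prog Stored

/-- If the label of `p` is `1` or `2`, then the children whose type is the label are moved above,
else those of the other type below. The other type cannot be read off from the counters if it is `0`
and the label is `3`, that is, at the node above the root, which has one child. -/
theorem tri_decideMove {s : State} {p lam c1 c2 nm : ℕ} (hrp : s.reg rP = p)
    (hl : s.mem aLab p = lam) (h1 : s.mem aOne p = c1) (h2 : s.mem aTwo p = c2)
    (hn : s.mem aNum p = nm) :
    Tri decideMove s 120 fun s' => s'.reg rLam = lam ∧
      ((lam = 1 ∧ s'.reg rMove = 1 ∧ s'.reg rUp = 1 ∧ s'.reg rNum = nm - c1 ∧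
          s'.reg rType = if c2 ≠ 0 then 2 else 0) ∨
        (lam = 2 ∧ s'.reg rMove = 2 ∧ s'.reg rUp = 1 ∧ s'.reg rNum = nm - c2 ∧
          s'.reg rType = if c1 ≠ 0 then 1 else 0) ∨
        (lam ≠ 1 ∧ lam ≠ 2 ∧ c1 ≠ 0 ∧ s'.reg rMove = 1 ∧ s'.reg rUp = 0 ∧ s'.reg rNum = c1 ∧
          s'.reg rType = 1) ∨
        (lam ≠ 1 ∧ lam ≠ 2 ∧ c1 = 0 ∧ c2 ≠ 0 ∧ s'.reg rMove = 2 ∧ s'.reg rUp = 0 ∧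
          s'.reg rNum = c2 ∧ s'.reg rType = 2) ∨
        (lam ≠ 1 ∧ lam ≠ 2 ∧ c1 = 0 ∧ c2 = 0 ∧ s'.reg rMove = 0 ∧ s'.reg rUp = 1 ∧
          s'.reg rNum = 1 ∧ s'.reg rType = 0)) := by
  refine Tri.straight rfl (by decide) ?_
  by_cases hl1 : lam = 1
  · subst hl1
    by_cases h0 : c2 = 0 <;>
      simp [decideMove, Prog.run, Term.val, hrp, hl, h1, h2, hn, h0]
  by_cases hl2 : lam = 2
  · subst hl2
    by_cases h0 : c1 = 0 <;>
      simp [decideMove, Prog.run, Term.val, hrp, hl, h1, h2, hn, h0]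
  by_cases h0 : c1 = 0
  · by_cases h0' : c2 = 0 <;>
      simp [decideMove, Prog.run, Term.val, hrp, hl, h1, h2, h0, h0', hl1, hl2]
  · simp [decideMove, Prog.run, Term.val, hrp, hl, h1, h0, hl1, hl2]

/-- The tree for the vertices below `x` has been built, and the work space has been cleaned up. -/
def Built (e : ℕ → ℕ → ℕ) (n M x : ℕ) (s : State) : Prop :=
  ∃ I D, Stored e (Finset.range x) I n M (s.reg rNew) (s.mem aPar) (s.mem aLab) (s.mem aNum)
    (s.mem aSum) D ∧ (∀ t ∈ I, s.mem aLab t ≠ s.mem aLab (s.mem aPar t)) ∧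
    s.reg rNew ≤ n + 1 + 2 * x ∧ (∀ t, s.mem aType t = 0) ∧ (∀ t, s.mem aOne t = 0) ∧
    (∀ t, s.mem aTwo t = 0) ∧ ∀ t, s.mem aMark t = 0

/-- A vertex is inserted in time linear in the number of arcs between it and the vertices inserted
before. -/
theorem tri_insertVertex {e : ℕ → ℕ → ℕ} {n M x : ℕ} {s : State} {l : List ℕ}
    (hE : IsSymbolic e {u | u < n}) (hx0 : x ≠ 0) (hxn : x < n) (hnM : 3 * n + 3 ≤ M)
    (h : Built e n M x s) (hrX : s.reg rX = x) (hrN : s.reg rN = n) (hrM : s.reg rM = M)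
    (hl : Linked (s.mem aNext) (s.mem aFirst x) l)
    (hcount : ∀ y, (l.map (s.mem aOther)).count y = if y < x then e x y else 0) :
    Tri insertVertex s (l.length * 700 + 1000) (Built e n M (x + 1)) := by
  obtain ⟨I, D, hS, hred, hNle, hty0, h10, h20, hmk0⟩ := h
  obtain ⟨par, hpar⟩ : ∃ par, par = s.mem aPar := ⟨_, rfl⟩
  obtain ⟨lab, hlab⟩ : ∃ lab, lab = s.mem aLab := ⟨_, rfl⟩
  obtain ⟨num, hnum⟩ : ∃ num, num = s.mem aNum := ⟨_, rfl⟩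
  obtain ⟨sum, hsum⟩ : ∃ sum, sum = s.mem aSum := ⟨_, rfl⟩
  obtain ⟨N, hN⟩ : ∃ N, N = s.reg rNew := ⟨_, rfl⟩
  rw [← hpar, ← hlab, ← hnum, ← hsum, ← hN] at hS
  rw [← hpar, ← hlab] at hred
  rw [← hN] at hNle
  have hT := hS.tree
  have hVE : ∀ v ∈ Finset.range x, v ∈ {u | u < n} := fun v hv =>
    (Finset.mem_range.1 hv).trans hxn
  have hxE : x ∈ {u | u < n} := hxn
  have hxV : x ∉ Finset.range x := Finset.notMem_range_self
  unfold insertVertex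
  -- The types of the vertices.
  refine Tri.seq (T := l.length * 40 + 20) (T' := l.length * 660 + 980)
    (tri_collect hrX hl hty0).frame ?_ (by omega)
  rintro s1 ⟨⟨hty1, hnd1, hmem1, hLl⟩, hr1, hm1⟩
  simp only [hcount] at hty1
  have hp1 : s1.mem aPar = par := by rw [hm1 _ (by decide), hpar]
  -- The types of the nodes.
  refine Tri.seq (T := l.length * 160 + 20) (T' := l.length * 500 + 960)
    ((tri_spread (f := e x) hT hp1 (fun u _ => hE.le_two x u)
      (fun q hq => by rw [hm1 _ (by decide), ← hnum]; exact hS.num_eq q hq)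
      (by rw [hm1 _ (by decide), ← hnum]; exact hS.num_top)
      (by rw [hm1 _ (by decide)]; exact h10) (by rw [hm1 _ (by decide)]; exact h20)
      (fun v hv => by rw [hty1, if_pos (Finset.mem_range.1 hv)])
      (fun v hv => by rw [hty1, if_neg fun h => hv (Finset.mem_range.2 h)])
      hnd1 hmem1).frame.conseq (by omega) fun _ h => h) ?_ (by omega)
  rintro s2 ⟨⟨wl, hwl, hsp, hone2, htwo2, hQ2, hK2, hlen2⟩, hr2, hm2⟩
  obtain ⟨L, hL⟩ : ∃ L, L = s2.reg rLenW := ⟨_, rfl⟩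
  obtain ⟨K, hK⟩ : ∃ K, K = s2.reg rLenQ := ⟨_, rfl⟩
  obtain ⟨ty, hty⟩ : ∃ ty, ty = s2.mem aType := ⟨_, rfl⟩
  obtain ⟨W, hW⟩ : ∃ W, W = s2.mem aW := ⟨_, rfl⟩
  obtain ⟨Q, hQ⟩ : ∃ Q, Q = s2.mem aQ := ⟨_, rfl⟩
  rw [← hW, ← hL] at hwl
  rw [← hty] at hsp hone2 htwo2
  rw [← hK] at hK2
  rw [← hQ, ← hK] at hQ2
  have hLw : L = wl.length := by rw [← hwl, length_seg]
  have hL2 : L ≤ 2 * l.length := by omega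
  have hKL : K ≤ 2 * l.length := by omega
  have hlive : ∀ q, IsTree.Live e (Finset.range x) I n par D x q ↔
      ∃ j < K, Q j = q ∧ ty (Q j) = 0 := by
    intro q
    rw [live_iff hT hsp, ← hQ2, mem_seg]
    constructor
    · rintro ⟨⟨j, hj, rfl⟩, h0⟩
      exact ⟨j, hj, rfl, h0⟩
    · rintro ⟨j, hj, rfl, h0⟩
      exact ⟨⟨j, hj, rfl⟩, h0⟩
  -- Marks.
  refine Tri.setReg_seq (C := 2) (T := l.length * 500 + 958) (by decide)
      (fun s3 hm3 hI3 hr3 => ?_) (by omega)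
  refine Tri.seq (T := l.length * 80 + 4) (T' := l.length * 420 + 954)
    ((tri_mark (par := par) (ty := ty) (Q := Q) (K := K)
      (by rw [hm3, hm2 _ (by decide), hp1]) (by rw [hm3, hty]) (by rw [hm3, hQ])
      (by rw [hr3 _ (by decide), hK]) hI3
      (fun t => by rw [hm3, hm2 _ (by decide), hm1 _ (by decide)]; exact hmk0 t)).frame.conseq
      (by omega) fun _ h => h) ?_ (by omega)
  rintro s4 ⟨hmk4, hr4, hm4⟩
  -- The lowest live node.
  refine Tri.setReg_seq (C := 2) (T := l.length * 420 + 952) (by decide)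
      (fun s5 hm5 hP5 hr5 => ?_) (by omega)
  rw [Term.val, hr4 _ (by decide), hr3 _ (by decide), hr2 _ (by decide), hr1 _ (by decide),
    hrN] at hP5
  refine Tri.setReg_seq (C := 2) (T := l.length * 420 + 950) (by decide)
      (fun s6 hm6 hI6 hr6 => ?_) (by omega)
  have hQ4 : s4.mem aQ = Q := by rw [hm4 _ (by decide), hm3, hQ]
  have hty4 : s4.mem aType = ty := by rw [hm4 _ (by decide), hm3, hty]
  have hK4 : s4.reg rLenQ = K := by rw [hr4 _ (by decide), hr3 _ (by decide), hK]
  refine Tri.seq (T := l.length * 80 + 4) (T' := l.length * 340 + 946)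
    ((tri_select (ty := ty) (mk := s4.mem aMark) (Q := Q) (K := K) (z := n)
      (by rw [hm6, hm5, hty4]) (by rw [hm6, hm5]) (by rw [hm6, hm5, hQ4])
      (by rw [hr6 _ (by decide), hr5 _ (by decide), hK4]) hI6
      (by rw [hr6 _ (by decide), hP5])).frame.conseq (by omega) fun _ h => h) ?_ (by omega)
  rintro s7 ⟨hsel, hr7, hm7⟩
  obtain ⟨p, hp⟩ : ∃ p, p = s7.reg rP := ⟨_, rfl⟩
  rw [← hp] at hsel
  have hnI : M ∉ I := fun hMI => by have := hS.inner M hMI; omega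
  have hsel' := selected hT hE hVE hxE hxV hred (p := p) (by omega) hnI hS.par_top hS.par_bound (by
    rcases hsel with ⟨h1, h2⟩ | ⟨j, h1, h2, h3, h4⟩
    · refine .inl ⟨h1, fun q hq => ?_⟩
      obtain ⟨j, h3, rfl, h4⟩ := (hlive q).1 hq
      obtain ⟨i, h5, h6, h7⟩ := (hmk4 _).1 (h2 j h3 h4)
      exact ⟨Q i, (hlive _).2 ⟨i, h5, rfl, h6⟩, h7⟩
    · refine .inr ⟨(hlive p).2 ⟨j, h1, h2, h3⟩, fun q hq => ?_⟩
      obtain ⟨i, h5, rfl, h6⟩ := (hlive q).1 hq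
      have h7 := mt (hmk4 p).2 (by rw [← h2]; exact not_not.2 h4)
      constructor <;> intro h8
      · exact h7 ⟨i, h5, h6, .inl h8.symm⟩
      · exact h7 ⟨i, h5, h6, .inr h8.symm⟩)
  have hpz : p = n ∨ p ∈ I := hsel'.imp And.left And.left
  -- The decision.
  have hm7' : ∀ a, a ≠ aMark → s7.mem a = s2.mem a := fun a ha => by
    rw [hm7 a (by simp [forUp, selectBody, Prog.writesMem]), hm6, hm5,
      hm4 a (by simp [forUp, markBody, Prog.writesMem, ha]), hm3]
  refine Tri.seq (T := 120) (T' := l.length * 340 + 826) (tri_decideMove (p := p) (lam := lab p)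
    (c1 := typeCount par wl ty 1 p) (c2 := typeCount par wl ty 2 p) (nm := num p) hp.symm
    (by rw [hm7' _ (by decide), hm2 _ (by decide), hm1 _ (by decide), hlab])
    (by rw [hm7' _ (by decide), hone2]) (by rw [hm7' _ (by decide), htwo2])
    (by rw [hm7' _ (by decide), hm2 _ (by decide), hm1 _ (by decide), hnum])).frame ?_ (by omega)
  rintro s8 ⟨⟨hlam8, hdec⟩, hr8, hm8⟩
  obtain ⟨mv, hmv⟩ : ∃ mv, mv = s8.reg rMove := ⟨_, rfl⟩
  obtain ⟨up, hup⟩ : ∃ up, up = s8.reg rUp := ⟨_, rfl⟩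
  obtain ⟨nu, hnu⟩ : ∃ nu, nu = s8.reg rNum := ⟨_, rfl⟩
  obtain ⟨k, hk⟩ : ∃ k, k = s8.reg rType := ⟨_, rfl⟩
  rw [← hmv, ← hup, ← hnu, ← hk] at hdec
  have hDec : Decided e (Finset.range x) I n par lab D x p (typeSet par wl ty mv p) k up nu := by
    have hsubs : ∀ k, typeSet par wl ty k p ⊆ kids (Finset.range x) I par p := by
      intro k t ht
      simp only [typeSet, Finset.mem_filter, List.mem_toFinset] at ht
      exact mem_kids.2 ⟨(hsp.node t (by simp [ht.1])).1, ht.2.1⟩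
    have hnumI : (lab p = 1 ∨ lab p = 2) → num p = (kids (Finset.range x) I par p).card := by
      intro hl'
      rcases hpz with rfl | hpI
      · rw [hS.lab_top] at hl'
        simp at hl'
      · exact hS.num_eq p hpI
    obtain ⟨k', hk2, hkl, hmv', hrest⟩ := exists_place hT hE hVE hxE hxV hS.lab_top
      ⟨0, Finset.mem_range.2 (Nat.pos_of_ne_zero hx0)⟩ hsp hsel'
    obtain ⟨a1, a2, a3⟩ := hmv' 1 (.inl rfl)
    obtain ⟨b1, b2, b3⟩ := hmv' 2 (.inr rfl)
    clear hsel hsel'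
    have hcard : ∀ k, typeCount par wl ty k p = (typeSet par wl ty k p).card := fun _ => rfl
    rcases hdec with ⟨hl1, rfl, rfl, rfl, hkk⟩ | ⟨hl1, rfl, rfl, rfl, hkk⟩ |
        ⟨hl1, hl2, h1, rfl, rfl, rfl, rfl⟩ | ⟨hl1, hl2, h1, h2, rfl, rfl, rfl, rfl⟩ |
        ⟨hl1, hl2, h1, h2, rfl, rfl, rfl, rfl⟩
    · obtain rfl : k = k' := by
        split_ifs at hkk with h2
        · have := b1.1 h2
          omega
        · have := mt b1.2 h2
          omega
      refine ⟨hsubs 1, fun _ => ⟨a2 hl1.symm, ?_⟩, by omega⟩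
      rw [Finset.card_sdiff_of_subset (hsubs 1), hnumI (.inl hl1), hcard]
    · obtain rfl : k = k' := by
        split_ifs at hkk with h2
        · have := a1.1 h2
          omega
        · have := mt a1.2 h2
          omega
      refine ⟨hsubs 2, fun _ => ⟨b2 hl1.symm, ?_⟩, by omega⟩
      rw [Finset.card_sdiff_of_subset (hsubs 2), hnumI (.inr hl1), hcard]
    · obtain rfl : 1 = k' := by
        have := a1.1 h1
        omega
      exact ⟨hsubs 1, by omega, fun _ => ⟨a3 rfl, rfl⟩⟩
    · obtain rfl : 2 = k' := by
        have := b1.1 h2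
        omega
      exact ⟨hsubs 2, by omega, fun _ => ⟨b3 rfl, rfl⟩⟩
    · obtain rfl : 0 = k' := by
        have := mt a1.2 (not_not.2 h1)
        have := mt b1.2 (not_not.2 h2)
        omega
      obtain ⟨c1, c2⟩ := hrest hl1 hl2 rfl
      have hempty : typeSet par wl ty 0 p = ∅ := by
        rw [Finset.eq_empty_iff_forall_notMem]
        intro t ht
        simp only [typeSet, Finset.mem_filter, List.mem_toFinset] at ht
        exact (hsp.node t (by simp [ht.1])).2.1 ht.2.2
      refine ⟨hsubs 0, fun _ => ?_, by omega⟩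
      rw [hempty, Finset.sdiff_empty]
      exact ⟨c2, c1.symm⟩
  -- Cleaning up.
  refine Tri.setReg_seq (C := 2) (T := l.length * 340 + 824) (by decide)
      (fun s9 hm9 hI9 hr9 => ?_) (by omega)
  have hm9' : ∀ a, a ≠ aMark → s9.mem a = s2.mem a := fun a ha => by
    rw [hm9, hm8 a (by simp [decideMove, Prog.writesMem]), hm7' a ha]
  have hmk9 : s9.mem aMark = s4.mem aMark := by
    rw [hm9, hm8 _ (by decide), hm7 _ (by decide), hm6, hm5]
  have hK9 : s9.reg rLenQ = K := by
    rw [hr9 _ (by decide), hr8 _ (by decide), hr7 _ (by decide), hr6 _ (by decide),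
      hr5 _ (by decide), hK4]
  have hinQ : ∀ t k, typeCount par wl ty k t ≠ 0 → ∃ j < K, t = Q j := by
    intro t k ht
    obtain ⟨t', h1, h2, _⟩ := SpreadInv.exists_of_typeCount_ne_zero ht
    obtain ⟨j, h3, h4⟩ := mem_seg.1 ((hQ2 t).2 ⟨t', h1, h2⟩)
    exact ⟨j, h3, h4.symm⟩
  have hp9 : s9.mem aPar = par := by rw [hm9' _ (by decide), hm2 _ (by decide), hp1]
  refine Tri.seq (T := l.length * 80 + 4) (T' := l.length * 260 + 820)
    ((tri_clear (par := par) (Q := Q) (K := K) hp9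
      (by rw [hm9' _ (by decide), hQ]) hK9 hI9 (fun t ht => by
        rw [hmk9] at ht
        obtain ⟨j, h1, _, h2⟩ := (hmk4 t).1 ht
        exact ⟨j, h1, h2⟩)
      (fun t ht => by rw [hm9' _ (by decide), hone2] at ht; exact hinQ t _ ht)
      (fun t ht => by rw [hm9' _ (by decide), htwo2] at ht; exact hinQ t _ ht)).frame.conseq
      (by omega) fun _ h => h) ?_ (by omega)
  rintro s10 ⟨⟨hmk10, hone10, htwo10⟩, hr10, hm10⟩
  have hm10' : ∀ a, a ≠ aMark ∧ a ≠ aOne ∧ a ≠ aTwo → s10.mem a = s2.mem a := fun a ⟨h1, h2, h3⟩ => by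
    rw [hm10 a (by simp [forUp, clearBody, Prog.writesMem, h1, h2, h3]), hm9' a h1]
  have hr10' : ∀ r, r ≠ rI ∧ r ≠ rT → s10.reg r = s8.reg r := fun r ⟨h1, h2⟩ => by
    rw [hr10 r (by simp [forUp, clearBody, Prog.writesReg, h1, h2]), hr9 r h1]
  -- Attaching the new vertex.
  have q1 : s10.mem aPar = par := by rw [hm10' _ (by decide), hm2 _ (by decide), hp1]
  have q2 : s10.mem aLab = lab := by
    rw [hm10' _ (by decide), hm2 _ (by decide), hm1 _ (by decide), hlab]
  have q3 : s10.mem aNum = num := by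
    rw [hm10' _ (by decide), hm2 _ (by decide), hm1 _ (by decide), hnum]
  have q4 : s10.mem aSum = sum := by
    rw [hm10' _ (by decide), hm2 _ (by decide), hm1 _ (by decide), hsum]
  have q5 : s10.mem aType = ty := by rw [hm10' _ (by decide), hty]
  have q6 : s10.mem aW = W := by rw [hm10' _ (by decide), hW]
  have hr78 : ∀ r, r ∉ [rI, rT, rP, rLam, rMove, rUp, rNum, rType] → s10.reg r = s2.reg r := by
    intro r hr
    simp only [List.mem_cons, List.not_mem_nil, or_false, not_or] at hr
    obtain ⟨h1, h2, h3, h4, h5, h6, h7, h8⟩ := hr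
    rw [hr10' r ⟨h1, h2⟩, hr8 r (by simp [decideMove, Prog.writesReg, h4, h5, h6, h7, h8]),
      hr7 r (by simp [forUp, selectBody, Prog.writesReg, h1, h2, h3]), hr6 r h1, hr5 r h3,
      hr4 r (by simp [forUp, markBody, Prog.writesReg, h1, h2]), hr3 r h1]
  have w1 : s10.reg rLenW = L := by rw [hr78 _ (by decide), hL]
  have w2 : s10.reg rNew = N := by
    rw [hr78 _ (by decide), hr2 _ (by decide), hr1 _ (by decide), hN]
  have w3 : s10.reg rM = M := by rw [hr78 _ (by decide), hr2 _ (by decide), hr1 _ (by decide), hrM]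
  have w4 : s10.reg rX = x := by rw [hr78 _ (by decide), hr2 _ (by decide), hr1 _ (by decide), hrX]
  have w5 : s10.reg rP = p := by rw [hr10' _ (by decide), hr8 _ (by decide), hp]
  have hndw : (seg W L).Nodup := by
    rw [hwl]
    have := hsp.nodup
    rwa [List.append_nil] at this
  refine Tri.seq (T := l.length * 216 + 300) (T' := l.length * 44 + 520)
    ((tri_regroup (V := Finset.range x) (I := I) (z := n) (N := N) (D := D) (x := x) (p := p) (k := k)
      (mv := mv) (up := up)
      (nu := nu) (L := L) (ty := ty) (W := W) (M := M) (by rw [q1, q2, q3, q4]; exact hS)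
      (by omega) hE hVE hxE hxV (by rw [q1, q2]; exact hred) (by rw [q1, q2, hwl]; exact hDec)
      q5 q6 w1 w5 (by rw [hr10' _ (by decide), hmv])
      (by rw [hr10' _ (by decide), hup]) (by rw [hr10' _ (by decide), hnu])
      (by rw [hr10' _ (by decide), hlam8, q2]) w2 w3 hndw (fun t ht => by
        rw [hwl] at ht
        have := (hS.node_lt (hsp.node t (by simpa using ht)).1).1
        omega)).frame.conseq (by omega) fun _ h => h) ?_ (by omega)
  rintro s11 ⟨⟨I', D', hS', hR, hN'⟩, hr11, hm11⟩
  refine Tri.seq (T := 300) (T' := l.length * 44 + 220)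
    (tri_attach hS' (by omega) hE.comm hxn hxV hR (by rw [hr11 _ (by decide), w4]) rfl
      (by rw [hr11 _ (by decide), hr10' _ (by decide), hk]) rfl
      (by rw [hr11 _ (by decide), w3])).frame ?_ (by omega)
  rintro s12 ⟨⟨I'', D'', hS'', hred'', hN''⟩, hr12, hm12⟩
  -- Forgetting the types.
  refine Tri.setReg_seq (C := 2) (T := l.length * 44 + 218) (by decide)
      (fun s13 hm13 hI13 hr13 => ?_) (by omega)
  refine (tri_forget (ty := ty) (W := W) (L := L)
    (by rw [hm13, hm12 _ (by decide), hm11 _ (by decide), q5])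
    (by rw [hm13, hm12 _ (by decide), hm11 _ (by decide), q6])
    (by rw [hr13 _ (by decide), hr12 _ (by decide), hr11 _ (by decide), w1]) hI13
    (fun t ht => by
      rw [hwl]
      by_contra hcon
      exact ht (hsp.zero t (by simpa using hcon)))).frame.conseq (by omega) ?_
  rintro s14 ⟨hty14, hr14, hm14⟩
  have hm14' : ∀ a, a ≠ aType → s14.mem a = s12.mem a := fun a ha => by
    rw [hm14 a (by simp [forUp, forgetBody, Prog.writesMem, ha]), hm13]
  have hN14 : s14.reg rNew = s12.reg rNew := by rw [hr14 _ (by decide), hr13 _ (by decide)]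
  refine ⟨I'', D'', ?_, ?_, by omega, hty14, fun t => ?_, fun t => ?_, fun t => ?_⟩
  · rw [hN14, hm14' _ (by decide), hm14' _ (by decide), hm14' _ (by decide), hm14' _ (by decide),
      Finset.range_add_one]
    exact hS''
  · rw [hm14' _ (by decide), hm14' _ (by decide)]
    exact hred''
  · rw [hm14' _ (by decide), hm12 _ (by decide), hm11 _ (by decide)]
    exact hone10 t
  · rw [hm14' _ (by decide), hm12 _ (by decide), hm11 _ (by decide)]
    exact htwo10 t
  · rw [hm14' _ (by decide), hm12 _ (by decide), hm11 _ (by decide)]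
    exact hmk10 t

end RAM

namespace RAM

open Term Prog Stored

/-! ### Building the tree -/

/-- The arcs stored in the first `m` cells of two arrays. -/
def ArcIn (T H : ℕ → ℕ) (m u v : ℕ) : Prop :=
  ∃ i < m, T i = u ∧ H i = v

/-- The multiplicity of `y` in the list of the arcs filed under `x`. -/
theorem count_arcsAt (T H o : ℕ → ℕ) (m x y : ℕ) (ho : ∀ i < m, o i = min (T i) (H i)) :
    ((arcsAt T H m x).map o).count y =
      ((Finset.range m).filter fun i => max (T i) (H i) = x ∧ min (T i) (H i) = y).card := by
  induction m with
  | zero => simp [arcsAt]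
  | succ m ih =>
    have h1 := ih fun i hi => ho i (by omega)
    rw [arcsAt_succ, Finset.range_add_one, Finset.filter_insert]
    have h2 := ho m (by omega)
    have h3 : m ∉ (Finset.range m).filter fun i =>
      max (T i) (H i) = x ∧ min (T i) (H i) = y := by simp
    by_cases hx : max (T m) (H m) = x
    · by_cases hy : min (T m) (H m) = y
      · rw [if_pos hx, if_pos ⟨hx, hy⟩, Finset.card_insert_of_notMem h3, List.map_cons,
          List.count_cons, h1, h2, hy]
        simp
      · rw [if_pos hx, if_neg (by tauto), List.map_cons, List.count_cons, h1, h2]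
        simp [hy]
    · rw [if_neg hx, if_neg (by tauto), h1]

theorem card_arcs {T H : ℕ → ℕ} {m : ℕ}
    (hnd : ∀ i < m, ∀ j < m, T i = T j → H i = H j → i = j) (u v : ℕ) [Decidable (ArcIn T H m u v)] :
    ((Finset.range m).filter fun i => T i = u ∧ H i = v).card =
      if ArcIn T H m u v then 1 else 0 := by
  split_ifs with h
  · obtain ⟨i, hi, h1, h2⟩ := h
    rw [Finset.card_eq_one]
    refine ⟨i, Finset.eq_singleton_iff_unique_mem.2 ⟨by simp [hi, h1, h2], fun j hj => ?_⟩⟩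
    simp only [Finset.mem_filter, Finset.mem_range] at hj
    exact hnd j hj.1 i hi (hj.2.1.trans h1.symm) (hj.2.2.trans h2.symm)
  · rw [Finset.card_eq_zero, Finset.filter_eq_empty_iff]
    exact fun i hi hi' => h ⟨i, Finset.mem_range.1 hi, hi'⟩

theorem count_arcsAt_eq {T H o : ℕ → ℕ} {m : ℕ}
    (hnd : ∀ i < m, ∀ j < m, T i = T j → H i = H j → i = j) (hne : ∀ i < m, T i ≠ H i)
    (ho : ∀ i < m, o i = min (T i) (H i)) (x y : ℕ) :
    ((arcsAt T H m x).map o).count y = if y < x then arcCount (ArcIn T H m) x y else 0 := by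
  classical
  rw [count_arcsAt T H o m x y ho]
  split_ifs with hxy
  · rw [arcCount, add_comm, ← card_arcs hnd, ← card_arcs hnd, ← Finset.card_union_of_disjoint]
    · congr 1
      ext i
      simp only [Finset.mem_filter, Finset.mem_range, Finset.mem_union]
      constructor
      · rintro ⟨h1, h2, h3⟩
        rcases le_total (T i) (H i) with h | h
        · left; rw [max_eq_right h] at h2; rw [min_eq_left h] at h3; exact ⟨h1, h3, h2⟩
        · right; rw [max_eq_left h] at h2; rw [min_eq_right h] at h3; exact ⟨h1, h2, h3⟩
      · rintro (⟨h1, rfl, rfl⟩ | ⟨h1, rfl, rfl⟩)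
        · exact ⟨h1, max_eq_right hxy.le, min_eq_left hxy.le⟩
        · exact ⟨h1, max_eq_left hxy.le, min_eq_right hxy.le⟩
    · rw [Finset.disjoint_left]
      intro i hi hi'
      simp only [Finset.mem_filter, Finset.mem_range] at hi hi'
      omega
  · rw [Finset.card_eq_zero, Finset.filter_eq_empty_iff]
    rintro i hi ⟨h1, h2⟩
    have := hne i (Finset.mem_range.1 hi)
    omega

/-- The tree for the vertex `0` alone. -/
theorem tri_initTree {e : ℕ → ℕ → ℕ} {n M : ℕ} {s : State} (hn : 0 < n) (hnM : n + 1 < M)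
    (hrN : s.reg rN = n) (hrM : s.reg rM = M) (h0 : ∀ a, aPar ≤ a → ∀ i, s.mem a i = 0) :
    Tri initTree s 40 (Built e n M 1) := by
  refine Tri.straight rfl (by decide) ⟨∅, fun _ => {0}, ?_⟩
  have g : initTree.run s = (((((((s.write aPar 0 n).write aLab 0 3).write aPar n M).write
      aPar M M).write aLab n 3).write aNum n 2).setReg rNew (n + 1)) := by
    simp [initTree, Prog.run, Term.val, hrN, hrM]
  rw [g]
  have h6 : s.mem aPar = fun _ => 0 := funext (h0 _ (by decide))
  have h7 : s.mem aLab = fun _ => 0 := funext (h0 _ (by decide))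
  have h8 : s.mem aNum = fun _ => 0 := funext (h0 _ (by decide))
  have h9 : s.mem aSum = fun _ => 0 := funext (h0 _ (by decide))
  have h10 : s.mem aType = fun _ => 0 := funext (h0 _ (by decide))
  have h11 : s.mem aOne = fun _ => 0 := funext (h0 _ (by decide))
  have h12 : s.mem aTwo = fun _ => 0 := funext (h0 _ (by decide))
  have h13 : s.mem aMark = fun _ => 0 := funext (h0 _ (by decide))
  obtain ⟨par, hpar⟩ : ∃ par : ℕ → ℕ, par = Function.update (Function.update (Function.update
    (fun _ => 0) 0 n) n M) M M := ⟨_, rfl⟩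
  have hp0 : par 0 = n := by
    rw [hpar, Function.update_of_ne (by omega), Function.update_of_ne (by omega),
      Function.update_self]
  have hk : kids (Finset.range 1) ∅ par n = {0} := by
    ext t
    simp only [mem_kids, Finset.mem_range, Finset.mem_singleton, Finset.notMem_empty, or_false]
    constructor
    · rintro ⟨h1, _⟩
      omega
    · rintro rfl
      exact ⟨by omega, hp0⟩
  have key : Stored e (Finset.range 1) ∅ n M (n + 1) par
      (Function.update (Function.update (fun _ => 0) 0 3) n 3)
      (Function.update (fun _ => 0) n 2) (fun _ => 0) (fun _ => {0}) := by
    refine ⟨⟨by simp, by simp; omega, by simp, ?_, ?_, ?_, ?_, by simp, ?_, by simp, by simp, ?_⟩,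
      by simp, ?_, by simp, by simp, ?_, by omega, ?_, ?_, by simp, by simp, ?_⟩
    · rintro t (ht | ht)
      · obtain rfl : t = 0 := by simpa using ht
        exact .inl hp0
      · simp at ht
    · intro v hv
      obtain rfl : v = 0 := by simpa using hv
      rfl
    · rintro q (rfl | hq) u
      · constructor
        · intro hu
          obtain rfl : u = 0 := by simpa using hu
          exact ⟨0, by simp, hp0, by simp⟩
        · rintro ⟨_, _, _, h⟩
          exact h
      · simp at hq
    · rintro c c' (hc | hc) (hc' | hc') hne
      · simp only [Finset.mem_range] at hc hc'
        omega
      all_goals simp at hc hc'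
    · rintro t _
      simp
    · rintro c c' (hc | hc) (hc' | hc') _ _
      · simp only [Finset.mem_range] at hc hc'
        omega
      all_goals simp at hc hc'
    · intro v hv
      obtain rfl : v = 0 := by simpa using hv
      rw [Function.update_of_ne (by omega), Function.update_self]
    · intro v hv
      simp only [Finset.mem_range] at hv
      omega
    · rw [hpar, Function.update_of_ne (by omega), Function.update_self]
    · rw [hpar, Function.update_self]
    · rintro q (rfl | hq)
      · rw [hk]
        exact ⟨by omega, by simp⟩
      · simp at hq
  refine ⟨by simpa [h6, h7, h8, h9, ← hpar] using key, by simp, by simp, ?_, ?_, ?_, ?_⟩ <;>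
    simp [h10, h11, h12, h13]

/-- The tree is built in linear time, because each arc is used for the insertion of its larger
endpoint only. -/
theorem tri_buildTree {T H : ℕ → ℕ} {m n M : ℕ} {s : State} (hn : 0 < n) (hnM : 3 * n + 3 ≤ M)
    (hE : IsSymbolic (arcCount (ArcIn T H m)) {u | u < n})
    (hnd : ∀ i < m, ∀ j < m, T i = T j → H i = H j → i = j) (hne : ∀ i < m, T i ≠ H i)
    (hT : s.mem aTail = T) (hH : s.mem aHead = H) (h0 : ∀ a, 2 ≤ a → ∀ i, s.mem a i = 0)
    (hrN : s.reg rN = n) (hrE : s.reg rE = m) (hrM : s.reg rM = M) :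
    Tri buildTree s (m * 760 + n * 1100 + 100) fun s' =>
      Built (arcCount (ArcIn T H m)) n M n s' ∧
      ∀ v, s'.mem aIndeg v = ((Finset.range m).filter fun i => H i = v).card := by
  unfold buildTree
  refine Tri.setReg_seq (C := 2) (T := m * 760 + n * 1100 + 98) (by decide)
      (fun s1 hm1 hI1 hr1 => ?_) (by omega)
  refine Tri.seq (T := m * 60 + 4) (T' := m * 700 + n * 1100 + 94)
    (tri_arcs (T := T) (H := H) (m := m) (by rw [hm1, hT]) (by rw [hm1, hH])
      (by rw [hm1]; exact h0 _ (by decide)) (by rw [hm1]; exact h0 _ (by decide)) hI1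
      (by rw [hr1 _ (by decide), hrE])).frame ?_ (by omega)
  rintro s2 ⟨⟨hlk, hot, hin⟩, hr2, hm2⟩
  refine Tri.seq (T := 40) (T' := m * 700 + n * 1100 + 54)
    (tri_initTree (e := arcCount (ArcIn T H m)) (n := n) (M := M) hn (by omega)
      (by rw [hr2 _ (by decide), hr1 _ (by decide), hrN])
      (by rw [hr2 _ (by decide), hr1 _ (by decide), hrM]) (fun a ha i => by
        rw [hm2 a (by simp [forUp, arcBody, Prog.writesMem]; omega), hm1]
        exact h0 a (by omega) i)).frame ?_ (by omega)
  rintro s3 ⟨hb3, hr3, hm3⟩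
  refine Tri.setReg_seq (C := 2) (T := m * 700 + n * 1100 + 52) (by decide)
      (fun s4 hm4 hX4 hr4 => ?_) (by omega)
  obtain ⟨nx, hnx⟩ : ∃ f, f = s2.mem aNext := ⟨_, rfl⟩
  obtain ⟨fs, hfs⟩ : ∃ f, f = s2.mem aFirst := ⟨_, rfl⟩
  obtain ⟨ot, hoth⟩ : ∃ f, f = s2.mem aOther := ⟨_, rfl⟩
  obtain ⟨ind, hind⟩ : ∃ f, f = s2.mem aIndeg := ⟨_, rfl⟩
  rw [← hnx, ← hfs] at hlk
  rw [← hoth] at hot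
  rw [← hind] at hin
  have hcount := count_arcsAt_eq hnd hne hot
  have hsum := sum_length_arcsAt T H m n
  refine (Tri.forUp' (N := n) (fun x => (arcsAt T H m x).length * 700 + 1010)
    (fun x s' => Built (arcCount (ArcIn T H m)) n M (max x 1) s' ∧ s'.reg rN = n ∧ s'.reg rM = M ∧
      s'.mem aNext = nx ∧ s'.mem aFirst = fs ∧ s'.mem aOther = ot ∧ s'.mem aIndeg = ind) ?_
    rfl rfl (by decide) hX4 ?_ ?_ ?_).conseq le_rfl ?_
  · rintro x s5 hx ⟨hb, hrN5, hrM5, h1, h2, h3, h4⟩ hrX5 _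
    refine Tri.ite (T := (arcsAt T H m x).length * 700 + 1000) (fun hne => ?_) (fun heq => ?_)
      (by simp only [Term.cost]; omega)
    · have hx0 : x ≠ 0 := by simpa [Term.val, hrX5] using hne
      rw [max_eq_left (by omega)] at hb
      refine (tri_insertVertex hE hx0 hx hnM hb hrX5 hrN5 hrM5 (by rw [h1, h2]; exact hlk x)
        (by rw [h3]; exact hcount x)).frame.conseq le_rfl ?_
      rintro s6 ⟨hb6, hr6, hm6⟩
      refine ⟨?_, ?_⟩
      · rw [max_eq_left (by omega)]
        exact hb6
      · have e1 := hr6 rN (by decide)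
        have e2 := hr6 rM (by decide)
        have e3 := hm6 aNext (by decide)
        have e4 := hm6 aFirst (by decide)
        have e5 := hm6 aOther (by decide)
        have e6 := hm6 aIndeg (by decide)
        simp [*]
    · have hx0 : x = 0 := by simpa [Term.val, hrX5] using heq
      subst hx0
      refine Tri.straight rfl (le_trans (b := 1) (by decide) (by omega)) ?_
      exact ⟨hb, by simp [Prog.run, hrN5], by simp [Prog.run, hrM5], h1, h2, h3, h4⟩
  · rw [hr4 _ (by decide), hr3 _ (by decide), hr2 _ (by decide), hr1 _ (by decide), hrN]
  · refine ⟨?_, ?_, ?_, ?_, ?_, ?_, ?_⟩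
    · unfold Built at hb3 ⊢
      rw [hm4, hr4 _ (by decide)]
      exact hb3
    · rw [hr4 _ (by decide), hr3 _ (by decide), hr2 _ (by decide), hr1 _ (by decide), hrN]
    · rw [hr4 _ (by decide), hr3 _ (by decide), hr2 _ (by decide), hr1 _ (by decide), hrM]
    · rw [hm4, hm3 _ (by decide), hnx]
    · rw [hm4, hm3 _ (by decide), hfs]
    · rw [hm4, hm3 _ (by decide), hoth]
    · rw [hm4, hm3 _ (by decide), hind]
  · simp only [Finset.sum_add_distrib, ← Finset.sum_mul, Finset.sum_const, Finset.card_range,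
      smul_eq_mul]
    omega
  · rintro s' ⟨⟨h1, _, _, _, _, _, h2⟩, _⟩
    rw [max_eq_left (by omega)] at h1
    exact ⟨h1, by rw [h2]; exact hin⟩

end RAM

/-! ### Compatible vertices and the tree -/

/-- Some other vertex of `S` has no arc to `v`. -/
def Alpha (A : ℕ → ℕ → Prop) (S : Finset ℕ) (v : ℕ) : Prop :=
  ∃ w ∈ S, w ≠ v ∧ ¬ A w v

/-- Some other vertex of `S` receives no arc from `v`. -/
def Beta (A : ℕ → ℕ → Prop) (S : Finset ℕ) (v : ℕ) : Prop :=
  ∃ w ∈ S, w ≠ v ∧ ¬ A v w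

/-- A reduced tree for a relation with the local structure of a directed co-graph. -/
structure CoTree (A : ℕ → ℕ → Prop) (V I : Finset ℕ) (z : ℕ) (par lab : ℕ → ℕ) (D : ℕ → Finset ℕ) :
    Prop where
  rel : IsCoRel A {u | u ∈ V}
  mem : ∀ u v, A u v → u ∈ V ∧ v ∈ V
  tree : IsTree (arcCount A) V I z par lab D
  red : ∀ t ∈ I, lab t ≠ lab (par t)
  lab_le : ∀ t ∈ I, lab t ≤ 2

namespace CoTree

variable {A : ℕ → ℕ → Prop} {V I : Finset ℕ} {z : ℕ} {par lab : ℕ → ℕ} {D : ℕ → Finset ℕ}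

theorem sub_kid (h : CoTree A V I z par lab D) {p c : ℕ} (hc : c ∈ kids V I par p) : D c ⊆ D p := by
  obtain ⟨h1, h2⟩ := mem_kids.1 hc
  exact h2 ▸ h.tree.subset_par h1

theorem mem_kid (h : CoTree A V I z par lab D) {p u : ℕ} (hp : p ∈ I) :
    u ∈ D p ↔ ∃ c ∈ kids V I par p, u ∈ D c := by
  rw [h.tree.mem_iff p (.inr hp)]
  exact ⟨fun ⟨c, h1, h2, h3⟩ => ⟨c, mem_kids.2 ⟨h1, h2⟩, h3⟩, fun ⟨c, h1, h2⟩ =>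
    ⟨c, (mem_kids.1 h1).1, (mem_kids.1 h1).2, h2⟩⟩

theorem cross (h : CoTree A V I z par lab D) {p c c' u v : ℕ} (hc : c ∈ kids V I par p)
    (hc' : c' ∈ kids V I par p) (hne : c ≠ c') (hu : u ∈ D c) (hv : v ∈ D c') :
    u ≠ v ∧ arcCount A u v = lab p := by
  obtain ⟨h1, h2⟩ := mem_kids.1 hc
  obtain ⟨h3, h4⟩ := mem_kids.1 hc'
  have := h.tree.sibling c c' h1 h3 hne (h2.trans h4.symm) u hu v hv
  rwa [h2] at this

theorem exists_other (h : CoTree A V I z par lab D) {p c : ℕ} (hp : p ∈ I)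
    (hc : c ∈ kids V I par p) : ∃ c' ∈ kids V I par p, c' ≠ c ∧ ∃ w, w ∈ D c' := by
  obtain ⟨h1, h2⟩ := mem_kids.1 hc
  obtain ⟨c', h3, h4, h5⟩ := h.tree.exists_sibling (h2 ▸ hp)
  exact ⟨c', mem_kids.2 ⟨h3, h5.trans h2⟩, h4, h.tree.nonempty c' h3⟩

theorem mem_V (h : CoTree A V I z par lab D) {p c u : ℕ} (hc : c ∈ kids V I par p) (hu : u ∈ D c) :
    u ∈ V := h.tree.sub c (mem_kids.1 hc).1 hu

/-- A vertex outside a module that is joined to itself in both directions is not sensitive to the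
direction of arcs. -/
theorem outside (h : CoTree A V I z par lab D) {t u v w : ℕ} (ht : t ∈ V ∨ t ∈ I) (hu : u ∈ D t)
    (hv : v ∈ D t) (hw : w ∈ V) (hwt : w ∉ D t) (huv : A u v ∧ A v u) :
    (A w u ↔ A w v) ∧ (A u w ↔ A v w) := by
  have h1 := h.tree.eq_of_notMem t ht w hw hwt u hu v hv
  have hu' := h.tree.sub t ht hu
  have hv' := h.tree.sub t ht hv
  have t1 := h.rel.trans u hu' w hw v hv'
  have t2 := h.rel.trans v hv' w hw u hu'
  unfold arcCount at h1
  split_ifs at h1 <;> simp_all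

/-- Compatible vertices below a node are distinguished, in both directions, by vertices below that
node. -/
theorem compat_cond (h : CoTree A V I z par lab D) {t u v : ℕ} (ht : t ∈ V ∨ t ∈ I) (hu : u ∈ D t)
    (hv : v ∈ D t) (hK : (Digraph.mk A).Compatible u v) :
    (Beta A (D t) u ∨ Alpha A (D t) v) ∧ (Beta A (D t) v ∨ Alpha A (D t) u) := by
  have key : ∀ u v, u ∈ D t → v ∈ D t → A u v ∧ A v u → (Digraph.mk A).Distinguished u v →
      Beta A (D t) u ∨ Alpha A (D t) v := by
    rintro u v hu hv huv ⟨w, hwu, hwv, hw⟩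
    by_cases hwt : w ∈ D t
    · rcases hw with ⟨_, h2⟩ | ⟨_, h2⟩
      · exact .inr ⟨w, hwt, hwv, h2⟩
      · exact .inl ⟨w, hwt, hwu, h2⟩
    · exfalso
      have hwV : w ∈ V := by
        rcases hw with ⟨h1, _⟩ | ⟨h1, _⟩
        · exact (h.mem _ _ h1).1
        · exact (h.mem _ _ h1).2
      have := h.outside ht hu hv hwV hwt huv
      rcases hw with ⟨h1, h2⟩ | ⟨h1, h2⟩
      · exact h2 (this.1.1 h1)
      · exact h2 (this.2.2 h1)
  obtain ⟨h1, h2, h3, h4⟩ := hK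
  exact ⟨key u v hu hv ⟨h1, h2⟩ h3, key v u hv hu ⟨h2, h1⟩ h4⟩

theorem join_adj (h : CoTree A V I z par lab D) {p c c' u v : ℕ} (hl : lab p = 2)
    (hc : c ∈ kids V I par p) (hc' : c' ∈ kids V I par p) (hne : c ≠ c') (hu : u ∈ D c)
    (hv : v ∈ D c') : A u v ∧ A v u :=
  arcCount_eq_two.1 ((h.cross hc hc' hne hu hv).2.trans hl)

/-- At a join, the vertices of different children are compatible if one of them has a non-neighbour
of the right direction among its own descendants, for each of the two directions. -/
theorem compat_of_cond (h : CoTree A V I z par lab D) {p c c' u v : ℕ} (hl : lab p = 2)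
    (hc : c ∈ kids V I par p) (hc' : c' ∈ kids V I par p) (hne : c ≠ c') (hu : u ∈ D c)
    (hv : v ∈ D c') (h1 : Beta A (D c) u ∨ Alpha A (D c') v)
    (h2 : Beta A (D c') v ∨ Alpha A (D c) u) : (Digraph.mk A).Compatible u v := by
  have key : ∀ c c' u v, c ∈ kids V I par p → c' ∈ kids V I par p → c ≠ c' → u ∈ D c → v ∈ D c' →
      Beta A (D c) u ∨ Alpha A (D c') v → (Digraph.mk A).Distinguished u v := by
    rintro c c' u v hc hc' hne hu hv (⟨w, hw, hwu, hA⟩ | ⟨w, hw, hwv, hA⟩)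
    · have h3 := h.cross hc hc' hne hw hv
      exact ⟨w, hwu, h3.1, .inr ⟨(h.join_adj hl hc hc' hne hw hv).2, hA⟩⟩
    · have h3 := h.cross hc hc' hne hu hw
      exact ⟨w, h3.1.symm, hwv, .inl ⟨(h.join_adj hl hc hc' hne hu hw).2, hA⟩⟩
  obtain ⟨h3, h4⟩ := h.join_adj hl hc hc' hne hu hv
  exact ⟨h3, h4, key c c' u v hc hc' hne hu hv h1, key c' c v u hc' hc hne.symm hv hu h2⟩

theorem not_compat (h : CoTree A V I z par lab D) {p c c' u v : ℕ} (hl : lab p ≠ 2)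
    (hc : c ∈ kids V I par p) (hc' : c' ∈ kids V I par p) (hne : c ≠ c') (hu : u ∈ D c)
    (hv : v ∈ D c') : ¬ (Digraph.mk A).Compatible u v := fun hK =>
  hl ((h.cross hc hc' hne hu hv).2.symm.trans (arcCount_eq_two.2 ⟨hK.1, hK.2.1⟩))

/-! ### In-degrees and the order of the children of a directed join -/

open Classical in
/-- The number of arcs that enter `v`. -/
noncomputable def inDeg (A : ℕ → ℕ → Prop) (V : Finset ℕ) (v : ℕ) : ℕ :=
  (V.filter fun u => A u v).card

/-- Single arcs lead to vertices of larger in-degree, by transitivity. -/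
theorem inDeg_lt (h : CoTree A V I z par lab D) {u v : ℕ} (huv : A u v) (hvu : ¬ A v u) :
    inDeg A V u < inDeg A V v := by
  classical
  obtain ⟨hu, hv⟩ := h.mem u v huv
  refine Finset.card_lt_card (Finset.ssubset_iff_of_subset ?_ |>.2 ⟨u, ?_, ?_⟩)
  · intro w hw
    rw [Finset.mem_filter] at hw ⊢
    refine ⟨hw.1, ?_⟩
    have hwu : w ≠ u := by rintro rfl; exact h.rel.irrefl w hu hw.2
    have hwv : w ≠ v := by rintro rfl; exact hvu hw.2
    have huv' : u ≠ v := by rintro rfl; exact hvu huv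
    have r := h.rel.rainbow w hw.1 u hu v hv hwu hwv huv'
    have t1 := h.rel.trans w hw.1 u hu v hv
    have t2 := h.rel.trans u hu v hv w hw.1
    have hwu' := hw.2
    by_contra hcon
    unfold arcCount at r
    by_cases h1 : A u w <;> by_cases h2 : A v w <;> simp_all
  · simp [hu, huv]
  · simp [h.rel.irrefl u hu]

/-- All arcs between two children of a directed join have the same direction. -/
theorem uniform (h : CoTree A V I z par lab D) {p c c' : ℕ} (hl : lab p = 1)
    (hc : c ∈ kids V I par p) (hc' : c' ∈ kids V I par p) (hne : c ≠ c') :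
    (∀ u ∈ D c, ∀ v ∈ D c', A u v ∧ ¬ A v u) ∨ ∀ u ∈ D c, ∀ v ∈ D c', A v u ∧ ¬ A u v := by
  -- Moving one endpoint within a child does not turn an arc around.
  have move : ∀ c c', c ∈ kids V I par p → c' ∈ kids V I par p → c ≠ c' → ∀ u ∈ D c, ∀ u' ∈ D c,
      ∀ v ∈ D c', A u v → ¬ A v u → A u' v := by
    intro c c' hc hc' hne u hu u' hu' v hv h1 h2
    by_contra hcon
    have huv' := (h.cross hc hc' hne hu' hv).2.trans hl
    have h3 : A v u' ∧ ¬ A u' v := (arcCount_eq_one.1 huv').resolve_left fun h4 => hcon h4.1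
    have huu : u ≠ u' := by rintro rfl; exact hcon h1
    have hcI : c ∈ I := by
      refine (mem_kids.1 hc).1.resolve_left fun hcV => huu ?_
      rw [h.tree.leaf c hcV, Finset.mem_singleton] at hu hu'
      rw [hu, hu']
    have hlc : lab c ≠ 1 := by
      have := h.red c hcI
      rwa [(mem_kids.1 hc).2, hl] at this
    have hVu := h.mem_V hc hu
    have hVu' := h.mem_V hc hu'
    have hVv := h.mem_V hc' hv
    obtain ⟨b, hb, hub⟩ := (h.mem_kid hcI).1 hu
    obtain ⟨b', hb', hub'⟩ := (h.mem_kid hcI).1 hu'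
    have t1 := h.rel.trans u hVu v hVv u' hVu' h1 h2 h3.1 h3.2
    by_cases hbb : b = b'
    · obtain ⟨a, ha, hab, w, hw⟩ := h.exists_other hcI hb
      have h4 := (h.cross ha hb hab hw hub).2
      have h5 := (h.cross ha hb' (by rw [← hbb]; exact hab) hw hub').2
      have hwc : w ∈ D c := h.sub_kid ha hw
      have hVw := h.mem_V hc hwc
      rcases arcCount_eq_one.1 ((h.cross hc hc' hne hwc hv).2.trans hl) with h6 | h6
      · have := h.rel.trans w hVw v hVv u' hVu' h6.1 h6.2 h3.1 h3.2
        exact hlc (h5.symm.trans (arcCount_eq_one.2 (.inl this)))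
      · have := h.rel.trans u hVu v hVv w hVw h1 h2 h6.1 h6.2
        exact hlc (h4.symm.trans (arcCount_eq_one.2 (.inr this)))
    · exact hlc ((h.cross hb hb' hbb hub hub').2.symm.trans (arcCount_eq_one.2 (.inl t1)))
  have both : ∀ c c', c ∈ kids V I par p → c' ∈ kids V I par p → c ≠ c' → ∀ u ∈ D c, ∀ v ∈ D c',
      A u v → ¬ A v u → ∀ u' ∈ D c, ∀ v' ∈ D c', A u' v' ∧ ¬ A v' u' := by
    intro c c' hc hc' hne u hu v hv h1 h2 u' hu' v' hv'
    have e1 := (h.cross hc hc' hne hu' hv).2.trans hl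
    have e2 := (h.cross hc hc' hne hu' hv').2.trans hl
    have h3 : A u' v := move c c' hc hc' hne u hu u' hu' v hv h1 h2
    rw [arcCount_eq_one] at e1 e2
    by_contra hcon
    have h4 : A v' u' ∧ ¬ A u' v' := e2.resolve_left hcon
    have h5 := move c' c hc' hc hne.symm v' hv' v hv u' hu' h4.1 h4.2
    tauto
  obtain ⟨u, hu⟩ := h.tree.nonempty c (mem_kids.1 hc).1
  obtain ⟨v, hv⟩ := h.tree.nonempty c' (mem_kids.1 hc').1
  rcases arcCount_eq_one.1 ((h.cross hc hc' hne hu hv).2.trans hl) with h1 | h1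
  · exact .inl (both c c' hc hc' hne u hu v hv h1.1 h1.2)
  · exact .inr fun a ha b hb => both c' c hc' hc hne.symm v hv u hu h1.1 h1.2 b hb a ha

/-- The child `c` has a predecessor (`lo`) or a successor (`hi`) among the other children of its
parent, in the sense that each of its vertices receives no arc from, or has no arc to, some vertex
of another child. -/
structure Flags (A : ℕ → ℕ → Prop) (V I : Finset ℕ) (par lab : ℕ → ℕ) (D : ℕ → Finset ℕ)
    (lo hi : ℕ → Prop) : Prop where
  beta : ∀ p ∈ I, ∀ c ∈ kids V I par p, ∀ u ∈ D c,
    Beta A (D p) u ↔ (lab p ≠ 2 ∧ lo c) ∨ Beta A (D c) u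
  alpha : ∀ p ∈ I, ∀ c ∈ kids V I par p, ∀ u ∈ D c,
    Alpha A (D p) u ↔ (lab p ≠ 2 ∧ hi c) ∨ Alpha A (D c) u
  either : ∀ p ∈ I, lab p ≠ 2 → ∀ c ∈ kids V I par p, lo c ∨ hi c

/-- In a directed join the first and the last child are those of the least and the greatest
in-degree, where the in-degree `r c` of a child is that of any of its vertices. -/
theorem flags (h : CoTree A V I z par lab D) {r mn mx : ℕ → ℕ}
    (hr : ∀ t, t ∈ V ∨ t ∈ I → ∃ u ∈ D t, r t = inDeg A V u)
    (hmn : ∀ p ∈ I, (∀ c ∈ kids V I par p, mn p ≤ r c) ∧ ∃ c ∈ kids V I par p, mn p = r c)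
    (hmx : ∀ p ∈ I, (∀ c ∈ kids V I par p, r c ≤ mx p) ∧ ∃ c ∈ kids V I par p, mx p = r c) :
    Flags A V I par lab D (fun c => lab (par c) = 0 ∨ r c ≠ mn (par c))
      (fun c => lab (par c) = 0 ∨ r c ≠ mx (par c)) := by
  -- The arcs between two children of a directed join, from the in-degrees.
  have dir : ∀ p ∈ I, lab p = 1 → ∀ c ∈ kids V I par p, ∀ c' ∈ kids V I par p, c ≠ c' →
      (r c < r c' ∧ ∀ u ∈ D c, ∀ v ∈ D c', A u v ∧ ¬ A v u) ∨
      (r c' < r c ∧ ∀ u ∈ D c, ∀ v ∈ D c', A v u ∧ ¬ A u v) := by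
    intro p _ hl c hc c' hc' hne
    obtain ⟨u, hu, hru⟩ := hr c (mem_kids.1 hc).1
    obtain ⟨v, hv, hrv⟩ := hr c' (mem_kids.1 hc').1
    rw [hru, hrv]
    refine (h.uniform hl hc hc' hne).imp (fun h1 => ⟨?_, h1⟩) fun h1 => ⟨?_, h1⟩
    · exact h.inDeg_lt (h1 u hu v hv).1 (h1 u hu v hv).2
    · exact h.inDeg_lt (h1 u hu v hv).1 (h1 u hu v hv).2
  have lab1 : ∀ p ∈ I, lab p ≠ 2 → lab p ≠ 0 → lab p = 1 := fun p hp h1 h2 => by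
    have := h.lab_le p hp
    omega
  refine ⟨?_, ?_, ?_⟩
  · intro p hp c hc u hu
    rw [(mem_kids.1 hc).2]
    constructor
    · rintro ⟨w, hw, hwu, hA⟩
      obtain ⟨c', hc', hwc⟩ := (h.mem_kid hp).1 hw
      by_cases hcc : c = c'
      · exact .inr ⟨w, hcc ▸ hwc, hwu, hA⟩
      · refine .inl ⟨fun hl => hA (h.join_adj hl hc hc' hcc hu hwc).1, ?_⟩
        by_contra hcon
        push Not at hcon
        have hl2 : lab p ≠ 2 := fun hl => hA (h.join_adj hl hc hc' hcc hu hwc).1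
        rcases dir p hp (lab1 p hp hl2 hcon.1) c hc c' hc' hcc with h1 | h1
        · exact hA (h1.2 u hu w hwc).1
        · have := (hmn p hp).1 c' hc'
          omega
    · rintro (⟨hl, h1⟩ | ⟨w, hw, h1, h2⟩)
      · by_cases hl0 : lab p = 0
        · obtain ⟨c', hc', hcc, w, hw⟩ := h.exists_other hp hc
          have := h.cross hc' hc hcc hw hu
          exact ⟨w, h.sub_kid hc' hw, this.1, (arcCount_eq_zero.1 (this.2.trans hl0)).2⟩
        · obtain ⟨c', hc', hm⟩ := (hmn p hp).2
          have hcc : c ≠ c' := by rintro rfl; exact h1.elim hl0 fun h1 => h1 hm.symm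
          have h3 := (hmn p hp).1 c hc
          obtain ⟨w, hw⟩ := h.tree.nonempty c' (mem_kids.1 hc').1
          rcases dir p hp (lab1 p hp hl hl0) c hc c' hc' hcc with h4 | h4
          · omega
          · exact ⟨w, h.sub_kid hc' hw, (h.cross hc hc' hcc hu hw).1.symm, (h4.2 u hu w hw).2⟩
      · exact ⟨w, h.sub_kid hc hw, h1, h2⟩
  · intro p hp c hc u hu
    rw [(mem_kids.1 hc).2]
    constructor
    · rintro ⟨w, hw, hwu, hA⟩
      obtain ⟨c', hc', hwc⟩ := (h.mem_kid hp).1 hw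
      by_cases hcc : c = c'
      · exact .inr ⟨w, hcc ▸ hwc, hwu, hA⟩
      · have hl2 : lab p ≠ 2 := fun hl => hA (h.join_adj hl hc hc' hcc hu hwc).2
        refine .inl ⟨hl2, ?_⟩
        by_contra hcon
        push Not at hcon
        rcases dir p hp (lab1 p hp hl2 hcon.1) c hc c' hc' hcc with h1 | h1
        · have := (hmx p hp).1 c' hc'
          omega
        · exact hA (h1.2 u hu w hwc).1
    · rintro (⟨hl, h1⟩ | ⟨w, hw, h1, h2⟩)
      · by_cases hl0 : lab p = 0
        · obtain ⟨c', hc', hcc, w, hw⟩ := h.exists_other hp hc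
          have := h.cross hc' hc hcc hw hu
          exact ⟨w, h.sub_kid hc' hw, this.1, (arcCount_eq_zero.1 (this.2.trans hl0)).1⟩
        · obtain ⟨c', hc', hm⟩ := (hmx p hp).2
          have hcc : c ≠ c' := by rintro rfl; exact h1.elim hl0 fun h1 => h1 hm.symm
          have h3 := (hmx p hp).1 c hc
          obtain ⟨w, hw⟩ := h.tree.nonempty c' (mem_kids.1 hc').1
          rcases dir p hp (lab1 p hp hl hl0) c hc c' hc' hcc with h4 | h4
          · exact ⟨w, h.sub_kid hc' hw, (h.cross hc hc' hcc hu hw).1.symm, (h4.2 u hu w hw).2⟩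
          · omega
      · exact ⟨w, h.sub_kid hc hw, h1, h2⟩
  · intro p hp hl c hc
    rw [(mem_kids.1 hc).2]
    by_cases hl0 : lab p = 0
    · exact .inl (.inl hl0)
    · obtain ⟨c', hc', hcc, _⟩ := h.exists_other hp hc
      have h1 := (hmn p hp).1 c' hc'
      have h2 := (hmx p hp).1 c' hc'
      rcases dir p hp (lab1 p hp hl hl0) c hc c' hc' hcc.symm with h4 | h4
      · exact .inr (.inr (by omega))
      · exact .inl (.inr (by omega))

end CoTree

/-! ### Maximum cliques of compatible vertices -/

/-- The classes of cliques below a node: in class `1` every vertex has both a missing in-neighbour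
(`a`) and a missing out-neighbour (`b`) below the node, in class `2` it has the former, in class `3`
the latter, and in class `4` both or none. Class `5` does not restrict the clique, and class `0`
contains the empty clique only. -/
def Cls : ℕ → Prop → Prop → Prop
  | 1, a, b => a ∧ b
  | 2, a, _ => a
  | 3, _, b => b
  | 4, a, b => (a ↔ b)
  | 5, _, _ => True
  | _, _, _ => False

open Classical in
/-- A clique below a child `c` of a union or of a directed join is of class `k` with respect to the
parent if it is of this class with respect to `c`. -/
noncomputable def kidClass (lo hi : Prop) : ℕ → ℕ
  | 2 => if hi then 5 else 2
  | 3 => if lo then 5 else 3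
  | _ => if lo then if hi then 5 else 2 else 3

/-- The maximum sizes of the cliques of all classes, from those of the classes `1`, `2` and `3`; the
number `l t` is not `0` if some leaf at `t` extends all cliques of class `1`. -/
def valOf (val : ℕ → ℕ → ℕ) (l : ℕ → ℕ) (k t : ℕ) : ℕ :=
  if k = 5 then max (max (val 2 t) (val 3 t)) (val 1 t + if l t = 0 then 0 else 1)
  else if k = 4 then val 1 t + if l t = 0 then 0 else 1
  else if k = 0 then 0 else val k t

/-- A class with cliques of maximum size. -/
def resolve (val : ℕ → ℕ → ℕ) (l : ℕ → ℕ) (k t : ℕ) : ℕ :=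
  if k = 5 then
    if (val 1 t + if l t = 0 then 0 else 1) < max (val 2 t) (val 3 t) then
      if val 3 t < val 2 t then 2 else 3
    else 4
  else k

/-- The recurrences for the maximum sizes of cliques. -/
structure Values (V I : Finset ℕ) (par lab : ℕ → ℕ) (lo hi : ℕ → Prop) (val arg : ℕ → ℕ → ℕ)
    (l : ℕ → ℕ) : Prop where
  leaf : ∀ v ∈ V, (∀ k, 1 ≤ k → k ≤ 3 → val k v = 0) ∧ l v ≠ 0
  join : ∀ p ∈ I, lab p = 2 → (∀ k, 1 ≤ k → k ≤ 3 → val k p = ∑ c ∈ kids V I par p, val k c) ∧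
    (∀ c ∈ kids V I par p, c ∈ V → l p ≠ 0) ∧
    (l p ≠ 0 → ∃ c ∈ kids V I par p, c ∈ V ∧ l p = c + 1)
  other : ∀ p ∈ I, lab p ≠ 2 → l p = 0 ∧ ∀ k, 1 ≤ k → k ≤ 3 → arg k p ∈ kids V I par p ∧
    val k p = valOf val l (kidClass (lo (arg k p)) (hi (arg k p)) k) (arg k p) ∧
    ∀ c ∈ kids V I par p, valOf val l (kidClass (lo c) (hi c) k) c ≤ val k p

/-- A choice of classes, from the root to the leaves, that leads to a maximum clique. -/
structure Classes (V I : Finset ℕ) (z : ℕ) (par lab : ℕ → ℕ) (lo hi : ℕ → Prop)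
    (val arg : ℕ → ℕ → ℕ) (l cls : ℕ → ℕ) : Prop where
  top : ∀ c ∈ kids V I par z, cls c = resolve val l 5 c
  join : ∀ p ∈ I, lab p = 2 → ∀ c ∈ kids V I par p,
    cls c = if cls p = 4 then if l p = c + 1 then 4 else 1 else cls p
  other : ∀ p ∈ I, lab p ≠ 2 → ∀ c ∈ kids V I par p,
    cls c = if cls p = 0 then 0 else if arg (if cls p = 4 then 1 else cls p) p = c then
      resolve val l (kidClass (lo c) (hi c) (if cls p = 4 then 1 else cls p)) c else 0

theorem valOf_resolve (val : ℕ → ℕ → ℕ) (l : ℕ → ℕ) (k t : ℕ) :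
    valOf val l (resolve val l k t) t = valOf val l k t := by
  unfold resolve
  by_cases hk : k = 5
  · rw [if_pos hk, hk]
    unfold valOf
    simp only [max_def, if_true]
    split_ifs <;> simp_all <;> omega
  · rw [if_neg hk]

theorem resolve_le {val : ℕ → ℕ → ℕ} {l : ℕ → ℕ} {k t : ℕ} (hk : k ≤ 5) :
    resolve val l k t ≤ 4 := by
  unfold resolve
  split_ifs <;> omega

theorem kidClass_le (lo hi : Prop) (k : ℕ) : kidClass lo hi k ≤ 5 := by
  unfold kidClass
  split <;> split_ifs <;> omega

theorem Cls.resolve {val : ℕ → ℕ → ℕ} {l : ℕ → ℕ} {k t : ℕ} {a b : Prop}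
    (h : Cls (resolve val l k t) a b) : Cls k a b := by
  by_cases hk : k = 5
  · subst hk
    trivial
  · unfold _root_.resolve at h
    rwa [if_neg hk] at h

theorem cls_kidClass {lo hi a b a' b' : Prop} {k : ℕ} (hk : 1 ≤ k) (hk3 : k ≤ 3)
    (ha : a' ↔ hi ∨ a) (hb : b' ↔ lo ∨ b) (hor : lo ∨ hi) :
    Cls (kidClass lo hi k) a b ↔ Cls k a' b' := by
  have : k = 1 ∨ k = 2 ∨ k = 3 := by omega
  rcases this with rfl | rfl | rfl <;> by_cases h1 : lo <;> by_cases h2 : hi <;>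
    simp_all [kidClass, Cls]

namespace CoTree

variable {A : ℕ → ℕ → Prop} {V I : Finset ℕ} {z : ℕ} {par lab : ℕ → ℕ} {D : ℕ → Finset ℕ}
  {lo hi : ℕ → Prop} {val arg : ℕ → ℕ → ℕ} {l cls : ℕ → ℕ}

/-- A clique of class `k` below the node `t`. -/
def Good (A : ℕ → ℕ → Prop) (D : ℕ → Finset ℕ) (t k : ℕ) (Q : Finset ℕ) : Prop :=
  Q ⊆ D t ∧ (∀ u ∈ Q, ∀ v ∈ Q, u ≠ v → (Digraph.mk A).Compatible u v) ∧
    ∀ u ∈ Q, Cls k (Alpha A (D t) u) (Beta A (D t) u)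

theorem alpha_leaf (h : CoTree A V I z par lab D) {v u : ℕ} (hv : v ∈ V) :
    (u ∈ D v ↔ u = v) ∧ ¬ Alpha A (D v) v ∧ ¬ Beta A (D v) v := by
  simp [Alpha, Beta, h.tree.leaf v hv]

/-- Every clique is of class `2`, `3` or `4`. A vertex without a missing in-neighbour and another
one without a missing out-neighbour are not compatible; so if the clique is neither of class `2` nor
of class `3`, then the two are one vertex, and every other vertex has missing neighbours of both
kinds. -/
theorem exists_class (h : CoTree A V I z par lab D) {t : ℕ} (ht : t ∈ V ∨ t ∈ I) {Q : Finset ℕ}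
    (hQ : Good A D t 5 Q) : Good A D t 2 Q ∨ Good A D t 3 Q ∨ Good A D t 4 Q := by
  obtain ⟨h1, h2, -⟩ := hQ
  by_contra hcon
  have hA : ¬ ∀ u ∈ Q, Alpha A (D t) u := fun h => hcon (.inl ⟨h1, h2, h⟩)
  have hB : ¬ ∀ u ∈ Q, Beta A (D t) u := fun h => hcon (.inr (.inl ⟨h1, h2, h⟩))
  have hAB : ¬ ∀ u ∈ Q, (Alpha A (D t) u ↔ Beta A (D t) u) :=
    fun h => hcon (.inr (.inr ⟨h1, h2, h⟩))
  push Not at hA hB hAB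
  obtain ⟨u, hu, hua⟩ := hA
  obtain ⟨v, hv, hvb⟩ := hB
  obtain ⟨w, hw, hwab⟩ := hAB
  have key : ∀ u ∈ Q, ∀ v ∈ Q, u ≠ v → (Beta A (D t) u ∨ Alpha A (D t) v) ∧
      (Beta A (D t) v ∨ Alpha A (D t) u) := fun u hu v hv huv =>
    h.compat_cond ht (h1 hu) (h1 hv) (h2 u hu v hv huv)
  by_cases huv : u = v
  · subst huv
    by_cases huw : u = w
    · subst huw
      tauto
    · have := key u hu w hw huw
      tauto
  · have := key u hu v hv huv
    tauto

theorem Flags.of_join (hf : Flags A V I par lab D lo hi) {p : ℕ} (hp : p ∈ I) (hl : lab p = 2) :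
    ∀ c ∈ kids V I par p, ∀ u ∈ D c, (Alpha A (D p) u ↔ Alpha A (D c) u) ∧
      (Beta A (D p) u ↔ Beta A (D c) u) := fun c hc u hu => by
  rw [hf.alpha p hp c hc u hu, hf.beta p hp c hc u hu]
  simp [hl]

theorem both_or (h : CoTree A V I z par lab D) (hf : Flags A V I par lab D lo hi) {p u : ℕ}
    (hp : p ∈ I) (hl : lab p ≠ 2) (hu : u ∈ D p) : Alpha A (D p) u ∨ Beta A (D p) u := by
  obtain ⟨c, hc, huc⟩ := (h.mem_kid hp).1 hu
  rw [hf.alpha p hp c hc u huc, hf.beta p hp c hc u huc]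
  have := hf.either p hp hl c hc
  tauto

/-- No clique is larger than the recurrences say. -/
theorem card_le (h : CoTree A V I z par lab D) (hf : Flags A V I par lab D lo hi)
    (hv : Values V I par lab lo hi val arg l) : ∀ t, t ∈ V ∨ t ∈ I → ∀ k ≤ 5, ∀ Q,
    Good A D t k Q → Q.card ≤ valOf val l k t := by
  classical
  have any : ∀ t, t ∈ V ∨ t ∈ I → (∀ k, 1 ≤ k → k ≤ 4 → ∀ Q, Good A D t k Q →
      Q.card ≤ valOf val l k t) → ∀ k ≤ 5, ∀ Q, Good A D t k Q → Q.card ≤ valOf val l k t := by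
    intro t ht hk k hk5 Q hQ
    rcases Nat.eq_zero_or_pos k with rfl | hk0
    · have : Q = ∅ := Finset.eq_empty_of_forall_notMem fun u hu => hQ.2.2 u hu
      simp [this]
    · by_cases hk5' : k = 5
      · subst hk5'
        have h5 : ∀ j, j = 2 ∨ j = 3 ∨ j = 4 → valOf val l j t ≤ valOf val l 5 t := by
          rintro j (rfl | rfl | rfl) <;> simp [valOf]
        rcases h.exists_class ht hQ with h1 | h1 | h1
        · exact (hk 2 (by omega) (by omega) Q h1).trans (h5 2 (by simp))
        · exact (hk 3 (by omega) (by omega) Q h1).trans (h5 3 (by simp))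
        · exact (hk 4 (by omega) (by omega) Q h1).trans (h5 4 (by simp))
      · exact hk k hk0 (by omega) Q hQ
  refine h.tree.down ?_ ?_
  · intro v hvV
    refine any v (.inl hvV) fun k hk1 hk4 Q hQ => ?_
    obtain ⟨h1, h2, h3⟩ := h.alpha_leaf (u := v) hvV
    have hQv : ∀ u ∈ Q, u = v := fun u hu => (h.alpha_leaf hvV).1.1 (hQ.1 hu)
    by_cases hk : k = 4
    · have : Q.card ≤ 1 := Finset.card_le_one.2 fun a ha b hb => (hQv a ha).trans (hQv b hb).symm
      simp [valOf, hk, (hv.leaf v hvV).2]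
      omega
    · have : Q = ∅ := by
        refine Finset.eq_empty_of_forall_notMem fun u hu => ?_
        have h4 := hQ.2.2 u hu
        rw [hQv u hu] at h4
        have : k = 1 ∨ k = 2 ∨ k = 3 := by omega
        rcases this with rfl | rfl | rfl <;> simp_all [Cls]
      simp [this]
  · intro p hp ih
    refine any p (.inr hp) fun k hk1 hk4 Q hQ => ?_
    have ih' : ∀ c ∈ kids V I par p, ∀ k ≤ 5, ∀ Q, Good A D c k Q → Q.card ≤ valOf val l k c :=
      fun c hc => ih c (mem_kids.1 hc).1 (mem_kids.1 hc).2
    by_cases hl : lab p = 2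
    · have hclass := hf.of_join hp hl
      have low : ∀ k, 1 ≤ k → k ≤ 3 → ∀ Q, Good A D p k Q → Q.card ≤ val k p := by
        intro k hk1 hk3 Q hQ
        rw [(hv.join p hp hl).1 k hk1 hk3]
        have hcover : Q ⊆ (kids V I par p).biUnion fun c => Q ∩ D c := by
          intro u hu
          obtain ⟨c, hc, huc⟩ := (h.mem_kid hp).1 (hQ.1 hu)
          exact Finset.mem_biUnion.2 ⟨c, hc, Finset.mem_inter.2 ⟨hu, huc⟩⟩
        refine (Finset.card_le_card hcover).trans (Finset.card_biUnion_le.trans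
          (Finset.sum_le_sum fun c hc => ?_))
        have := ih' c hc k (by omega) (Q ∩ D c) ⟨Finset.inter_subset_right,
          fun u hu v hv => hQ.2.1 u (Finset.mem_inter.1 hu).1 v (Finset.mem_inter.1 hv).1,
          fun u hu => ?_⟩
        · rwa [valOf, if_neg (by omega), if_neg (by omega), if_neg (by omega)] at this
        · obtain ⟨h1, h2⟩ := Finset.mem_inter.1 hu
          have h3 := hQ.2.2 u h1
          rwa [propext (hclass c hc u h2).1, propext (hclass c hc u h2).2] at h3
      by_cases hk : k = 4
      · subst hk
        have hsplit := Finset.card_filter_add_card_filter_not (s := Q) (fun u => Alpha A (D p) u)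
        have h1 := low 1 (by omega) (by omega) (Q.filter fun u => Alpha A (D p) u)
          ⟨(Finset.filter_subset _ _).trans hQ.1, fun u hu v hv => hQ.2.1 u (Finset.mem_filter.1 hu).1
            v (Finset.mem_filter.1 hv).1, fun u hu => by
            obtain ⟨h1, h2⟩ := Finset.mem_filter.1 hu
            exact ⟨h2, (hQ.2.2 u h1).1 h2⟩⟩
        -- Two vertices that miss no neighbours are not compatible, and such a vertex is a child.
        have h2 : (Q.filter fun u => ¬ Alpha A (D p) u).card ≤ if l p = 0 then 0 else 1 := by
          have h3 : ∀ u ∈ Q.filter fun u => ¬ Alpha A (D p) u, u ∈ Q ∧ ¬ Alpha A (D p) u ∧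
              ¬ Beta A (D p) u := fun u hu => by
            obtain ⟨h1, h2⟩ := Finset.mem_filter.1 hu
            exact ⟨h1, h2, fun hb => h2 ((hQ.2.2 u h1).2 hb)⟩
          have h4 : (Q.filter fun u => ¬ Alpha A (D p) u).card ≤ 1 := by
            refine Finset.card_le_one.2 fun u hu v hv => ?_
            by_contra huv
            obtain ⟨a1, a2, a3⟩ := h3 u hu
            obtain ⟨b1, b2, b3⟩ := h3 v hv
            have := h.compat_cond (.inr hp) (hQ.1 a1) (hQ.1 b1) (hQ.2.1 u a1 v b1 huv)
            tauto
          split_ifs with hlp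
          · rw [Nat.le_zero, Finset.card_eq_zero, Finset.eq_empty_iff_forall_notMem]
            intro u hu
            obtain ⟨a1, a2, a3⟩ := h3 u hu
            obtain ⟨c, hc, huc⟩ := (h.mem_kid hp).1 (hQ.1 a1)
            rw [(hclass c hc u huc).1] at a2
            rw [(hclass c hc u huc).2] at a3
            refine (mem_kids.1 hc).1.elim (fun hcV => (hv.join p hp hl).2.1 c hc hcV hlp)
              fun hcI => ?_
            have := h.red c hcI
            rw [(mem_kids.1 hc).2, hl] at this
            have := h.both_or hf hcI this huc
            tauto
          · exact h4
        simp only [valOf, Nat.reduceEqDiff, if_false, if_true]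
        omega
      · have := low k hk1 (by omega) Q hQ
        rwa [valOf, if_neg (by omega), if_neg hk, if_neg (by omega)]
    · have low : ∀ k, 1 ≤ k → k ≤ 3 → ∀ Q, Good A D p k Q → Q.card ≤ val k p := by
        intro k hk1 hk3 Q hQ
        rcases Q.eq_empty_or_nonempty with rfl | ⟨u, hu⟩
        · simp
        obtain ⟨c, hc, huc⟩ := (h.mem_kid hp).1 (hQ.1 hu)
        have hsub : Q ⊆ D c := by
          intro v hv'
          obtain ⟨c', hc', hvc⟩ := (h.mem_kid hp).1 (hQ.1 hv')
          by_contra hvn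
          have hcc : c ≠ c' := by rintro rfl; exact hvn hvc
          exact h.not_compat hl hc hc' hcc huc hvc
            (hQ.2.1 u hu v hv' (h.cross hc hc' hcc huc hvc).1)
        refine (ih' c hc _ (kidClass_le (lo c) (hi c) k) Q ⟨hsub, hQ.2.1, fun w hw => ?_⟩).trans
          (((hv.other p hp hl).2 k hk1 hk3).2.2 c hc)
        have h1 := hf.alpha p hp c hc w (hsub hw)
        have h2 := hf.beta p hp c hc w (hsub hw)
        rw [and_iff_right hl] at h1 h2
        exact (cls_kidClass hk1 hk3 h1 h2 (hf.either p hp hl c hc)).2 (hQ.2.2 w hw)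
      by_cases hk : k = 4
      · subst hk
        refine (low 1 (by omega) (by omega) Q ⟨hQ.1, hQ.2.1, fun u hu => ?_⟩).trans (by simp [valOf])
        have h1 : Alpha A (D p) u ↔ Beta A (D p) u := hQ.2.2 u hu
        have h2 := h.both_or hf hp hl (hQ.1 hu)
        exact ⟨by tauto, by tauto⟩
      · have := low k hk1 (by omega) Q hQ
        rwa [valOf, if_neg (by omega), if_neg hk, if_neg (by omega)]

/-- The leaves that are assigned class `4` form a clique, with the predicted size below each
node. -/
theorem good_of_classes (h : CoTree A V I z par lab D) (hf : Flags A V I par lab D lo hi)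
    (hv : Values V I par lab lo hi val arg l)
    (hc : Classes V I z par lab lo hi val arg l cls) (hle : ∀ t, t ∈ V ∨ t ∈ I → cls t ≤ 4) :
    ∀ t, t ∈ V ∨ t ∈ I → Good A D t (cls t) (D t ∩ V.filter fun v => cls v = 4) ∧
      (D t ∩ V.filter fun v => cls v = 4).card = valOf val l (cls t) t := by
  classical
  set R := V.filter fun v => cls v = 4 with hR
  refine h.tree.down ?_ ?_
  · intro v hvV
    obtain ⟨_, h2, h3⟩ := h.alpha_leaf (u := v) hvV
    have h4 := hle v (.inl hvV)
    have hDv : D v = {v} := h.tree.leaf v hvV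
    by_cases hv4 : cls v = 4
    · have hin : D v ∩ R = {v} := by
        rw [hDv, Finset.inter_eq_left]
        simpa [hR] using ⟨hvV, hv4⟩
      rw [hin]
      refine ⟨⟨by simp [hDv], by simp, by simp [hv4, Cls, h2, h3]⟩, ?_⟩
      simp [valOf, hv4, (hv.leaf v hvV).1 1, (hv.leaf v hvV).2]
    · have hin : D v ∩ R = ∅ := by
        rw [hDv, Finset.singleton_inter_of_notMem]
        simp [hR, hv4]
      rw [hin]
      refine ⟨⟨by simp, by simp, by simp⟩, ?_⟩
      rw [valOf, if_neg (by omega), if_neg hv4]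
      split_ifs with h0
      · rfl
      · rw [(hv.leaf v hvV).1 _ (by omega) (by omega)]
        rfl
  · intro p hp ih
    have ih' : ∀ c ∈ kids V I par p, Good A D c (cls c) (D c ∩ R) ∧
        (D c ∩ R).card = valOf val l (cls c) c :=
      fun c hc => ih c (mem_kids.1 hc).1 (mem_kids.1 hc).2
    have hp4 := hle p (.inr hp)
    by_cases hl : lab p = 2
    · have hclass := hf.of_join hp hl
      have hkc := hc.join p hp hl
      have hgood : ∀ c ∈ kids V I par p, ∀ u ∈ D c ∩ R,
          Cls (cls c) (Alpha A (D c) u) (Beta A (D c) u) := fun c hc u hu => (ih' c hc).1.2.2 u hu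
      have hmemc : ∀ u ∈ D p ∩ R, ∃ c ∈ kids V I par p, u ∈ D c ∩ R := by
        intro u hu
        obtain ⟨h1, h2⟩ := Finset.mem_inter.1 hu
        obtain ⟨c, hc, huc⟩ := (h.mem_kid hp).1 h1
        exact ⟨c, hc, Finset.mem_inter.2 ⟨huc, h2⟩⟩
      refine ⟨⟨Finset.inter_subset_left, ?_, ?_⟩, ?_⟩
      · intro u hu v hv' huv
        obtain ⟨c, hc1, huc⟩ := hmemc u hu
        obtain ⟨c', hc2, hvc⟩ := hmemc v hv'
        by_cases hcc : c = c'
        · subst hcc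
          exact (ih' c hc1).1.2.1 u huc v hvc huv
        · have g1 := hgood c hc1 u huc
          have g2 := hgood c' hc2 v hvc
          rw [hkc c hc1] at g1
          rw [hkc c' hc2] at g2
          refine h.compat_of_cond hl hc1 hc2 hcc (Finset.mem_inter.1 huc).1
            (Finset.mem_inter.1 hvc).1 ?_ ?_
          all_goals
            by_cases h4 : cls p = 4
            · rw [if_pos h4] at g1 g2
              by_cases h5 : l p = c + 1
              · have h6 : l p ≠ c' + 1 := by omega
                rw [if_neg h6] at g2
                have := g2.1
                have := g2.2
                tauto
              · rw [if_neg h5] at g1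
                have := g1.1
                have := g1.2
                tauto
            · rw [if_neg h4] at g1 g2
              generalize cls p = k at *
              have : k = 0 ∨ k = 1 ∨ k = 2 ∨ k = 3 := by omega
              rcases this with rfl | rfl | rfl | rfl <;> simp_all [Cls]
      · intro u hu
        obtain ⟨c, hc1, huc⟩ := hmemc u hu
        have g1 := hgood c hc1 u huc
        have g2 := hclass c hc1 u (Finset.mem_inter.1 huc).1
        rw [propext g2.1, propext g2.2]
        rw [hkc c hc1] at g1
        by_cases h4 : cls p = 4
        · rw [if_pos h4] at g1
          rw [h4]
          split_ifs at g1
          · exact g1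
          · exact ⟨fun _ => g1.2, fun _ => g1.1⟩
        · rwa [if_neg h4] at g1
      · have hcard : (D p ∩ R).card = ∑ c ∈ kids V I par p, (D c ∩ R).card := by
          rw [← Finset.card_biUnion]
          · congr 1
            ext u
            simp only [Finset.mem_biUnion]
            refine ⟨hmemc u, fun ⟨c, hc1, hu⟩ => ?_⟩
            obtain ⟨h1, h2⟩ := Finset.mem_inter.1 hu
            exact Finset.mem_inter.2 ⟨h.sub_kid hc1 h1, h2⟩
          · intro c hc1 c' hc2 hcc
            refine Finset.disjoint_left.2 fun u hu hu' => ?_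
            exact (h.cross hc1 hc2 hcc (Finset.mem_inter.1 hu).1 (Finset.mem_inter.1 hu').1).1 rfl
        rw [hcard, Finset.sum_congr rfl fun c hc1 => (ih' c hc1).2]
        by_cases h4 : cls p = 4
        · have hsum : ∑ c ∈ kids V I par p, valOf val l (cls c) c =
              ∑ c ∈ kids V I par p, (val 1 c + if l p = c + 1 then 1 else 0) := by
            refine Finset.sum_congr rfl fun c hc1 => ?_
            rw [hkc c hc1, if_pos h4]
            split_ifs with h5
            · obtain ⟨c', h6, h7, h8⟩ := (hv.join p hp hl).2.2 (by omega)
              obtain rfl : c = c' := by omega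
              simp [valOf, (hv.leaf c h7).2]
            · simp [valOf]
          rw [hsum, Finset.sum_add_distrib, ← (hv.join p hp hl).1 1 (by omega) (by omega), h4]
          simp only [valOf, if_true, Nat.reduceEqDiff, if_false]
          congr 1
          by_cases h0 : l p = 0
          · rw [if_pos h0]
            exact Finset.sum_eq_zero fun c _ => if_neg (by omega)
          · obtain ⟨c', h6, _, h8⟩ := (hv.join p hp hl).2.2 h0
            rw [if_neg h0, Finset.sum_eq_single_of_mem c' h6 fun c _ hcc => if_neg (by omega),
              if_pos h8]
        · have hsum : ∑ c ∈ kids V I par p, valOf val l (cls c) c =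
              ∑ c ∈ kids V I par p, valOf val l (cls p) c :=
            Finset.sum_congr rfl fun c hc1 => by rw [hkc c hc1, if_neg h4]
          rw [hsum]
          by_cases h0 : cls p = 0
          · simp [valOf, h0]
          · have := (hv.join p hp hl).1 (cls p) (by omega) (by omega)
            unfold valOf
            rw [if_neg (by omega), if_neg h4, if_neg h0, this]
            exact Finset.sum_congr rfl fun c _ => by
              rw [if_neg (by omega), if_neg h4, if_neg h0]
    · have hkc := hc.other p hp hl
      obtain ⟨hlp, hval⟩ := hv.other p hp hl
      have hempty : ∀ c ∈ kids V I par p, cls c = 0 → D c ∩ R = ∅ := fun c hc1 h0 =>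
        Finset.eq_empty_of_forall_notMem fun u hu => by
          have := (ih' c hc1).1.2.2 u hu
          rw [h0] at this
          exact this
      by_cases h0 : cls p = 0
      · have : D p ∩ R = ∅ := Finset.eq_empty_of_forall_notMem fun u hu => by
          obtain ⟨h1, h2⟩ := Finset.mem_inter.1 hu
          obtain ⟨c, hc1, huc⟩ := (h.mem_kid hp).1 h1
          have h3 := hempty c hc1 (by rw [hkc c hc1, if_pos h0])
          exact Finset.notMem_empty u (h3 ▸ Finset.mem_inter.2 ⟨huc, h2⟩)
        rw [this, h0]
        exact ⟨⟨by simp, by simp, by simp⟩, by simp [valOf]⟩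
      · obtain ⟨k, hk⟩ : ∃ k, k = if cls p = 4 then 1 else cls p := ⟨_, rfl⟩
        have hk13 : 1 ≤ k ∧ k ≤ 3 := by
          rw [hk]
          split_ifs <;> omega
        simp only [← hk, if_neg h0] at hkc
        obtain ⟨ha, hva, -⟩ := hval k hk13.1 hk13.2
        set a := arg k p with ha'
        have hDa : D p ∩ R = D a ∩ R := by
          ext u
          simp only [Finset.mem_inter]
          refine ⟨fun ⟨h1, h2⟩ => ⟨?_, h2⟩, fun ⟨h1, h2⟩ => ⟨h.sub_kid ha h1, h2⟩⟩
          obtain ⟨c, hc1, huc⟩ := (h.mem_kid hp).1 h1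
          by_cases hac : a = c
          · rwa [hac]
          · have h3 := hempty c hc1 (by rw [hkc c hc1, if_neg hac])
            exact absurd (h3 ▸ Finset.mem_inter.2 ⟨huc, h2⟩) (Finset.notMem_empty u)
        have hca := hkc a ha
        rw [if_pos rfl] at hca
        obtain ⟨⟨g1, g2, g3⟩, g4⟩ := ih' a ha
        rw [hDa]
        have hclsk : ∀ u ∈ D a ∩ R, Cls k (Alpha A (D p) u) (Beta A (D p) u) := by
          intro u hu
          have g5 := g3 u hu
          rw [hca] at g5
          have h1 := hf.alpha p hp a ha u (g1 hu)
          have h2 := hf.beta p hp a ha u (g1 hu)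
          rw [and_iff_right hl] at h1 h2
          exact (cls_kidClass hk13.1 hk13.2 h1 h2 (hf.either p hp hl a ha)).1 g5.resolve
        refine ⟨⟨g1.trans (h.sub_kid ha), g2, fun u hu => ?_⟩, ?_⟩
        · have g5 := hclsk u hu
          by_cases h4 : cls p = 4
          · rw [if_pos h4] at hk
            rw [hk] at g5
            rw [h4]
            exact ⟨fun _ => g5.2, fun _ => g5.1⟩
          · rw [if_neg h4] at hk
            rwa [← hk]
        · rw [g4, hca, valOf_resolve, ← hva]
          by_cases h4 : cls p = 4
          · rw [if_pos h4] at hk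
            simp [valOf, h4, hlp, hk]
          · rw [if_neg h4] at hk
            rw [← hk, valOf, if_neg (by omega), if_neg (by omega), if_neg (by omega)]

theorem cls_le (h : CoTree A V I z par lab D) (hc : Classes V I z par lab lo hi val arg l cls) :
    ∀ t, t ∈ V ∨ t ∈ I → cls t ≤ 4 := by
  refine h.tree.up ?_ ?_
  · intro t ht hpt
    rw [hc.top t (mem_kids.2 ⟨ht, hpt⟩)]
    exact resolve_le le_rfl
  · intro t ht hpt ih
    have htk : t ∈ kids V I par (par t) := mem_kids.2 ⟨ht, rfl⟩
    by_cases hl : lab (par t) = 2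
    · rw [hc.join _ hpt hl t htk]
      split_ifs <;> omega
    · rw [hc.other _ hpt hl t htk]
      split_ifs
      all_goals first | omega | exact resolve_le (kidClass_le _ _ _)

/-- The leaves of class `4` form a maximum clique. -/
theorem isMaxClique (h : CoTree A V I z par lab D) (hf : Flags A V I par lab D lo hi)
    (hv : Values V I par lab lo hi val arg l) (hc : Classes V I z par lab lo hi val arg l cls) :
    (∀ u ∈ V, ∀ v ∈ V, cls u = 4 → cls v = 4 → u ≠ v → (Digraph.mk A).Compatible u v) ∧
    ∀ Q ⊆ V, (∀ u ∈ Q, ∀ v ∈ Q, u ≠ v → (Digraph.mk A).Compatible u v) →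
      Q.card ≤ (V.filter fun v => cls v = 4).card := by
  rcases V.eq_empty_or_nonempty with rfl | ⟨u, hu⟩
  · refine ⟨by simp, fun Q hQ _ => ?_⟩
    rw [Finset.subset_empty.1 hQ]
    simp
  rw [← h.tree.top] at hu
  obtain ⟨c, hcN, hcz, _⟩ := (h.tree.mem_iff z (.inl rfl) u).1 hu
  have hDc : D c = V := by
    refine Finset.Subset.antisymm (h.tree.sub c hcN) fun v hv => ?_
    rw [← h.tree.top] at hv
    obtain ⟨c', h1, h2, h3⟩ := (h.tree.mem_iff z (.inl rfl) v).1 hv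
    rwa [h.tree.one c c' hcN h1 hcz h2]
  obtain ⟨⟨_, g2, _⟩, g4⟩ := h.good_of_classes hf hv hc (h.cls_le hc) c hcN
  rw [hDc, Finset.inter_eq_right.2 (Finset.filter_subset _ _), hc.top c (mem_kids.2 ⟨hcN, hcz⟩),
    valOf_resolve] at g4
  rw [hDc, Finset.inter_eq_right.2 (Finset.filter_subset _ _)] at g2
  refine ⟨fun u hu v hv h1 h2 => g2 u (by simp [hu, h1]) v (by simp [hv, h2]), fun Q hQ hK => ?_⟩
  rw [g4]
  exact h.card_le hf hv c hcN 5 le_rfl Q ⟨hDc ▸ hQ, hK, fun _ _ => trivial⟩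

end CoTree

/-! ### Recurrences in a topological order -/

/-- The numbers `w 0, …, w (N - 1)` are the nodes of the tree, children before their parents. -/
structure Topo (V I : Finset ℕ) (par w : ℕ → ℕ) (N : ℕ) : Prop where
  inj : ∀ i < N, ∀ j < N, w i = w j → i = j
  mem : ∀ t, (∃ i < N, w i = t) ↔ t ∈ V ∨ t ∈ I
  lt : ∀ i < N, ∀ j < N, par (w i) = w j → i < j

/-- The children of a node among the first `i` numbers of the order. -/
def kidsTo (V I : Finset ℕ) (par w : ℕ → ℕ) (i p : ℕ) : Finset ℕ :=
  (kids V I par p).filter fun t => ∃ j < i, w j = t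

section

variable {e : ℕ → ℕ → ℕ} {V I : Finset ℕ} {z : ℕ} {par lab w : ℕ → ℕ} {D : ℕ → Finset ℕ} {N i : ℕ}

theorem IsTree.sum_card_le (h : IsTree e V I z par lab D) {p : ℕ} {K : Finset ℕ}
    (hK : K ⊆ kids V I par p) : ∑ c ∈ K, (D c).card ≤ (D p).card := by
  classical
  rw [← Finset.card_biUnion]
  · refine Finset.card_le_card fun u hu => ?_
    obtain ⟨c, hc, huc⟩ := Finset.mem_biUnion.1 hu
    obtain ⟨h1, h2⟩ := mem_kids.1 (hK hc)
    exact h2 ▸ h.subset_par h1 huc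
  · intro c hc c' hc' hne
    obtain ⟨h1, h2⟩ := mem_kids.1 (hK hc)
    obtain ⟨h3, h4⟩ := mem_kids.1 (hK hc')
    exact Finset.disjoint_left.2 fun u hu hu' =>
      (h.sibling c c' h1 h3 hne (h2.trans h4.symm) u hu u hu').1 rfl

namespace Topo

theorem node (h : Topo V I par w N) (hi : i < N) : w i ∈ V ∨ w i ∈ I :=
  (h.mem _).1 ⟨i, hi, rfl⟩

theorem kidsTo_zero (p : ℕ) : kidsTo V I par w 0 p = ∅ := by
  simp [kidsTo]

theorem kidsTo_all (h : Topo V I par w N) (p : ℕ) : kidsTo V I par w N p = kids V I par p :=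
  Finset.filter_true_of_mem fun t ht => (h.mem t).2 (mem_kids.1 ht).1

theorem kidsTo_succ_of_ne {p : ℕ} (hp : p ≠ par (w i)) :
    kidsTo V I par w (i + 1) p = kidsTo V I par w i p := by
  refine Finset.filter_congr fun t ht => ⟨?_, fun ⟨j, hj, h⟩ => ⟨j, by omega, h⟩⟩
  rintro ⟨j, hj, rfl⟩
  refine ⟨j, ?_, rfl⟩
  have : j ≠ i := by
    rintro rfl
    exact hp (mem_kids.1 ht).2.symm
  omega

theorem kidsTo_succ (h : Topo V I par w N) (hi : i < N) :
    kidsTo V I par w (i + 1) (par (w i)) = insert (w i) (kidsTo V I par w i (par (w i))) := by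
  ext t
  simp only [kidsTo, Finset.mem_filter, Finset.mem_insert, mem_kids]
  constructor
  · rintro ⟨h1, j, hj, rfl⟩
    rcases Nat.lt_succ_iff_lt_or_eq.1 hj with hj | rfl
    · exact .inr ⟨h1, j, hj, rfl⟩
    · exact .inl rfl
  · rintro (rfl | ⟨h1, j, hj, h2⟩)
    · exact ⟨⟨h.node hi, rfl⟩, i, by omega, rfl⟩
    · exact ⟨h1, j, by omega, h2⟩

theorem notMem_kidsTo (h : Topo V I par w N) (hi : i < N) (p : ℕ) : w i ∉ kidsTo V I par w i p := by
  intro ht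
  obtain ⟨j, hj, h2⟩ := (Finset.mem_filter.1 ht).2
  have := h.inj j (by omega) i hi h2
  omega

theorem ne_par (h : Topo V I par w N) (hi : i < N) {j : ℕ} (hj : j ≤ i) : w j ≠ par (w i) := by
  intro h2
  have := h.lt i hi j (by omega) h2.symm
  omega

/-- A parent is not among the nodes that have been reached. -/
theorem ne_par_of_mem (h : Topo V I par w N) (hi : i < N) {c p : ℕ}
    (hc : c ∈ kidsTo V I par w (i + 1) p) : c ≠ par (w i) := by
  obtain ⟨j, hj, rfl⟩ := (Finset.mem_filter.1 hc).2
  exact h.ne_par hi (by omega)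

end Topo

/-! #### Representative in-degrees -/

/-- The least and the greatest value of `r` on the children that have been reached, where `r` is
passed from the children to the parents; values are increased by one, and `0` means that there are
none. -/
def DegTo (V I : Finset ℕ) (par w : ℕ → ℕ) (i : ℕ) (r mn mx : ℕ → ℕ) : Prop :=
  ∀ p ∈ I, (kidsTo V I par w i p = ∅ ∧ mn p = 0 ∧ mx p = 0) ∨
    ((∃ c ∈ kidsTo V I par w i p, r p = r c) ∧ (∃ c ∈ kidsTo V I par w i p, mn p = r c + 1) ∧
      (∃ c ∈ kidsTo V I par w i p, mx p = r c + 1) ∧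
      ∀ c ∈ kidsTo V I par w i p, mn p ≤ r c + 1 ∧ r c + 1 ≤ mx p)

/-- One more node passes its value to its parent. -/
theorem DegTo.step (h : Topo V I par w N) (hi : i < N) {r mn mx r' mn' mx' : ℕ → ℕ}
    (hd : DegTo V I par w i r mn mx)
    (ho : ∀ t, t ≠ par (w i) → r' t = r t ∧ mn' t = mn t ∧ mx' t = mx t)
    (hr : r' (par (w i)) = r (w i))
    (hmn : mn' (par (w i)) = if mn (par (w i)) = 0 ∨ r (w i) + 1 < mn (par (w i)) then r (w i) + 1
      else mn (par (w i)))
    (hmx : mx' (par (w i)) = if mx (par (w i)) < r (w i) + 1 then r (w i) + 1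
      else mx (par (w i))) :
    DegTo V I par w (i + 1) r' mn' mx' := by
  intro p hp
  have hc : ∀ c ∈ kidsTo V I par w (i + 1) p, r' c = r c :=
    fun c hc => (ho c (h.ne_par_of_mem hi hc)).1
  by_cases hpU : p = par (w i)
  · subst hpU
    rw [h.kidsTo_succ hi] at hc ⊢
    have hw := hc (w i) (Finset.mem_insert_self _ _)
    right
    refine ⟨⟨w i, Finset.mem_insert_self _ _, by rw [hr, hw]⟩, ?_⟩
    rcases hd _ hp with ⟨h1, h2, h3⟩ | ⟨_, ⟨c, hc1, h2⟩, ⟨c', hc2, h3⟩, h4⟩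
    · rw [h1, hmn, hmx, h2, h3]
      simp [hw]
    · rw [hmn, hmx]
      refine ⟨?_, ?_, ?_⟩
      · split_ifs
        · exact ⟨w i, Finset.mem_insert_self _ _, by rw [hw]⟩
        · exact ⟨c, Finset.mem_insert_of_mem hc1, by rw [h2, hc c (Finset.mem_insert_of_mem hc1)]⟩
      · split_ifs
        · exact ⟨w i, Finset.mem_insert_self _ _, by rw [hw]⟩
        · exact ⟨c', Finset.mem_insert_of_mem hc2, by rw [h3, hc c' (Finset.mem_insert_of_mem hc2)]⟩
      · intro x hx
        rw [hc x hx]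
        rcases Finset.mem_insert.1 hx with rfl | hx
        · constructor <;> split_ifs <;> omega
        · have := h4 x hx
          constructor <;> split_ifs <;> omega
  · obtain ⟨h1, h2, h3⟩ := ho p hpU
    rw [Topo.kidsTo_succ_of_ne hpU] at hc ⊢
    rw [h1, h2, h3]
    refine (hd p hp).imp id fun ⟨⟨c, c1, c2⟩, ⟨d, d1, d2⟩, ⟨x, x1, x2⟩, h7⟩ =>
      ⟨⟨c, c1, by rw [c2, hc c c1]⟩, ⟨d, d1, by rw [d2, hc d d1]⟩, ⟨x, x1, by rw [x2, hc x x1]⟩,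
        fun y hy => by rw [hc y hy]; exact h7 y hy⟩

/-- Once all nodes have been reached, the first and the last children of the directed joins are
known. -/
theorem CoTree.flags_of_degTo {A : ℕ → ℕ → Prop} (h : CoTree A V I z par lab D)
    (ht : Topo V I par w N) {r mn mx : ℕ → ℕ} (hd : DegTo V I par w N r mn mx)
    (hr : ∀ v ∈ V, r v = inDeg A V v) :
    Flags A V I par lab D (fun c => lab (par c) = 0 ∨ r c ≠ mn (par c) - 1)
      (fun c => lab (par c) = 0 ∨ r c ≠ mx (par c) - 1) := by
  have hd' : ∀ p ∈ I, (∃ c ∈ kids V I par p, r p = r c) ∧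
      (∃ c ∈ kids V I par p, mn p = r c + 1) ∧ (∃ c ∈ kids V I par p, mx p = r c + 1) ∧
      ∀ c ∈ kids V I par p, mn p ≤ r c + 1 ∧ r c + 1 ≤ mx p := by
    intro p hp
    have := hd p hp
    rw [ht.kidsTo_all] at this
    refine this.resolve_left fun h1 => ?_
    obtain ⟨c, _, _, hc, _, hcp, _⟩ := h.tree.two p hp
    exact Finset.notMem_empty c (h1.1 ▸ mem_kids.2 ⟨hc, hcp⟩)
  refine h.flags (r := r) (mn := fun p => mn p - 1) (mx := fun p => mx p - 1)
    (h.tree.down (fun v hv => ⟨v, by simp [h.tree.leaf v hv], hr v hv⟩) ?_) ?_ ?_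
  · intro p hp ih
    obtain ⟨c, hc, hrc⟩ := (hd' p hp).1
    obtain ⟨u, hu, hru⟩ := ih c (mem_kids.1 hc).1 (mem_kids.1 hc).2
    exact ⟨u, h.sub_kid hc hu, hrc.trans hru⟩
  · intro p hp
    obtain ⟨_, ⟨c, hc, hm⟩, _, hle⟩ := hd' p hp
    exact ⟨fun x hx => by have := hle x hx; omega, c, hc, by omega⟩
  · intro p hp
    obtain ⟨_, _, ⟨c, hc, hm⟩, hle⟩ := hd' p hp
    exact ⟨fun x hx => by have := hle x hx; omega, c, hc, by omega⟩

/-! #### Sizes of cliques -/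

/-- The recurrences for the children that have been reached. -/
structure ValuesTo (V I : Finset ℕ) (par lab w : ℕ → ℕ) (D : ℕ → Finset ℕ) (lo hi : ℕ → Prop)
    (i : ℕ) (val arg : ℕ → ℕ → ℕ) (l : ℕ → ℕ) : Prop where
  leaf : ∀ v ∈ V, (∀ k, 1 ≤ k → k ≤ 3 → val k v = 0) ∧ l v ≠ 0
  join : ∀ p ∈ I, lab p = 2 →
    (∀ k, 1 ≤ k → k ≤ 3 → val k p = ∑ c ∈ kidsTo V I par w i p, val k c) ∧
    (∀ c ∈ kidsTo V I par w i p, c ∈ V → l p ≠ 0) ∧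
    (l p ≠ 0 → ∃ c ∈ kidsTo V I par w i p, c ∈ V ∧ l p = c + 1)
  other : ∀ p ∈ I, lab p ≠ 2 → l p = 0 ∧ ∀ k, 1 ≤ k → k ≤ 3 →
    ((kidsTo V I par w i p = ∅ ∧ val k p = 0) ∨ (arg k p ∈ kidsTo V I par w i p ∧
      val k p = valOf val l (kidClass (lo (arg k p)) (hi (arg k p)) k) (arg k p))) ∧
    ∀ c ∈ kidsTo V I par w i p, valOf val l (kidClass (lo c) (hi c) k) c ≤ val k p
  bound : ∀ p ∈ I, ∀ k, 1 ≤ k → k ≤ 3 →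
    val k p + (if k = 1 ∧ l p ≠ 0 then 1 else 0) ≤ ∑ c ∈ kidsTo V I par w i p, (D c).card

namespace ValuesTo

variable {lo up : ℕ → Prop} {val arg val' arg' : ℕ → ℕ → ℕ} {l l' : ℕ → ℕ}

theorem values (ht : Topo V I par w N) (hT : IsTree e V I z par lab D)
    (h : ValuesTo V I par lab w D lo up N val arg l) : Values V I par lab lo up val arg l where
  leaf := h.leaf
  join p hp hl := by simpa only [ht.kidsTo_all] using h.join p hp hl
  other p hp hl := by
    obtain ⟨h1, h2⟩ := h.other p hp hl
    refine ⟨h1, fun k hk hk' => ?_⟩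
    obtain ⟨h3, h4⟩ := h2 k hk hk'
    rw [ht.kidsTo_all] at h3 h4
    rcases h3 with ⟨h3, _⟩ | ⟨h3, h5⟩
    · obtain ⟨c, _, _, hc, _, hcp, _⟩ := hT.two p hp
      exact absurd (h3 ▸ mem_kids.2 ⟨hc, hcp⟩) (Finset.notMem_empty c)
    · exact ⟨h3, h5, h4⟩

theorem valOf_le (hT : IsTree e V I z par lab D)
    (h : ValuesTo V I par lab w D lo up i val arg l) {t k : ℕ} (ht : t ∈ V ∨ t ∈ I) (hk : k ≤ 5) :
    valOf val l k t ≤ (D t).card := by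
  have key : ∀ k, 1 ≤ k → k ≤ 3 →
      val k t + (if k = 1 ∧ l t ≠ 0 then 1 else 0) ≤ (D t).card := by
    intro k hk hk'
    rcases ht with ht | ht
    · rw [(h.leaf t ht).1 k hk hk', hT.leaf t ht, Finset.card_singleton]
      split_ifs <;> omega
    · exact (h.bound t ht k hk hk').trans (hT.sum_card_le (Finset.filter_subset _ _))
  have h1 := key 1 (by omega) (by omega)
  have h2 := key 2 (by omega) (by omega)
  have h3 := key 3 (by omega) (by omega)
  have : k = 0 ∨ k = 1 ∨ k = 2 ∨ k = 3 ∨ k = 4 ∨ k = 5 := by omega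
  rcases this with rfl | rfl | rfl | rfl | rfl | rfl <;> by_cases h0 : l t = 0 <;>
    simp [h0, valOf] at h1 h2 h3 ⊢ <;> omega

/-- The sums do not exceed the number of vertices. -/
theorem add_le (hT : IsTree e V I z par lab D) (ht : Topo V I par w N) (hi : i < N)
    (h : ValuesTo V I par lab w D lo up i val arg l) {k : ℕ} (hk : 1 ≤ k) (hk3 : k ≤ 3)
    (hp : par (w i) ∈ I) : val k (par (w i)) + val k (w i) ≤ V.card := by
  have h1 := h.valOf_le hT (ht.node hi) (show k ≤ 5 by omega)
  rw [valOf, if_neg (by omega), if_neg (by omega), if_neg (by omega)] at h1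
  have h2 := h.bound _ hp k hk hk3
  have h3 := hT.sum_card_le (K := kidsTo V I par w (i + 1) (par (w i)))
    (Finset.filter_subset _ _)
  rw [ht.kidsTo_succ hi, Finset.sum_insert (ht.notMem_kidsTo hi _)] at h3
  have h4 := Finset.card_le_card (hT.sub _ (.inr hp))
  omega

/-- One more node is taken into account at its parent. -/
theorem step (hT : IsTree e V I z par lab D) (ht : Topo V I par w N) (hi : i < N)
    (h : ValuesTo V I par lab w D lo up i val arg l)
    (ho : ∀ t, t ≠ par (w i) → (∀ k, val' k t = val k t ∧ arg' k t = arg k t) ∧ l' t = l t)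
    (hj : lab (par (w i)) = 2 → (∀ k, 1 ≤ k → k ≤ 3 →
        val' k (par (w i)) = val k (par (w i)) + val k (w i)) ∧
      l' (par (w i)) = if w i ∈ V then w i + 1 else l (par (w i)))
    (hn : par (w i) ∈ I → lab (par (w i)) ≠ 2 → l' (par (w i)) = l (par (w i)) ∧
      ∀ k, 1 ≤ k → k ≤ 3 →
        (val' k (par (w i)) = valOf val l (kidClass (lo (w i)) (up (w i)) k) (w i) ∧
          arg' k (par (w i)) = w i ∧
          val k (par (w i)) ≤ valOf val l (kidClass (lo (w i)) (up (w i)) k) (w i)) ∨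
        (val' k (par (w i)) = val k (par (w i)) ∧ arg' k (par (w i)) = arg k (par (w i)) ∧
          valOf val l (kidClass (lo (w i)) (up (w i)) k) (w i) < val k (par (w i)))) :
    ValuesTo V I par lab w D lo up (i + 1) val' arg' l' := by
  have hc : ∀ p, ∀ c ∈ kidsTo V I par w (i + 1) p, (∀ k, val' k c = val k c) ∧ l' c = l c ∧
      ∀ k, valOf val' l' k c = valOf val l k c := by
    intro p c hc
    obtain ⟨h1, h2⟩ := ho c (ht.ne_par_of_mem hi hc)
    refine ⟨fun k => (h1 k).1, h2, fun k => ?_⟩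
    simp only [valOf, (h1 _).1, h2]
  have hU : ∀ v ∈ V, par (w i) ∈ I → v ≠ par (w i) := by
    rintro v hv hp rfl
    exact hT.disj _ hv hp
  have hself : w i ∈ kidsTo V I par w (i + 1) (par (w i)) := by
    rw [ht.kidsTo_succ hi]
    exact Finset.mem_insert_self _ _
  have hsub : ∀ c ∈ kidsTo V I par w i (par (w i)), c ∈ kidsTo V I par w (i + 1) (par (w i)) := by
    intro c hc
    rw [ht.kidsTo_succ hi]
    exact Finset.mem_insert_of_mem hc
  constructor
  · intro v hv
    have hne : v ≠ par (w i) := by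
      rintro rfl
      rcases hT.par_mem _ (ht.node hi) with h1 | h1
      · exact hT.zV (h1 ▸ hv)
      · exact hT.disj _ hv h1
    obtain ⟨h1, h2⟩ := ho v hne
    rw [h2]
    exact ⟨fun k hk hk' => by rw [(h1 k).1]; exact (h.leaf v hv).1 k hk hk', (h.leaf v hv).2⟩
  · intro p hp hl
    obtain ⟨h1, h2, h3⟩ := h.join p hp hl
    by_cases hpU : p = par (w i)
    · subst hpU
      obtain ⟨g1, g2⟩ := hj hl
      refine ⟨fun k hk hk' => ?_, fun c hc1 hcV => ?_, fun h0 => ?_⟩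
      · rw [Finset.sum_congr rfl fun c hc1 => (hc _ c hc1).1 k, ht.kidsTo_succ hi,
          Finset.sum_insert (ht.notMem_kidsTo hi _), ← h1 k hk hk', g1 k hk hk', add_comm]
      · rw [g2]
        split_ifs with h4
        · omega
        · rw [ht.kidsTo_succ hi] at hc1
          rcases Finset.mem_insert.1 hc1 with rfl | hc1
          · exact absurd hcV h4
          · exact h2 c hc1 hcV
      · rw [g2] at h0 ⊢
        split_ifs at h0 ⊢ with h4
        · exact ⟨_, hself, h4, rfl⟩
        · obtain ⟨c, h5, h6⟩ := h3 h0
          exact ⟨c, hsub c h5, h6⟩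
    · obtain ⟨g1, g2⟩ := ho p hpU
      have hc' := hc p
      rw [Topo.kidsTo_succ_of_ne hpU] at hc' ⊢
      rw [g2]
      refine ⟨fun k hk hk' => ?_, h2, h3⟩
      rw [Finset.sum_congr rfl fun c hc1 => (hc' c hc1).1 k, (g1 k).1, h1 k hk hk']
  · intro p hp hl
    obtain ⟨h1, h2⟩ := h.other p hp hl
    by_cases hpU : p = par (w i)
    · subst hpU
      obtain ⟨g1, g2⟩ := hn hp hl
      refine ⟨g1.trans h1, fun k hk hk' => ?_⟩
      obtain ⟨h3, h4⟩ := h2 k hk hk'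
      rcases g2 k hk hk' with ⟨g3, g4, g5⟩ | ⟨g3, g4, g5⟩
      · rw [g3, g4]
        refine ⟨.inr ⟨hself, ((hc _ _ hself).2.2 _).symm⟩, fun c hc1 => ?_⟩
        rw [(hc _ c hc1).2.2]
        rw [ht.kidsTo_succ hi] at hc1
        rcases Finset.mem_insert.1 hc1 with rfl | hc1
        · exact le_rfl
        · exact (h4 c hc1).trans g5
      · rw [g3, g4]
        refine ⟨.inr ?_, fun c hc1 => ?_⟩
        · obtain ⟨h5, h6⟩ := h3.resolve_left fun h5 => by omega
          rw [(hc _ _ (hsub _ h5)).2.2]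
          exact ⟨hsub _ h5, h6⟩
        · rw [(hc _ c hc1).2.2]
          rw [ht.kidsTo_succ hi] at hc1
          rcases Finset.mem_insert.1 hc1 with rfl | hc1
          · exact g5.le
          · exact h4 c hc1
    · obtain ⟨g1, g2⟩ := ho p hpU
      have hc' := hc p
      rw [Topo.kidsTo_succ_of_ne hpU] at hc' ⊢
      rw [g2]
      refine ⟨h1, fun k hk hk' => ?_⟩
      obtain ⟨h3, h4⟩ := h2 k hk hk'
      rw [(g1 k).1, (g1 k).2]
      refine ⟨?_, fun c hc1 => (hc' c hc1).2.2 _ ▸ h4 c hc1⟩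
      rcases h3 with h3 | ⟨h5, h6⟩
      · exact .inl h3
      · exact .inr ⟨h5, by rw [(hc' _ h5).2.2, h6]⟩
  · intro p hp k hk hk'
    have h1 := h.bound p hp k hk hk'
    by_cases hpU : p = par (w i)
    · subst hpU
      rw [ht.kidsTo_succ hi, Finset.sum_insert (ht.notMem_kidsTo hi _)]
      have h2 : ∀ j ≤ 5, valOf val l j (w i) ≤ (D (w i)).card :=
        fun j hj => h.valOf_le hT (ht.node hi) hj
      by_cases hl : lab (par (w i)) = 2
      · obtain ⟨g1, g2⟩ := hj hl
        rw [g1 k hk hk', g2]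
        have h3 := h2 k (by omega)
        rw [valOf, if_neg (by omega), if_neg (by omega), if_neg (by omega)] at h3
        by_cases hV : w i ∈ V
        · have := (h.leaf _ hV).1 k hk hk'
          have h5 := hT.leaf _ hV
          rw [h5, Finset.card_singleton]
          split_ifs at h1 ⊢ <;> omega
        · rw [if_neg hV]
          omega
      · obtain ⟨g1, g2⟩ := hn hp hl
        have h4 := (h.other _ hp hl).1
        have h5 := h2 _ (kidClass_le (lo (w i)) (up (w i)) k)
        rw [g1, h4, if_neg (by tauto)]
        rw [h4, if_neg (by tauto)] at h1
        rcases g2 k hk hk' with ⟨g3, -⟩ | ⟨g3, -⟩ <;> omega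
    · obtain ⟨g1, g2⟩ := ho p hpU
      rw [Topo.kidsTo_succ_of_ne hpU, (g1 k).1, g2]
      exact h1

end ValuesTo

end

namespace RAM

open Term Prog

/-! ### The program for cliques -/

/-- List all vertices, give them type `2`, and let each of them extend cliques. -/
def leavesBody : Prog :=
  write aW (reg rI) (reg rI) ;; write aType (reg rI) (const 2) ;;
  write aLeaf (reg rI) (add (reg rI) (const 1))

/-- Pass the in-degree of a node to its parent. -/
def degBody : Prog :=
  setReg rT (read aW (reg rI)) ;; setReg rU (read aPar (reg rT)) ;;
  setReg rNum (add (read aIndeg (reg rT)) (const 1)) ;;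
  write aIndeg (reg rU) (read aIndeg (reg rT)) ;;
  ite (read aLo (reg rU)) (ite (lt (reg rNum) (read aLo (reg rU)))
    (write aLo (reg rU) (reg rNum)) skip) (write aLo (reg rU) (reg rNum)) ;;
  ite (lt (read aHi (reg rU)) (reg rNum)) (write aHi (reg rU) (reg rNum)) skip

/-- Whether there are children before and after the current node, in registers `rA` and `rD`. -/
def flagProg : Prog :=
  ite (eq (reg rLam) (const 0)) (setReg rA (const 1) ;; setReg rD (const 1))
    (setReg rA (sub (const 1) (eq (read aIndeg (reg rT)) (sub (read aLo (reg rU)) (const 1)))) ;;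
      setReg rD (sub (const 1) (eq (read aIndeg (reg rT)) (sub (read aHi (reg rU)) (const 1)))))

/-- Replace the class in register `rC` by that for the child. -/
def kidProg : Prog :=
  ite (eq (reg rC) (const 2)) (ite (reg rD) (setReg rC (const 5)) (setReg rC (const 2)))
    (ite (eq (reg rC) (const 3)) (ite (reg rA) (setReg rC (const 5)) (setReg rC (const 3)))
      (ite (reg rA) (ite (reg rD) (setReg rC (const 5)) (setReg rC (const 2)))
        (setReg rC (const 3))))

/-- The size of the cliques of the class in register `rC`. -/
def valProg : Prog :=
  ite (eq (reg rC) (const 5))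
    (setReg rNum (read aB (reg rT)) ;;
      ite (read aLeaf (reg rT)) (setReg rNum (add (reg rNum) (const 1))) skip ;;
      ite (lt (reg rNum) (read aX (reg rT))) (setReg rNum (read aX (reg rT))) skip ;;
      ite (lt (reg rNum) (read aY (reg rT))) (setReg rNum (read aY (reg rT))) skip)
    (ite (eq (reg rC) (const 2)) (setReg rNum (read aX (reg rT)))
      (setReg rNum (read aY (reg rT))))

/-- Whether the cliques of the class of array `a` are larger than those of class `4`. -/
def beatsTerm (a : ℕ) : Term :=
  lt (read aB (reg rT))
    (sub (read a (reg rT)) (sub (const 1) (eq (read aLeaf (reg rT)) (const 0))))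

/-- If register `rC` contains class `5`, replace it by a class with cliques of maximum size. -/
def resolveProg : Prog :=
  ite (eq (reg rC) (const 5))
    (ite (lt (read aY (reg rT)) (read aX (reg rT)))
      (ite (beatsTerm aX) (setReg rC (const 2)) (setReg rC (const 4)))
      (ite (beatsTerm aY) (setReg rC (const 3)) (setReg rC (const 4)))) skip

/-- Add the size for a child of a join. -/
def joinProg (k : ℕ) : Prog :=
  setReg rNum (read (17 + k) (reg rU)) ;; addMod rNum (read (17 + k) (reg rT)) ;;
  write (17 + k) (reg rU) (reg rNum)

/-- Compare with the size for a child of a union or of a directed join. -/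
def maxProg (k : ℕ) : Prog :=
  setReg rC (const k) ;; kidProg ;; valProg ;;
  ite (lt (reg rNum) (read (17 + k) (reg rU))) skip
    (write (17 + k) (reg rU) (reg rNum) ;; write (21 + k) (reg rU) (reg rT))

/-- Pass the sizes of cliques at the node in register `rT` to its parent. -/
def passProg : Prog :=
  ite (eq (reg rLam) (const 3)) skip (ite (eq (reg rLam) (const 2))
    (joinProg 1 ;; joinProg 2 ;; joinProg 3 ;;
      ite (eq (read aLab (reg rT)) (const 3))
        (write aLeaf (reg rU) (add (reg rT) (const 1))) skip)
    (flagProg ;; maxProg 1 ;; maxProg 2 ;; maxProg 3))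

/-- Pass the sizes of cliques at the node with number `rI` in the order to its parent. -/
def valuesBody : Prog :=
  setReg rT (read aW (reg rI)) ;; setReg rU (read aPar (reg rT)) ;;
  setReg rLam (read aLab (reg rU)) ;; passProg

/-- The child chosen for the class in register `rC`. -/
def chooseProg : Prog :=
  ite (eq (reg rC) (const 2)) (setReg rNum (read aArgX (reg rU)))
    (ite (eq (reg rC) (const 3)) (setReg rNum (read aArgY (reg rU)))
      (setReg rNum (read aArgB (reg rU))))

/-- Find the class of the current node from that of its parent. -/
def classProg : Prog :=
  ite (eq (reg rLam) (const 3)) (setReg rC (const 5) ;; resolveProg)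
    (setReg rC (read aClass (reg rU)) ;;
      ite (eq (reg rLam) (const 2))
        (ite (eq (reg rC) (const 4)) (ite (eq (read aLeaf (reg rU)) (add (reg rT) (const 1))) skip
          (setReg rC (const 1))) skip)
        (ite (reg rC) (ite (eq (reg rC) (const 4)) (setReg rC (const 1)) skip ;; chooseProg ;;
          ite (eq (reg rNum) (reg rT)) (flagProg ;; kidProg ;; resolveProg) (setReg rC (const 0)))
          skip))

/-- Find the class of a node, where parents come before their children. -/
def classBody : Prog :=
  setReg rT (read aW (sub (sub (reg rLenW) (reg rI)) (const 1))) ;;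
  setReg rU (read aPar (reg rT)) ;; setReg rLam (read aLab (reg rU)) ;; classProg ;;
  write aClass (reg rT) (reg rC)

/-- Output a vertex that is not of class `4`. -/
def outBody : Prog :=
  ite (eq (read aClass (reg rI)) (const 4)) skip
    (write aTail (reg rLam) (reg rI) ;; setReg rLam (add (reg rLam) (const 1)))

/-- Find the vertices outside of a maximum clique, from the tree. -/
def cliqueProg : Prog :=
  setReg rI (const 0) ;; forUp rI rN leavesBody ;; setReg rLenW (reg rN) ;; spread ;;
  setReg rI (const 0) ;; forUp rI rLenW degBody ;;
  setReg rI (const 0) ;; forUp rI rLenW valuesBody ;;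
  setReg rI (const 0) ;; forUp rI rLenW classBody ;;
  setReg rI (const 0) ;; setReg rLam (const 0) ;; forUp rI rN outBody ;; setReg rN (reg rLam)

@[simp] theorem State.setReg_setReg (s : State) (r x y : ℕ) :
    (s.setReg r x).setReg r y = s.setReg r y := by
  simp [State.setReg]

theorem State.setReg_self {s : State} {r x : ℕ} (h : s.reg r = x) : s.setReg r x = s := by
  subst h
  simp [State.setReg]

/-- The sizes of cliques that are stored. -/
def State.val (s : State) (k : ℕ) : ℕ → ℕ :=
  s.mem (17 + k)

/-- The children that are stored. -/
def State.arg (s : State) (k : ℕ) : ℕ → ℕ :=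
  s.mem (21 + k)

@[simp] theorem State.setReg_val (s : State) (r x : ℕ) : (s.setReg r x).val = s.val := rfl

@[simp] theorem State.setReg_arg (s : State) (r x : ℕ) : (s.setReg r x).arg = s.arg := rfl

theorem run_flag (s : State) : flagProg.run s =
    (s.setReg rA (if s.reg rLam = 0 ∨ s.mem aIndeg (s.reg rT) ≠ s.mem aLo (s.reg rU) - 1
      then 1 else 0)).setReg rD
      (if s.reg rLam = 0 ∨ s.mem aIndeg (s.reg rT) ≠ s.mem aHi (s.reg rU) - 1 then 1 else 0) := by
  by_cases h : s.reg rLam = 0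
  · simp [flagProg, Prog.run, Term.val, h]
  · have key : ∀ x y : ℕ, (1 - if x = y then 1 else 0) = if x ≠ y then 1 else 0 := by
      intro x y
      split_ifs <;> first | rfl | contradiction
    simp only [h, false_or, ← key]
    rw [flagProg, Prog.run, if_neg (by simp [Term.val, h])]
    rfl

theorem run_kid (s : State) : kidProg.run s =
    s.setReg rC (kidClass (s.reg rA ≠ 0) (s.reg rD ≠ 0) (s.reg rC)) := by
  by_cases h2 : s.reg rC = 2
  · by_cases hD : s.reg rD = 0 <;> simp [kidProg, Prog.run, Term.val, kidClass, h2, hD]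
  by_cases h3 : s.reg rC = 3
  · by_cases hA : s.reg rA = 0 <;> simp [kidProg, Prog.run, Term.val, kidClass, h3, hA]
  · have : kidClass (s.reg rA ≠ 0) (s.reg rD ≠ 0) (s.reg rC) =
        kidClass (s.reg rA ≠ 0) (s.reg rD ≠ 0) 1 := by
      unfold kidClass
      split <;> simp_all
    rw [this]
    by_cases hD : s.reg rD = 0 <;> by_cases hA : s.reg rA = 0 <;>
      simp [kidProg, Prog.run, Term.val, kidClass, h2, h3, hD, hA]

theorem kidClass_mem (lo up : Prop) (k : ℕ) :
    kidClass lo up k = 2 ∨ kidClass lo up k = 3 ∨ kidClass lo up k = 5 := by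
  unfold kidClass
  split <;> split_ifs <;> simp

theorem run_val {s : State} (h : s.reg rC = 2 ∨ s.reg rC = 3 ∨ s.reg rC = 5) : valProg.run s =
    s.setReg rNum (valOf s.val (s.mem aLeaf) (s.reg rC) (s.reg rT)) := by
  rcases h with h | h | h
  iterate 2 simp [valProg, Prog.run, Term.val, valOf, State.val, h]
  · obtain ⟨b, hb⟩ : ∃ b, b = s.mem aB (s.reg rT) := ⟨_, rfl⟩
    obtain ⟨x, hx⟩ : ∃ x, x = s.mem aX (s.reg rT) := ⟨_, rfl⟩
    obtain ⟨y, hy⟩ : ∃ y, y = s.mem aY (s.reg rT) := ⟨_, rfl⟩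
    have hm : valOf s.val (s.mem aLeaf) (s.reg rC) (s.reg rT) =
        max (max x y) (b + if s.mem aLeaf (s.reg rT) = 0 then 0 else 1) := by
      rw [valOf, if_pos h, hb, hx, hy]
      rfl
    rw [hm]
    have key : ∀ c, max (max x y) c =
        if (if c < x then x else c) < y then y else if c < x then x else c := by
      intro c
      simp only [max_def]
      split_ifs <;> omega
    rw [key]
    by_cases h0 : s.mem aLeaf (s.reg rT) = 0 <;> by_cases h1 : b < x <;> by_cases h2 : x < y <;>
      by_cases h3 : b < y <;> by_cases h4 : b + 1 < x <;> by_cases h5 : b + 1 < y <;>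
      simp [valProg, Prog.run, Term.val, h, h0, ← hb, ← hx, ← hy, h1, h2, h3, h4, h5]

theorem run_resolve (s : State) : resolveProg.run s =
    s.setReg rC (resolve s.val (s.mem aLeaf) (s.reg rC) (s.reg rT)) := by
  by_cases h : s.reg rC = 5
  · obtain ⟨b, hb⟩ : ∃ b, b = s.mem aB (s.reg rT) := ⟨_, rfl⟩
    obtain ⟨x, hx⟩ : ∃ x, x = s.mem aX (s.reg rT) := ⟨_, rfl⟩
    obtain ⟨y, hy⟩ : ∃ y, y = s.mem aY (s.reg rT) := ⟨_, rfl⟩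
    have hr : resolve s.val (s.mem aLeaf) (s.reg rC) (s.reg rT) =
        if y < x then if (b + if s.mem aLeaf (s.reg rT) = 0 then 0 else 1) < x then 2 else 4
        else if (b + if s.mem aLeaf (s.reg rT) = 0 then 0 else 1) < y then 3 else 4 := by
      have : resolve s.val (s.mem aLeaf) (s.reg rC) (s.reg rT) =
          if (b + if s.mem aLeaf (s.reg rT) = 0 then 0 else 1) < max x y then
            if y < x then 2 else 3 else 4 := by
        rw [resolve, if_pos h, hb, hx, hy]
        rfl
      rw [this]
      by_cases h1 : y < x
      · rw [max_eq_left h1.le, if_pos h1, if_pos h1]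
      · rw [max_eq_right (by omega), if_neg h1, if_neg h1]
    rw [hr]
    by_cases h0 : s.mem aLeaf (s.reg rT) = 0 <;> by_cases h1 : y < x <;>
      simp only [resolveProg, beatsTerm, Prog.run, Term.val, h, ← hb, ← hx, ← hy, h0, h1, if_true,
        if_false, ne_eq, one_ne_zero, not_false_eq_true, not_true_eq_false, Nat.sub_self,
        Nat.sub_zero, Nat.add_zero, Nat.lt_sub_iff_add_lt, ite_eq_right_iff, imp_false,
        Decidable.not_not] <;>
      split_ifs <;> rfl
  · rw [resolve, if_neg h, State.setReg_self rfl]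
    simp [resolveProg, Prog.run, Term.val, h]

theorem run_choose {s : State} (h : 1 ≤ s.reg rC) (h3 : s.reg rC ≤ 3) : chooseProg.run s =
    s.setReg rNum (s.arg (s.reg rC) (s.reg rU)) := by
  have : s.reg rC = 1 ∨ s.reg rC = 2 ∨ s.reg rC = 3 := by omega
  rcases this with h | h | h <;> simp [chooseProg, Prog.run, Term.val, State.arg, h]

theorem Prog.run_reg {p : Prog} (hp : p.straight = true) {r : ℕ} (hr : p.writesReg r = false)
    (s : State) : (p.run s).reg r = s.reg r := by
  obtain ⟨t, _, h⟩ := p.ev_of_straight hp s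
  exact h.reg_eq hr

theorem Prog.run_mem {p : Prog} (hp : p.straight = true) {a : ℕ} (ha : p.writesMem a = false)
    (s : State) : (p.run s).mem a = s.mem a := by
  obtain ⟨t, _, h⟩ := p.ev_of_straight hp s
  exact h.mem_eq ha

/-- From `s` to `s'` only the values numbered `k` at the node in register `rU` have changed. -/
structure State.Stores (k : ℕ) (s s' : State) : Prop where
  reg : ∀ r, r ≠ rC → r ≠ rNum → s'.reg r = s.reg r
  mem : ∀ a, a ≠ 17 + k → a ≠ 21 + k → s'.mem a = s.mem a
  off : ∀ a t, t ≠ s.reg rU → s'.mem a t = s.mem a t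

/-- The values stored by three programs in succession do not interfere. -/
theorem State.Stores.three {P : ℕ → Prog} (h : ∀ k s, Stores k s ((P k).run s)) {s s' : State}
    (hs : s' = (P 3).run ((P 2).run ((P 1).run s))) : s'.mem aLeaf = s.mem aLeaf ∧
    (∀ r, r ≠ rC → r ≠ rNum → s'.reg r = s.reg r) ∧
    (∀ a t, t ≠ s.reg rU → s'.mem a t = s.mem a t) ∧
    ∀ k, 1 ≤ k → k ≤ 3 → ∃ s0, (∀ r, r ≠ rC → r ≠ rNum → s0.reg r = s.reg r) ∧
      (∀ a t, t ≠ s.reg rU → s0.mem a t = s.mem a t) ∧ s0.val k = s.val k ∧ s0.arg k = s.arg k ∧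
      s'.val k = ((P k).run s0).val k ∧ s'.arg k = ((P k).run s0).arg k := by
  subst hs
  obtain ⟨r1, m1, o1⟩ := h 1 s
  generalize e1 : (P 1).run s = s1 at *
  obtain ⟨r2, m2, o2⟩ := h 2 s1
  generalize e2 : (P 2).run s1 = s2 at *
  obtain ⟨r3, m3, o3⟩ := h 3 s2
  have hr : ∀ r, r ≠ rC → r ≠ rNum → s2.reg r = s.reg r := fun r h1 h2 =>
    (r2 r h1 h2).trans (r1 r h1 h2)
  rw [r1 rU (by decide) (by decide)] at o2
  rw [hr rU (by decide) (by decide)] at o3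
  have ho : ∀ a t, t ≠ s.reg rU → s2.mem a t = s.mem a t := fun a t ht =>
    (o2 a t ht).trans (o1 a t ht)
  refine ⟨by rw [m3 _ (by decide) (by decide), m2 _ (by decide) (by decide),
    m1 _ (by decide) (by decide)], fun r h1 h2 => (r3 r h1 h2).trans (hr r h1 h2),
    fun a t ht => (o3 a t ht).trans (ho a t ht), fun k hk hk3 => ?_⟩
  have : k = 1 ∨ k = 2 ∨ k = 3 := by omega
  rcases this with rfl | rfl | rfl
  · exact ⟨s, fun _ _ _ => rfl, fun _ _ _ => rfl, rfl, rfl, by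
      rw [State.val, m3 _ (by decide) (by decide), m2 _ (by decide) (by decide), e1]; rfl, by
      rw [State.arg, m3 _ (by decide) (by decide), m2 _ (by decide) (by decide), e1]; rfl⟩
  · exact ⟨s1, r1, o1, m1 _ (by decide) (by decide), m1 _ (by decide) (by decide), by
      rw [State.val, m3 _ (by decide) (by decide), e2]; rfl, by
      rw [State.arg, m3 _ (by decide) (by decide), e2]; rfl⟩
  · exact ⟨s2, hr, ho, (m2 _ (by decide) (by decide)).trans (m1 _ (by decide) (by decide)),
      (m2 _ (by decide) (by decide)).trans (m1 _ (by decide) (by decide)), rfl, rfl⟩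

/-- The node at hand replaces the child that is stored at its parent if it is at least as good. -/
theorem maxProg_spec (s : State) (k : ℕ) {c : ℕ}
    (hc : c = valOf s.val (s.mem aLeaf) (kidClass (s.reg rA ≠ 0) (s.reg rD ≠ 0) k) (s.reg rT)) :
    State.Stores k s ((maxProg k).run s) ∧
    ((((maxProg k).run s).val k (s.reg rU) = c ∧ ((maxProg k).run s).arg k (s.reg rU) = s.reg rT ∧
        s.val k (s.reg rU) ≤ c) ∨
      (((maxProg k).run s).val k (s.reg rU) = s.val k (s.reg rU) ∧
        ((maxProg k).run s).arg k (s.reg rU) = s.arg k (s.reg rU) ∧ c < s.val k (s.reg rU))) := by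
  obtain ⟨s1, h1⟩ : ∃ s1 : State, s1 = (s.setReg rC (kidClass (s.reg rA ≠ 0) (s.reg rD ≠ 0)
    k)).setReg rNum c := ⟨_, rfl⟩
  have hrun : (maxProg k).run s = if c < s.val k (s.reg rU) then s1 else
      (s1.write (17 + k) (s.reg rU) c).write (21 + k) (s.reg rU) (s.reg rT) := by
    rw [maxProg, Prog.run, Prog.run, Prog.run, Prog.run, run_kid, run_val (by
      simpa using kidClass_mem _ _ _)]
    have h2 : s1.reg rNum = c := by simp [h1]
    simp only [Term.val, State.setReg_reg, if_true, State.setReg_setReg, Nat.reduceEqDiff,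
      if_false, State.setReg_mem, State.setReg_val]
    rw [← hc, ← h1]
    by_cases h3 : c < s.mem (17 + k) (s.reg rU) <;>
      simp [Prog.run, Term.val, h1, h3, State.val]
  rw [hrun]
  by_cases h3 : c < s.val k (s.reg rU)
  · rw [if_pos h3]
    refine ⟨⟨fun r hr hr' => by simp [h1, hr, hr'], fun a _ _ => by simp [h1],
      fun a t _ => by simp [h1]⟩, .inr ⟨by simp [h1, State.val], by simp [h1, State.arg], h3⟩⟩
  · rw [if_neg h3]
    refine ⟨⟨fun r hr hr' => by simp [h1, hr, hr'], fun a ha ha' => by simp [h1, ha, ha'],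
      fun a t ht => ?_⟩, .inl ⟨by simp [h1, State.val], by simp [State.arg], by omega⟩⟩
    simp only [State.write_mem]
    split_ifs <;> simp_all

end RAM

namespace RAM

open Term Prog

/-! ### The stages of the program for cliques -/

section

variable {e : ℕ → ℕ → ℕ} {V I : Finset ℕ} {z : ℕ} {par lab w : ℕ → ℕ} {D : ℕ → Finset ℕ} {N : ℕ}

/-- All vertices are put on the work list, with the same type. -/
theorem tri_leaves {s : State} {n : ℕ} (hI : s.reg rI = 0) (hN : s.reg rN = n)
    (hty : ∀ t, s.mem aType t = 0) (hl : ∀ t, s.mem aLeaf t = 0) :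
    Tri (forUp rI rN leavesBody) s (n * 30 + 4) fun s' =>
      (∀ i < n, s'.mem aW i = i) ∧ (∀ t, s'.mem aType t = if t < n then 2 else 0) ∧
        ∀ t, s'.mem aLeaf t = if t < n then t + 1 else 0 := by
  refine (Tri.forUp (C := 20) (N := n) (fun i s' => (∀ j < i, s'.mem aW j = j) ∧
    (∀ t, s'.mem aType t = if t < i then 2 else 0) ∧
      ∀ t, s'.mem aLeaf t = if t < i then t + 1 else 0) ?_ rfl rfl (by decide) hI hN
      ⟨by simp, by simp [hty], by simp [hl]⟩ (by omega)).conseq le_rfl fun s' hs' => hs'.1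
  rintro i s hi ⟨h1, h2, h3⟩ hri _
  refine Tri.straight rfl (by decide) ?_
  simp only [leavesBody, Prog.run, Term.val, State.setReg_mem, State.write_mem, State.write_reg,
    hri, Nat.reduceEqDiff, if_false, if_true, Function.update_apply, h2, h3]
  refine ⟨fun j hj => ?_, fun t => ?_, fun t => ?_⟩
  · split_ifs with h
    · exact h.symm
    · exact h1 j (by omega)
  · split_ifs <;> omega
  · split_ifs <;> omega

/-- Representative in-degrees, and their extreme values among the children of each node, from the
leaves to the root. -/
theorem tri_deg {s : State} (ht : Topo V I par (s.mem aW) N) (hT : IsTree e V I z par lab D)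
    (hpar : s.mem aPar = par) (hI : s.reg rI = 0) (hN : s.reg rLenW = N)
    (hlo : ∀ t, s.mem aLo t = 0) (hhi : ∀ t, s.mem aHi t = 0) :
    Tri (forUp rI rLenW degBody) s (N * 80 + 4) fun s' =>
      DegTo V I par (s.mem aW) N (s'.mem aIndeg) (s'.mem aLo) (s'.mem aHi) ∧
        ∀ v ∈ V, s'.mem aIndeg v = s.mem aIndeg v := by
  obtain ⟨w, hw⟩ : ∃ w, w = s.mem aW := ⟨_, rfl⟩
  obtain ⟨r, hr⟩ : ∃ r, r = s.mem aIndeg := ⟨_, rfl⟩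
  rw [← hw] at ht ⊢
  rw [← hr]
  refine (Tri.forUp (C := 70) (N := N) (fun i s' => s'.mem aW = w ∧ s'.mem aPar = par ∧
    DegTo V I par w i (s'.mem aIndeg) (s'.mem aLo) (s'.mem aHi) ∧
      ∀ v ∈ V, s'.mem aIndeg v = r v) ?_ rfl rfl (by decide) hI hN
      ⟨hw.symm, hpar, fun p _ => .inl ⟨Topo.kidsTo_zero p, hlo p, hhi p⟩, by simp [hr]⟩
      (by omega)).conseq le_rfl fun s' hs' => hs'.1.2.2
  rintro i s hi ⟨h1, h2, h3, h4⟩ hri _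
  have hTU : w i ≠ par (w i) := ht.ne_par hi le_rfl
  refine ((Tri.straight (T := 70) (Q := fun s' =>
    s'.mem aIndeg = Function.update (s.mem aIndeg) (par (w i)) (s.mem aIndeg (w i)) ∧
    s'.mem aLo = (if s.mem aLo (par (w i)) = 0 ∨ s.mem aIndeg (w i) + 1 < s.mem aLo (par (w i)) then
      Function.update (s.mem aLo) (par (w i)) (s.mem aIndeg (w i) + 1) else s.mem aLo) ∧
    s'.mem aHi = (if s.mem aHi (par (w i)) < s.mem aIndeg (w i) + 1 then
      Function.update (s.mem aHi) (par (w i)) (s.mem aIndeg (w i) + 1) else s.mem aHi))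
    rfl (by decide) ?_).frame).conseq le_rfl ?_
  · simp only [degBody, Prog.run, Term.val, State.setReg_reg, State.setReg_mem, State.write_mem,
      State.write_reg, hri, h1, h2, Nat.reduceEqDiff, if_false, if_true]
    by_cases g1 : s.mem aLo (par (w i)) = 0 <;>
      by_cases g2 : s.mem aIndeg (w i) + 1 < s.mem aLo (par (w i)) <;>
      by_cases g3 : s.mem aHi (par (w i)) < s.mem aIndeg (w i) + 1 <;>
      simp [g1, g2, g3]
  · rintro s' ⟨⟨q1, q2, q3⟩, _, hm⟩
    refine ⟨(hm aW (by decide)).trans h1, (hm aPar (by decide)).trans h2, ?_, fun v hv => ?_⟩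
    · refine h3.step ht hi (fun t ht' => ?_) ?_ ?_ ?_
      · simp only [State.setReg_mem, q1, q2, q3]
        refine ⟨Function.update_of_ne ht' _ _, ?_, ?_⟩
        · split_ifs
          · exact Function.update_of_ne ht' _ _
          · rfl
        · split_ifs
          · exact Function.update_of_ne ht' _ _
          · rfl
      · rw [State.setReg_mem, q1, Function.update_self]
      · rw [State.setReg_mem, q2]
        split_ifs
        · exact Function.update_self _ _ _
        · rfl
      · rw [State.setReg_mem, q3]
        split_ifs
        · exact Function.update_self _ _ _
        · rfl
    · rw [State.setReg_mem, q1, Function.update_of_ne, h4 v hv]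
      rintro rfl
      rcases hT.par_mem _ (ht.node hi) with h5 | h5
      · exact hT.zV (h5 ▸ hv)
      · exact hT.disj _ hv h5

theorem joinProg_spec (s : State) (k : ℕ) : State.Stores k s ((joinProg k).run s) ∧
    ((joinProg k).run s).val k (s.reg rU) =
      addM (s.reg rM) (s.val k (s.reg rU)) (s.val k (s.reg rT)) := by
  have hrun : (joinProg k).run s = (s.setReg rNum (addM (s.reg rM) (s.val k (s.reg rU))
      (s.val k (s.reg rT)))).write (17 + k) (s.reg rU)
      (addM (s.reg rM) (s.val k (s.reg rU)) (s.val k (s.reg rT))) := by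
    simp [joinProg, Prog.run, Term.val, State.val]
  rw [hrun]
  refine ⟨⟨fun r _ hr => by simp [hr], fun a ha _ => by simp [ha], fun a t ht => ?_⟩, by
    simp [State.val]⟩
  simp only [State.write_mem]
  split_ifs <;> simp_all

theorem addM_eq {M x y : ℕ} (h : x + y < M) : addM M x y = x + y := by
  unfold addM
  split_ifs <;> omega

theorem valOf_congr {val val' : ℕ → ℕ → ℕ} {l l' : ℕ → ℕ} {t : ℕ} (h : ∀ k, val' k t = val k t)
    (hl : l' t = l t) (k : ℕ) : valOf val' l' k t = valOf val l k t := by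
  simp only [valOf, h, hl]

/-- Maximum sizes of cliques, from the leaves to the root. -/
theorem tri_values {s : State} {M : ℕ} (ht : Topo V I par (s.mem aW) N)
    (hT : IsTree e V I z par lab D) (hlV : ∀ v ∈ V, lab v = 3) (hlI : ∀ t ∈ I, lab t ≤ 2)
    (hz : lab z = 3) (hVM : V.card < M) (hpar : s.mem aPar = par) (hlab : s.mem aLab = lab)
    (hI : s.reg rI = 0) (hN : s.reg rLenW = N) (hM : s.reg rM = M) {lo up : ℕ → Prop}
    (hlo : lo = fun c => lab (par c) = 0 ∨ s.mem aIndeg c ≠ s.mem aLo (par c) - 1)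
    (hup : up = fun c => lab (par c) = 0 ∨ s.mem aIndeg c ≠ s.mem aHi (par c) - 1)
    (h0 : ValuesTo V I par lab (s.mem aW) D lo up 0 s.val s.arg (s.mem aLeaf)) :
    Tri (forUp rI rLenW valuesBody) s (N * 600 + 4) fun s' =>
      ValuesTo V I par lab (s.mem aW) D lo up N s'.val s'.arg (s'.mem aLeaf) := by
  obtain ⟨w, hw⟩ : ∃ w, w = s.mem aW := ⟨_, rfl⟩
  obtain ⟨r, hr⟩ : ∃ r, r = s.mem aIndeg := ⟨_, rfl⟩
  obtain ⟨mn, hmn⟩ : ∃ mn, mn = s.mem aLo := ⟨_, rfl⟩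
  obtain ⟨mx, hmx⟩ : ∃ mx, mx = s.mem aHi := ⟨_, rfl⟩
  rw [← hw] at ht h0 ⊢
  rw [← hr, ← hmn] at hlo
  rw [← hr, ← hmx] at hup
  refine (Tri.forUp (C := 590) (N := N) (fun i s' => s'.mem aW = w ∧ s'.mem aPar = par ∧
    s'.mem aLab = lab ∧ s'.mem aIndeg = r ∧ s'.mem aLo = mn ∧ s'.mem aHi = mx ∧ s'.reg rM = M ∧
    ValuesTo V I par lab w D lo up i s'.val s'.arg (s'.mem aLeaf)) ?_ rfl rfl (by decide) hI hN
      ⟨hw.symm, hpar, hlab, hr.symm, hmn.symm, hmx.symm, hM, h0⟩ (by omega)).conseq le_rfl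
      fun s' hs' => hs'.1.2.2.2.2.2.2.2
  rintro i s hi ⟨h1, h2, h3, h4, h5, h6, h7, h8⟩ hri _
  have hTU : w i ≠ par (w i) := ht.ne_par hi le_rfl
  refine ((Tri.straight (T := 590) (Q := fun s' => ValuesTo V I par lab w D lo up (i + 1)
    s'.val s'.arg (s'.mem aLeaf)) rfl (by decide) ?_).frame).conseq le_rfl ?_
  swap
  · rintro s' ⟨q, hr', hm⟩
    refine ⟨(hm aW (by decide)).trans h1, (hm aPar (by decide)).trans h2,
      (hm aLab (by decide)).trans h3, (hm aIndeg (by decide)).trans h4,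
      (hm aLo (by decide)).trans h5, (hm aHi (by decide)).trans h6, ?_, q⟩
    simpa using (hr' rM (by decide)).trans h7
  obtain ⟨s0, hs0⟩ : ∃ s0 : State, s0 = ((s.setReg rT (w i)).setReg rU (par (w i))).setReg rLam
    (lab (par (w i))) := ⟨_, rfl⟩
  have hrun : valuesBody.run s = passProg.run s0 := by
    simp [valuesBody, Prog.run, Term.val, hri, h1, h2, h3, hs0]
  rw [hrun]
  clear hrun
  have hv0 : s0.val = s.val := by simp [hs0]
  have ha0 : s0.arg = s.arg := by simp [hs0]
  have hm0 : s0.mem = s.mem := by simp [hs0]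
  have hT0 : s0.reg rT = w i := by simp [hs0]
  have hU0 : s0.reg rU = par (w i) := by simp [hs0]
  have hL0 : s0.reg rLam = lab (par (w i)) := by simp [hs0]
  have hM0 : s0.reg rM = M := by simp [hs0, h7]
  by_cases l3 : lab (par (w i)) = 3
  · have : passProg.run s0 = s0 := by simp [passProg, Prog.run, Term.val, hL0, l3]
    rw [this, hv0, ha0, hm0]
    refine h8.step hT ht hi (by simp) (fun h => by omega) (fun h => ?_)
    have := hlI _ h
    omega
  have hUI : par (w i) ∈ I :=
    (hT.par_mem _ (ht.node hi)).resolve_left fun h => l3 (h ▸ hz)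
  by_cases l2 : lab (par (w i)) = 2
  · obtain ⟨s3, e3⟩ : ∃ s3, s3 = (joinProg 3).run ((joinProg 2).run ((joinProg 1).run s0)) :=
      ⟨_, rfl⟩
    obtain ⟨hl3, hr3, off, hk3⟩ := State.Stores.three (fun k s => (joinProg_spec s k).1) e3
    have hU3 := (hr3 rU (by decide) (by decide)).trans hU0
    have hT3 := (hr3 rT (by decide) (by decide)).trans hT0
    rw [hm0] at hl3 off
    rw [hU0] at off hk3
    have hsum : ∀ k, 1 ≤ k → k ≤ 3 → s3.val k (par (w i)) =
        s.val k (par (w i)) + s.val k (w i) := by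
      intro k hk hk3'
      rw [← addM_eq (lt_of_le_of_lt (h8.add_le hT ht hi hk hk3' hUI) hVM)]
      obtain ⟨sk, rk, ok, vk, -, vk', -⟩ := hk3 k hk hk3'
      have := (joinProg_spec sk k).2
      rw [rk rU (by decide) (by decide), rk rM (by decide) (by decide),
        rk rT (by decide) (by decide), hU0, hM0, hT0, vk, hv0] at this
      rw [vk', this]
    have hlT : s3.mem aLab (w i) = lab (w i) := by rw [off _ _ hTU, h3]
    have hrun : passProg.run s0 =
        if w i ∈ V then s3.write aLeaf (par (w i)) (w i + 1) else s3 := by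
      have : lab (w i) = 3 ↔ w i ∈ V := by
        rcases ht.node hi with h | h
        · simp [h, hlV _ h]
        · have h9 := hlI _ h
          have : w i ∉ V := fun h10 => hT.disj _ h10 h
          simp only [this, iff_false]
          omega
      by_cases hV : w i ∈ V
      · have h9 := this.2 hV
        simp [passProg, Prog.run, Term.val, hL0, l2, ← e3, hT3, hU3, hlT, h9, hV]
      · have h9 : ¬ lab (w i) = 3 := fun h => hV (this.1 h)
        simp [passProg, Prog.run, Term.val, hL0, l2, ← e3, hT3, hlT, h9, hV]
    rw [hrun]
    refine h8.step hT ht hi (fun t h => ?_) (fun _ => ?_) (fun _ h => absurd l2 h)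
    · have h9 := fun a => off a t h
      split_ifs with hV
      · have h10 : ∀ a, (s3.write aLeaf (par (w i)) (w i + 1)).mem a t = s.mem a t := by
          intro a
          rw [State.write_mem]
          split_ifs with ha
          · rw [Function.update_of_ne h, ha, h9]
          · exact h9 a
        exact ⟨fun k => ⟨h10 _, h10 _⟩, h10 _⟩
      · exact ⟨fun k => ⟨h9 _, h9 _⟩, h9 _⟩
    · split_ifs with hV
      · refine ⟨fun k hk hk3 => ?_, by simp⟩
        rw [← hsum k hk hk3, State.val, State.write_mem, if_neg (by omega)]
        rfl
      · exact ⟨hsum, by rw [hl3]⟩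
  · obtain ⟨sf, ef⟩ : ∃ sf, sf = flagProg.run s0 := ⟨_, rfl⟩
    obtain ⟨s3, e3⟩ : ∃ s3, s3 = (maxProg 3).run ((maxProg 2).run ((maxProg 1).run sf)) :=
      ⟨_, rfl⟩
    have hrun : passProg.run s0 = s3 := by
      simp [passProg, Prog.run, Term.val, hL0, l2, l3, ← ef, ← e3]
    rw [hrun]
    rw [run_flag, hL0, hT0, hU0, hm0, h4, h5, h6] at ef
    have hmf : sf.mem = s.mem := by rw [ef]; simp [hm0]
    have hTf : sf.reg rT = w i := by rw [ef]; simp [hT0]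
    have hUf : sf.reg rU = par (w i) := by rw [ef]; simp [hU0]
    have hAf : (sf.reg rA ≠ 0) = lo (w i) := by
      rw [ef, hlo]
      simp only [State.setReg_reg, Nat.reduceEqDiff, if_false, if_true]
      split_ifs with h <;> simp [h]
    have hDf : (sf.reg rD ≠ 0) = up (w i) := by
      rw [ef, hup]
      simp only [State.setReg_reg, if_true]
      split_ifs with h <;> simp [h]
    clear ef
    obtain ⟨hl3, -, off, hk3⟩ := State.Stores.three (fun k s => (maxProg_spec s k rfl).1) e3
    rw [hmf] at hl3 off
    rw [hUf] at off hk3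
    have hvf : ∀ k, sf.val k = s.val k := fun k => congrFun hmf (17 + k)
    have haf : ∀ k, sf.arg k = s.arg k := fun k => congrFun hmf (21 + k)
    refine h8.step hT ht hi (fun t h => ⟨fun k => ⟨off _ _ h, off _ _ h⟩, off _ _ h⟩)
      (fun h => absurd h l2) (fun _ _ => ⟨by rw [hl3], fun k hk hk3' => ?_⟩)
    obtain ⟨sk, rk, ok, vk, ak, vk', ak'⟩ := hk3 k hk hk3'
    rw [hmf] at ok
    have := (maxProg_spec sk k rfl).2
    rw [rk rU (by decide) (by decide), rk rT (by decide) (by decide),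
      rk rA (by decide) (by decide), rk rD (by decide) (by decide), hUf, hTf, hAf, hDf, vk, ak,
      hvf, haf, ← vk', ← ak', valOf_congr (val := s.val) (val' := sk.val)
        (l := s.mem aLeaf) (fun j => ok (17 + j) _ hTU) (ok _ _ hTU)] at this
    exact this

end

end RAM

/-! ### The choice of a maximum clique -/

/-- The class of the node `t`, given the class `c` of its parent. -/
noncomputable def classFrom (par lab : ℕ → ℕ) (lo up : ℕ → Prop) (val arg : ℕ → ℕ → ℕ) (l : ℕ → ℕ)
    (c t : ℕ) : ℕ :=
  if lab (par t) = 3 then resolve val l 5 t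
  else if lab (par t) = 2 then if c = 4 then if l (par t) = t + 1 then 4 else 1 else c
  else if c = 0 then 0
  else if arg (if c = 4 then 1 else c) (par t) = t then
    resolve val l (kidClass (lo t) (up t) (if c = 4 then 1 else c)) t
  else 0

theorem classFrom_le {par lab : ℕ → ℕ} {lo up : ℕ → Prop} {val arg : ℕ → ℕ → ℕ} {l : ℕ → ℕ}
    {c : ℕ} (hc : c ≤ 4) (t : ℕ) : classFrom par lab lo up val arg l c t ≤ 4 := by
  unfold classFrom
  split_ifs
  all_goals first | omega | exact resolve_le le_rfl | exact resolve_le (kidClass_le _ _ _)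

theorem resolve_congr {val val' : ℕ → ℕ → ℕ} {l l' : ℕ → ℕ} (h : ∀ k ≤ 3, val' k = val k)
    (hl : l' = l) (k t : ℕ) : resolve val' l' k t = resolve val l k t := by
  simp only [resolve, h 1 (by omega), h 2 (by omega), h 3 (by omega), hl]

namespace RAM

open Term Prog

section

variable {e : ℕ → ℕ → ℕ} {V I : Finset ℕ} {z : ℕ} {par lab w : ℕ → ℕ} {D : ℕ → Finset ℕ} {N : ℕ}

theorem flag_spec {s : State} {lo up : Prop}
    (hlo : lo ↔ s.reg rLam = 0 ∨ s.mem aIndeg (s.reg rT) ≠ s.mem aLo (s.reg rU) - 1)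
    (hup : up ↔ s.reg rLam = 0 ∨ s.mem aIndeg (s.reg rT) ≠ s.mem aHi (s.reg rU) - 1) :
    ((flagProg.run s).reg rA ≠ 0) = lo ∧ ((flagProg.run s).reg rD ≠ 0) = up := by
  rw [run_flag, propext hlo, propext hup]
  simp only [State.setReg_reg, Nat.reduceEqDiff, if_false, if_true]
  constructor <;> split_ifs with h <;> simp [h]

/-- The class of a node, from that of its parent. -/
theorem run_class {s : State} {T : ℕ} (hT : s.reg rT = T) (hU : s.reg rU = par T)
    (hL : s.reg rLam = lab (par T)) (hc : s.mem aClass (par T) ≤ 4) {lo up : ℕ → Prop}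
    {val arg : ℕ → ℕ → ℕ} {l : ℕ → ℕ}
    (hlo : lo T ↔ (lab (par T) = 0 ∨ s.mem aIndeg T ≠ s.mem aLo (par T) - 1))
    (hup : up T ↔ (lab (par T) = 0 ∨ s.mem aIndeg T ≠ s.mem aHi (par T) - 1))
    (hval : ∀ k ≤ 3, s.val k = val k) (harg : ∀ k ≤ 3, s.arg k = arg k) (hl : s.mem aLeaf = l) :
    (classProg.run s).reg rC = classFrom par lab lo up val arg l (s.mem aClass (par T)) T := by
  unfold classFrom
  by_cases l3 : lab (par T) = 3
  · have : classProg.run s = resolveProg.run (s.setReg rC 5) := by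
      simp [classProg, Prog.run, Term.val, hL, l3]
    rw [this, run_resolve, if_pos l3]
    simpa [hT] using resolve_congr hval hl 5 T
  rw [if_neg l3]
  by_cases l2 : lab (par T) = 2
  · rw [if_pos l2]
    by_cases h4 : s.mem aClass (par T) = 4 <;> by_cases h5 : l (par T) = T + 1 <;>
      simp [classProg, Prog.run, Term.val, hL, l2, hU, h4, hl, hT, h5]
  rw [if_neg l2]
  by_cases h0 : s.mem aClass (par T) = 0
  · simp [classProg, Prog.run, Term.val, hL, l2, l3, hU, h0]
  rw [if_neg h0]
  obtain ⟨k, hk⟩ : ∃ k, k = if s.mem aClass (par T) = 4 then 1 else s.mem aClass (par T) := ⟨_, rfl⟩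
  have hk13 : 1 ≤ k ∧ k ≤ 3 := by
    rw [hk]
    split_ifs <;> omega
  rw [← hk]
  have hrun : classProg.run s = (chooseProg ;; ite (eq (reg rNum) (reg rT))
      (flagProg ;; kidProg ;; resolveProg) (setReg rC (const 0))).run (s.setReg rC k) := by
    rw [hk]
    by_cases h4 : s.mem aClass (par T) = 4 <;>
      simp [classProg, Prog.run, Term.val, hL, l2, l3, hU, h0, h4]
  rw [hrun, Prog.run, run_choose (by simpa using hk13.1) (by simpa using hk13.2)]
  have hak : (s.setReg rC k).arg ((s.setReg rC k).reg rC) ((s.setReg rC k).reg rU) =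
      arg k (par T) := by
    simp [hU, harg k hk13.2]
  rw [hak]
  by_cases ha : arg k (par T) = T
  · obtain ⟨s1, h1⟩ : ∃ s1 : State, s1 = (s.setReg rC k).setReg rNum (arg k (par T)) := ⟨_, rfl⟩
    have h2 := flag_spec (s := s1) (lo := lo T) (up := up T) (by simp [h1, hT, hU, hL, hlo])
      (by simp [h1, hT, hU, hL, hup])
    have h3 : (flagProg.run s1).mem = s.mem := by
      funext a
      rw [Prog.run_mem rfl rfl, h1]
      rfl
    have h4 : (flagProg.run s1).reg rT = T := by
      rw [Prog.run_reg rfl (by decide)]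
      simp [h1, hT]
    have h5 : (flagProg.run s1).reg rC = k := by
      rw [Prog.run_reg rfl (by decide)]
      simp [h1]
    rw [if_pos ha, ← h1, Prog.run, if_pos (by simp [Term.val, ha, hT, h1]), Prog.run, Prog.run,
      run_kid, run_resolve, h2.1, h2.2, h5]
    simp only [State.setReg_reg, State.setReg_mem, State.setReg_val, Nat.reduceEqDiff, if_true,
      if_false, h4, h3]
    exact resolve_congr (fun j hj => by rw [State.val, h3]; exact hval j hj) hl _ T
  · rw [if_neg ha, Prog.run, if_neg (by simp [Term.val, ha, hT])]
    simp [Prog.run, Term.val]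

/-- Classes, from the root to the leaves. -/
theorem tri_class {s : State} (ht : Topo V I par (s.mem aW) N)
    (hz : lab z = 3) (hlI : ∀ t ∈ I, lab t ≤ 2) (hpar : s.mem aPar = par) (hlab : s.mem aLab = lab)
    (hI : s.reg rI = 0) (hN : s.reg rLenW = N) {lo up : ℕ → Prop}
    (hlo : lo = fun c => lab (par c) = 0 ∨ s.mem aIndeg c ≠ s.mem aLo (par c) - 1)
    (hup : up = fun c => lab (par c) = 0 ∨ s.mem aIndeg c ≠ s.mem aHi (par c) - 1)
    (h0 : ∀ t, s.mem aClass t = 0) :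
    Tri (forUp rI rLenW classBody) s (N * 400 + 4) fun s' =>
      Classes V I z par lab lo up s.val s.arg (s.mem aLeaf) (s'.mem aClass) := by
  obtain ⟨w, hw⟩ : ∃ w, w = s.mem aW := ⟨_, rfl⟩
  obtain ⟨r, hr⟩ : ∃ r, r = s.mem aIndeg := ⟨_, rfl⟩
  obtain ⟨mn, hmn⟩ : ∃ mn, mn = s.mem aLo := ⟨_, rfl⟩
  obtain ⟨mx, hmx⟩ : ∃ mx, mx = s.mem aHi := ⟨_, rfl⟩
  obtain ⟨val, hval⟩ : ∃ val, val = s.val := ⟨_, rfl⟩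
  obtain ⟨arg, harg⟩ : ∃ arg, arg = s.arg := ⟨_, rfl⟩
  obtain ⟨l, hl⟩ : ∃ l, l = s.mem aLeaf := ⟨_, rfl⟩
  rw [← hw] at ht
  rw [← hr, ← hmn] at hlo
  rw [← hr, ← hmx] at hup
  rw [← hval, ← harg, ← hl]
  refine (Tri.forUp (C := 390) (N := N) (fun i s' => s'.mem aW = w ∧ s'.mem aPar = par ∧
    s'.mem aLab = lab ∧ s'.mem aIndeg = r ∧ s'.mem aLo = mn ∧ s'.mem aHi = mx ∧
    (∀ k ≤ 3, s'.val k = val k) ∧ (∀ k ≤ 3, s'.arg k = arg k) ∧ s'.mem aLeaf = l ∧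
    (∀ t, s'.mem aClass t ≤ 4) ∧ ∀ j < N, N ≤ j + i → s'.mem aClass (w j) =
      classFrom par lab lo up val arg l (s'.mem aClass (par (w j))) (w j)) ?_ rfl rfl (by decide) hI
      hN ⟨hw.symm, hpar, hlab, hr.symm, hmn.symm, hmx.symm, by simp [hval], by simp [harg], hl.symm,
        by simp [h0], fun j hj hj' => by omega⟩ (by omega)).conseq le_rfl ?_
  · rintro i s hi ⟨h1, h2, h3, h4, h5, h6, h7, h8, h9, h10, h11⟩ hri hrN
    have hj : N - i - 1 < N := by omega
    obtain ⟨T, hTw⟩ : ∃ T, T = w (N - i - 1) := ⟨_, rfl⟩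
    obtain ⟨s0, hs0⟩ : ∃ s0 : State, s0 = ((s.setReg rT T).setReg rU (par T)).setReg rLam
      (lab (par T)) := ⟨_, rfl⟩
    have hm0 : s0.mem = s.mem := by simp [hs0]
    have hcls : (classProg.run s0).reg rC =
        classFrom par lab lo up val arg l (s.mem aClass (par T)) T := by
      rw [← hm0]
      exact run_class (by simp [hs0]) (by simp [hs0]) (by simp [hs0]) (hm0 ▸ h10 _)
        (by rw [hlo, hm0, h4, h5]) (by rw [hup, hm0, h4, h6]) (by simpa [hs0] using h7)
        (by simpa [hs0] using h8) (by rw [hm0, h9])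
    have hTr : (classProg.run s0).reg rT = T := by
      rw [Prog.run_reg rfl (by decide)]
      simp [hs0]
    have hcm : (classProg.run s0).mem aClass = s.mem aClass := by
      rw [Prog.run_mem rfl (by decide), hm0]
    have hrun : classBody.run s = (classProg.run s0).write aClass T
        (classFrom par lab lo up val arg l (s.mem aClass (par T)) T) := by
      have : classBody.run s = (write aClass (reg rT) (reg rC)).run (classProg.run s0) := by
        simp [classBody, Prog.run, Term.val, hri, hrN, h1, h2, h3, hs0, ← hTw]
      rw [this, Prog.run, Term.val, Term.val, hTr, hcls]
    refine ((Tri.straight (T := 390) (Q := fun s' => s'.mem aClass =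
      Function.update (s.mem aClass) T (classFrom par lab lo up val arg l (s.mem aClass (par T)) T))
      rfl (by decide) ?_).frame).conseq le_rfl ?_
    · rw [hrun, State.write_mem, if_pos rfl, hcm]
    · rintro s' ⟨q, _, hm⟩
      refine ⟨(hm aW (by decide)).trans h1, (hm aPar (by decide)).trans h2,
        (hm aLab (by decide)).trans h3, (hm aIndeg (by decide)).trans h4,
        (hm aLo (by decide)).trans h5, (hm aHi (by decide)).trans h6, fun k hk => ?_, fun k hk => ?_,
        (hm aLeaf (by decide)).trans h9, fun t => ?_, fun j hj1 hj2 => ?_⟩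
      · rw [← h7 k hk, State.setReg_val, State.val, hm _ (by interval_cases k <;> decide)]
        rfl
      · rw [← h8 k hk, State.setReg_arg, State.arg, hm _ (by interval_cases k <;> decide)]
        rfl
      · rw [State.setReg_mem, q, Function.update_apply]
        split_ifs
        · exact classFrom_le (h10 _) _
        · exact h10 t
      · have hne : par (w j) ≠ T := by
          intro h
          have := ht.lt j hj1 _ hj (h.trans hTw)
          omega
        rw [State.setReg_mem, q, Function.update_of_ne hne]
        by_cases hjT : w j = T
        · rw [hjT, Function.update_self]
        · rw [Function.update_of_ne hjT]
          refine h11 j hj1 ?_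
          have : j ≠ N - i - 1 := by
            rintro rfl
            exact hjT hTw.symm
          omega
  · rintro s' ⟨⟨_, _, _, _, _, _, _, _, _, _, h11⟩, _⟩
    have key : ∀ p, ∀ c ∈ kids V I par p, s'.mem aClass c =
        classFrom par lab lo up val arg l (s'.mem aClass p) c := by
      intro p c hc
      obtain ⟨hcN, rfl⟩ := mem_kids.1 hc
      obtain ⟨j, hj, rfl⟩ := (ht.mem c).2 hcN
      exact h11 j hj (by omega)
    constructor
    · intro c hc
      rw [key z c hc, classFrom, (mem_kids.1 hc).2, if_pos hz]
    · intro p hp hl2 c hc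
      rw [key p c hc, classFrom, (mem_kids.1 hc).2, if_neg (by omega), if_pos hl2]
    · intro p hp hl2 c hc
      have := hlI p hp
      rw [key p c hc, classFrom, (mem_kids.1 hc).2, if_neg (by omega), if_neg hl2]

/-- The vertices that are not of class `4` are written to the output array. -/
theorem tri_out {s : State} {n : ℕ} (hI : s.reg rI = 0) (hN : s.reg rN = n)
    (hL : s.reg rLam = 0) :
    Tri (forUp rI rN outBody) s (n * 40 + 4) fun s' =>
      s'.reg rLam = ((Finset.range n).filter fun v => s.mem aClass v ≠ 4).card ∧
      (Finset.range (s'.reg rLam)).image (s'.mem aTail) =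
        (Finset.range n).filter fun v => s.mem aClass v ≠ 4 := by
  obtain ⟨cls, hcls⟩ : ∃ cls, cls = s.mem aClass := ⟨_, rfl⟩
  rw [← hcls]
  refine (Tri.forUp (C := 30) (N := n) (fun i s' => s'.mem aClass = cls ∧
    s'.reg rLam = ((Finset.range i).filter fun v => cls v ≠ 4).card ∧
    (Finset.range (s'.reg rLam)).image (s'.mem aTail) =
      (Finset.range i).filter fun v => cls v ≠ 4) ?_ rfl rfl (by decide) hI hN
      ⟨hcls.symm, by simp [hL], by simp [hL]⟩ (by omega)).conseq le_rfl fun s' hs' => hs'.1.2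
  rintro i s hi ⟨h1, h2, h3⟩ hri _
  refine Tri.straight rfl (by decide) ?_
  by_cases h : cls i = 4
  · have hrun : outBody.run s = s := by simp [outBody, Prog.run, Term.val, hri, h1, h]
    rw [hrun, Finset.range_add_one, Finset.filter_insert, if_neg (by simpa using h)]
    exact ⟨h1, by simpa using h2, by simpa using h3⟩
  · have hrun : outBody.run s = (s.write aTail (s.reg rLam) i).setReg rLam (s.reg rLam + 1) := by
      simp [outBody, Prog.run, Term.val, hri, h1, h]
    rw [hrun, Finset.range_add_one, Finset.filter_insert, if_pos h]
    refine ⟨by simpa using h1, ?_, ?_⟩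
    · rw [Finset.card_insert_of_notMem (by simp)]
      simpa using h2
    · simp only [State.setReg_reg, State.setReg_mem, State.write_mem, Nat.reduceEqDiff, if_false,
        if_true]
      rw [Finset.range_add_one, Finset.image_insert, Function.update_self, ← h3]
      congr 1
      refine Finset.image_congr fun j hj => ?_
      rw [Function.update_of_ne]
      have := Finset.mem_range.1 hj
      omega

end

end RAM

/-! ### From the tree to the complement of a clique -/

namespace RAM

open Term Prog

theorem seg_split (f : ℕ → ℕ) {j N : ℕ} (hj : j < N) : ∃ l, seg f N = seg f j ++ f j :: l := by
  induction N with
  | zero => omega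
  | succ N ih =>
    rw [seg_succ]
    rcases Nat.lt_succ_iff_lt_or_eq.1 hj with hj | rfl
    · obtain ⟨l, hl⟩ := ih hj
      exact ⟨l ++ [f N], by rw [hl]; simp⟩
    · exact ⟨[], rfl⟩

/-- If all vertices get the same type, then the search for uniform nodes yields a
topological order. -/
theorem _root_.SpreadInv.topo_seg {e : ℕ → ℕ → ℕ} {V I : Finset ℕ} {z : ℕ} {par lab w f : ℕ → ℕ}
    {D : ℕ → Finset ℕ} {N k : ℕ} {ty : ℕ → ℕ} (h : SpreadInv V I par D f (seg w N) [] ty)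
    (hT : IsTree e V I z par lab D) (hk : k ≠ 0) (hf : ∀ v ∈ V, f v = k) : Topo V I par w N where
  inj := seg_nodup_iff.1 (by simpa using h.nodup)
  mem t := by
    rw [← mem_seg, h.mem_iff hT]
    exact and_iff_left_of_imp fun ht => ⟨k, hk, fun u hu => hf u (hT.sub t ht hu)⟩
  lt i hi j hj hp := by
    have hn : ∀ i < N, w i ∈ V ∨ w i ∈ I := fun i hi =>
      ((h.mem_iff hT (w i)).1 (mem_seg.2 ⟨i, hi, rfl⟩)).1
    have hI : w j ∈ I := by
      rcases hT.par_mem _ (hn i hi) with h1 | h1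
      · rcases hn j hj with h2 | h2
        · exact absurd (h1 ▸ hp ▸ h2) hT.zV
        · exact h2
      · exact hp ▸ h1
    obtain ⟨l, hl⟩ := seg_split w hj
    have := h.topo (seg w j) (w j) l (by simpa using hl) hI (w i) (mem_kids.2 ⟨hn i hi, hp⟩)
    obtain ⟨i', hi', h3⟩ := mem_seg.1 this
    have := seg_nodup_iff.1 (by simpa using h.nodup) i' (by omega) i hi h3
    omega

/-- From the tree, the complement of a maximum clique is computed in linear time. -/
theorem tri_cliqueProg {A : ℕ → ℕ → Prop} {n M : ℕ} {s : State}
    (hA : IsCoRel A {u | u ∈ Finset.range n}) (hmem : ∀ u v, A u v → u ∈ Finset.range n ∧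
      v ∈ Finset.range n) (hnM : n < M) (hB : Built (arcCount A) n M n s)
    (hdeg : ∀ v ∈ Finset.range n, s.mem aIndeg v = CoTree.inDeg A (Finset.range n) v)
    (hrN : s.reg rN = n) (hrM : s.reg rM = M) (h0 : ∀ a, 16 ≤ a → a ≤ 25 → ∀ t, s.mem a t = 0) :
    Tri cliqueProg s (n * 3000 + 100) fun s' => ∃ K ⊆ Finset.range n,
      ((∀ u ∈ K, ∀ v ∈ K, u ≠ v → (Digraph.mk A).Compatible u v) ∧
      ∀ Q ⊆ Finset.range n, (∀ u ∈ Q, ∀ v ∈ Q, u ≠ v → (Digraph.mk A).Compatible u v) →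
        Q.card ≤ K.card) ∧
      s'.reg rN = (Finset.range n \ K).card ∧
      (Finset.range (s'.reg rN)).image (s'.mem aTail) = Finset.range n \ K := by
  obtain ⟨I, D, hS, hred, _, hty, hone, htwo, _⟩ := hB
  obtain ⟨par, hpar⟩ : ∃ par, par = s.mem aPar := ⟨_, rfl⟩
  obtain ⟨lab, hlab⟩ : ∃ lab, lab = s.mem aLab := ⟨_, rfl⟩
  obtain ⟨V, hV⟩ : ∃ V, V = Finset.range n := ⟨_, rfl⟩
  have hVn : ∀ v, v ∈ V ↔ v < n := fun v => by rw [hV, Finset.mem_range]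
  rw [← hpar, ← hlab] at hS hred
  rw [← hV] at hS hA hmem hdeg ⊢
  have hT := hS.tree
  have hC : CoTree A V I n par lab D := ⟨hA, hmem, hT, hred, hS.lab_le⟩
  unfold cliqueProg
  refine Tri.seq (T := 2) (T' := n * 3000 + 98) (Q := fun s' => s' = s.setReg rI 0)
    (Tri.straight rfl (by decide) rfl) ?_ (by omega)
  rintro s1 rfl
  refine Tri.seq (T := n * 30 + 4) (T' := n * 2970 + 94)
    (tri_leaves (s := s.setReg rI 0) (n := n) (by simp)
    (by simpa using hrN) hty (h0 aLeaf (by decide) (by decide))).frame ?_ (by omega)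
  rintro s2 ⟨⟨w2, t2, l2⟩, r2, m2⟩
  refine Tri.seq (T := 2) (T' := n * 2970 + 92) (Q := fun s' => s' = s2.setReg rLenW n)
    (Tri.straight rfl (by decide) ?_) ?_ (by omega)
  · rw [Prog.run, Term.val, r2 rN (by decide)]
    simp [hrN]
  rintro s3 rfl
  have hw2 : seg (s2.mem aW) n = List.range n :=
    (List.map_congr_left fun i hi => w2 i (List.mem_range.1 hi)).trans (List.map_id _)
  refine Tri.seq (T := n * 160 + 20) (T' := n * 2810 + 72) ((tri_spread (s := s2.setReg rLenW n)
    (f := fun _ => 2) hT ?_ (by simp) ?_ ?_ ?_ ?_ ?_ ?_ ?_ ?_).frame.conseq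
      (by simp) fun _ h => h) ?_ (by omega)
  · rw [State.setReg_mem, m2 _ (by decide), hpar]
    rfl
  · intro q hq
    rw [State.setReg_mem, m2 _ (by decide)]
    exact hS.num_eq q hq
  · rw [State.setReg_mem, m2 _ (by decide)]
    exact hS.num_top
  · intro q
    rw [State.setReg_mem, m2 _ (by decide)]
    exact hone q
  · intro q
    rw [State.setReg_mem, m2 _ (by decide)]
    exact htwo q
  · intro v hv
    rw [State.setReg_mem, t2, if_pos ((hVn v).1 hv)]
  · intro v hv
    rw [State.setReg_mem, t2, if_neg (mt (hVn v).2 hv)]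
  · simpa [hw2] using List.nodup_range
  · intro y
    simp [hw2, t2]
  rintro s3 ⟨⟨wl, hwl, hsp, _, _, _, _, hlen⟩, r3, m3⟩
  subst hwl
  have ht : Topo V I par (s3.mem aW) (s3.reg rLenW) := hsp.topo_seg hT two_ne_zero fun _ _ => rfl
  obtain ⟨N, hN⟩ : ∃ N, N = s3.reg rLenW := ⟨_, rfl⟩
  rw [← hN] at ht hlen
  have hN2 : N ≤ 2 * n := by simpa using hlen
  clear hlen hsp
  have z3 : ∀ a, 16 ≤ a → a ≠ aLeaf → s3.mem a = s.mem a := by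
    intro a ha ha'
    rw [m3 a, State.setReg_mem, m2 a, State.setReg_mem]
    · simp [leavesBody, forUp, Prog.writesMem]
      omega
    · simp [spread, spreadBody, passType, Prog.writesMem]
      omega
  have l3 : ∀ t, s3.mem aLeaf t = if t < n then t + 1 else 0 := by
    intro t
    rw [m3 _ (by decide)]
    exact l2 t
  have p3 : s3.mem aPar = par := by
    rw [m3 _ (by decide), State.setReg_mem, m2 _ (by decide), hpar]
    rfl
  have b3 : s3.mem aLab = lab := by
    rw [m3 _ (by decide), State.setReg_mem, m2 _ (by decide), hlab]
    rfl
  have d3 : s3.mem aIndeg = s.mem aIndeg := by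
    rw [m3 _ (by decide), State.setReg_mem, m2 _ (by decide)]
    rfl
  have n3 : s3.reg rN = n := by
    rw [r3 _ (by decide), State.setReg_reg, if_neg (by decide), r2 _ (by decide)]
    simpa using hrN
  have M3 : s3.reg rM = M := by
    rw [r3 _ (by decide), State.setReg_reg, if_neg (by decide), r2 _ (by decide)]
    simpa using hrM
  clear r3 m3 r2 m2 w2 t2 l2 hw2
  refine Tri.seq (T := 2) (T' := n * 2810 + 70) (Q := fun s' => s' = s3.setReg rI 0)
    (Tri.straight rfl (by decide) rfl) ?_ (by omega)
  rintro s4 rfl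
  refine Tri.seq (T := N * 80 + 4) (T' := n * 2650 + 66) (tri_deg (s := s3.setReg rI 0) ht hT p3
    (by simp) (by simp [hN]) (fun t => (congrFun (z3 _ (by decide) (by decide)) t).trans
      (h0 _ (by decide) (by decide) t)) (fun t => (congrFun (z3 _ (by decide) (by decide)) t).trans
      (h0 _ (by decide) (by decide) t))).frame ?_ (by omega)
  rintro s4 ⟨⟨g4, d4⟩, r4, m4⟩
  have hF := hC.flags_of_degTo ht g4 fun v hv => by
    rw [d4 v hv, State.setReg_mem, d3]
    exact hdeg v hv
  obtain ⟨lo, hlo⟩ : ∃ lo : ℕ → Prop, lo = fun c => lab (par c) = 0 ∨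
    s4.mem aIndeg c ≠ s4.mem aLo (par c) - 1 := ⟨_, rfl⟩
  obtain ⟨up, hup⟩ : ∃ up : ℕ → Prop, up = fun c => lab (par c) = 0 ∨
    s4.mem aIndeg c ≠ s4.mem aHi (par c) - 1 := ⟨_, rfl⟩
  rw [← hlo, ← hup] at hF
  have w4 : s4.mem aW = s3.mem aW := m4 _ (by decide)
  rw [← w4] at ht
  have l4 : ∀ t, s4.mem aLeaf t = if t < n then t + 1 else 0 := by
    intro t
    rw [m4 _ (by decide)]
    exact l3 t
  have v4 : ∀ k, 1 ≤ k → k ≤ 3 → ∀ t, s4.val k t = 0 := by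
    intro k hk hk3 t
    rw [State.val, m4 _ (by interval_cases k <;> decide), State.setReg_mem,
      z3 _ (by omega) (by omega)]
    exact h0 _ (by omega) (by omega) t
  have lI : ∀ p ∈ I, s4.mem aLeaf p = 0 := fun p hp => by
    rw [l4, if_neg]
    have := hS.inner p hp
    omega
  have hval0 : ValuesTo V I par lab (s4.mem aW) D lo up 0 s4.val s4.arg (s4.mem aLeaf) := by
    refine ⟨fun v hv => ⟨fun k hk hk3 => v4 k hk hk3 v, ?_⟩, fun p hp _ => ?_, fun p hp _ => ?_,
      fun p hp k hk hk3 => ?_⟩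
    · rw [l4, if_pos ((hVn v).1 hv)]
      omega
    · rw [Topo.kidsTo_zero]
      exact ⟨fun k hk hk3 => by simp [v4 k hk hk3], by simp, fun h => absurd (lI p hp) h⟩
    · rw [Topo.kidsTo_zero]
      exact ⟨lI p hp, fun k hk hk3 => ⟨.inl ⟨rfl, v4 k hk hk3 p⟩, by simp⟩⟩
    · simp [v4 k hk hk3, lI p hp]
  refine Tri.seq (T := 2) (T' := n * 2650 + 64) (Q := fun s' => s' = s4.setReg rI 0)
    (Tri.straight rfl (by decide) rfl) ?_ (by omega)
  rintro s5 rfl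
  refine Tri.seq (T := N * 600 + 4) (T' := n * 1450 + 60) (tri_values (s := s4.setReg rI 0)
    (M := M) (N := N) ht hT hS.lab_leaf hS.lab_le hS.lab_top (by rw [hV, Finset.card_range]; omega)
    ?_ ?_ (by simp) ?_ ?_ hlo hup hval0).frame ?_ (by omega)
  · rw [State.setReg_mem, m4 _ (by decide)]
    exact p3
  · rw [State.setReg_mem, m4 _ (by decide)]
    exact b3
  · rw [State.setReg_reg, if_neg (by decide), r4 _ (by decide), hN]
    rfl
  · rw [State.setReg_reg, if_neg (by decide), r4 _ (by decide)]
    simpa using M3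
  rintro s5 ⟨g5, r5, m5⟩
  have hvals := g5.values ht hT
  have w5 : s5.mem aW = s4.mem aW := m5 _ (by decide)
  rw [← w5] at ht
  refine Tri.seq (T := 2) (T' := n * 1450 + 58) (Q := fun s' => s' = s5.setReg rI 0)
    (Tri.straight rfl (by decide) rfl) ?_ (by omega)
  rintro s6 rfl
  refine Tri.seq (T := N * 400 + 4) (T' := n * 650 + 54) (tri_class (s := s5.setReg rI 0)
    (N := N) (lo := lo) (up := up) ht hS.lab_top hS.lab_le ?_ ?_ (by simp) ?_ ?_ ?_ ?_).frame ?_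
    (by omega)
  · rw [State.setReg_mem, m5 _ (by decide), State.setReg_mem, m4 _ (by decide)]
    exact p3
  · rw [State.setReg_mem, m5 _ (by decide), State.setReg_mem, m4 _ (by decide)]
    exact b3
  · rw [State.setReg_reg, if_neg (by decide), r5 _ (by decide), State.setReg_reg,
      if_neg (by decide), r4 _ (by decide), hN]
    rfl
  · rw [hlo, State.setReg_mem, m5 _ (by decide), m5 _ (by decide)]
    rfl
  · rw [hup, State.setReg_mem, m5 _ (by decide), m5 _ (by decide)]
    rfl
  · intro t
    rw [State.setReg_mem, m5 _ (by decide), State.setReg_mem, m4 _ (by decide), State.setReg_mem,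
      z3 _ (by decide) (by decide)]
    exact h0 _ (by decide) (by decide) t
  rintro s6 ⟨g6, r6, _⟩
  have hmax := hC.isMaxClique hF hvals g6
  refine Tri.seq (T := 2) (T' := n * 650 + 52) (Q := fun s' => s' = s6.setReg rI 0)
    (Tri.straight rfl (by decide) rfl) ?_ (by omega)
  rintro s7 rfl
  refine Tri.seq (T := 2) (T' := n * 650 + 50)
    (Q := fun s' => s' = (s6.setReg rI 0).setReg rLam 0)
    (Tri.straight rfl (by decide) rfl) ?_ (by omega)
  rintro s7 rfl
  refine Tri.seq (T := n * 40 + 4) (T' := 2) (tri_out (n := n) (by simp) ?_ (by simp)) ?_ (by omega)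
  · simp only [State.setReg_reg, Nat.reduceEqDiff, if_false]
    rw [r6 _ (by decide), State.setReg_reg, if_neg (by decide), r5 _ (by decide),
      State.setReg_reg, if_neg (by decide), r4 _ (by decide)]
    simpa using n3
  rintro s7 ⟨c7, i7⟩
  refine Tri.straight rfl (by decide) ⟨V.filter fun v => s6.mem aClass v = 4,
    Finset.filter_subset _ _, ⟨fun u hu v hv => hmax.1 u (Finset.mem_filter.1 hu).1 v
      (Finset.mem_filter.1 hv).1 (Finset.mem_filter.1 hu).2 (Finset.mem_filter.1 hv).2, hmax.2⟩, ?_⟩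
  have hK : V \ (V.filter fun v => s6.mem aClass v = 4) =
      (Finset.range n).filter fun v => s6.mem aClass v ≠ 4 := by
    ext v
    simp only [hV, Finset.mem_sdiff, Finset.mem_filter]
    tauto
  rw [hK]
  simp only [Prog.run, Term.val, State.setReg_reg, if_true, State.setReg_mem]
  exact ⟨c7, i7⟩

end RAM

/-! ### The whole program -/

namespace RAM

open Term Prog

/-- The program: the bound for the names of nodes, the tree, and the complement of a clique. -/
def strongBasisProg : Prog :=
  setReg rM (add (add (add (reg rN) (reg rN)) (reg rN)) (const 3)) ;; (buildTree ;; cliqueProg)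

theorem _root_.IsCoRel.isSymbolic {A : ℕ → ℕ → Prop} {S : Set ℕ} (h : IsCoRel A S) :
    IsSymbolic (arcCount A) S where
  comm := arcCount_comm A
  le_two := arcCount_le_two A
  rainbow := h.rainbow
  path := h.path

/-- The arcs of a directed graph with vertices `0, …, n - 1`, as a relation on the numbers. -/
def valArc {n : ℕ} (G : Digraph (Fin n)) (u v : ℕ) : Prop :=
  ∃ (hu : u < n) (hv : v < n), G.Adj ⟨u, hu⟩ ⟨v, hv⟩

@[simp] theorem valArc_val {n : ℕ} (G : Digraph (Fin n)) (u v : Fin n) :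
    valArc G u v ↔ G.Adj u v := by
  simp [valArc]

theorem _root_.Digraph.IsDirectedCograph.isCoRel_valArc {n : ℕ} {G : Digraph (Fin n)}
    (h : G.IsDirectedCograph) : IsCoRel (valArc G) {u | u ∈ Finset.range n} := by
  have h1 := h.isCoRel
  have he : ∀ u v : Fin n, arcCount (valArc G) u v = arcCount G.Adj u v := fun u v => by
    rw [arcCount, propext (valArc_val G u v), propext (valArc_val G v u), arcCount]
  have hl : ∀ u ∈ {u | u ∈ Finset.range n}, ∃ v : Fin n, (v : ℕ) = u := fun u hu =>
    ⟨⟨u, Finset.mem_range.1 hu⟩, rfl⟩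
  constructor
  · intro u hu
    obtain ⟨u, rfl⟩ := hl u hu
    simpa using h1.irrefl u trivial
  · intro u hu v hv w hw huv huw hvw
    obtain ⟨u, rfl⟩ := hl u hu
    obtain ⟨v, rfl⟩ := hl v hv
    obtain ⟨w, rfl⟩ := hl w hw
    simp only [he]
    exact h1.rainbow u trivial v trivial w trivial (fun h => huv (h ▸ rfl)) (fun h => huw (h ▸ rfl))
      (fun h => hvw (h ▸ rfl))
  · intro a ha b hb c hc d hd hab hac had hbc hbd hcd
    obtain ⟨a, rfl⟩ := hl a ha
    obtain ⟨b, rfl⟩ := hl b hb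
    obtain ⟨c, rfl⟩ := hl c hc
    obtain ⟨d, rfl⟩ := hl d hd
    simp only [he]
    exact h1.path a trivial b trivial c trivial d trivial (fun h => hab (h ▸ rfl))
      (fun h => hac (h ▸ rfl)) (fun h => had (h ▸ rfl)) (fun h => hbc (h ▸ rfl))
      (fun h => hbd (h ▸ rfl)) (fun h => hcd (h ▸ rfl))
  · intro u hu v hv w hw
    obtain ⟨u, rfl⟩ := hl u hu
    obtain ⟨v, rfl⟩ := hl v hv
    obtain ⟨w, rfl⟩ := hl w hw
    simpa using h1.trans u trivial v trivial w trivial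

theorem compatible_valArc {n : ℕ} (G : Digraph (Fin n)) (u v : Fin n) :
    (Digraph.mk (valArc G)).Compatible u v ↔ G.Compatible u v := by
  have hd : ∀ u v : Fin n, (Digraph.mk (valArc G)).Distinguished u v ↔ G.Distinguished u v := by
    intro u v
    constructor
    · rintro ⟨w, h1, h2, h3⟩
      have hw : w < n := by
        rcases h3 with ⟨⟨h, _⟩, _⟩ | ⟨⟨_, h, _⟩, _⟩ <;> exact h
      obtain ⟨w, rfl⟩ : ∃ x : Fin n, (x : ℕ) = w := ⟨⟨w, hw⟩, rfl⟩
      exact ⟨w, fun h => h1 (h ▸ rfl), fun h => h2 (h ▸ rfl), by simpa using h3⟩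
    · rintro ⟨w, h1, h2, h3⟩
      exact ⟨w, by simpa [Fin.ext_iff] using h1, by simpa [Fin.ext_iff] using h2, by simpa using h3⟩
  simp only [Digraph.Compatible, hd, valArc_val]

/-- What the program computes, without a bound on the size of the numbers. -/
theorem tri_strongBasis {n : ℕ} {G : Digraph (Fin n)} {arcs : List (Fin n × Fin n)}
    (hG : G.IsDirectedCograph) (hs : G.IsStronglyConnected) (ha : G.IsArcList arcs) (hn : 0 < n) :
    Tri (buildTree ;; cliqueProg) ((inputState arcs).setReg rM (3 * n + 3))
      (arcs.length * 760 + n * 4100 + 200) fun s' => ∃ R : Finset (Fin n), Outputs s' R ∧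
        G.IsStrongMetricBasis R ∧ s'.reg 0 = G.strongMetricDim := by
  obtain ⟨T, hT⟩ : ∃ T, T = (inputState arcs).mem aTail := ⟨_, rfl⟩
  obtain ⟨H, hH⟩ : ∃ H, H = (inputState arcs).mem aHead := ⟨_, rfl⟩
  have hTi : ∀ (i : ℕ) (hi : i < arcs.length), T i = (arcs[i].1 : ℕ) := fun i hi => by
    simp [hT, inputState, hi]
  have hHi : ∀ (i : ℕ) (hi : i < arcs.length), H i = (arcs[i].2 : ℕ) := fun i hi => by
    simp [hH, inputState, hi]
  have hA : ArcIn T H arcs.length = valArc G := by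
    funext u v
    refine propext ⟨?_, ?_⟩
    · rintro ⟨i, hi, rfl, rfl⟩
      rw [hTi i hi, hHi i hi, valArc_val, ha.2]
      exact List.getElem_mem hi
    · rintro ⟨hu, hv, h⟩
      obtain ⟨i, hi, h1⟩ := List.getElem_of_mem ((ha.2 _ _).1 h)
      exact ⟨i, hi, by rw [hTi i hi, h1], by rw [hHi i hi, h1]⟩
  have hR := hG.isCoRel_valArc
  have hirr : ∀ u, ¬ G.Adj u u := fun u => hG.isCoRel.irrefl u trivial
  have hnd : ∀ i < arcs.length, ∀ j < arcs.length, T i = T j → H i = H j → i = j := by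
    intro i hi j hj h1 h2
    rw [hTi i hi, hTi j hj] at h1
    rw [hHi i hi, hHi j hj] at h2
    exact (ha.1.getElem_inj_iff).1 (Prod.ext (Fin.ext h1) (Fin.ext h2))
  refine Tri.seq (T := arcs.length * 760 + n * 1100 + 100) (T' := n * 3000 + 100)
    (tri_buildTree (s := (inputState arcs).setReg rM (3 * n + 3)) (T := T) (H := H) (m := arcs.length)
      (n := n) (M := 3 * n + 3) hn le_rfl
      (by rw [hA]; simpa using hR.isSymbolic) hnd (fun i hi h => ?_) hT.symm hH.symm ?_
      (by simp [inputState]) (by simp [inputState]) (by simp)).frame ?_ (by omega)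
  · rw [hTi i hi, hHi i hi] at h
    have h1 : (arcs[i].1, arcs[i].2) ∈ arcs := List.getElem_mem hi
    rw [← ha.2, Fin.ext h] at h1
    exact hirr _ h1
  · intro a ha i
    simp only [State.setReg_mem, inputState]
    rw [if_neg (by omega), if_neg (by omega)]
  rintro s1 ⟨⟨hB, hdeg⟩, r1, m1⟩
  rw [hA] at hB
  refine (tri_cliqueProg hR (fun u v ⟨hu, hv, _⟩ => ⟨Finset.mem_range.2 hu, Finset.mem_range.2 hv⟩)
    (by omega) hB ?_ ?_ ?_ ?_).conseq le_rfl ?_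
  · classical
    intro v _
    rw [hdeg v, CoTree.inDeg, ← hA]
    -- Each in-neighbour is the tail of exactly one arc.
    refine Finset.card_bij (fun i _ => T i) (fun i hi => ?_) (fun i hi j hj h => ?_)
      fun u hu => ?_
    · obtain ⟨hi, hv⟩ := Finset.mem_filter.1 hi
      rw [Finset.mem_range] at hi
      refine Finset.mem_filter.2 ⟨Finset.mem_range.2 ?_, i, hi, rfl, hv⟩
      rw [hTi i hi]
      exact Fin.is_lt _
    · obtain ⟨hi, hv⟩ := Finset.mem_filter.1 hi
      obtain ⟨hj, hv'⟩ := Finset.mem_filter.1 hj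
      exact hnd i (Finset.mem_range.1 hi) j (Finset.mem_range.1 hj) h (hv.trans hv'.symm)
    · obtain ⟨_, i, hi, h1, h2⟩ := Finset.mem_filter.1 hu
      exact ⟨i, Finset.mem_filter.2 ⟨Finset.mem_range.2 hi, h2⟩, h1⟩
  · rw [r1 _ (by decide)]
    simp [inputState]
  · rw [r1 _ (by decide)]
    simp
  · intro a ha ha' t
    rw [m1 a]
    · simp only [State.setReg_mem, inputState]
      rw [if_neg (by omega), if_neg (by omega)]
    · interval_cases a <;> decide
  rintro s2 ⟨K, hK, ⟨hK1, hK2⟩, hc, hi⟩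
  have hmap : ∀ Q : Finset (Fin n), Q.map Fin.valEmbedding ⊆ Finset.range n := by
    intro Q u hu
    obtain ⟨v, _, rfl⟩ := Finset.mem_map.1 hu
    exact Finset.mem_range.2 v.2
  obtain ⟨L, hL⟩ : ∃ L : Finset (Fin n), L = Finset.univ.filter fun v : Fin n => (v : ℕ) ∈ K
    := ⟨_, rfl⟩
  have hLK : L.map Fin.valEmbedding = K := by
    ext u
    simp only [hL, Finset.mem_map, Finset.mem_filter, Finset.mem_univ, true_and,
      Fin.valEmbedding_apply]
    refine ⟨fun ⟨v, h1, h2⟩ => h2 ▸ h1, fun h => ⟨⟨u, Finset.mem_range.1 (hK h)⟩, h, rfl⟩⟩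
  have hLc : Lᶜ.map Fin.valEmbedding = Finset.range n \ K := by
    rw [← hLK]
    ext u
    simp only [Finset.mem_map, Finset.mem_compl, Fin.valEmbedding_apply, Finset.mem_sdiff,
      Finset.mem_range]
    constructor
    · rintro ⟨v, h1, rfl⟩
      refine ⟨v.2, ?_⟩
      rintro ⟨v', h2, h3⟩
      exact h1 (Fin.ext h3 ▸ h2)
    · rintro ⟨h1, h2⟩
      exact ⟨⟨u, h1⟩, fun h => h2 ⟨_, h, rfl⟩, rfl⟩
  have hcard : Lᶜ.card = (Finset.range n \ K).card := by rw [← hLc, Finset.card_map]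
  obtain ⟨b1, b2⟩ := (hG.diamLeTwo hs).isStrongMetricBasis hirr (Q := L)
    (fun u hu v hv huv => (compatible_valArc G u v).1 (hK1 u
      (hLK ▸ Finset.mem_map_of_mem Fin.valEmbedding hu) v
      (hLK ▸ Finset.mem_map_of_mem Fin.valEmbedding hv) (by simpa [Fin.ext_iff] using huv)))
    (fun Q hQ => by
      have := hK2 (Q.map Fin.valEmbedding) (hmap Q) ?_
      · rwa [Finset.card_map, ← hLK, Finset.card_map] at this
      · intro u hu v hv huv
        obtain ⟨u, hu', rfl⟩ := Finset.mem_map.1 hu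
        obtain ⟨v, hv', rfl⟩ := Finset.mem_map.1 hv
        exact (compatible_valArc G u v).2 (hQ u hu' v hv' fun h => huv (h ▸ rfl)))
  refine ⟨Lᶜ, ⟨hc.trans hcard.symm, ?_⟩, b1, ?_⟩
  · rw [hLc, ← hi, hc, hcard]
  · rw [b2, hcard]
    exact hc

end RAM

/-- There are a program and a constant `c` such that, for every strongly connected directed co-graph
`G` with `n` vertices and `m` arcs, given by a list of its arcs, the program outputs a strong metric
basis of `G`, and its size as the directed strong metric dimension, within `c * (n + m)` steps and
using only numbers up to `c * (n + m)`. -/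
theorem mainTheorem2 :
    ∃ (P : RAM.Prog) (c : ℕ),
      ∀ (n : ℕ) (G : Digraph (Fin n)) (arcs : List (Fin n × Fin n)),
        G.IsDirectedCograph → G.IsStronglyConnected → G.IsArcList arcs →
        ∃ (s : RAM.State) (t : ℕ) (R : Finset (Fin n)),
          RAM.Runs (c * (n + arcs.length)) P (RAM.inputState arcs) s t ∧
          t ≤ c * (n + arcs.length) ∧
          RAM.Outputs s R ∧
          G.IsStrongMetricBasis R ∧
          s.reg 0 = G.strongMetricDim := by
  refine ⟨RAM.strongBasisProg, 5000, fun n G arcs hG hs ha => ?_⟩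
  have hn : 0 < n := by
    obtain ⟨T, -⟩ := hG
    obtain ⟨v, -⟩ := T.leaves_ne_nil
    exact v.pos
  obtain ⟨s, t, h1, h2, R, h3, h4, h5⟩ := RAM.tri_strongBasis hG hs ha hn
  have hb : ((RAM.inputState arcs).setReg 2 (3 * n + 3)).Bdd (3 * n + arcs.length + 5) := by
    have hget : ∀ (f : Fin n × Fin n → Fin n) (e : ℕ),
        (arcs.map fun p => (f p : ℕ)).getD e 0 ≤ 3 * n + arcs.length + 5 := by
      intro f e
      by_cases he : e < arcs.length
      · have := (f arcs[e]).2
        simp only [List.getD_eq_getElem?_getD, List.getElem?_map, List.getElem?_eq_getElem he,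
          Option.map_some, Option.getD_some]
        omega
      · simp [List.getElem?_eq_none (Nat.le_of_not_lt he)]
    refine ⟨fun r => ?_, fun a e => ?_⟩
    · simp only [RAM.State.setReg_reg, RAM.inputState]
      split_ifs <;> omega
    · simp only [RAM.State.setReg_mem, RAM.inputState]
      split_ifs
      · exact hget Prod.fst e
      · exact hget Prod.snd e
      · omega
  have h6 := (h1.runs (k := 5) rfl (by omega) (by omega) hb).2 (5000 * (n + arcs.length)) (by omega)
  have h7 : RAM.Runs (5000 * (n + arcs.length)) (.setReg 2 (.add (.add (.add (.reg 0) (.reg 0))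
      (.reg 0)) (.const 3))) (RAM.inputState arcs)
      ((RAM.inputState arcs).setReg 2 (3 * n + 3)) 8 := by
    have : 3 * n + 3 = RAM.Term.val (RAM.inputState arcs) (.add (.add (.add (.reg 0) (.reg 0))
        (.reg 0)) (.const 3)) := by
      simp [RAM.Term.val, RAM.inputState]
      omega
    rw [this]
    refine .setReg ?_
    simp [RAM.Term.Fits, RAM.Term.val, RAM.inputState]
    omega
  exact ⟨s, 8 + t, R, .seq h7 h6, by omega, h3, h4, h5⟩
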